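/- **Theorem 6.4 (Difference estimate for the Allen–Cahn equation).** *Setting.* Let $N\ge2$ and let $\Omega\subset\mathbb R^N$ be a bounded domain (open, nonempty, connected) with smooth boundary and outer unit normal $N_{\partial\Omega}$; put $Q_T:=\Omega\times(0,T)$. Let $T_0>0$ and let $\Gamma=(\Gamma_t)_{t\in[0,T_0]}$, $\Gamma_t=X_0(\Sigma,t)$, be a smooth evolving hypersurface in $\overline\Omega$ parametrized over a smooth, orientable, compact, connected hypersurface $\Sigma\subset\mathbb R^N$ with boundary: $X_0$ is the restriction of a smooth map on $\Sigma_0\times(-\tau_0,T_0+\tau_0)$ that is an injective immersion at each time, where $\Sigma_0\supsetneq\Sigma$ is a smooth, orientable, connected hypersurface without boundary and $\tau_0>0$; $X_0(\Sigma\setminus\partial\Sigma,t)\subset\Omega$, $X_0(\partial\Sigma,t)\subset\partial\Omega$, and $\Gamma_t$ meets $\partial\Omega$ at angle $\pi/2$. Let $\vec n$ be a smooth unit normal field of $\Gamma$. Let $\delta>0$ and let $X:[-2\delta,2\delta]\times\Sigma\times[0,T_0]\to\overline\Omega$ be smooth with $X|_{r=0}=X_0$ such that: $\overline X:=(X,\mathrm{pr}_t)$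 extends to a smooth diffeomorphism, again of the form $(X,\mathrm{pr}_t)$, from an open neighbourhood of $[-2\delta,2\delta]\times\Sigma\times[0,T_0]$ in $\mathbb R\times\Sigma_0\times\mathbb R$ onto an open subset of $\mathbb R^{N+1}$, with inverse $(r,s,\mathrm{pr}_t)$; $X(r,s,t)\in\partial\Omega$ if and only if $s\in\partial\Sigma$; the set $\Gamma(\eta):=\overline X((-\eta,\eta)\times\Sigma\times[0,T_0])$ is open in $\overline\Omega\times[0,T_0]$ for $\eta\in(0,2\delta]$; and $\nabla r=\vec n$, $D_xs\,\nabla r=0$ and $\partial_r(|\nabla r|^2\circ\overline X)=0$ on $\Gamma$, i.e. at $r=0$. Let $\Gamma_t(\eta)$ be the time slices of $\Gamma(\eta)$ and set $$\partial_n\psi:=\partial_r(\psi\circ\overline X)\circ\overline X^{-1},\qquad \nabla_\tau\psi:=(D_xs)^\top\big[\nabla_\Sigma(\psi\circ\overline X)\circ\overline X^{-1}\big].$$ Let $f\in C^\infty(\mathbb R)$ with $f'(\pm1)=0$, $f''(\pm1)>0$, $f(-1)=f(1)$, $f>f(1)$ on $(-1,1)$, and $uf'(u)\ge0$ for all $|u|\ge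 R_0$, for some $R_0\ge1$. Let $\varepsilon_0>0$ and $u^A_\varepsilon\in C^2(\overline{Q_{T_0}})$ for $\varepsilon\in(0,\varepsilon_0]$. Let $c_0,C>0$ be such that the *spectral estimate* $$\int_\Omega|\nabla\psi|^2+\tfrac1{\varepsilon^2}f''(u^A_\varepsilon(\cdot,t))\psi^2\,dx\ \ge\ -C\|\psi\|_{L^2(\Omega)}^2+\|\nabla\psi\|^2_{L^2(\Omega\setminus\Gamma_t(\delta))}+c_0\|\nabla_\tau\psi\|^2_{L^2(\Omega\cap\Gamma_t(\delta))}$$ holds for all $\psi\in H^1(\Omega)$, $\varepsilon\in(0,\varepsilon_0]$, $t\in[0,T_0]$. Let $K\in\mathbb R$ and $k(N):=\max\{2,N/2\}$. *Conditions.* For families $u_{0,\varepsilon}\in C^2(\overline\Omega)$ with $\partial_{N_{\partial\Omega}}u_{0,\varepsilon}=0$ on $\partial\Omega$ and $u_\varepsilon\in C^2(\overline{Q_{T_0}})$, $\varepsilon\in(0,\varepsilon_0]$, solving $$\partial_tu_\varepsilon-\Delta u_\varepsilon+\tfrac1{\varepsilon^2}f'(u_\varepsilon)=0\text{ in }\Omega\times(0,T_0),\quad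 \partial_{N_{\partial\Omega}}u_\varepsilon=0\text{ on }\partial\Omega\times(0,T_0),\quad u_\varepsilon|_{t=0}=u_{0,\varepsilon}\text{ in }\Omega,$$ put $\overline u_\varepsilon:=u_\varepsilon-u^A_\varepsilon$, $r^A_\varepsilon:=\partial_tu^A_\varepsilon-\Delta u^A_\varepsilon+\frac1{\varepsilon^2}f'(u^A_\varepsilon)$, $s^A_\varepsilon:=\partial_{N_{\partial\Omega}}u^A_\varepsilon$, and consider, for real $m$ and $R>0$: * (B) $|u^A_\varepsilon|\le K$ on $Q_{T_0}$ and $|u_{0,\varepsilon}|\le K$ on $\Omega$ for all $\varepsilon\in(0,\varepsilon_0]$; * (A$_m$) for all $\varepsilon\in(0,\varepsilon_0]$ and $t\in(0,T_0]$, $$\Big|\int_{\partial\Omega}s^A_\varepsilon\,\overline u_\varepsilon(t)\,d\mathcal H^{N-1}+\int_\Omega r^A_\varepsilon\,\overline u_\varepsilon(t)\,dx\Big|\le C\varepsilon^{m+\frac12}\big(\|\overline u_\varepsilon(t)\|_{L^2(\Omega)}+\|\nabla_\tau\overline u_\varepsilon(t)\|_{L^2(\Omega\cap\Gamma_t(\delta))}+\|\nabla\overline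 u_\varepsilon(t)\|_{L^2(\Omega\setminus\Gamma_t(\delta))}\big);$$ * (I$_{R,m}$) $\|u_{0,\varepsilon}-u^A_\varepsilon|_{t=0}\|_{L^2(\Omega)}\le R\,\varepsilon^{m+\frac12}$ for all $\varepsilon\in(0,\varepsilon_0]$. With $g_\beta(t):=e^{-\beta t}$, let (D$_{R,M,\beta}$) at $(\varepsilon,T)$ denote the two inequalities $$\sup_{t\in[0,T]}\|(g_\beta\overline u_\varepsilon)(t)\|^2_{L^2(\Omega)}+\|g_\beta\nabla\overline u_\varepsilon\|^2_{L^2(Q_T\setminus\Gamma(\delta))}\le2R^2\varepsilon^{2M+1},$$ $$c_0\|g_\beta\nabla_\tau\overline u_\varepsilon\|^2_{L^2(Q_T\cap\Gamma(\delta))}+\varepsilon^2\|g_\beta\partial_n\overline u_\varepsilon\|^2_{L^2(Q_T\cap\Gamma(\delta))}\le2R^2\varepsilon^{2M+1}.$$ *Conclusion.* 1. Let $M\in\mathbb N$, $M>k(N)$ and $R>0$. Then there are $\beta>0$ and $\varepsilon_1\in(0,\varepsilon_0]$ such that for all families $(u_{0,\varepsilon},u_\varepsilon)$ as above with (B), (A$_M$)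 and (I$_{R,M}$), (D$_{R,M,\beta}$) holds for all $\varepsilon\in(0,\varepsilon_1]$ and $T\in(0,T_0]$. 2. Let $M\in\mathbb N$, $M=k(N)$ and let $\tilde M>M$ be real. Then there are $\beta,\tilde R>0$ and $\varepsilon_1\in(0,\varepsilon_0]$ such that for all families $(u_{0,\varepsilon},u_\varepsilon)$ as above with (B), (A$_{\tilde M}$) and (I$_{\tilde R,M}$), (D$_{\tilde R,M,\beta}$) holds for all $\varepsilon\in(0,\varepsilon_1]$ and $T\in(0,T_0]$. 3. Let $N\in\{2,3\}$, $M=2\,(=k(N))$ and $R>0$. Then there are $\varepsilon_1\in(0,\varepsilon_0]$ and $T_1\in(0,T_0]$ such that for all families $(u_{0,\varepsilon},u_\varepsilon)$ as above with (B), (A$_2$) and (I$_{R,2}$), (D$_{R,2,0}$) holds for all $\varepsilon\in(0,\varepsilon_1]$ and $T\in(0,T_1]$. -/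

import Mathlib

open Set MeasureTheory
open scoped ContDiff Gradient

noncomputable section

/-- `N`-dimensional Euclidean space. -/
abbrev Euc (N : ℕ) := EuclideanSpace ℝ (Fin N)

/-! ### Bounded smooth domains -/

/-- Near the boundary point `x`, the set `Ω` is the sublevel set `{ρ < 0}` of the smooth
function `ρ`, whose gradient does not vanish at `x`. -/
def IsLocalDefiningFunction {N : ℕ} (Ω : Set (Euc N)) (x : Euc N) (U : Set (Euc N))
    (ρ : Euc N → ℝ) : Prop :=
  IsOpen U ∧ x ∈ U ∧ ContDiffOn ℝ ∞ ρ U ∧ ρ x = 0 ∧ gradient ρ x ≠ 0 ∧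
    Ω ∩ U = {y ∈ U | ρ y < 0}

/-- A bounded smooth domain: open, nonempty, connected, bounded, with smooth boundary. -/
structure IsBoundedSmoothDomain {N : ℕ} (Ω : Set (Euc N)) : Prop where
  isOpen : IsOpen Ω
  isConnected : IsConnected Ω
  isBounded : Bornology.IsBounded Ω
  smooth_boundary : ∀ x ∈ frontier Ω, ∃ U ρ, IsLocalDefiningFunction Ω x U ρ

def IsOuterUnitNormal {N : ℕ} (Ω : Set (Euc N)) (x ν : Euc N) : Prop :=
  ∃ U ρ, IsLocalDefiningFunction Ω x U ρ ∧ ν = ‖gradient ρ x‖⁻¹ • gradient ρ x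

open Classical in
/-- The outer unit normal `N_{∂Ω}`; the value `0` is only taken off the smooth boundary. -/
def outerUnitNormal {N : ℕ} (Ω : Set (Euc N)) (x : Euc N) : Euc N :=
  if h : ∃ ν, IsOuterUnitNormal Ω x ν then h.choose else 0

/-! ### Smooth hypersurfaces of Euclidean space, possibly with boundary -/

/-- Near `p`, the set `S` is the zero set of the smooth function `h`, which is regular at `p`. -/
def IsHypersurfaceChart {N : ℕ} (S : Set (Euc N)) (p : Euc N) (U : Set (Euc N))
    (h : Euc N → ℝ) : Prop :=
  IsOpen U ∧ p ∈ U ∧ ContDiffOn ℝ ∞ h U ∧ h p = 0 ∧ gradient h p ≠ 0 ∧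
    S ∩ U = {y ∈ U | h y = 0}

/-- Near `p`, the set `S` is the smooth half hypersurface `{h = 0, b ≤ 0}`, and `p` is a point of
its boundary `{h = 0, b = 0}`; the differentials of `h` and `b` are independent at `p`. -/
def IsHypersurfaceBoundaryPoint {N : ℕ} (S : Set (Euc N)) (p : Euc N) : Prop :=
  ∃ (U : Set (Euc N)) (h b : Euc N → ℝ), IsOpen U ∧ p ∈ U ∧ ContDiffOn ℝ ∞ h U ∧
    ContDiffOn ℝ ∞ b U ∧ h p = 0 ∧ b p = 0 ∧
    LinearIndependent ℝ ![gradient h p, gradient b p] ∧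
    S ∩ U = {y ∈ U | h y = 0 ∧ b y ≤ 0}

/-- A smooth (embedded) hypersurface without boundary. -/
def IsSmoothHypersurface {N : ℕ} (S : Set (Euc N)) : Prop :=
  ∀ p ∈ S, ∃ U h, IsHypersurfaceChart S p U h

/-- The boundary `∂S` of a hypersurface with boundary (in the sense of manifolds). -/
def hypersurfaceBoundary {N : ℕ} (S : Set (Euc N)) : Set (Euc N) :=
  {p ∈ S | IsHypersurfaceBoundaryPoint S p}

/-- A smooth (embedded) hypersurface with boundary. -/
def IsSmoothHypersurfaceWithBoundary {N : ℕ} (S : Set (Euc N)) : Prop :=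
  ∀ p ∈ S, (∃ U h, IsHypersurfaceChart S p U h) ∨ IsHypersurfaceBoundaryPoint S p

/-- `v` belongs to the tangent space `T_p S` of the hypersurface (without boundary) `S`. -/
def IsTangentTo {N : ℕ} (S : Set (Euc N)) (p v : Euc N) : Prop :=
  ∃ U h, IsHypersurfaceChart S p U h ∧ inner ℝ (gradient h p) v = 0

/-- A hypersurface without boundary is orientable: it has a continuous unit normal field. -/
def IsOrientableHypersurface {N : ℕ} (S : Set (Euc N)) : Prop :=
  ∃ ν : Euc N → Euc N, ContinuousOn ν S ∧
    ∀ p ∈ S, ‖ν p‖ = 1 ∧ ∀ v, IsTangentTo S p v → inner ℝ (ν p) v = 0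

/-! ### Evolving hypersurfaces with contact angle `π/2`, and curvilinear coordinates -/

/-- A smooth evolving hypersurface `Γ_t = X₀(Σ, t)`, `t ∈ [0,T]`, in the closure of `Ω`, which
meets `∂Ω` at a right angle. Here `S` is the reference hypersurface `Σ`, and `S₀ ⊋ Σ` is the
hypersurface without boundary to which the parametrization extends as an injective immersion. A
map on a hypersurface is smooth if it is the restriction of a smooth map on an open subset of the
ambient space; `X₀` and `n` denote such ambient representatives. -/
structure EvolvingHypersurface {N : ℕ} (Ω : Set (Euc N)) (T : ℝ) where
  S : Set (Euc N)
  S₀ : Set (Euc N)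
  isCompact_S : IsCompact S
  isConnected_S : IsConnected S
  smooth_S : IsSmoothHypersurfaceWithBoundary S
  isConnected_S₀ : IsConnected S₀
  smooth_S₀ : IsSmoothHypersurface S₀
  orientable_S₀ : IsOrientableHypersurface S₀
  S_ssubset : S ⊂ S₀
  τ : ℝ
  τ_pos : 0 < τ
  X₀ : Euc N → ℝ → Euc N
  smooth_X₀ : ∃ O : Set (Euc N × ℝ), IsOpen O ∧ S₀ ×ˢ Ioo (-τ) (T + τ) ⊆ O ∧
    ContDiffOn ℝ ∞ (fun p : Euc N × ℝ => X₀ p.1 p.2) O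
  injective_X₀ : ∀ t ∈ Ioo (-τ) (T + τ), InjOn (fun σ => X₀ σ t) S₀
  immersion_X₀ : ∀ t ∈ Ioo (-τ) (T + τ), ∀ σ ∈ S₀, ∀ v, IsTangentTo S₀ σ v →
    fderiv ℝ (fun y => X₀ y t) σ v = 0 → v = 0
  interior_X₀ : ∀ t ∈ Icc 0 T, ∀ σ ∈ S \ hypersurfaceBoundary S, X₀ σ t ∈ Ω
  boundary_X₀ : ∀ t ∈ Icc 0 T, ∀ σ ∈ hypersurfaceBoundary S, X₀ σ t ∈ frontier Ω
  /-- the chosen smooth unit normal field of `Γ` -/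
  n : Euc N → ℝ → Euc N
  smooth_n : ∃ O : Set (Euc N × ℝ), IsOpen O ∧ S ×ˢ Icc 0 T ⊆ O ∧
    ContDiffOn ℝ ∞ (fun p : Euc N × ℝ => n p.1 p.2) O
  norm_n : ∀ t ∈ Icc 0 T, ∀ σ ∈ S, ‖n σ t‖ = 1
  normal_n : ∀ t ∈ Icc 0 T, ∀ σ ∈ S, ∀ v, IsTangentTo S₀ σ v →
    inner ℝ (n σ t) (fderiv ℝ (fun y => X₀ y t) σ v) = 0
  contact_angle : ∀ t ∈ Icc 0 T, ∀ σ ∈ hypersurfaceBoundary S,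
    inner ℝ (outerUnitNormal Ω (X₀ σ t)) (n σ t) = 0

/-- The tube `Γ(η) = X̄((-η,η) × Σ × [0,T])` in space-time, for `X̄(r,s,t) = (X(r,s,t),t)`. -/
def tubeOf {N : ℕ} (S : Set (Euc N)) (T : ℝ) (X : ℝ → Euc N → ℝ → Euc N) (η : ℝ) :
    Set (Euc N × ℝ) :=
  {p | ∃ ρ ∈ Ioo (-η) η, ∃ σ ∈ S, ∃ t ∈ Icc 0 T, p = (X ρ σ t, t)}

/-- Curvilinear coordinates of half-width `w` around `Γ`: a smooth map `X` of
`[-w,w] × Σ × [0,T]` to the closure of `Ω` such that `X̄ = (X, pr_t)` extends to a smooth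
diffeomorphism from an open neighbourhood of `[-w,w] × Σ × [0,T]` in `ℝ × S₀ × ℝ` (given as
`{(ρ,σ,t) ∈ O : σ ∈ S₀}` with `O` open) onto an open set `W` of `ℝ^{N+1}`; its inverse on `W` is
`(r, s, pr_t)`. -/
structure CurvilinearCoordinates {N : ℕ} {Ω : Set (Euc N)} {T : ℝ}
    (Γ : EvolvingHypersurface Ω T) (w : ℝ) where
  X : ℝ → Euc N → ℝ → Euc N
  r : Euc N → ℝ → ℝ
  s : Euc N → ℝ → Euc N
  O : Set (ℝ × Euc N × ℝ)
  W : Set (Euc N × ℝ)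
  isOpen_O : IsOpen O
  isOpen_W : IsOpen W
  subset_O : Icc (-w) w ×ˢ (Γ.S ×ˢ Icc 0 T) ⊆ O
  smooth_X : ContDiffOn ℝ ∞ (fun p : ℝ × Euc N × ℝ => X p.1 p.2.1 p.2.2) O
  smooth_r : ContDiffOn ℝ ∞ (fun p : Euc N × ℝ => r p.1 p.2) W
  smooth_s : ContDiffOn ℝ ∞ (fun p : Euc N × ℝ => s p.1 p.2) W
  left_inv : ∀ ρ σ t, (ρ, σ, t) ∈ O → σ ∈ Γ.S₀ →
    (X ρ σ t, t) ∈ W ∧ r (X ρ σ t) t = ρ ∧ s (X ρ σ t) t = σ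
  right_inv : ∀ x t, (x, t) ∈ W →
    (r x t, s x t, t) ∈ O ∧ s x t ∈ Γ.S₀ ∧ X (r x t) (s x t) t = x
  /-- `X` takes values in the closure of `Ω` -/
  maps_closure : ∀ ρ ∈ Icc (-w) w, ∀ σ ∈ Γ.S, ∀ t ∈ Icc 0 T, X ρ σ t ∈ closure Ω
  /-- the boundary `∂Ω` corresponds to `∂Σ` -/
  mem_frontier_iff : ∀ ρ ∈ Icc (-w) w, ∀ σ ∈ Γ.S, ∀ t ∈ Icc 0 T,
    (X ρ σ t ∈ frontier Ω ↔ σ ∈ hypersurfaceBoundary Γ.S)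
  /-- the tubes are relatively open in `closure Ω × [0,T]` -/
  tube_open : ∀ η ∈ Ioc 0 w, ∃ V : Set (Euc N × ℝ), IsOpen V ∧
    tubeOf Γ.S T X η = V ∩ (closure Ω ×ˢ Icc 0 T)
  /-- `X = X₀` at `r = 0` -/
  X_zero : ∀ σ ∈ Γ.S, ∀ t ∈ Icc 0 T, X 0 σ t = Γ.X₀ σ t
  /-- `∇r = n` on `Γ` -/
  gradient_r : ∀ σ ∈ Γ.S, ∀ t ∈ Icc 0 T, gradient (fun y => r y t) (Γ.X₀ σ t) = Γ.n σ t
  /-- `∂_r (|∇r|² ∘ X̄) = 0` at `r = 0` -/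
  deriv_gradient_r : ∀ σ ∈ Γ.S, ∀ t ∈ Icc 0 T,
    deriv (fun ρ => ‖gradient (fun y => r y t) (X ρ σ t)‖ ^ 2) 0 = 0
  /-- `D_x s ∇r = 0` on `Γ` -/
  fderiv_s : ∀ σ ∈ Γ.S, ∀ t ∈ Icc 0 T, fderiv ℝ (fun y => s y t) (Γ.X₀ σ t) (Γ.n σ t) = 0

namespace CurvilinearCoordinates

variable {N : ℕ} {Ω : Set (Euc N)} {T w : ℝ} {Γ : EvolvingHypersurface Ω T}

/-- The space-time tube `Γ(η)`. -/
def tube (X : CurvilinearCoordinates Γ w) (η : ℝ) : Set (Euc N × ℝ) := tubeOf Γ.S T X.X η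

/-- The time slice `Γ_t(η)` of the tube. -/
def tubeAt (X : CurvilinearCoordinates Γ w) (η t : ℝ) : Set (Euc N) := {x | (x, t) ∈ X.tube η}

/-- The normal derivative `∂_n ψ = ∂_r(ψ ∘ X̄) ∘ X̄⁻¹` at `(x,t)`, as a function of the (possibly
weak) gradient `g = ∇ψ(x)`: by the chain rule it is `∇ψ · ∂_r X`. -/
def normalDeriv (X : CurvilinearCoordinates Γ w) (t : ℝ) (x g : Euc N) : ℝ :=
  inner ℝ g (deriv (fun ρ => X.X ρ (X.s x t) t) (X.r x t))

/-- The tangential gradient `∇_τ ψ = (D_x s)ᵀ [∇_Σ(ψ ∘ X̄) ∘ X̄⁻¹]` at `(x,t)`, as a function of the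
(possibly weak) gradient `g = ∇ψ(x)`. By the chain rule, `∇_Σ(ψ ∘ X̄)` is the tangential part of
`(D_s X)ᵀ ∇ψ`; its normal part is annihilated by `(D_x s)ᵀ`, because `D_x s` takes values in the
tangent space of the hypersurface. -/
def tangentialGrad (X : CurvilinearCoordinates Γ w) (t : ℝ) (x g : Euc N) : Euc N :=
  ContinuousLinearMap.adjoint (fderiv ℝ (fun y => X.s y t) x)
    (ContinuousLinearMap.adjoint (fderiv ℝ (fun σ => X.X (X.r x t) σ t) (X.s x t)) g)

end CurvilinearCoordinates

/-! ### The Allen-Cahn equation -/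

/-- The conditions on the double well potential. -/
structure IsDoubleWell (f : ℝ → ℝ) : Prop where
  smooth : ContDiff ℝ ∞ f
  deriv_neg_one : deriv f (-1) = 0
  deriv_one : deriv f 1 = 0
  deriv2_neg_one : 0 < deriv (deriv f) (-1)
  deriv2_one : 0 < deriv (deriv f) 1
  eq_wells : f (-1) = f 1
  gt_wells : ∀ u ∈ Ioo (-1 : ℝ) 1, f 1 < f u
  sign : ∃ R₀ : ℝ, 1 ≤ R₀ ∧ ∀ u : ℝ, R₀ ≤ |u| → 0 ≤ u * deriv f u

/-- `u ∈ C²(closure Ω × [0,T])`. -/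
def IsC2Cylinder {N : ℕ} (Ω : Set (Euc N)) (T : ℝ) (u : Euc N → ℝ → ℝ) : Prop :=
  ContDiffOn ℝ 2 (fun p : Euc N × ℝ => u p.1 p.2) (closure Ω ×ˢ Icc 0 T)

/-- The spatial gradient at an interior point. -/
def spaceGrad {N : ℕ} (u : Euc N → ℝ → ℝ) (x : Euc N) (t : ℝ) : Euc N :=
  gradient (fun y => u y t) x

/-- The normal derivative `∂_{N_{∂Ω}} v` at a boundary point, for `v` differentiable up to the
boundary. -/
def boundaryNormalDeriv {N : ℕ} (Ω : Set (Euc N)) (v : Euc N → ℝ) (x : Euc N) : ℝ :=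
  fderivWithin ℝ v (closure Ω) x (outerUnitNormal Ω x)

/-- The Allen-Cahn operator `∂_t u - Δu + ε⁻² f'(u)` at `x ∈ Ω`, `t ∈ [0,T]`. -/
def allenCahnOp {N : ℕ} (T : ℝ) (f : ℝ → ℝ) (ε : ℝ) (u : Euc N → ℝ → ℝ) (x : Euc N) (t : ℝ) : ℝ :=
  derivWithin (fun τ => u x τ) (Icc 0 T) t - Laplacian.laplacian (fun y => u y t) x
    + 1 / ε ^ 2 * deriv f (u x t)

/-- `u` is a `C²` solution, up to the boundary, of the Allen-Cahn equation on `Ω × (0,T)` with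
homogeneous Neumann condition and initial value `u₀`, where `u₀ ∈ C²(closure Ω)` satisfies
the Neumann condition. -/
structure IsAllenCahnSolution {N : ℕ} (Ω : Set (Euc N)) (T : ℝ) (f : ℝ → ℝ) (ε : ℝ)
    (u₀ : Euc N → ℝ) (u : Euc N → ℝ → ℝ) : Prop where
  initial_C2 : ContDiffOn ℝ 2 u₀ (closure Ω)
  initial_neumann : ∀ x ∈ frontier Ω, boundaryNormalDeriv Ω u₀ x = 0
  C2 : IsC2Cylinder Ω T u
  equation : ∀ x ∈ Ω, ∀ t ∈ Ioo 0 T, allenCahnOp T f ε u x t = 0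
  neumann : ∀ x ∈ frontier Ω, ∀ t ∈ Ioo 0 T, boundaryNormalDeriv Ω (fun y => u y t) x = 0
  initial : ∀ x ∈ Ω, u x 0 = u₀ x

/-! ### Norms and the Sobolev space `H¹` -/

/-- The `L²(A)`-norm. -/
def l2Norm {α V : Type*} [MeasureSpace α] [NormedAddCommGroup V] (A : Set α) (v : α → V) : ℝ :=
  Real.sqrt (∫ x in A, ‖v x‖ ^ 2)

/-- `ψ ∈ H¹(Ω)` with weak gradient `G ∈ L²(Ω)^N`. -/
def IsH1WithGradient {N : ℕ} (Ω : Set (Euc N)) (ψ : Euc N → ℝ) (G : Euc N → Euc N) : Prop :=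
  MemLp ψ 2 (volume.restrict Ω) ∧ MemLp G 2 (volume.restrict Ω) ∧
    ∀ φ : Euc N → ℝ, ContDiff ℝ ∞ φ → HasCompactSupport φ → tsupport φ ⊆ Ω →
      ∀ v : Euc N, ∫ x in Ω, ψ x * fderiv ℝ φ x v = -∫ x in Ω, inner ℝ (G x) v * φ x

/-! ### The conditions and the difference estimate -/

section Estimates

variable {N : ℕ} {Ω : Set (Euc N)} {T₀ w : ℝ} {Γ : EvolvingHypersurface Ω T₀}

/-- Uniform boundedness, with bound `K`, of the approximate solutions and the initial values. -/
def UniformlyBounded (Ω : Set (Euc N)) (T₀ ε₀ K : ℝ) (uA : ℝ → Euc N → ℝ → ℝ)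
    (u₀ : ℝ → Euc N → ℝ) : Prop :=
  ∀ ε ∈ Ioc 0 ε₀, (∀ x ∈ Ω, ∀ t ∈ Ioo 0 T₀, |uA ε x t| ≤ K) ∧ ∀ x ∈ Ω, |u₀ ε x| ≤ K

/-- The spectral estimate with constants `c₀` and `C`. -/
def SpectralEstimate (X : CurvilinearCoordinates Γ w) (δ : ℝ) (f : ℝ → ℝ) (ε₀ c₀ C : ℝ)
    (uA : ℝ → Euc N → ℝ → ℝ) : Prop :=
  ∀ ε ∈ Ioc 0 ε₀, ∀ t ∈ Icc 0 T₀, ∀ ψ G, IsH1WithGradient Ω ψ G →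
    -C * l2Norm Ω ψ ^ 2 + l2Norm (Ω \ X.tubeAt δ t) G ^ 2
        + c₀ * l2Norm (Ω ∩ X.tubeAt δ t) (fun x => X.tangentialGrad t x (G x)) ^ 2
      ≤ ∫ x in Ω, (‖G x‖ ^ 2 + 1 / ε ^ 2 * deriv (deriv f) (uA ε x t) * ψ x ^ 2)

/-- The bound of order `ε^(m+1/2)`, with constant `C`, for the remainders
`r^A = ∂_t u^A - Δu^A + ε⁻² f'(u^A)` in `Ω` and `s^A = ∂_{N_{∂Ω}} u^A` on `∂Ω`, tested with the
difference `u - u^A`. The surface measure is the `(N-1)`-dimensional Hausdorff measure, normalized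
so as to agree with Lebesgue measure on `ℝ^(N-1)`. -/
def RemainderEstimate (X : CurvilinearCoordinates Γ w) (δ : ℝ) (f : ℝ → ℝ) (ε₀ C m : ℝ)
    (uA u : ℝ → Euc N → ℝ → ℝ) : Prop :=
  ∀ ε ∈ Ioc 0 ε₀, ∀ t ∈ Ioc 0 T₀,
    |(∫ x in frontier Ω, boundaryNormalDeriv Ω (fun y => uA ε y t) x * (u ε x t - uA ε x t)
          ∂(Measure.euclideanHausdorffMeasure (N - 1)))
        + ∫ x in Ω, allenCahnOp T₀ f ε (uA ε) x t * (u ε x t - uA ε x t)|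
      ≤ C * ε ^ (m + 1 / 2) *
        (l2Norm Ω (fun x => u ε x t - uA ε x t)
          + l2Norm (Ω ∩ X.tubeAt δ t)
              (fun x => X.tangentialGrad t x (spaceGrad (u ε - uA ε) x t))
          + l2Norm (Ω \ X.tubeAt δ t) (fun x => spaceGrad (u ε - uA ε) x t))

/-- Well-prepared initial data of order `ε^(m+1/2)`. -/
def WellPrepared (Ω : Set (Euc N)) (ε₀ R m : ℝ) (uA : ℝ → Euc N → ℝ → ℝ)
    (u₀ : ℝ → Euc N → ℝ) : Prop :=
  ∀ ε ∈ Ioc 0 ε₀, l2Norm Ω (fun x => u₀ ε x - uA ε x 0) ≤ R * ε ^ (m + 1 / 2)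

/-- The space-time cylinder `Q_T = Ω × (0,T)`. -/
def cylinder (Ω : Set (Euc N)) (T : ℝ) : Set (Euc N × ℝ) := Ω ×ˢ Ioo 0 T

/-- The two difference estimates for `v` with weight `g_β(t) = e^{-βt}` on `[0,T]`; the supremum
over `t` in the first one is written as a bound for every `t`. -/
def DifferenceEstimate (X : CurvilinearCoordinates Γ w) (δ c₀ R : ℝ) (M : ℕ) (ε β T : ℝ)
    (v : Euc N → ℝ → ℝ) : Prop :=
  (∀ t ∈ Icc 0 T,
    l2Norm Ω (fun x => Real.exp (-β * t) * v x t) ^ 2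
      + l2Norm (cylinder Ω T \ X.tube δ)
          (fun p => Real.exp (-β * p.2) • spaceGrad v p.1 p.2) ^ 2
      ≤ 2 * R ^ 2 * ε ^ (2 * M + 1)) ∧
  c₀ * l2Norm (cylinder Ω T ∩ X.tube δ)
        (fun p => Real.exp (-β * p.2) • X.tangentialGrad p.2 p.1 (spaceGrad v p.1 p.2)) ^ 2
      + ε ^ 2 * l2Norm (cylinder Ω T ∩ X.tube δ)
          (fun p => Real.exp (-β * p.2) * X.normalDeriv p.2 p.1 (spaceGrad v p.1 p.2)) ^ 2
    ≤ 2 * R ^ 2 * ε ^ (2 * M + 1)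

end Estimates

end

/-! ### The area formula for graphs -/

section AreaFormula

open Module Filter Topology

variable {Z E : Type*} [NormedAddCommGroup Z] [InnerProductSpace ℝ Z] [FiniteDimensional ℝ Z]
  [MeasurableSpace Z] [BorelSpace Z] [NormedAddCommGroup E] [InnerProductSpace ℝ E]
  [MeasurableSpace E] [BorelSpace E]

/-! The theorem is an energy estimate for v = u_ε - u^A_ε, closed by a continuation argument.
Testing the difference of the equations with v and using Green's identity gives d/dt ∫v² = -2(∫|∇v|²
+ ε⁻² ∫ v (f'(u) - f'(u^A)) + residual terms). The maximum principle bounds u, so a Taylor expansion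
replaces the nonlinear term by f''(u^A) v² up to an error of size |v|³/ε². The spectral estimate
bounds the resulting quadratic form from below by the tangential gradient and the gradient off the
tube. A fraction of order ε² of the form is not spent on the spectral estimate: its gradient part
yields ε²|∂_n v|², and its potential part costs only a multiple of ‖v‖², since ε²·ε⁻² f'' is
bounded. Young's inequality absorbs the residual (`energy_bookkeeping`,
`CurvilinearCoordinates.exists_energy_inequality`).

The heart is the cubic term. The anisotropic Gagliardo–Nirenberg inequality
(`CurvilinearCoordinates.exists_integral_rpow_le`) bounds ∫|v|^(2+4/N) by (‖v‖²/ε)^(2/N) times the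
available energy; only one direction carries the weight ε, so only one factor 1/ε is lost. On a
bounded range, |v|³/ε² is at most A v² + θ |v|^(2+4/N) ε^(-4k/N) with k = max{2, N/2}
(`exists_absorbsCube`): for N < 4 by Young's inequality in |v|/ε², for N ≥ 4 because |v| is bounded.
Hence as long as ‖v‖² ≲ ε^(2M+1), the cubic term costs a fraction of order θ ε^(4(M-k)/N) of the
energy. This is small for small ε if M > k. If M = k, it is small by the choice of the radius, or,
for N ≤ 3, by the choice of θ at the price of a large A and hence a short time. In each case the
differential inequality improves the bound under which it was derived, so the bound persists
(`bootstrap_estimate`).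

The Gagliardo–Nirenberg inequality is proved without an extension operator. Ω is covered by charts
in which every coordinate line, followed forward, stays in Ω until it leaves the chart
(`IsForwardChart`). A cut-off function extended by zero is then the integral of its derivative along
forward half lines, and Gagliardo's product argument applies. Near Γ the first coordinate is r, so
one coordinate derivative is ∂_n and the others see only ∇_τ; compactness in space and time makes
the constants uniform.

The divergence theorem is derived from the area formula for graphs: near a boundary point Ω is a
subgraph in each direction of a suitable basis of outward vectors, and in each of these directions
the theorem is the fundamental theorem of calculus along lines. -/

theorem euclideanHausdorffMeasure_image_le_of_dist_le {X Y W : Type*} [MetricSpace X]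
    [MeasurableSpace X] [BorelSpace X] [MetricSpace Y] [MeasurableSpace Y] [BorelSpace Y]
    {K : NNReal} {d : ℕ} {A : Set W}
    {F : W → X} {G : W → Y} (h : ∀ z ∈ A, ∀ z' ∈ A, dist (G z) (G z') ≤ K * dist (F z) (F z')) :
    Measure.euclideanHausdorffMeasure d (G '' A) ≤
      (K : ENNReal) ^ d * Measure.euclideanHausdorffMeasure d (F '' A) := by
  classical
  rcases A.eq_empty_or_nonempty with rfl | ⟨z₀, -⟩
  · simp
  have : Nonempty W := ⟨z₀⟩
  -- Points of A with equal F-values have equal G-values, so G factors through F even if F is not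
  -- injective; the factor H is K-Lipschitz on F(A).
  let H : X → Y := fun x => G (Function.invFunOn F A x)
  have hinv : ∀ z ∈ A, Function.invFunOn F A (F z) ∈ A ∧ F (Function.invFunOn F A (F z)) = F z :=
    fun z hz => ⟨Function.invFunOn_mem ⟨z, hz, rfl⟩, Function.invFunOn_eq ⟨z, hz, rfl⟩⟩
  have hH : ∀ z ∈ A, H (F z) = G z := by
    intro z hz
    have h1 := h _ (hinv z hz).1 z hz
    rw [(hinv z hz).2, dist_self, mul_zero] at h1
    exact dist_le_zero.1 h1
  have hL : LipschitzOnWith K H (F '' A) := by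
    rw [lipschitzOnWith_iff_dist_le_mul]
    rintro _ ⟨z, hz, rfl⟩ _ ⟨z', hz', rfl⟩
    rw [hH z hz, hH z' hz']
    exact h z hz z' hz'
  have him : H '' (F '' A) = G '' A := by
    rw [image_image]
    exact image_congr hH
  have := hL.hausdorffMeasure_image_le (d := (d : ℝ)) (by positivity)
  rw [him] at this
  simp only [Measure.euclideanHausdorffMeasure_def, Measure.smul_apply, ENNReal.smul_def,
    smul_eq_mul]
  rw [mul_left_comm]
  gcongr
  simpa using this

/-- A strictly differentiable map is locally, up to a factor close to `1`, area-scaling by the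
Jacobian of its derivative. -/
theorem HasStrictFDerivAt.euclideanHausdorffMeasure_image_near {G : Z → E} {L : Z →L[ℝ] E} {z₀ : Z}
    (hG : HasStrictFDerivAt G L z₀) (hL : Function.Injective L) {k : NNReal} (hk : 1 < k) :
    ∃ B ∈ 𝓝 z₀, ∀ A ⊆ B,
      Measure.euclideanHausdorffMeasure (finrank ℝ Z) (G '' A) ≤
        (k : ENNReal) ^ finrank ℝ Z * (ENNReal.ofReal L.toLinearMap.normDet * volume A) ∧
      ENNReal.ofReal L.toLinearMap.normDet * volume A ≤ (k : ENNReal) ^ finrank ℝ Z *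
        Measure.euclideanHausdorffMeasure (finrank ℝ Z) (G '' A) := by
  obtain ⟨K, hK, hKL⟩ := L.toLinearMap.exists_antilipschitzWith (LinearMap.ker_eq_bot.2 hL)
  -- Chosen so that 1 + η ≤ k and 1 - η ≥ 1/k: near z₀ the distances under G and under L then agree
  -- up to the factor k in both directions.
  set η : NNReal := min (k - 1) (1 - k⁻¹) with hη
  have hk0 : 0 < k := zero_lt_one.trans hk
  have hki : k⁻¹ < 1 := inv_lt_one_of_one_lt₀ hk
  have hη0 : 0 < η := lt_min (tsub_pos_of_lt hk) (tsub_pos_of_lt hki)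
  obtain ⟨B, hB, hGB⟩ := hG.approximates_deriv_on_nhds (c := η / K) (Or.inr (by positivity))
  have key : ∀ z ∈ B, ∀ z' ∈ B, ‖G z - G z' - L (z - z')‖ ≤ η * ‖L (z - z')‖ := by
    intro z hz z' hz'
    refine (hGB z hz z' hz').trans ?_
    have := hKL.le_mul_dist z z'
    rw [dist_eq_norm, dist_eq_norm] at this
    have h2 : ‖L.toLinearMap z - L.toLinearMap z'‖ = ‖L (z - z')‖ := by simp
    rw [h2] at this
    push_cast
    calc (η : ℝ) / K * ‖z - z'‖ ≤ η / K * (K * ‖L (z - z')‖) := by gcongr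
      _ = η * ‖L (z - z')‖ := by
        have : (K : ℝ) ≠ 0 := by exact_mod_cast hK.ne'
        field_simp
  have hη1 : (η : ℝ) ≤ k - 1 := by
    have : η ≤ k - 1 := min_le_left _ _
    have h3 : (η : ℝ) ≤ ((k - 1 : NNReal) : ℝ) := by exact_mod_cast this
    rwa [NNReal.coe_sub hk.le] at h3
  have hη2 : (η : ℝ) ≤ 1 - (k : ℝ)⁻¹ := by
    have : η ≤ 1 - k⁻¹ := min_le_right _ _
    have h3 : (η : ℝ) ≤ ((1 - k⁻¹ : NNReal) : ℝ) := by exact_mod_cast this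
    rwa [NNReal.coe_sub hki.le] at h3
  refine ⟨B, hB, fun A hA => ?_⟩
  have hLA := L.toLinearMap.euclideanHausdorffMeasure_image_eq_normDet_mul_volume A
  rw [← hLA]
  constructor
  · refine euclideanHausdorffMeasure_image_le_of_dist_le (F := L.toLinearMap) (G := G) ?_
    intro z hz z' hz'
    have := key z (hA hz) z' (hA hz')
    rw [dist_eq_norm, dist_eq_norm]
    have h2 : ‖L.toLinearMap z - L.toLinearMap z'‖ = ‖L (z - z')‖ := by simp
    rw [h2]
    have h4 := norm_sub_norm_le (G z - G z') (L (z - z'))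
    nlinarith [norm_nonneg (L (z - z'))]
  · refine euclideanHausdorffMeasure_image_le_of_dist_le (F := G) (G := L.toLinearMap) ?_
    intro z hz z' hz'
    have := key z (hA hz) z' (hA hz')
    rw [dist_eq_norm, dist_eq_norm]
    have h2 : ‖L.toLinearMap z - L.toLinearMap z'‖ = ‖L (z - z')‖ := by simp
    rw [h2]
    have h4 := norm_sub_norm_le (L (z - z')) (G z - G z')
    rw [norm_sub_rev (L (z - z'))] at h4
    have hk0' : (0 : ℝ) < k := by exact_mod_cast hk0
    have h5 : (k : ℝ)⁻¹ * ‖L (z - z')‖ ≤ ‖G z - G z'‖ := by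
      nlinarith [norm_nonneg (L (z - z'))]
    calc ‖L (z - z')‖ = k * ((k : ℝ)⁻¹ * ‖L (z - z')‖) := by field_simp
      _ ≤ _ := by gcongr

/-- Two measures which are comparable with a constant near every point of an open set are
comparable with this constant on the open set. -/
theorem measure_restrict_le_smul_of_locally {X : Type*} [TopologicalSpace X]
    [SecondCountableTopology X] [MeasurableSpace X] [OpensMeasurableSpace X] {μ ν : Measure X}
    {D : Set X} {c : ENNReal}
    (h : ∀ x ∈ D, ∃ B ∈ 𝓝 x, ∀ A ⊆ B, MeasurableSet A → μ A ≤ c * ν A)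
    {A : Set X} (hA : MeasurableSet A) (hAD : A ⊆ D) : μ A ≤ c * ν A := by
  choose! B hB hBA using h
  obtain ⟨t, htD, htc, hcov⟩ :=
    TopologicalSpace.countable_cover_nhdsWithin (s := D) (f := fun x => interior (B x))
      (fun x hx => mem_nhdsWithin_of_mem_nhds (interior_mem_nhds.2 (hB x hx)))
  rcases t.eq_empty_or_nonempty with rfl | hne
  · have : A = ∅ := by
      apply eq_empty_of_subset_empty
      refine hAD.trans (hcov.trans ?_)
      simp
    simp [this]
  obtain ⟨f, hf⟩ := htc.exists_eq_range hne
  -- After cutting A along a disjointed countable cover both measures are sums over the pieces, so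
  -- the local bounds add up without loss in the constant.
  let s : ℕ → Set X := fun n => A ∩ interior (B (f n))
  have hs : ∀ n, MeasurableSet (s n) := fun n => hA.inter isOpen_interior.measurableSet
  have hU : ⋃ n, disjointed s n = A := by
    rw [iUnion_disjointed]
    apply Subset.antisymm (iUnion_subset fun n => inter_subset_left)
    intro x hx
    have := hcov (hAD hx)
    simp only [hf, mem_iUnion, mem_range, exists_prop, exists_exists_eq_and] at this
    obtain ⟨n, hn⟩ := this
    exact mem_iUnion.2 ⟨n, hx, hn⟩
  have hm := fun n => (MeasurableSet.disjointed hs n)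
  rw [← hU, measure_iUnion (disjoint_disjointed s) hm, measure_iUnion (disjoint_disjointed s) hm,
    ← ENNReal.tsum_mul_left]
  refine ENNReal.tsum_le_tsum fun n => ?_
  refine hBA (f n) (htD (hf ▸ mem_range_self n)) _ ?_ (hm n)
  exact (disjointed_subset s n).trans (inter_subset_right.trans interior_subset)

end AreaFormula

/-! ### Graphs over a hyperplane: Jacobian and surface measure. -/

section AreaFormula

open Module Filter Topology

variable {Z E : Type*} [NormedAddCommGroup Z] [InnerProductSpace ℝ Z] [NormedAddCommGroup E]
  [InnerProductSpace ℝ E]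

/-- The graph map `z ↦ z + g(z) e`, where `i` embeds the domain into the ambient space. -/
def graphMap (i : Z →ₗᵢ[ℝ] E) (e : E) (g : Z → ℝ) (z : Z) : E := i z + g z • e

/-- The derivative of the graph map. -/
noncomputable def graphDeriv (i : Z →ₗᵢ[ℝ] E) (e : E) (g' : Z →L[ℝ] ℝ) : Z →L[ℝ] E :=
  i.toContinuousLinearMap + g'.smulRight e

variable {i : Z →ₗᵢ[ℝ] E} {e : E}

theorem inner_graphDeriv (he : ‖e‖ = 1) (hi : ∀ z, inner ℝ (i z) e = 0) (g' : Z →L[ℝ] ℝ)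
    (z w : Z) :
    inner ℝ (graphDeriv i e g' z) (graphDeriv i e g' w) = inner ℝ z w + g' z * g' w := by
  have h2 : inner ℝ e (i w) = 0 := by
    rw [real_inner_comm]; exact hi w
  have h3 : inner ℝ e e = 1 := by rw [real_inner_self_eq_norm_sq, he]; norm_num
  simp only [graphDeriv, add_apply, LinearIsometry.coe_toContinuousLinearMap,
    ContinuousLinearMap.smulRight_apply, inner_add_left, inner_add_right, inner_smul_left,
    inner_smul_right, hi z, h2, h3]
  simp [mul_comm]

theorem graphDeriv_injective (he : ‖e‖ = 1) (hi : ∀ z, inner ℝ (i z) e = 0) (g' : Z →L[ℝ] ℝ) :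
    Function.Injective (graphDeriv i e g') := by
  refine (injective_iff_map_eq_zero _).2 fun z hz => ?_
  have := inner_graphDeriv he hi g' z z
  rw [hz, inner_zero_left, real_inner_self_eq_norm_sq] at this
  have : ‖z‖ ^ 2 = 0 := by nlinarith [sq_nonneg ‖z‖, mul_self_nonneg (g' z)]
  simpa using this

theorem HasStrictFDerivAt.graphMap {g : Z → ℝ} {g' : Z →L[ℝ] ℝ}
    {z : Z} (hg : HasStrictFDerivAt g g' z) :
    HasStrictFDerivAt (graphMap i e g) (graphDeriv i e g') z :=
  i.toContinuousLinearMap.hasStrictFDerivAt.add (hg.smul_const e)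

variable [FiniteDimensional ℝ Z] [FiniteDimensional ℝ E]

/-- The Gram operator of the derivative is the identity plus the rank-one map z ↦ g'(z) a, where a
represents g'. It is a transvection, with determinant 1 + g'(a) = 1 + ‖g'‖². -/
theorem normDet_graphDeriv (he : ‖e‖ = 1) (hi : ∀ z, inner ℝ (i z) e = 0) (g' : Z →L[ℝ] ℝ) :
    (graphDeriv i e g').toLinearMap.normDet = Real.sqrt (1 + ‖g'‖ ^ 2) := by
  have h := (graphDeriv i e g').normDet_sq
  set a := (InnerProductSpace.toDual ℝ Z).symm g' with ha
  have hga : ∀ z, inner ℝ a z = g' z := fun z => InnerProductSpace.toDual_symm_apply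
  have h2 : ((graphDeriv i e g').adjoint ∘L graphDeriv i e g').toLinearMap =
      LinearMap.transvection g'.toLinearMap a := by
    ext1 z
    refine ext_inner_right ℝ fun w => ?_
    simp only [ContinuousLinearMap.coe_coe, ContinuousLinearMap.comp_apply,
      ContinuousLinearMap.adjoint_inner_left, LinearMap.transvection.apply]
    rw [inner_graphDeriv he hi, inner_add_left, inner_smul_left, hga]
    simp
  have h3 : ((graphDeriv i e g').adjoint ∘L graphDeriv i e g').det = 1 + ‖g'‖ ^ 2 := by
    rw [ContinuousLinearMap.det, h2, LinearMap.transvection.det]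
    simp only [ContinuousLinearMap.coe_coe]
    rw [← hga, real_inner_self_eq_norm_sq, ha, LinearIsometryEquiv.norm_map]
  rw [h3] at h
  rw [← Real.sqrt_sq (LinearMap.normDet_nonneg _)]
  congr 1

theorem adjoint_graphMap (hi : ∀ z, inner ℝ (i z) e = 0) (g : Z → ℝ) (z : Z) :
    i.toContinuousLinearMap.adjoint (graphMap i e g z) = z := by
  refine ext_inner_right ℝ fun w => ?_
  rw [ContinuousLinearMap.adjoint_inner_left, graphMap, inner_add_left, inner_smul_left,
    LinearIsometry.coe_toContinuousLinearMap, i.inner_map_map, real_inner_comm, real_inner_comm,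
    real_inner_comm _ e, hi w]
  simp

variable [MeasurableSpace Z] [BorelSpace Z] [MeasurableSpace E] [BorelSpace E]

/-- Near a point the graph map scales measure by the Jacobian there up to a factor k^d, and
continuity of the Jacobian costs one more factor k. These two-sided bounds with k^(d+1) pass to all
measurable sets, and k → 1 gives equality. Working with the projected measure turns surface
integrals into integrals with a density. -/
theorem map_adjoint_restrict_graph (he : ‖e‖ = 1) (hi : ∀ z, inner ℝ (i z) e = 0) {D : Set Z} (hD : IsOpen D)
    {g : Z → ℝ} (hg : ContDiffOn ℝ 1 g D) :
    ((Measure.euclideanHausdorffMeasure (finrank ℝ Z)).restrict (graphMap i e g '' D)).map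
        i.toContinuousLinearMap.adjoint =
      (volume.restrict D).withDensity
        (fun z => ENNReal.ofReal (Real.sqrt (1 + ‖fderiv ℝ g z‖ ^ 2))) := by
  set d := finrank ℝ Z with hd
  set P := i.toContinuousLinearMap.adjoint with hP
  set J : Z → ℝ := fun z => Real.sqrt (1 + ‖fderiv ℝ g z‖ ^ 2) with hJ
  have hJ1 : ∀ z, 1 ≤ J z := fun z => by
    rw [hJ]; apply Real.one_le_sqrt.2; nlinarith [sq_nonneg ‖fderiv ℝ g z‖]
  have hJc : ContinuousOn J D := by
    have : ContinuousOn (fderiv ℝ g) D := hg.continuousOn_fderiv_of_isOpen hD le_rfl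
    exact (continuousOn_const.add (this.norm.pow 2)).sqrt
  have himg : ∀ A ⊆ D, P ⁻¹' A ∩ graphMap i e g '' D = graphMap i e g '' A := by
    intro A hA
    ext x
    constructor
    · rintro ⟨hx, z, hz, rfl⟩
      rw [mem_preimage, hP, adjoint_graphMap hi] at hx
      exact ⟨z, hx, rfl⟩
    · rintro ⟨z, hz, rfl⟩
      refine ⟨?_, z, hA hz, rfl⟩
      rw [mem_preimage, hP, adjoint_graphMap hi]
      exact hz
  set μ := ((Measure.euclideanHausdorffMeasure d).restrict (graphMap i e g '' D)).map P with hμ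
  set ν := (volume.restrict D).withDensity (fun z => ENNReal.ofReal (J z)) with hν
  have hμA : ∀ A ⊆ D, MeasurableSet A → μ A =
      Measure.euclideanHausdorffMeasure d (graphMap i e g '' A) := by
    intro A hA hAm
    rw [hμ, Measure.map_apply P.continuous.measurable hAm,
      Measure.restrict_apply (P.continuous.measurable hAm), himg A hA]
  have hνA : ∀ A ⊆ D, MeasurableSet A → ν A = ∫⁻ z in A, ENNReal.ofReal (J z) := by
    intro A hA hAm
    rw [hν, withDensity_apply _ hAm, Measure.restrict_restrict hAm, inter_eq_left.2 hA]
  -- comparison near a point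
  have hloc : ∀ k : NNReal, 1 < k → ∀ z ∈ D, ∃ B ∈ 𝓝 z, ∀ A ⊆ B, A ⊆ D → MeasurableSet A →
      μ A ≤ (k : ENNReal) ^ (d + 1) * ν A ∧ ν A ≤ (k : ENNReal) ^ (d + 1) * μ A := by
    intro k hk z hz
    have hk0 : (0 : ℝ) < k := by exact_mod_cast zero_lt_one.trans hk
    have hstrict : HasStrictFDerivAt g (fderiv ℝ g z) z :=
      (hg.contDiffAt (hD.mem_nhds hz)).hasStrictFDerivAt one_ne_zero
    obtain ⟨B, hB, hBA⟩ := hstrict.graphMap.euclideanHausdorffMeasure_image_near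
      (graphDeriv_injective he hi _) hk
    rw [normDet_graphDeriv he hi] at hBA
    have hcont := hJc.continuousAt (hD.mem_nhds hz)
    have hJz : 0 < J z := zero_lt_one.trans_le (hJ1 z)
    have hk1 : (1 : ℝ) < k := by exact_mod_cast hk
    have h1 : ∀ᶠ y in 𝓝 z, J y < k * J z := hcont.eventually_lt_const (by nlinarith)
    have h2 : ∀ᶠ y in 𝓝 z, J z < k * J y := by
      have : ContinuousAt (fun y => k * J y) z := hcont.const_mul _
      exact this.eventually_const_lt (by nlinarith)
    refine ⟨B ∩ {y | J y < k * J z ∧ J z < k * J y}, inter_mem hB (h1.and h2), ?_⟩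
    intro A hA hAD hAm
    obtain ⟨h3, h4⟩ := hBA A (hA.trans inter_subset_left)
    rw [hμA A hAD hAm, hνA A hAD hAm]
    have hup : ∫⁻ y in A, ENNReal.ofReal (J y) ≤ k * (ENNReal.ofReal (J z) * volume A) := by
      rw [← mul_assoc, ← ENNReal.ofReal_coe_nnreal, ← ENNReal.ofReal_mul hk0.le,
        ← setLIntegral_const]
      exact setLIntegral_mono' hAm fun y hy => ENNReal.ofReal_le_ofReal (hA hy).2.1.le
    have hlow : ENNReal.ofReal (J z) * volume A ≤ k * ∫⁻ y in A, ENNReal.ofReal (J y) := by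
      rw [← lintegral_const_mul' _ _ ENNReal.coe_ne_top, ← setLIntegral_const]
      refine setLIntegral_mono' hAm fun y hy => ?_
      rw [← ENNReal.ofReal_coe_nnreal, ← ENNReal.ofReal_mul hk0.le]
      exact ENNReal.ofReal_le_ofReal (hA hy).2.2.le
    constructor
    · calc _ ≤ _ := h3
        _ ≤ (k : ENNReal) ^ d * (k * ∫⁻ y in A, ENNReal.ofReal (J y)) := by gcongr
        _ = _ := by rw [pow_succ, mul_assoc]
    · calc _ ≤ _ := hup
        _ ≤ k * ((k : ENNReal) ^ d * Measure.euclideanHausdorffMeasure d (graphMap i e g '' A)) := by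
            gcongr
        _ = _ := by rw [pow_succ', mul_assoc]
  have hglob : ∀ k : NNReal, 1 < k → ∀ A ⊆ D, MeasurableSet A →
      μ A ≤ (k : ENNReal) ^ (d + 1) * ν A ∧ ν A ≤ (k : ENNReal) ^ (d + 1) * μ A := by
    intro k hk A hAD hAm
    constructor
    · refine measure_restrict_le_smul_of_locally (fun z hz => ?_) hAm hAD
      obtain ⟨B, hB, h⟩ := hloc k hk z hz
      exact ⟨B ∩ D, inter_mem hB (hD.mem_nhds hz), fun A hA hAm =>
        (h A (hA.trans inter_subset_left) (hA.trans inter_subset_right) hAm).1⟩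
    · refine measure_restrict_le_smul_of_locally (fun z hz => ?_) hAm hAD
      obtain ⟨B, hB, h⟩ := hloc k hk z hz
      exact ⟨B ∩ D, inter_mem hB (hD.mem_nhds hz), fun A hA hAm =>
        (h A (hA.trans inter_subset_left) (hA.trans inter_subset_right) hAm).2⟩
  have hlim : ∀ x y : ENNReal, (∀ k : NNReal, 1 < k → x ≤ (k : ENNReal) ^ (d + 1) * y) → x ≤ y := by
    intro x y h
    have hc : Tendsto (fun k : NNReal => (k : ENNReal) ^ (d + 1) * y) (𝓝[>] 1) (𝓝 (1 * y)) := by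
      refine ENNReal.Tendsto.mul_const ?_ (Or.inl one_ne_zero)
      have : Tendsto (fun k : NNReal => ((k ^ (d + 1) : NNReal) : ENNReal)) (𝓝[>] 1)
          (𝓝 ((1 ^ (d + 1) : NNReal) : ENNReal)) :=
        ENNReal.tendsto_coe.2 (((continuous_id.pow (d + 1)).tendsto 1).mono_left
          nhdsWithin_le_nhds)
      simpa using this
    rw [one_mul] at hc
    exact ge_of_tendsto hc (eventually_mem_nhdsWithin.mono fun k hk => h k hk)
  refine Measure.ext fun A hA => ?_
  have hres : ∀ A, MeasurableSet A → μ A = μ (A ∩ D) ∧ ν A = ν (A ∩ D) := by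
    intro A hA
    constructor
    · rw [hμ, Measure.map_apply P.continuous.measurable hA,
        Measure.map_apply P.continuous.measurable (hA.inter hD.measurableSet),
        Measure.restrict_apply (P.continuous.measurable hA),
        Measure.restrict_apply (P.continuous.measurable (hA.inter hD.measurableSet)),
        preimage_inter, inter_assoc]
      congr 2
      symm
      rw [inter_eq_right]
      rintro _ ⟨z, hz, rfl⟩
      rw [mem_preimage, hP, adjoint_graphMap hi]
      exact hz
    · rw [hν, withDensity_apply _ hA, withDensity_apply _ (hA.inter hD.measurableSet),
        Measure.restrict_restrict hA, Measure.restrict_restrict (hA.inter hD.measurableSet),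
        inter_assoc, inter_self]
  rw [(hres A hA).1, (hres A hA).2]
  have hm := hA.inter hD.measurableSet
  exact le_antisymm (hlim _ _ fun k hk => (hglob k hk _ inter_subset_right hm).1)
    (hlim _ _ fun k hk => (hglob k hk _ inter_subset_right hm).2)

theorem euclideanHausdorffMeasure_graph (he : ‖e‖ = 1) (hi : ∀ z, inner ℝ (i z) e = 0)
    {D : Set Z} (hD : IsOpen D) {g : Z → ℝ} (hg : ContDiffOn ℝ 1 g D) :
    Measure.euclideanHausdorffMeasure (finrank ℝ Z) (graphMap i e g '' D) =
      ∫⁻ z in D, ENNReal.ofReal (Real.sqrt (1 + ‖fderiv ℝ g z‖ ^ 2)) := by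
  have key := congrArg (fun μ => μ univ) (map_adjoint_restrict_graph he hi hD hg)
  simpa [Measure.map_apply (ContinuousLinearMap.continuous _).measurable MeasurableSet.univ,
    withDensity_apply _ MeasurableSet.univ] using key

/-- The area formula for a graph over the orthogonal complement of a unit vector. -/
theorem setIntegral_graph (he : ‖e‖ = 1) (hi : ∀ z, inner ℝ (i z) e = 0) {D : Set Z} (hD : IsOpen D)
    {g : Z → ℝ} (hg : ContDiffOn ℝ 1 g D) (hm : MeasurableSet (graphMap i e g '' D))
    {h : E → ℝ} (hh : ContinuousOn (fun z => h (graphMap i e g z)) D) :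
    ∫ x in graphMap i e g '' D, h x
        ∂(Measure.euclideanHausdorffMeasure (finrank ℝ Z)) =
      ∫ z in D, Real.sqrt (1 + ‖fderiv ℝ g z‖ ^ 2) * h (graphMap i e g z) := by
  have hJc : ContinuousOn (fun z => Real.sqrt (1 + ‖fderiv ℝ g z‖ ^ 2)) D := by
    have : ContinuousOn (fderiv ℝ g) D := hg.continuousOn_fderiv_of_isOpen hD le_rfl
    exact (continuousOn_const.add (this.norm.pow 2)).sqrt
  have hJm : AEMeasurable (fun z => (Real.sqrt (1 + ‖fderiv ℝ g z‖ ^ 2)).toNNReal)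
      (volume.restrict D) := (hJc.aemeasurable hD.measurableSet).real_toNNReal
  have key := map_adjoint_restrict_graph he hi hD hg
  have hae : AEStronglyMeasurable (fun z => h (graphMap i e g z))
      (((Measure.euclideanHausdorffMeasure (finrank ℝ Z)).restrict
        (graphMap i e g '' D)).map i.toContinuousLinearMap.adjoint) := by
    rw [key]
    exact (hh.aestronglyMeasurable hD.measurableSet).mono_ac (withDensity_absolutelyContinuous _ _)
  -- On the graph the integrand depends only on the projection of x, so the surface integral is one
  -- against the projected measure.
  have h1 : ∫ x in graphMap i e g '' D, h x
        ∂(Measure.euclideanHausdorffMeasure (finrank ℝ Z)) =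
      ∫ x in graphMap i e g '' D, h (graphMap i e g (i.toContinuousLinearMap.adjoint x))
        ∂(Measure.euclideanHausdorffMeasure (finrank ℝ Z)) := by
    refine setIntegral_congr_fun hm ?_
    rintro _ ⟨z, hz, rfl⟩
    simp only [adjoint_graphMap hi]
  rw [h1, ← integral_map (φ := i.toContinuousLinearMap.adjoint)
    (f := fun z => h (graphMap i e g z))
    (ContinuousLinearMap.continuous _).measurable.aemeasurable hae, key]
  rw [show (fun z => ENNReal.ofReal (Real.sqrt (1 + ‖fderiv ℝ g z‖ ^ 2))) =
    fun z => ((Real.sqrt (1 + ‖fderiv ℝ g z‖ ^ 2)).toNNReal : ENNReal) from rfl,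
    integral_withDensity_eq_integral_smul₀ hJm]
  refine integral_congr_ae (ae_of_all _ fun z => ?_)
  simp only [NNReal.smul_def, smul_eq_mul, Real.coe_toNNReal _ (Real.sqrt_nonneg _)]

end AreaFormula

/-! ### Defining functions, the outer unit normal, and differentiability up to the boundary. -/

section DomainGeometry

open Filter Topology

variable {N : ℕ} {Ω U : Set (Euc N)} {x y : Euc N} {ρ : Euc N → ℝ}

namespace IsLocalDefiningFunction

theorem contDiffAt (h : IsLocalDefiningFunction Ω x U ρ) (hy : y ∈ U) : ContDiffAt ℝ ∞ ρ y :=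
  h.2.2.1.contDiffAt (h.1.mem_nhds hy)

theorem differentiableAt (h : IsLocalDefiningFunction Ω x U ρ) (hy : y ∈ U) :
    DifferentiableAt ℝ ρ y :=
  (h.contDiffAt hy).differentiableAt (by simp)

theorem mem_iff (h : IsLocalDefiningFunction Ω x U ρ) (hy : y ∈ U) : y ∈ Ω ↔ ρ y < 0 := by
  have := h.2.2.2.2.2
  constructor
  · intro hyΩ
    have : y ∈ {y ∈ U | ρ y < 0} := this ▸ ⟨hyΩ, hy⟩
    exact this.2
  · intro hρ
    have : y ∈ Ω ∩ U := this ▸ ⟨hy, hρ⟩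
    exact this.1

theorem nonpos_of_mem_closure (h : IsLocalDefiningFunction Ω x U ρ) (hy : y ∈ U)
    (hyΩ : y ∈ closure Ω) : ρ y ≤ 0 := by
  by_contra! hpos
  have hev : ∀ᶠ z in 𝓝 y, 0 < ρ z ∧ z ∈ U :=
    ((h.contDiffAt hy).continuousAt.eventually_const_lt hpos).and (h.1.mem_nhds hy)
  obtain ⟨z, hz, hzΩ⟩ := mem_closure_iff_nhds.1 hyΩ _ hev
  exact absurd ((h.mem_iff hz.2).1 hzΩ) hz.1.le.not_gt

theorem eq_zero_of_mem_frontier (h : IsLocalDefiningFunction Ω x U ρ) (hΩ : IsOpen Ω)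
    (hy : y ∈ U) (hyΩ : y ∈ frontier Ω) : ρ y = 0 := by
  rw [hΩ.frontier_eq] at hyΩ
  refine le_antisymm (h.nonpos_of_mem_closure hy hyΩ.1) ?_
  by_contra! hneg
  exact hyΩ.2 ((h.mem_iff hy).2 hneg)

/-- One defining function thus gives the normal at all boundary points near the base point;
continuity of the normal and its formula in graph charts rest on this. -/
theorem of_mem_frontier (h : IsLocalDefiningFunction Ω x U ρ) (hΩ : IsOpen Ω)
    (hy : y ∈ U) (hyΩ : y ∈ frontier Ω) (hne : gradient ρ y ≠ 0) :
    IsLocalDefiningFunction Ω y U ρ :=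
  ⟨h.1, hy, h.2.2.1, h.eq_zero_of_mem_frontier hΩ hy hyΩ, hne, h.2.2.2.2.2⟩

theorem inner_gradient (h : IsLocalDefiningFunction Ω x U ρ) (hy : y ∈ U) (v : Euc N) :
    inner ℝ (gradient ρ y) v = fderiv ℝ ρ y v := by
  rw [(h.differentiableAt hy).hasGradientAt.hasFDerivAt.fderiv, InnerProductSpace.toDual_apply_apply]

theorem hasDerivAt_line (h : IsLocalDefiningFunction Ω x U ρ) (v : Euc N) :
    HasDerivAt (fun s : ℝ => ρ (x + s • v)) (fderiv ℝ ρ x v) 0 := by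
  have h1 : HasDerivAt (fun s : ℝ => x + s • v) v 0 := by
    simpa using ((hasDerivAt_id (0 : ℝ)).smul_const v).const_add x
  have h2 : HasFDerivAt ρ (fderiv ℝ ρ x) (x + (0 : ℝ) • v) := by
    simpa using (h.differentiableAt h.2.1).hasFDerivAt
  exact h2.comp_hasDerivAt 0 h1

theorem eventually_mem (h : IsLocalDefiningFunction Ω x U ρ) {v : Euc N}
    (hv : fderiv ℝ ρ x v < 0) : ∀ᶠ s : ℝ in 𝓝[>] 0, x + s • v ∈ Ω := by
  have hd := h.hasDerivAt_line v
  have hslope := (hasDerivAt_iff_tendsto_slope.1 hd).mono_left (nhdsGT_le_nhdsNE (0 : ℝ))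
  have h1 := hslope.eventually_lt_const hv
  have hU : ∀ᶠ s : ℝ in 𝓝[>] 0, x + s • v ∈ U := by
    have : ContinuousAt (fun s : ℝ => x + s • v) 0 := by fun_prop
    exact nhdsWithin_le_nhds (this.preimage_mem_nhds (h.1.mem_nhds (by simpa using h.2.1)))
  filter_upwards [h1, hU, self_mem_nhdsWithin] with s hs hsU hs0
  rw [h.mem_iff hsU]
  have hs0' : (0 : ℝ) < s := hs0
  rw [slope_def_field, sub_zero, zero_smul, add_zero, h.2.2.2.1, sub_zero,
    div_lt_iff₀ hs0'] at hs
  simpa using hs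

theorem eventually_not_mem (h : IsLocalDefiningFunction Ω x U ρ) {v : Euc N}
    (hv : 0 < fderiv ℝ ρ x v) : ∀ᶠ s : ℝ in 𝓝[>] 0, x + s • v ∉ closure Ω := by
  have hd := h.hasDerivAt_line v
  have hslope := (hasDerivAt_iff_tendsto_slope.1 hd).mono_left (nhdsGT_le_nhdsNE (0 : ℝ))
  have h1 := hslope.eventually_const_lt hv
  have hU : ∀ᶠ s : ℝ in 𝓝[>] 0, x + s • v ∈ U := by
    have : ContinuousAt (fun s : ℝ => x + s • v) 0 := by fun_prop
    exact nhdsWithin_le_nhds (this.preimage_mem_nhds (h.1.mem_nhds (by simpa using h.2.1)))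
  filter_upwards [h1, hU, self_mem_nhdsWithin] with s hs hsU hs0 hcl
  have hs0' : (0 : ℝ) < s := hs0
  have := h.nonpos_of_mem_closure hsU hcl
  rw [slope_def_field, sub_zero, zero_smul, add_zero, h.2.2.2.1, sub_zero,
    lt_div_iff₀ hs0'] at hs
  linarith

/-- Two local defining functions at the same point have the same normalized gradient. -/
theorem normalized_gradient_unique {U₁ U₂ : Set (Euc N)} {ρ₁ ρ₂ : Euc N → ℝ}
    (h₁ : IsLocalDefiningFunction Ω x U₁ ρ₁) (h₂ : IsLocalDefiningFunction Ω x U₂ ρ₂) :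
    ‖gradient ρ₁ x‖⁻¹ • gradient ρ₁ x = ‖gradient ρ₂ x‖⁻¹ • gradient ρ₂ x := by
  set a := gradient ρ₁ x with ha
  set b := gradient ρ₂ x with hb
  have ha0 : a ≠ 0 := h₁.2.2.2.2.1
  have hb0 : b ≠ 0 := h₂.2.2.2.2.1
  have hna : 0 < ‖a‖ := norm_pos_iff.2 ha0
  have hnb : 0 < ‖b‖ := norm_pos_iff.2 hb0
  -- the two open half spaces are compatible
  have key : ∀ v, inner ℝ a v < 0 → inner ℝ b v ≤ 0 := by
    intro v hv
    by_contra! hbv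
    rw [ha, h₁.inner_gradient h₁.2.1] at hv
    rw [hb, h₂.inner_gradient h₂.2.1] at hbv
    obtain ⟨s, hs1, hs2⟩ := ((h₁.eventually_mem hv).and (h₂.eventually_not_mem hbv)).exists
    exact hs2 (subset_closure hs1)
  set p := ‖a‖⁻¹ • a with hp
  set q := ‖b‖⁻¹ • b with hq
  have hp1 : ‖p‖ = 1 := by rw [hp, norm_smul, norm_inv, norm_norm, inv_mul_cancel₀ hna.ne']
  have hq1 : ‖q‖ = 1 := by rw [hq, norm_smul, norm_inv, norm_norm, inv_mul_cancel₀ hnb.ne']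
  have key' : ∀ v, inner ℝ p v < 0 → inner ℝ q v ≤ 0 := by
    intro v hv
    rw [hp, real_inner_smul_left] at hv
    rw [hq, real_inner_smul_left]
    have hv' : inner ℝ a v < 0 := by
      by_contra! h0
      exact absurd hv (mul_nonneg (inv_pos.2 hna).le h0).not_gt
    exact mul_nonpos_of_nonneg_of_nonpos (inv_pos.2 hnb).le (key v hv')
  set c := inner ℝ p q with hc
  have hpp : inner ℝ p p = (1 : ℝ) := by rw [real_inner_self_eq_norm_sq, hp1]; norm_num
  have hqq : inner ℝ q q = (1 : ℝ) := by rw [real_inner_self_eq_norm_sq, hq1]; norm_num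
  have hqp : inner ℝ q p = c := real_inner_comm _ _
  have hc1 : c ≤ 1 := by
    have := real_inner_le_norm p q
    rwa [hp1, hq1, mul_one] at this
  have hclt : 1 ≤ c := by
    by_contra! hlt
    -- the vector `q - (c + t) p` with a small `t > 0` violates `key'`
    have hcm : -1 ≤ c := by
      have := neg_le_of_abs_le (abs_real_inner_le_norm p q)
      rwa [hp1, hq1, mul_one] at this
    -- For c = -1 the vector with t = (1 - c²)/2 would not satisfy the strict inequality, and -p is
    -- used instead. For c > -1 that vector v has ⟪q, v⟫ = (1 - c²)(1 - c/2) > 0.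
    rcases hcm.eq_or_lt with hc' | hc'
    · have := key' (-p) (by rw [inner_neg_right, hpp]; norm_num)
      rw [inner_neg_right, hqp, ← hc'] at this
      norm_num at this
    · have hpos : 0 < 1 - c ^ 2 := by nlinarith
      have := key' (q - (c + (1 - c ^ 2) / 2) • p) (by
        rw [inner_sub_right, real_inner_smul_right p p, hpp, ← hc]; linarith)
      rw [inner_sub_right, real_inner_smul_right q p, hqq, hqp] at this
      nlinarith
  have hceq : c = 1 := le_antisymm hc1 hclt
  exact (inner_eq_one_iff_of_norm_eq_one hp1 hq1).1 hceq

/-- The normal is defined through an arbitrary choice of defining function; uniqueness of the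
normalized gradient makes the choice irrelevant. -/
theorem outerUnitNormal_eq (h : IsLocalDefiningFunction Ω x U ρ) :
    outerUnitNormal Ω x = ‖gradient ρ x‖⁻¹ • gradient ρ x := by
  have hex : ∃ ν, IsOuterUnitNormal Ω x ν := ⟨_, U, ρ, h, rfl⟩
  rw [outerUnitNormal, dif_pos hex]
  obtain ⟨U', ρ', h', hν⟩ := hex.choose_spec
  rw [hν]
  exact h'.normalized_gradient_unique h

theorem fderiv_gradient_pos (h : IsLocalDefiningFunction Ω x U ρ) :
    0 < fderiv ℝ ρ x (gradient ρ x) := by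
  rw [← h.inner_gradient h.2.1, real_inner_self_eq_norm_sq]
  have : 0 < ‖gradient ρ x‖ := norm_pos_iff.2 h.2.2.2.2.1
  positivity

end IsLocalDefiningFunction

namespace IsBoundedSmoothDomain

theorem isCompact_closure (hΩ : IsBoundedSmoothDomain Ω) : IsCompact (closure Ω) :=
  hΩ.isBounded.isCompact_closure

/-- At a boundary point every v with dρ(v) < 0 lies in the tangent cone, and these vectors form a
nonempty open set, hence span. This is what makes `fderivWithin` on the closure a well-behaved
extension of interior derivatives to ∂Ω. -/
theorem uniqueDiffOn_closure (hΩ : IsBoundedSmoothDomain Ω) : UniqueDiffOn ℝ (closure Ω) := by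
  intro x hx
  by_cases hxΩ : x ∈ Ω
  · exact (hΩ.isOpen.uniqueDiffWithinAt hxΩ).mono subset_closure
  have hxf : x ∈ frontier Ω := by
    rw [hΩ.isOpen.frontier_eq]; exact ⟨hx, hxΩ⟩
  obtain ⟨U, ρ, h⟩ := hΩ.smooth_boundary x hxf
  refine ⟨?_, subset_closure hx⟩
  have hcone : {v : Euc N | fderiv ℝ ρ x v < 0} ⊆ tangentConeAt ℝ (closure Ω) x := by
    intro v hv
    have hev := h.eventually_mem hv
    refine mem_tangentConeAt_of_add_smul_mem (l := 𝓝[>] (0 : ℝ)) (nhdsGT_le_nhdsNE 0) ?_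
    exact hev.mono fun s hs => subset_closure hs
  have hopen : IsOpen {v : Euc N | fderiv ℝ ρ x v < 0} :=
    isOpen_lt (fderiv ℝ ρ x).continuous continuous_const
  have hne : {v : Euc N | fderiv ℝ ρ x v < 0}.Nonempty :=
    ⟨-gradient ρ x, by simpa using h.fderiv_gradient_pos⟩
  have hspan : Submodule.span ℝ {v : Euc N | fderiv ℝ ρ x v < 0} = ⊤ :=
    Submodule.eq_top_of_nonempty_interior' _ (by
      obtain ⟨v, hv⟩ := hne
      exact ⟨v, mem_interior.2 ⟨_, Submodule.subset_span, hopen, hv⟩⟩)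
  have : Submodule.span ℝ (tangentConeAt ℝ (closure Ω) x) = ⊤ :=
    top_le_iff.1 (hspan ▸ Submodule.span_mono hcone)
  rw [this]
  exact dense_univ

end IsBoundedSmoothDomain

end DomainGeometry

/-! ### The boundary as a graph. -/

section GraphChart

open Filter Topology

variable {N : ℕ} {Ω : Set (Euc N)} {Z : Type*} [NormedAddCommGroup Z] [InnerProductSpace ℝ Z]
  [FiniteDimensional ℝ Z] {i : Z →ₗᵢ[ℝ] Euc N} {e : Euc N}

/-- Over the open set `D` and for heights in `[a,b]`, the domain `Ω` is the subgraph of `g` in the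
direction `e`, and its boundary is the graph. -/
structure IsBoundaryGraph (Ω : Set (Euc N)) (i : Z →ₗᵢ[ℝ] Euc N) (e : Euc N) (D : Set Z) (a b : ℝ)
    (g : Z → ℝ) : Prop where
  isOpen : IsOpen D
  contDiffOn : ContDiffOn ℝ 1 g D
  mem_Ioo : ∀ z ∈ D, g z ∈ Ioo a b
  mem_iff : ∀ z ∈ D, ∀ s ∈ Icc a b, (i z + s • e ∈ Ω ↔ s < g z)
  mem_frontier_iff : ∀ z ∈ D, ∀ s ∈ Icc a b, (i z + s • e ∈ frontier Ω ↔ s = g z)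
  inner_normal : ∀ z ∈ D, inner ℝ (outerUnitNormal Ω (graphMap i e g z)) e *
    Real.sqrt (1 + ‖fderiv ℝ g z‖ ^ 2) = 1

/-- The implicit function theorem solves ρ(z + s e) = 0 for s = ψ(z). On a small box ρ is strictly
increasing in the direction e, so the sign of ρ, and with it membership in Ω, is decided by
comparing s with ψ(z). Any direction with positive derivative will do, not only the normal. -/
theorem IsLocalDefiningFunction.exists_isBoundaryGraph (hΩ : IsOpen Ω) (he : ‖e‖ = 1)
    (hi : ∀ z, inner ℝ (i z) e = 0)
    (hdec : ∀ x, i (i.toContinuousLinearMap.adjoint x) + (inner ℝ x e : ℝ) • e = x)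
    {x : Euc N} {U : Set (Euc N)}
    {ρ : Euc N → ℝ} (h : IsLocalDefiningFunction Ω x U ρ) (hpos : 0 < fderiv ℝ ρ x e) :
    ∃ (D : Set Z) (a b : ℝ) (g : Z → ℝ), IsBoundaryGraph Ω i e D a b g ∧
      i.toContinuousLinearMap.adjoint x ∈ D ∧ inner ℝ x e ∈ Ioo a b := by
  set z₀ := i.toContinuousLinearMap.adjoint x with hz₀
  set s₀ : ℝ := inner ℝ x e with hs₀
  let Θ : Z × ℝ →L[ℝ] Euc N := i.toContinuousLinearMap.coprod
    ((ContinuousLinearMap.id ℝ ℝ).smulRight e)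
  have hΘ : ∀ p : Z × ℝ, Θ p = i p.1 + p.2 • e := fun p => by simp [Θ]
  have hΘ0 : Θ (z₀, s₀) = x := by rw [hΘ]; exact hdec x
  let F : Z × ℝ → ℝ := fun p => ρ (Θ p)
  have hFd : ∀ p, Θ p ∈ U → HasFDerivAt F ((fderiv ℝ ρ (Θ p)).comp Θ) p := fun p hp =>
    (h.differentiableAt hp).hasFDerivAt.comp p Θ.hasFDerivAt
  have hF : ContDiffAt ℝ ∞ F (z₀, s₀) := by
    have : ContDiffAt ℝ ∞ ρ (Θ (z₀, s₀)) := hΘ0 ▸ h.contDiffAt h.2.1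
    exact this.comp _ Θ.contDiff.contDiffAt
  have hinv : (fderiv ℝ F (z₀, s₀) ∘L .inr ℝ Z ℝ).IsInvertible := by
    rw [(hFd _ (hΘ0 ▸ h.2.1)).fderiv, hΘ0]
    have : ((fderiv ℝ ρ x).comp Θ ∘L .inr ℝ Z ℝ) =
        (ContinuousLinearEquiv.unitsEquivAut ℝ (Units.mk0 _ hpos.ne') : ℝ →L[ℝ] ℝ) := by
      ext
      simp [hΘ]
    rw [this]
    exact ⟨_, rfl⟩
  set ψ := hF.implicitFunction (by simp) hinv with hψ
  have hψ0 : ψ z₀ = s₀ := hF.implicitFunction_apply_self (by simp) hinv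
  have hF0 : F (z₀, s₀) = 0 := by simp only [F]; rw [hΘ0, h.2.2.2.1]
  have hev1 := hF.eventually_apply_eq_iff_implicitFunction (by simp) hinv
  have hUn : ∀ᶠ p in 𝓝 (z₀, s₀), Θ p ∈ U :=
    Θ.continuous.continuousAt.preimage_mem_nhds (hΘ0.symm ▸ h.1.mem_nhds h.2.1)
  have hposn : ∀ᶠ p in 𝓝 (z₀, s₀), 0 < fderiv ℝ ρ (Θ p) e := by
    have h1 : ContinuousAt (fderiv ℝ ρ) x :=
      ((h.contDiffAt h.2.1).fderiv_right (m := 0) (by simp)).continuousAt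
    have h2 : ContinuousAt (fun p => fderiv ℝ ρ (Θ p) e) (z₀, s₀) := by
      have h3 : ContinuousAt (fun p => fderiv ℝ ρ (Θ p)) (z₀, s₀) :=
        ContinuousAt.comp (f := Θ) (x := (z₀, s₀)) (hΘ0.symm ▸ h1) Θ.continuous.continuousAt
      exact h3.clm_apply continuousAt_const
    refine h2.eventually_const_lt ?_
    show 0 < fderiv ℝ ρ (Θ (z₀, s₀)) e
    rw [hΘ0]; exact hpos
  obtain ⟨r, hr, hball⟩ := Metric.nhds_basis_closedBall.mem_iff.1
    (inter_mem hev1 (inter_mem hUn hposn))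
  have hball' : ∀ z ∈ Metric.closedBall z₀ r, ∀ s ∈ Icc (s₀ - r) (s₀ + r),
      (F (z, s) = 0 ↔ ψ z = s) ∧ Θ (z, s) ∈ U ∧ 0 < fderiv ℝ ρ (Θ (z, s)) e := by
    intro z hz s hs
    have hmem : (z, s) ∈ Metric.closedBall (z₀, s₀) r := by
      rw [← closedBall_prod_same]
      exact ⟨hz, by rw [Real.closedBall_eq_Icc]; exact hs⟩
    obtain ⟨h1, h2, h3⟩ := hball hmem
    refine ⟨?_, h2, h3⟩
    have h1' : F (z, s) = F (z₀, s₀) ↔ ψ z = s := h1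
    rwa [hF0] at h1'
  have hψc : ContDiffAt ℝ ∞ ψ z₀ := hF.contDiffAt_implicitFunction (by simp) hinv
  have hDn : ∀ᶠ z in 𝓝 z₀, z ∈ Metric.closedBall z₀ r ∧ ψ z ∈ Ioo (s₀ - r) (s₀ + r) ∧
      ContDiffAt ℝ 1 ψ z := by
    refine Filter.Eventually.and (Metric.closedBall_mem_nhds z₀ hr) (Filter.Eventually.and ?_ ?_)
    · refine hψc.continuousAt.preimage_mem_nhds (Ioo_mem_nhds ?_ ?_) <;> rw [hψ0] <;> linarith
    · exact (hψc.of_le (by exact_mod_cast le_top)).eventually (by simp)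
  obtain ⟨D, hD, hDo, hzD⟩ := eventually_nhds_iff.1 hDn
  have hmono : ∀ z ∈ D, StrictMonoOn (fun s => F (z, s)) (Icc (s₀ - r) (s₀ + r)) := by
    intro z hz
    have hder : ∀ s ∈ Icc (s₀ - r) (s₀ + r),
        HasDerivAt (fun s => F (z, s)) (fderiv ℝ ρ (Θ (z, s)) e) s := by
      intro s hs
      have h1 := hFd (z, s) (hball' z (hD z hz).1 s hs).2.1
      have h2 : HasDerivAt (fun s : ℝ => (z, s)) ((0 : Z), (1 : ℝ)) s :=
        (hasDerivAt_const s z).prodMk (hasDerivAt_id s)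
      have h3 := h1.comp_hasDerivAt s h2
      have h4 : ((fderiv ℝ ρ (Θ (z, s))).comp Θ) ((0 : Z), (1 : ℝ)) = fderiv ℝ ρ (Θ (z, s)) e := by
        simp [hΘ]
      rw [h4] at h3
      exact h3
    refine strictMonoOn_of_deriv_pos (convex_Icc _ _)
      (fun s hs => (hder s hs).continuousAt.continuousWithinAt) fun s hs => ?_
    rw [(hder s (interior_subset hs)).deriv]
    exact (hball' z (hD z hz).1 s (interior_subset hs)).2.2
  have hzero : ∀ z ∈ D, F (z, ψ z) = 0 := fun z hz =>
    (hball' z (hD z hz).1 (ψ z) (Ioo_subset_Icc_self (hD z hz).2.1)).1.2 rfl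
  have hmem : ∀ z ∈ D, ∀ s ∈ Icc (s₀ - r) (s₀ + r), (i z + s • e ∈ Ω ↔ s < ψ z) := by
    intro z hz s hs
    have hU := (hball' z (hD z hz).1 s hs).2.1
    have h1 := h.mem_iff hU
    rw [hΘ] at h1
    rw [h1, ← (hmono z hz).lt_iff_lt hs (Ioo_subset_Icc_self (hD z hz).2.1)]
    show _ ↔ F (z, s) < F (z, ψ z)
    rw [hzero z hz]
    simp only [F, hΘ]
  have hfro : ∀ z ∈ D, ∀ s ∈ Icc (s₀ - r) (s₀ + r), (i z + s • e ∈ frontier Ω ↔ s = ψ z) := by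
    intro z hz s hs
    have hU := (hball' z (hD z hz).1 s hs)
    have hψI := (hD z hz).2.1
    constructor
    · intro hf
      have h1 := h.eq_zero_of_mem_frontier hΩ hU.2.1 (by rw [hΘ]; exact hf)
      exact (hU.1.1 h1).symm
    · rintro rfl
      rw [hΩ.frontier_eq]
      refine ⟨?_, fun hmemΩ => lt_irrefl _ ((hmem z hz _ hs).1 hmemΩ)⟩
      have hcont : ContinuousWithinAt (fun s : ℝ => i z + s • e) (Ioo (s₀ - r) (ψ z)) (ψ z) := by
        fun_prop
      refine hcont.mem_closure ?_ ?_
      · rw [closure_Ioo hψI.1.ne]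
        exact ⟨hψI.1.le, le_rfl⟩
      · intro s hs
        exact (hmem z hz s ⟨hs.1.le, hs.2.le.trans hψI.2.le⟩).2 hs.2
  refine ⟨D, s₀ - r, s₀ + r, ψ, ⟨hDo, fun z hz => (hD z hz).2.2.contDiffWithinAt,
    fun z hz => (hD z hz).2.1, hmem, hfro, fun z hz => ?_⟩, hzD, by linarith, by linarith⟩
  -- the normal vector
  have hψI := Ioo_subset_Icc_self (hD z hz).2.1
  obtain ⟨-, hU, hp⟩ := hball' z (hD z hz).1 _ hψI
  set y := graphMap i e ψ z with hy
  have hΘy : Θ (z, ψ z) = y := by rw [hΘ]; rfl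
  rw [hΘy] at hU hp
  have hyf : y ∈ frontier Ω := (hfro z hz _ hψI).2 rfl
  have hne : gradient ρ y ≠ 0 := by
    intro h0
    rw [← h.inner_gradient hU, h0, inner_zero_left] at hp
    exact lt_irrefl _ hp
  have hyd := h.of_mem_frontier hΩ hU hyf hne
  rw [hyd.outerUnitNormal_eq, real_inner_smul_left]
  set ν := gradient ρ y with hν
  have hνe : 0 < inner ℝ ν e := by rw [hν, h.inner_gradient hU]; exact hp
  -- Differentiating ρ = 0 along the graph shows that the gradient ν of ρ has horizontal part -⟪ν,
  -- e⟫ ∇ψ; Pythagoras then gives ‖ν‖ = ⟪ν, e⟫ √(1 + |∇ψ|²).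
  have hder0 : (fderiv ℝ ρ y).comp (graphDeriv i e (fderiv ℝ ψ z)) = 0 := by
    have hψs : HasStrictFDerivAt ψ (fderiv ℝ ψ z) z :=
      (hD z hz).2.2.hasStrictFDerivAt one_ne_zero
    have h1 : HasFDerivAt (fun z => ρ (graphMap i e ψ z))
        ((fderiv ℝ ρ y).comp (graphDeriv i e (fderiv ℝ ψ z))) z :=
      (h.differentiableAt hU).hasFDerivAt.comp z hψs.graphMap.hasFDerivAt
    have h2 : (fun z => ρ (graphMap i e ψ z)) =ᶠ[𝓝 z] fun _ => 0 := by
      filter_upwards [hDo.mem_nhds hz] with w hw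
      have := hzero w hw
      simp only [F, hΘ] at this
      exact this
    exact h1.unique ((hasFDerivAt_const (0 : ℝ) z).congr_of_eventuallyEq h2)
  set a := (InnerProductSpace.toDual ℝ Z).symm (fderiv ℝ ψ z) with ha
  have hna : ‖a‖ = ‖fderiv ℝ ψ z‖ := by rw [ha, LinearIsometryEquiv.norm_map]
  have hνi : i.toContinuousLinearMap.adjoint ν = -(inner ℝ ν e : ℝ) • a := by
    refine ext_inner_right ℝ fun w => ?_
    have h1 := congrArg (fun L : Z →L[ℝ] ℝ => L w) hder0
    simp only [ContinuousLinearMap.comp_apply, graphDeriv, add_apply,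
      LinearIsometry.coe_toContinuousLinearMap, ContinuousLinearMap.smulRight_apply,
      zero_apply, map_add, map_smul, smul_eq_mul] at h1
    rw [← h.inner_gradient hU, ← h.inner_gradient hU, ← hν] at h1
    rw [ContinuousLinearMap.adjoint_inner_left, LinearIsometry.coe_toContinuousLinearMap,
      real_inner_smul_left, ha, InnerProductSpace.toDual_symm_apply]
    linarith
  have hnorm : ‖ν‖ ^ 2 = (inner ℝ ν e) ^ 2 * (1 + ‖fderiv ℝ ψ z‖ ^ 2) := by
    have h1 := hdec ν
    have h2 : ‖ν‖ ^ 2 = ‖i (i.toContinuousLinearMap.adjoint ν)‖ ^ 2 +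
        ‖(inner ℝ ν e : ℝ) • e‖ ^ 2 := by
      conv_lhs => rw [← h1]
      have := norm_add_sq_eq_norm_sq_add_norm_sq_of_inner_eq_zero
        (i (i.toContinuousLinearMap.adjoint ν)) ((inner ℝ ν e : ℝ) • e)
        (by rw [real_inner_smul_right, hi, mul_zero])
      simpa [sq] using this
    rw [h2, i.norm_map, hνi, norm_smul, norm_smul, he, hna, Real.norm_eq_abs, abs_neg,
      Real.norm_eq_abs, mul_pow, mul_pow, sq_abs]
    ring
  have hnν : ‖ν‖ = inner ℝ ν e * Real.sqrt (1 + ‖fderiv ℝ ψ z‖ ^ 2) := by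
    rw [← Real.sqrt_sq (norm_nonneg ν), hnorm, Real.sqrt_mul (sq_nonneg _),
      Real.sqrt_sq hνe.le]
  have hνpos : 0 < ‖ν‖ := norm_pos_iff.2 hne
  rw [mul_assoc, ← hnν, inv_mul_cancel₀ hνpos.ne']

end GraphChart

/-! ### The divergence theorem over one graph chart. -/

section LocalDivergence

open Filter Topology Module

variable {N : ℕ} {Ω : Set (Euc N)} {Z : Type*} [NormedAddCommGroup Z] [InnerProductSpace ℝ Z]
  [FiniteDimensional ℝ Z] [MeasurableSpace Z] [BorelSpace Z] {i : Z →ₗᵢ[ℝ] Euc N} {e : Euc N}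

/-- An orthogonal splitting of Euclidean space into the direction `e` and the image of `i`. -/
structure IsSplitting (i : Z →ₗᵢ[ℝ] Euc N) (e : Euc N) : Prop where
  norm_eq : ‖e‖ = 1
  inner_eq : ∀ z, inner ℝ (i z) e = 0
  decomp : ∀ x, i (i.toContinuousLinearMap.adjoint x) + (inner ℝ x e : ℝ) • e = x
  finrank_eq : finrank ℝ Z = N - 1
  measurePreserving : MeasurePreserving (fun p : Z × ℝ => i p.1 + p.2 • e) volume volume
  measurableEmbedding : MeasurableEmbedding (fun p : Z × ℝ => i p.1 + p.2 • e)

/-- The sum map is a linear isometry from the L² product of ℝⁿ and ℝ, hence preserves volume; this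
is what Fubini's theorem along the direction e needs. -/
theorem exists_isSplitting {n : ℕ} {e : Euc (n + 1)} (he : ‖e‖ = 1) :
    ∃ i : Euc n →ₗᵢ[ℝ] Euc (n + 1), IsSplitting i e := by
  have hne : e ≠ 0 := by
    rintro rfl; simp at he
  have : Fact (finrank ℝ (Euc (n + 1)) = n + 1) := ⟨by simp⟩
  let b := OrthonormalBasis.fromOrthogonalSpanSingleton (𝕜 := ℝ) n hne
  let i : Euc n →ₗᵢ[ℝ] Euc (n + 1) :=
    ((ℝ ∙ e)ᗮ.subtypeₗᵢ).comp b.repr.symm.toLinearIsometry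
  have hi : ∀ z, inner ℝ (i z) e = 0 := fun z =>
    Submodule.mem_orthogonal_singleton_iff_inner_left.1 (b.repr.symm z).2
  let L₀ : WithLp 2 (Euc n × ℝ) →ₗ[ℝ] Euc (n + 1) :=
    { toFun := fun p => i p.fst + p.snd • e
      map_add' := fun p q => by simp [add_smul]; abel
      map_smul' := fun c p => by simp [mul_smul] }
  let L : WithLp 2 (Euc n × ℝ) →ₗᵢ[ℝ] Euc (n + 1) :=
    { toLinearMap := L₀
      norm_map' := fun p => by
        have h1 := norm_add_sq_eq_norm_sq_add_norm_sq_of_inner_eq_zero (i p.fst) (p.snd • e)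
          (by rw [real_inner_smul_right, hi, mul_zero])
        have h2 : ‖L₀ p‖ ^ 2 = ‖p‖ ^ 2 := by
          rw [WithLp.prod_norm_sq_eq_of_L2]
          change ‖i p.fst + p.snd • e‖ ^ 2 = _
          rw [sq, h1, i.norm_map, norm_smul, he, mul_one, sq, sq]
        exact (sq_eq_sq₀ (norm_nonneg _) (norm_nonneg _)).1 h2 }
  have hrank : finrank ℝ (WithLp 2 (Euc n × ℝ)) = finrank ℝ (Euc (n + 1)) := by
    rw [(WithLp.linearEquiv 2 ℝ (Euc n × ℝ)).finrank_eq]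
    simp
  let Le := L.toLinearIsometryEquiv hrank
  have hmp : MeasurePreserving (fun p : Euc n × ℝ => i p.1 + p.2 • e) volume volume :=
    Le.measurePreserving.comp (WithLp.volume_preserving_toLp (Euc n) ℝ)
  have hemb : MeasurableEmbedding (fun p : Euc n × ℝ => i p.1 + p.2 • e) :=
    Le.toMeasurableEquiv.measurableEmbedding.comp
      (MeasurableEquiv.toLp 2 (Euc n × ℝ)).measurableEmbedding
  refine ⟨i, he, hi, fun x => ?_, by simp, hmp, hemb⟩
  obtain ⟨p, rfl⟩ := Le.surjective x
  have hLp : Le p = i p.fst + p.snd • e := rfl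
  have h1 : i.toContinuousLinearMap.adjoint (Le p) = p.fst := by
    rw [hLp]
    exact adjoint_graphMap hi (fun _ => p.snd) p.fst
  have h2 : inner ℝ (Le p) e = p.snd := by
    rw [hLp, inner_add_left, hi, real_inner_smul_left, real_inner_self_eq_norm_sq, he]
    norm_num
  rw [h1, h2, hLp]

theorem IsSplitting.adjoint_apply (h : IsSplitting i e) (z : Z) (s : ℝ) :
    i.toContinuousLinearMap.adjoint (i z + s • e) = z :=
  adjoint_graphMap h.inner_eq (fun _ => s) z

theorem IsSplitting.inner_apply (h : IsSplitting i e) (z : Z) (s : ℝ) :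
    inner ℝ (i z + s • e) e = s := by
  rw [inner_add_left, h.inner_eq, real_inner_smul_left, real_inner_self_eq_norm_sq, h.norm_eq]
  norm_num

/-- The box over `D` with heights in `(a,b)`. -/
def boxOver (i : Z →ₗᵢ[ℝ] Euc N) (e : Euc N) (D : Set Z) (a b : ℝ) : Set (Euc N) :=
  {x | i.toContinuousLinearMap.adjoint x ∈ D ∧ inner ℝ x e ∈ Ioo a b}

omit [MeasurableSpace Z] [BorelSpace Z] in
theorem isOpen_boxOver {D : Set Z} (hD : IsOpen D) (a b : ℝ) : IsOpen (boxOver i e D a b) := by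
  refine (hD.preimage (ContinuousLinearMap.continuous _)).inter (isOpen_Ioo.preimage ?_)
  fun_prop

/-- Functions which are continuous on the closure of `Ω` and continuously differentiable in `Ω`
with bounded derivative. -/
structure IsC1Closure (Ω : Set (Euc N)) (f : Euc N → ℝ) : Prop where
  continuousOn : ContinuousOn f (closure Ω)
  contDiffOn : ContDiffOn ℝ 1 f Ω
  bounded : ∃ C, ∀ x ∈ Ω, ‖fderiv ℝ f x‖ ≤ C

theorem IsC1Closure.integrableOn_fderiv {f : Euc N → ℝ} (hf : IsC1Closure Ω f)
    (hΩ : IsOpen Ω) (hΩb : Bornology.IsBounded Ω) (w : Euc N) :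
    IntegrableOn (fun x => fderiv ℝ f x w) Ω := by
  obtain ⟨C, hC⟩ := hf.bounded
  have hc : ContinuousOn (fun x => fderiv ℝ f x w) Ω :=
    (hf.contDiffOn.continuousOn_fderiv_of_isOpen hΩ le_rfl).clm_apply continuousOn_const
  have : IsFiniteMeasure (volume.restrict Ω) := ⟨by simpa using hΩb.measure_lt_top⟩
  refine Integrable.of_bound (hc.aestronglyMeasurable hΩ.measurableSet) (C * ‖w‖) ?_
  filter_upwards [ae_restrict_mem hΩ.measurableSet] with x hx
  exact (ContinuousLinearMap.le_opNorm _ _).trans (by gcongr; exact hC x hx)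

/-- The divergence theorem near the boundary in the direction of the graph. -/
theorem IsBoundaryGraph.integral_fderiv (hs : IsSplitting i e) (hΩ : IsOpen Ω)
    (hΩb : Bornology.IsBounded Ω) {D : Set Z} {a b : ℝ} {g : Z → ℝ}
    (hG : IsBoundaryGraph Ω i e D a b g) {f : Euc N → ℝ} (hf : IsC1Closure Ω f)
    {K : Set (Euc N)} (hK : IsClosed K) (hKb : K ⊆ boxOver i e D a b) (hfK : ∀ x ∉ K, f x = 0) :
    ∫ x in Ω, fderiv ℝ f x e = ∫ x in frontier Ω, f x * inner ℝ (outerUnitNormal Ω x) e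
      ∂(Measure.euclideanHausdorffMeasure (N - 1)) := by
  have hfd0 : ∀ x ∉ K, fderiv ℝ f x = 0 := by
    intro x hx
    have : f =ᶠ[𝓝 x] fun _ => 0 := by
      filter_upwards [hK.isOpen_compl.mem_nhds hx] with y hy using hfK y hy
    rw [this.fderiv_eq, fderiv_fun_const]; rfl
  have hbox : ∀ z s, i z + s • e ∈ K → z ∈ D ∧ s ∈ Ioo a b := by
    intro z s h
    have := hKb h
    rwa [boxOver, mem_ofPred_eq, hs.adjoint_apply, hs.inner_apply] at this
  have hgr : ∀ z ∈ D, graphMap i e g z ∈ frontier Ω := fun z hz =>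
    (hG.mem_frontier_iff z hz _ (Ioo_subset_Icc_self (hG.mem_Ioo z hz))).2 rfl
  have hgc : ContinuousOn (graphMap i e g) D :=
    i.continuous.continuousOn.add (hG.contDiffOn.continuousOn.smul continuousOn_const)
  -- left-hand side
  have hint := hf.integrableOn_fderiv hΩ hΩb e
  have hint2 : Integrable (fun p : Z × ℝ =>
      Ω.indicator (fun x => fderiv ℝ f x e) (i p.1 + p.2 • e)) := by
    have h1 : Integrable (Ω.indicator (fun x => fderiv ℝ f x e)) :=
      (integrable_indicator_iff hΩ.measurableSet).2 hint
    exact (hs.measurePreserving.integrable_comp_emb hs.measurableEmbedding).2 h1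
  have hlhs : ∫ x in Ω, fderiv ℝ f x e = ∫ z in D, f (graphMap i e g z) := by
    rw [← integral_indicator hΩ.measurableSet,
      ← hs.measurePreserving.integral_comp hs.measurableEmbedding, Measure.volume_eq_prod,
      integral_prod _ hint2, ← integral_indicator hG.isOpen.measurableSet]
    refine integral_congr_ae ?_
    -- Fubini's theorem gives integrability of the derivative along almost every line, a hypothesis
    -- of the fundamental theorem of calculus.
    filter_upwards [hint2.prod_right_ae] with z hz
    by_cases hzD : z ∈ D
    · rw [indicator_of_mem hzD]
      have hgz := hG.mem_Ioo z hzD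
      -- The endpoint s = g(z) belongs to the half-open interval but the boundary point above it is
      -- not in Ω; the conditional sets the value 0 there.
      have h1 : (fun s : ℝ => Ω.indicator (fun x => fderiv ℝ f x e) (i z + s • e)) =
          (Ioc a (g z)).indicator (fun s => if s < g z then fderiv ℝ f (i z + s • e) e else 0) := by
        ext s
        by_cases hsI : s ∈ Ioo a b
        · have hm := hG.mem_iff z hzD s (Ioo_subset_Icc_self hsI)
          by_cases hsg : s < g z
          · rw [indicator_of_mem (hm.2 hsg), indicator_of_mem (show s ∈ Ioc a (g z) from ⟨hsI.1, hsg.le⟩), if_pos hsg]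
          · rw [indicator_of_notMem (fun h => hsg (hm.1 h))]
            by_cases hs2 : s ∈ Ioc a (g z)
            · rw [indicator_of_mem hs2, if_neg hsg]
            · rw [indicator_of_notMem hs2]
        · have h0 : i z + s • e ∉ K := fun h => hsI (hbox z s h).2
          have h2 : s ∉ Ioc a (g z) := fun h => hsI ⟨h.1, h.2.trans_lt hgz.2⟩
          rw [indicator_of_notMem h2]
          by_cases h3 : i z + s • e ∈ Ω
          · rw [indicator_of_mem h3, hfd0 _ h0]; rfl
          · rw [indicator_of_notMem h3]
      have hz' : Integrable (fun s : ℝ => Ω.indicator (fun x => fderiv ℝ f x e) (i z + s • e)) := hz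
      rw [h1] at hz'
      show ∫ s : ℝ, Ω.indicator (fun x => fderiv ℝ f x e) (i z + s • e) = _
      rw [h1, integral_indicator measurableSet_Ioc, ← intervalIntegral.integral_of_le hgz.1.le]
      rw [intervalIntegral.integral_eq_sub_of_hasDerivAt_of_le
        (f := fun s : ℝ => f (i z + s • e)) hgz.1.le]
      -- The lower endpoint lies outside the open box, hence outside K, so only the boundary value
      -- at height g(z) survives.
      · have h2 : f (i z + a • e) = 0 := by
          refine hfK _ fun h => ?_
          exact lt_irrefl _ (hbox z a h).2.1
        simp only [h2, sub_zero]
        rfl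
      · refine hf.continuousOn.comp (by fun_prop) fun s hs' => ?_
        rcases hs'.2.eq_or_lt with rfl | hlt
        · exact frontier_subset_closure (hgr z hzD)
        · exact subset_closure ((hG.mem_iff z hzD s ⟨hs'.1, hs'.2.trans hgz.2.le⟩).2 hlt)
      · intro s hs'
        have hmem := (hG.mem_iff z hzD s ⟨hs'.1.le, hs'.2.le.trans hgz.2.le⟩).2 hs'.2
        have h2 := ((hf.contDiffOn.contDiffAt (hΩ.mem_nhds hmem)).differentiableAt
          one_ne_zero).hasFDerivAt
        have h3 : HasDerivAt (fun s : ℝ => i z + s • e) e s := by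
          simpa using ((hasDerivAt_id s).smul_const e).const_add (i z)
        have := h2.comp_hasDerivAt s h3
        simp only [if_pos hs'.2]
        exact this
      · rw [intervalIntegrable_iff_integrableOn_Ioc_of_le hgz.1.le]
        exact (integrable_indicator_iff measurableSet_Ioc).1 hz'
    · rw [indicator_of_notMem hzD]
      refine integral_eq_zero_of_ae (ae_of_all _ fun s => ?_)
      have h0 : i z + s • e ∉ K := fun h => hzD (hbox z s h).1
      by_cases h3 : i z + s • e ∈ Ω
      · simp only [indicator_of_mem h3, hfd0 _ h0]; rfl
      · simp only [indicator_of_notMem h3]; rfl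
  -- right-hand side
  have himg : graphMap i e g '' D = frontier Ω ∩ boxOver i e D a b := by
    ext x
    constructor
    · rintro ⟨z, hz, rfl⟩
      refine ⟨hgr z hz, ?_⟩
      rw [boxOver, mem_ofPred_eq, graphMap, hs.adjoint_apply, hs.inner_apply]
      exact ⟨hz, hG.mem_Ioo z hz⟩
    · rintro ⟨hx, hz, hxI⟩
      refine ⟨_, hz, ?_⟩
      have h1 := hG.mem_frontier_iff _ hz _ (Ioo_subset_Icc_self hxI)
      rw [hs.decomp] at h1
      rw [graphMap, ← h1.1 hx, hs.decomp]
  have hms : MeasurableSet (graphMap i e g '' D) := by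
    rw [himg]
    exact isClosed_frontier.measurableSet.inter (isOpen_boxOver hG.isOpen a b).measurableSet
  -- The e-component of the normal is the reciprocal of the surface Jacobian, so the two cancel and
  -- the surface integral becomes ∫_D f(z + g(z) e) dz.
  have hJ : ∀ z ∈ D, inner ℝ (outerUnitNormal Ω (graphMap i e g z)) e =
      (Real.sqrt (1 + ‖fderiv ℝ g z‖ ^ 2))⁻¹ := fun z hz =>
    eq_inv_of_mul_eq_one_left (hG.inner_normal z hz)
  have hJc : ContinuousOn (fun z => (Real.sqrt (1 + ‖fderiv ℝ g z‖ ^ 2))⁻¹) D := by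
    have : ContinuousOn (fderiv ℝ g) D :=
      hG.contDiffOn.continuousOn_fderiv_of_isOpen hG.isOpen le_rfl
    refine ((continuousOn_const.add (this.norm.pow 2)).sqrt).inv₀ fun z _ => ?_
    have : 0 < Real.sqrt (1 + ‖fderiv ℝ g z‖ ^ 2) := Real.sqrt_pos.2 (by positivity)
    exact this.ne'
  have hfc : ContinuousOn (fun z => f (graphMap i e g z)) D :=
    hf.continuousOn.comp hgc fun z hz => frontier_subset_closure (hgr z hz)
  have hrhs := setIntegral_graph hs.norm_eq hs.inner_eq hG.isOpen hG.contDiffOn hms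
    (h := fun x => f x * inner ℝ (outerUnitNormal Ω x) e)
    ((hfc.mul hJc).congr fun z hz => by simp only [hJ z hz, Pi.mul_apply])
  rw [hs.finrank_eq] at hrhs
  have hsub : graphMap i e g '' D ⊆ frontier Ω := himg ▸ inter_subset_left
  rw [hlhs, setIntegral_eq_of_subset_of_forall_sdiff_eq_zero isClosed_frontier.measurableSet hsub,
    hrhs]
  · refine setIntegral_congr_fun hG.isOpen.measurableSet fun z hz => ?_
    have := hG.inner_normal z hz
    linear_combination (-f (graphMap i e g z)) * this
  · intro x hx
    rw [himg] at hx
    have : x ∉ K := fun h => hx.2 ⟨hx.1, hKb h⟩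
    rw [hfK x this, zero_mul]

end LocalDivergence

/-! ### Partitions of unity and the divergence theorem on a bounded smooth domain. -/

section Divergence

open Filter Topology Module

/-- A nonzero functional takes the value `-1` on all members of a suitable basis. -/
theorem exists_basis_apply_eq_neg_one {V : Type*} [AddCommGroup V] [Module ℝ V]
    [FiniteDimensional ℝ V] {m : ℕ} (hm : finrank ℝ V = m) {ν : V →ₗ[ℝ] ℝ} (hν : ν ≠ 0) :
    ∃ b : Basis (Fin m) ℝ V, ∀ j, ν (b j) = -1 := by
  obtain ⟨w, hw⟩ : ∃ w, ν w ≠ 0 := by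
    by_contra! h
    exact hν (LinearMap.ext h)
  set d := -(ν w)⁻¹ • w with hd
  have hνd : ν d = -1 := by rw [hd, map_smul, smul_eq_mul]; field_simp
  -- The affine hyperplane ν = -1 spans V: it contains d, and for each v also v + (ν(v) + 1) d. A
  -- basis is extracted from it.
  obtain ⟨s, hs, hspan, hli⟩ := exists_linearIndependent ℝ {v | ν v = -1}
  have htop : Submodule.span ℝ {v | ν v = -1} = ⊤ := by
    rw [eq_top_iff]
    intro v _
    have h1 : v + (ν v) • d ∈ Submodule.span ℝ {v | ν v = -1} := by
      have h2 : v + (ν v + 1) • d ∈ Submodule.span ℝ {v | ν v = -1} := by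
        refine Submodule.subset_span ?_
        show ν (v + (ν v + 1) • d) = -1
        rw [map_add, map_smul, hνd, smul_eq_mul]; ring
      have h3 : d ∈ Submodule.span ℝ {v | ν v = -1} := Submodule.subset_span hνd
      have := Submodule.sub_mem _ h2 h3
      rwa [add_smul, one_smul, ← add_assoc, add_sub_cancel_right] at this
    have h3 : d ∈ Submodule.span ℝ {v | ν v = -1} := Submodule.subset_span hνd
    have := Submodule.sub_mem _ h1 (Submodule.smul_mem _ (ν v) h3)
    rwa [add_sub_cancel_right] at this
  have hsp : ⊤ ≤ Submodule.span ℝ (range ((↑) : s → V)) := by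
    rw [Subtype.range_coe, hspan, htop]
  let b := Basis.mk hli hsp
  have : Fintype s := FiniteDimensional.fintypeBasisIndex b
  have hcard : Fintype.card s = m := by rw [← hm, finrank_eq_card_basis b]
  refine ⟨b.reindex (Fintype.equivFinOfCardEq hcard), fun j => ?_⟩
  rw [Basis.reindex_apply, Basis.mk_apply]
  exact hs (Subtype.coe_prop _)

/-- Smooth partitions of unity on a compact set, subordinate to neighbourhoods of its points. -/
theorem IsCompact.exists_smooth_partition {N : ℕ} {S : Set (Euc N)} (hS : IsCompact S)
    {V : Euc N → Set (Euc N)} (hV : ∀ x ∈ S, V x ∈ 𝓝 x) :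
    ∃ (t : Finset (Euc N)) (χ : Euc N → Euc N → ℝ), (∀ x ∈ t, x ∈ S) ∧
      (∀ x, ContDiff ℝ ∞ (χ x)) ∧ (∀ x, HasCompactSupport (χ x)) ∧
      (∀ x ∈ t, tsupport (χ x) ⊆ V x) ∧ (∀ x y, 0 ≤ χ x y) ∧ (∀ x y, χ x y ≤ 1) ∧
      ∀ y ∈ S, ∑ x ∈ t, χ x y = 1 := by
  classical
  -- The intersection with unit balls serves only to make the supports compact.
  obtain ⟨t, htS, hcov⟩ := hS.elim_nhds_subcover (fun x => interior (V x) ∩ Metric.ball x 1)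
    (fun x hx => inter_mem (interior_mem_nhds.2 (hV x hx)) (Metric.ball_mem_nhds x one_pos))
  obtain ⟨f, hf⟩ := SmoothPartitionOfUnity.exists_isSubordinate (modelWithCornersSelf ℝ (Euc N))
    hS.isClosed (fun x : t => interior (V x) ∩ Metric.ball (x : Euc N) 1)
    (fun x => isOpen_interior.inter Metric.isOpen_ball) (by simpa [iUnion_subtype] using hcov)
  refine ⟨t, fun x => if h : x ∈ t then f ⟨x, h⟩ else fun _ => 0, htS, ?_, ?_, ?_, ?_, ?_, ?_⟩
  · intro x
    by_cases h : x ∈ t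
    · simp only [h, dite_true]; exact (f ⟨x, h⟩).contMDiff.contDiff
    · simp only [h, dite_false]; exact contDiff_const
  · intro x
    by_cases h : x ∈ t
    · simp only [h, dite_true]
      refine IsCompact.of_isClosed_subset (isCompact_closedBall x 1) (isClosed_tsupport _) ?_
      exact (hf ⟨x, h⟩).trans (inter_subset_right.trans Metric.ball_subset_closedBall)
    · simp only [h, dite_false]; exact HasCompactSupport.zero
  · intro x hx
    simp only [hx, dite_true]
    exact (hf ⟨x, hx⟩).trans (inter_subset_left.trans interior_subset)
  · intro x y
    by_cases h : x ∈ t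
    · simp only [h, dite_true]; exact f.nonneg _ _
    · simp [h]
  · intro x y
    by_cases h : x ∈ t
    · simp only [h, dite_true]; exact f.le_one _ _
    · simp [h]
  · intro y hy
    have h1 := f.sum_eq_one hy
    rw [finsum_eq_sum_of_fintype] at h1
    rw [← h1, ← Finset.sum_coe_sort t]
    exact Finset.sum_congr rfl fun x _ => by simp

variable {n : ℕ} {Ω : Set (Euc (n + 1))}

theorem IsBoundedSmoothDomain.continuousOn_outerUnitNormal {N : ℕ} {Ω : Set (Euc N)}
    (hΩ : IsBoundedSmoothDomain Ω) : ContinuousOn (outerUnitNormal Ω) (frontier Ω) := by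
  intro x hx
  obtain ⟨U, ρ, h⟩ := hΩ.smooth_boundary x hx
  have hc : ContinuousAt (gradient ρ) x := by
    have h1 : ContinuousAt (fderiv ℝ ρ) x :=
      ((h.contDiffAt h.2.1).fderiv_right (m := 0) (by simp)).continuousAt
    exact (InnerProductSpace.toDual ℝ (Euc N)).symm.continuous.continuousAt.comp h1
  have hc2 : ContinuousAt (fun y => ‖gradient ρ y‖⁻¹ • gradient ρ y) x :=
    (hc.norm.inv₀ (norm_ne_zero_iff.2 h.2.2.2.2.1)).smul hc
  refine hc2.continuousWithinAt.congr_of_eventuallyEq ?_ h.outerUnitNormal_eq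
  filter_upwards [self_mem_nhdsWithin, nhdsWithin_le_nhds (h.1.mem_nhds h.2.1),
    nhdsWithin_le_nhds (hc.eventually_ne h.2.2.2.2.1)] with y hy hyU hne
  exact (h.of_mem_frontier hΩ.isOpen hyU hy hne).outerUnitNormal_eq

theorem IsBoundedSmoothDomain.isCompact_frontier {N : ℕ} {Ω : Set (Euc N)}
    (hΩ : IsBoundedSmoothDomain Ω) : IsCompact (frontier Ω) :=
  hΩ.isCompact_closure.of_isClosed_subset isClosed_frontier frontier_subset_closure

theorem IsLocalDefiningFunction.exists_splitting_graph (hΩ : IsOpen Ω) {x : Euc (n + 1)}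
    {U : Set (Euc (n + 1))} {ρ : Euc (n + 1) → ℝ} (h : IsLocalDefiningFunction Ω x U ρ)
    {e : Euc (n + 1)} (he : ‖e‖ = 1) (hpos : 0 < fderiv ℝ ρ x e) :
    ∃ (i : Euc n →ₗᵢ[ℝ] Euc (n + 1)) (D : Set (Euc n)) (a b : ℝ) (g : Euc n → ℝ),
      IsSplitting i e ∧ IsBoundaryGraph Ω i e D a b g ∧ x ∈ boxOver i e D a b := by
  obtain ⟨i, hi⟩ := exists_isSplitting he
  obtain ⟨D, a, b, g, hg, h1, h2⟩ :=
    h.exists_isBoundaryGraph hΩ hi.norm_eq hi.inner_eq hi.decomp hpos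
  exact ⟨i, D, a, b, g, hi, hg, h1, h2⟩

/-- Near each of its points the boundary is a graph over a bounded set with bounded Jacobian, and
the boundary is compact. Finiteness makes continuous functions integrable on ∂Ω, so that surface
integrals may be split into sums. -/
theorem IsBoundedSmoothDomain.euclideanHausdorffMeasure_frontier_lt_top
    (hΩ : IsBoundedSmoothDomain Ω) :
    Measure.euclideanHausdorffMeasure n (frontier Ω) < ⊤ := by
  refine hΩ.isCompact_frontier.measure_lt_top_of_nhdsWithin fun x hx => ?_
  obtain ⟨U, ρ, h⟩ := hΩ.smooth_boundary x hx
  have hgn : 0 < ‖gradient ρ x‖ := norm_pos_iff.2 h.2.2.2.2.1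
  obtain ⟨i, D, a, b, g, hi, hg, hx1, hx2⟩ := h.exists_splitting_graph hΩ.isOpen
    (e := ‖gradient ρ x‖⁻¹ • gradient ρ x)
    (by rw [norm_smul, norm_inv, norm_norm, inv_mul_cancel₀ hgn.ne'])
    (by rw [map_smul, smul_eq_mul]; exact mul_pos (inv_pos.2 hgn) h.fderiv_gradient_pos)
  set e := ‖gradient ρ x‖⁻¹ • gradient ρ x with he
  set z₀ := i.toContinuousLinearMap.adjoint x with hz₀
  have hJc : ContinuousOn (fun z => Real.sqrt (1 + ‖fderiv ℝ g z‖ ^ 2)) D := by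
    have : ContinuousOn (fderiv ℝ g) D :=
      hg.contDiffOn.continuousOn_fderiv_of_isOpen hg.isOpen le_rfl
    exact (continuousOn_const.add (this.norm.pow 2)).sqrt
  have hev := ((hJc.continuousAt (hg.isOpen.mem_nhds hx1)).eventually_lt_const
    (lt_add_one _)).and (Filter.Eventually.and (hg.isOpen.mem_nhds hx1)
      (Metric.ball_mem_nhds z₀ one_pos))
  obtain ⟨D', hD', hD'o, hz₀'⟩ := eventually_nhds_iff.1 hev
  have hlt : Measure.euclideanHausdorffMeasure n (graphMap i e g '' D') < ⊤ := by
    have := euclideanHausdorffMeasure_graph hi.norm_eq hi.inner_eq hD'o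
      (hg.contDiffOn.mono fun z hz => (hD' z hz).2.1)
    rw [hi.finrank_eq, Nat.add_sub_cancel] at this
    rw [this]
    refine (setLIntegral_mono' (g := fun _ => ENNReal.ofReal
      (Real.sqrt (1 + ‖fderiv ℝ g z₀‖ ^ 2) + 1)) hD'o.measurableSet fun z hz =>
      ENNReal.ofReal_le_ofReal (hD' z hz).1.le).trans_lt ?_
    rw [setLIntegral_const]
    refine ENNReal.mul_lt_top ENNReal.ofReal_lt_top ?_
    exact (measure_mono fun z hz => (hD' z hz).2.2).trans_lt Metric.isBounded_ball.measure_lt_top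
  refine ⟨frontier Ω ∩ boxOver i e D' a b, ?_, (measure_mono ?_).trans_lt hlt⟩
  · exact inter_mem self_mem_nhdsWithin
      (mem_nhdsWithin_of_mem_nhds ((isOpen_boxOver hD'o a b).mem_nhds ⟨hz₀', hx2⟩))
  · rintro y ⟨hy, hz, hyI⟩
    refine ⟨_, hz, ?_⟩
    have h1 := hg.mem_frontier_iff _ (hD' _ hz).2.1 _ (Ioo_subset_Icc_self hyI)
    rw [hi.decomp] at h1
    rw [graphMap, ← h1.1 hy, hi.decomp]

theorem IsBoundedSmoothDomain.integrableOn_frontier (hΩ : IsBoundedSmoothDomain Ω)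
    {h : Euc (n + 1) → ℝ} (hc : ContinuousOn h (frontier Ω)) :
    IntegrableOn h (frontier Ω) (Measure.euclideanHausdorffMeasure n) := by
  have : IsFiniteMeasure ((Measure.euclideanHausdorffMeasure n).restrict (frontier Ω)) :=
    ⟨by simpa using hΩ.euclideanHausdorffMeasure_frontier_lt_top⟩
  obtain ⟨C, hC⟩ := hΩ.isCompact_frontier.exists_bound_of_continuousOn hc
  refine Integrable.of_bound (hc.aestronglyMeasurable isClosed_frontier.measurableSet) C ?_
  filter_upwards [ae_restrict_mem isClosed_frontier.measurableSet] with x hx using hC x hx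

theorem IsC1Closure.integrableOn_frontier {f : Euc (n + 1) → ℝ} (hf : IsC1Closure Ω f)
    (hΩ : IsBoundedSmoothDomain Ω) (w : Euc (n + 1)) :
    IntegrableOn (fun x => f x * inner ℝ (outerUnitNormal Ω x) w) (frontier Ω)
      (Measure.euclideanHausdorffMeasure n) :=
  hΩ.integrableOn_frontier ((hf.continuousOn.mono frontier_subset_closure).mul
    (hΩ.continuousOn_outerUnitNormal.inner continuousOn_const))

theorem IsC1Closure.mul {N : ℕ} {Ω : Set (Euc N)} {f g : Euc N → ℝ} (hΩ : IsOpen Ω)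
    (hb : IsCompact (closure Ω)) (hf : IsC1Closure Ω f) (hg : IsC1Closure Ω g) :
    IsC1Closure Ω (fun x => f x * g x) := by
  refine ⟨hf.continuousOn.mul hg.continuousOn, hf.contDiffOn.mul hg.contDiffOn, ?_⟩
  obtain ⟨A, hA⟩ := hb.exists_bound_of_continuousOn hf.continuousOn
  obtain ⟨B, hB⟩ := hb.exists_bound_of_continuousOn hg.continuousOn
  obtain ⟨A', hA'⟩ := hf.bounded
  obtain ⟨B', hB'⟩ := hg.bounded
  refine ⟨A * B' + B * A', fun x hx => ?_⟩
  have h1 := (hf.contDiffOn.contDiffAt (hΩ.mem_nhds hx)).differentiableAt one_ne_zero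
  have h2 := (hg.contDiffOn.contDiffAt (hΩ.mem_nhds hx)).differentiableAt one_ne_zero
  rw [fderiv_fun_mul h1 h2]
  refine (norm_add_le _ _).trans ?_
  rw [norm_smul, norm_smul]
  have hxc := subset_closure hx
  have := norm_nonneg (f x)
  have := norm_nonneg (g x)
  gcongr
  · exact (norm_nonneg _).trans (hA x hxc)
  · exact hA x hxc
  · exact hB' x hx
  · exact (norm_nonneg _).trans (hB x hxc)
  · exact hB x hxc
  · exact hA' x hx

theorem isC1Closure_of_contDiff {N : ℕ} {Ω : Set (Euc N)} (hb : IsCompact (closure Ω))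
    {f : Euc N → ℝ} (hf : ContDiff ℝ 1 f) : IsC1Closure Ω f := by
  refine ⟨hf.continuous.continuousOn, hf.contDiffOn, ?_⟩
  obtain ⟨C, hC⟩ := hb.exists_bound_of_continuousOn (hf.continuous_fderiv one_ne_zero).continuousOn
  exact ⟨C, fun x hx => hC x (subset_closure hx)⟩

/-- The divergence theorem, for functions supported near a given point. -/
theorem IsBoundedSmoothDomain.exists_local_divergence (hΩ : IsBoundedSmoothDomain Ω)
    {x : Euc (n + 1)} (hx : x ∈ closure Ω) :
    ∃ V ∈ 𝓝 x, ∀ f : Euc (n + 1) → ℝ, IsC1Closure Ω f → ∀ K, IsClosed K → K ⊆ V →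
      (∀ y ∉ K, f y = 0) → ∀ w, ∫ x in Ω, fderiv ℝ f x w =
        ∫ x in frontier Ω, f x * inner ℝ (outerUnitNormal Ω x) w
          ∂(Measure.euclideanHausdorffMeasure n) := by
  by_cases hxΩ : x ∈ Ω
  · refine ⟨Ω, hΩ.isOpen.mem_nhds hxΩ, fun f hf K hK hKV hfK w => ?_⟩
    have hd0 : ∀ y ∉ K, fderiv ℝ f y = 0 := by
      intro y hy
      have : f =ᶠ[𝓝 y] fun _ => 0 := by
        filter_upwards [hK.isOpen_compl.mem_nhds hy] with y hy using hfK y hy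
      rw [this.fderiv_eq, fderiv_fun_const]; rfl
    have hdiff : Differentiable ℝ f := by
      intro y
      by_cases hy : y ∈ K
      · exact (hf.contDiffOn.contDiffAt (hΩ.isOpen.mem_nhds (hKV hy))).differentiableAt one_ne_zero
      · have : f =ᶠ[𝓝 y] fun _ => 0 := by
          filter_upwards [hK.isOpen_compl.mem_nhds hy] with y hy using hfK y hy
        exact this.differentiableAt_iff.2 (differentiableAt_const 0)
    have h1 : ∫ x in Ω, fderiv ℝ f x w = ∫ x, fderiv ℝ f x w :=
      setIntegral_eq_integral_of_forall_compl_eq_zero fun y hy => by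
        rw [hd0 y fun h => hy (hKV h)]; rfl
    have hint : Integrable (fun x => fderiv ℝ f x w) := by
      refine (integrableOn_iff_integrable_of_support_subset ?_).1
        (hf.integrableOn_fderiv hΩ.isOpen hΩ.isBounded w)
      intro y hy
      by_contra h
      exact hy (by simp only [hd0 y fun h' => h (hKV h')]; rfl)
    have hfint : Integrable f := by
      have hfi : IntegrableOn f (closure Ω) := hf.continuousOn.integrableOn_compact
        hΩ.isCompact_closure
      refine (integrableOn_iff_integrable_of_support_subset ?_).1 hfi
      intro y hy
      by_contra h
      exact hy (hfK y fun h' => h (subset_closure (hKV h')))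
    -- In the interior case f extends by zero, and integration by parts against the constant 1 shows
    -- that the integral of its derivative vanishes.
    have h2 := integral_mul_fderiv_eq_neg_fderiv_mul_of_integrable (μ := volume)
      (f := fun _ : Euc (n + 1) => (1 : ℝ)) (g := f) (v := w) (by simp)
      (by simpa using hint) (by simpa using hfint) (fun _ _ => differentiableAt_const _)
      (fun y _ => hdiff y)
    simp only [one_mul, fderiv_fun_const, Pi.zero_apply, zero_apply, zero_mul,
      integral_zero, neg_zero] at h2
    rw [h1, h2]
    symm
    refine setIntegral_eq_zero_of_forall_eq_zero fun y hy => ?_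
    rw [hΩ.isOpen.frontier_eq] at hy
    rw [hfK y fun h => hy.2 (hKV h), zero_mul]
  · have hxf : x ∈ frontier Ω := by
      rw [hΩ.isOpen.frontier_eq]; exact ⟨hx, hxΩ⟩
    obtain ⟨U, ρ, h⟩ := hΩ.smooth_boundary x hxf
    have hν : (fderiv ℝ ρ x).toLinearMap ≠ 0 := by
      intro h0
      have := h.fderiv_gradient_pos
      have h1 := congrArg (fun L : Euc (n + 1) →ₗ[ℝ] ℝ => L (gradient ρ x)) h0
      simp only [ContinuousLinearMap.coe_coe, LinearMap.zero_apply] at h1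
      linarith
    -- All basis vectors cross the boundary transversally; reversed and normalized they point
    -- outward, and Ω is a subgraph in each of these directions. Tangential directions need no
    -- separate treatment, since a general w is a combination of the eⱼ.
    obtain ⟨b, hb⟩ := exists_basis_apply_eq_neg_one (m := n + 1) (by simp) hν
    have hb0 : ∀ j, 0 < ‖b j‖ := fun j => norm_pos_iff.2 (b.ne_zero j)
    set e : Fin (n + 1) → Euc (n + 1) := fun j => -(‖b j‖⁻¹) • b j with he
    have he1 : ∀ j, ‖e j‖ = 1 := fun j => by
      rw [he, norm_smul, norm_neg, norm_inv, norm_norm, inv_mul_cancel₀ (hb0 j).ne']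
    have hep : ∀ j, 0 < fderiv ℝ ρ x (e j) := fun j => by
      have h2 : fderiv ℝ ρ x (b j) = -1 := hb j
      simp only [he]
      rw [map_smul, h2, smul_eq_mul]
      have := inv_pos.2 (hb0 j)
      linarith
    choose i D a c g hi hg hbox using fun j => h.exists_splitting_graph hΩ.isOpen (he1 j) (hep j)
    refine ⟨⋂ j, boxOver (i j) (e j) (D j) (a j) (c j), ?_, ?_⟩
    · exact (Filter.iInter_mem).2 fun j => (isOpen_boxOver (hg j).isOpen _ _).mem_nhds (hbox j)
    · intro f hf K hK hKV hfK w
      have key : ∀ j, ∫ x in Ω, fderiv ℝ f x (e j) =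
          ∫ x in frontier Ω, f x * inner ℝ (outerUnitNormal Ω x) (e j)
            ∂(Measure.euclideanHausdorffMeasure n) := fun j =>
        (hg j).integral_fderiv (hi j) hΩ.isOpen hΩ.isBounded hf hK
          (hKV.trans (iInter_subset _ j)) hfK
      have hw : w = ∑ j, (-(‖b j‖ * b.repr w j)) • e j := by
        conv_lhs => rw [← b.sum_repr w]
        refine Finset.sum_congr rfl fun j _ => ?_
        simp only [he]
        rw [smul_smul]
        congr 1
        have := (hb0 j).ne'
        field_simp
      rw [hw]
      simp only [map_sum, map_smul, smul_eq_mul, inner_sum, real_inner_smul_right, Finset.mul_sum]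
      rw [integral_finsetSum, integral_finsetSum]
      · refine Finset.sum_congr rfl fun j _ => ?_
        rw [integral_const_mul, key j, ← integral_const_mul]
        refine integral_congr_ae (ae_of_all _ fun y => ?_)
        simp only
        ring
      · intro j _
        refine ((hf.integrableOn_frontier hΩ (e j)).const_mul (-(‖b j‖ * b.repr w j))).congr
          (ae_of_all _ fun y => ?_)
        simp only
        ring
      · intro j _
        exact (hf.integrableOn_fderiv hΩ.isOpen hΩ.isBounded (e j)).const_mul _

/-- The divergence theorem on a bounded smooth domain. -/
theorem IsBoundedSmoothDomain.integral_fderiv (hΩ : IsBoundedSmoothDomain Ω)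
    {f : Euc (n + 1) → ℝ} (hf : IsC1Closure Ω f) (w : Euc (n + 1)) :
    ∫ x in Ω, fderiv ℝ f x w = ∫ x in frontier Ω, f x * inner ℝ (outerUnitNormal Ω x) w
      ∂(Measure.euclideanHausdorffMeasure n) := by
  choose! V hV hloc using fun x (hx : x ∈ closure Ω) => hΩ.exists_local_divergence hx
  obtain ⟨t, χ, htS, hχs, -, hχV, -, -, hχ1⟩ := hΩ.isCompact_closure.exists_smooth_partition hV
  have hχ : ∀ x, IsC1Closure Ω (χ x) := fun x =>
    isC1Closure_of_contDiff hΩ.isCompact_closure ((hχs x).of_le (by exact_mod_cast le_top))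
  have hmul : ∀ x, IsC1Closure Ω (fun y => χ x y * f y) := fun x =>
    (hχ x).mul hΩ.isOpen hΩ.isCompact_closure hf
  have key : ∀ x ∈ t, ∫ y in Ω, fderiv ℝ (fun y => χ x y * f y) y w =
      ∫ y in frontier Ω, χ x y * f y * inner ℝ (outerUnitNormal Ω y) w
        ∂(Measure.euclideanHausdorffMeasure n) := fun x hx =>
    hloc x (htS x hx) _ (hmul x) _ (isClosed_tsupport (χ x)) (hχV x hx)
      (fun y hy => by rw [image_eq_zero_of_notMem_tsupport hy, zero_mul]) w
  have h1 : ∫ x in Ω, fderiv ℝ f x w =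
      ∑ x ∈ t, ∫ y in Ω, fderiv ℝ (fun y => χ x y * f y) y w := by
    rw [← integral_finsetSum _ fun x _ => (hmul x).integrableOn_fderiv hΩ.isOpen hΩ.isBounded w]
    refine setIntegral_congr_fun hΩ.isOpen.measurableSet fun y hy => ?_
    have h2 : f =ᶠ[𝓝 y] fun y => ∑ x ∈ t, χ x y * f y := by
      filter_upwards [hΩ.isOpen.mem_nhds hy] with z hz
      rw [← Finset.sum_mul, hχ1 z (subset_closure hz), one_mul]
    have h3 : ∀ x ∈ t, DifferentiableAt ℝ (fun y => χ x y * f y) y := fun x _ =>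
      ((hmul x).contDiffOn.contDiffAt (hΩ.isOpen.mem_nhds hy)).differentiableAt one_ne_zero
    rw [h2.fderiv_eq, fderiv_fun_sum h3, sum_apply]
  rw [h1, Finset.sum_congr rfl key,
    ← integral_finsetSum _ fun x _ => (hmul x).integrableOn_frontier hΩ w]
  refine setIntegral_congr_fun isClosed_frontier.measurableSet fun y hy => ?_
  rw [← Finset.sum_mul, ← Finset.sum_mul, hχ1 y (frontier_subset_closure hy), one_mul]

end Divergence

/-! ### Green's first identity. -/

section Green

open Filter Topology Module

theorem fderivWithin_closure_eq {N : ℕ} {Ω : Set (Euc N)} (hΩ : IsOpen Ω) {v : Euc N → ℝ}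
    {x : Euc N} (hx : x ∈ Ω) : fderivWithin ℝ v (closure Ω) x = fderiv ℝ v x :=
  fderivWithin_of_mem_nhds (mem_of_superset (hΩ.mem_nhds hx) subset_closure)

theorem isC1Closure_of_contDiffOn {N : ℕ} {Ω : Set (Euc N)} (hΩ : IsBoundedSmoothDomain Ω)
    {v : Euc N → ℝ} (hv : ContDiffOn ℝ 1 v (closure Ω)) : IsC1Closure Ω v := by
  refine ⟨hv.continuousOn, hv.mono subset_closure, ?_⟩
  obtain ⟨C, hC⟩ := hΩ.isCompact_closure.exists_bound_of_continuousOn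
    (hv.continuousOn_fderivWithin hΩ.uniqueDiffOn_closure le_rfl)
  refine ⟨C, fun x hx => ?_⟩
  rw [← fderivWithin_closure_eq hΩ.isOpen hx]
  exact hC x (subset_closure hx)

theorem laplacian_eq_sum_fderiv {N : ℕ} {v : Euc N → ℝ} {x : Euc N} :
    Laplacian.laplacian v x = ∑ j, fderiv ℝ (fderiv ℝ v) x (EuclideanSpace.basisFun (Fin N) ℝ j)
      (EuclideanSpace.basisFun (Fin N) ℝ j) := by
  rw [InnerProductSpace.laplacian_eq_iteratedFDeriv_orthonormalBasis v
    (EuclideanSpace.basisFun (Fin N) ℝ)]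
  simp [iteratedFDeriv_two_apply]

variable {n : ℕ} {Ω : Set (Euc (n + 1))}

/-- Green's first identity. -/
theorem IsBoundedSmoothDomain.green (hΩ : IsBoundedSmoothDomain Ω) {φ v : Euc (n + 1) → ℝ}
    (hφ : IsC1Closure Ω φ) (hv : ContDiffOn ℝ 2 v (closure Ω)) :
    ∫ x in Ω, (φ x * Laplacian.laplacian v x + inner ℝ (gradient φ x) (gradient v x)) =
      ∫ x in frontier Ω, φ x * boundaryNormalDeriv Ω v x
        ∂(Measure.euclideanHausdorffMeasure n) := by
  set b := EuclideanSpace.basisFun (Fin (n + 1)) ℝ with hb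
  -- The derivative within the closure extends ∂ⱼv continuously to ∂Ω; the identity is the
  -- divergence theorem for φ ∂ⱼv in direction j, summed over j.
  have hD : ∀ j, IsC1Closure Ω (fun x => fderivWithin ℝ v (closure Ω) x (b j)) := fun j =>
    isC1Closure_of_contDiffOn hΩ
      ((hv.fderivWithin hΩ.uniqueDiffOn_closure (by norm_num)).clm_apply contDiffOn_const)
  have hF : ∀ j, IsC1Closure Ω (fun x => φ x * fderivWithin ℝ v (closure Ω) x (b j)) := fun j =>
    hφ.mul hΩ.isOpen hΩ.isCompact_closure (hD j)
  have h1 : ∀ x ∈ Ω, φ x * Laplacian.laplacian v x + inner ℝ (gradient φ x) (gradient v x) =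
      ∑ j, fderiv ℝ (fun x => φ x * fderivWithin ℝ v (closure Ω) x (b j)) x (b j) := by
    intro x hx
    have hxn := hΩ.isOpen.mem_nhds hx
    have hva : ContDiffAt ℝ 2 v x := (hv.mono subset_closure).contDiffAt hxn
    have hφd : DifferentiableAt ℝ φ x := (hφ.contDiffOn.contDiffAt hxn).differentiableAt one_ne_zero
    have hvd : DifferentiableAt ℝ v x := hva.differentiableAt two_ne_zero
    have hvd2 : DifferentiableAt ℝ (fderiv ℝ v) x :=
      (hva.fderiv_right (m := 1) (by norm_num)).differentiableAt one_ne_zero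
    have hinner : inner ℝ (gradient φ x) (gradient v x) = ∑ j, fderiv ℝ φ x (b j) *
        fderiv ℝ v x (b j) := by
      rw [← b.sum_inner_mul_inner]
      refine Finset.sum_congr rfl fun j _ => ?_
      rw [hφd.hasGradientAt.hasFDerivAt.fderiv, hvd.hasGradientAt.hasFDerivAt.fderiv,
        InnerProductSpace.toDual_apply_apply, InnerProductSpace.toDual_apply_apply,
        real_inner_comm (gradient v x)]
    rw [hinner, laplacian_eq_sum_fderiv, Finset.mul_sum, ← Finset.sum_add_distrib]
    refine Finset.sum_congr rfl fun j _ => ?_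
    have h2 : (fun x => φ x * fderivWithin ℝ v (closure Ω) x (b j)) =ᶠ[𝓝 x]
        fun x => φ x * fderiv ℝ v x (b j) := by
      filter_upwards [hxn] with y hy
      rw [fderivWithin_closure_eq hΩ.isOpen hy]
    rw [h2.fderiv_eq, fderiv_fun_mul hφd (hvd2.clm_apply (differentiableAt_const _)),
      fderiv_clm_apply hvd2 (differentiableAt_const _)]
    simp only [fderiv_fun_const, Pi.zero_apply, ContinuousLinearMap.comp_zero, zero_add, add_apply,
      smul_apply, ContinuousLinearMap.flip_apply, smul_eq_mul, hb]
    ring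
  rw [setIntegral_congr_fun hΩ.isOpen.measurableSet h1,
    integral_finsetSum _ fun j _ => (hF j).integrableOn_fderiv hΩ.isOpen hΩ.isBounded (b j)]
  simp_rw [fun j => hΩ.integral_fderiv (hF j) (b j)]
  rw [← integral_finsetSum _ fun j _ => (hF j).integrableOn_frontier hΩ (b j)]
  refine setIntegral_congr_fun isClosed_frontier.measurableSet fun x hx => ?_
  simp only [boundaryNormalDeriv]
  conv_rhs => rw [← b.sum_repr (outerUnitNormal Ω x), map_sum, Finset.mul_sum]
  refine Finset.sum_congr rfl fun j _ => ?_
  rw [map_smul, smul_eq_mul, b.repr_apply_apply, real_inner_comm]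
  ring

end Green

/-! ### Functions on the closed space-time cylinder and integrals depending on time. -/

section Cylinder

open Filter Topology

variable {N : ℕ} {Ω : Set (Euc N)} {T : ℝ} {u v : Euc N → ℝ → ℝ}

/-- Continuously differentiable functions on the closed cylinder. -/
def IsC1Cylinder (Ω : Set (Euc N)) (T : ℝ) (u : Euc N → ℝ → ℝ) : Prop :=
  ContDiffOn ℝ 1 (fun p : Euc N × ℝ => u p.1 p.2) (closure Ω ×ˢ Icc 0 T)

theorem IsC2Cylinder.isC1Cylinder (hu : IsC2Cylinder Ω T u) : IsC1Cylinder Ω T u :=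
  ContDiffOn.of_le hu one_le_two

theorem IsC2Cylinder.sub (hu : IsC2Cylinder Ω T u) (hv : IsC2Cylinder Ω T v) :
    IsC2Cylinder Ω T (u - v) :=
  ContDiffOn.sub hu hv

theorem IsC2Cylinder.slice (hu : IsC2Cylinder Ω T u) {t : ℝ} (ht : t ∈ Icc 0 T) :
    ContDiffOn ℝ 2 (fun x => u x t) (closure Ω) :=
  ContDiffOn.comp (g := fun p : Euc N × ℝ => u p.1 p.2) (f := fun x => (x, t)) hu
    (contDiff_id.prodMk contDiff_const).contDiffOn fun _ hx => ⟨hx, ht⟩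

theorem IsC1Cylinder.slice (hu : IsC1Cylinder Ω T u) {t : ℝ} (ht : t ∈ Icc 0 T) :
    ContDiffOn ℝ 1 (fun x => u x t) (closure Ω) :=
  ContDiffOn.comp (g := fun p : Euc N × ℝ => u p.1 p.2) (f := fun x => (x, t)) hu
    (contDiff_id.prodMk contDiff_const).contDiffOn fun _ hx => ⟨hx, ht⟩

theorem IsBoundedSmoothDomain.isCompact_cylinder (hΩ : IsBoundedSmoothDomain Ω) :
    IsCompact (closure Ω ×ˢ Icc 0 T) :=
  hΩ.isCompact_closure.prod isCompact_Icc

theorem IsBoundedSmoothDomain.uniqueDiffOn_cylinder (hΩ : IsBoundedSmoothDomain Ω) (hT : 0 < T) :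
    UniqueDiffOn ℝ (closure Ω ×ˢ Icc 0 T) :=
  hΩ.uniqueDiffOn_closure.prod (uniqueDiffOn_Icc hT)

/-- The full space-time derivative, up to the boundary. -/
noncomputable def cylDeriv (Ω : Set (Euc N)) (T : ℝ) (u : Euc N → ℝ → ℝ) (p : Euc N × ℝ) :
    Euc N × ℝ →L[ℝ] ℝ :=
  fderivWithin ℝ (fun p : Euc N × ℝ => u p.1 p.2) (closure Ω ×ˢ Icc 0 T) p

theorem IsC1Cylinder.continuousOn_cylDeriv (hΩ : IsBoundedSmoothDomain Ω) (hT : 0 < T)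
    (hu : IsC1Cylinder Ω T u) : ContinuousOn (cylDeriv Ω T u) (closure Ω ×ˢ Icc 0 T) :=
  ContDiffOn.continuousOn_fderivWithin hu (hΩ.uniqueDiffOn_cylinder hT) le_rfl

theorem IsC1Cylinder.hasFDerivWithinAt (hu : IsC1Cylinder Ω T u) {p : Euc N × ℝ}
    (hp : p ∈ closure Ω ×ˢ Icc 0 T) :
    HasFDerivWithinAt (fun p : Euc N × ℝ => u p.1 p.2) (cylDeriv Ω T u p)
      (closure Ω ×ˢ Icc 0 T) p :=
  (ContDiffOn.differentiableOn hu one_ne_zero p hp).hasFDerivWithinAt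

theorem IsC1Cylinder.hasFDerivAt_space (hΩ : IsOpen Ω) (hu : IsC1Cylinder Ω T u) {x : Euc N}
    {t : ℝ} (hx : x ∈ Ω) (ht : t ∈ Icc 0 T) :
    HasFDerivAt (fun y => u y t) ((cylDeriv Ω T u (x, t)).comp (.inl ℝ (Euc N) ℝ)) x := by
  have h1 := hu.hasFDerivWithinAt (p := (x, t)) ⟨subset_closure hx, ht⟩
  have h2 : HasFDerivWithinAt (fun y : Euc N => (y, t)) (.inl ℝ (Euc N) ℝ) (closure Ω) x :=
    (hasFDerivAt_prodMk_left x t).hasFDerivWithinAt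
  have h0 : MapsTo (fun y : Euc N => (y, t)) (closure Ω) (closure Ω ×ˢ Icc 0 T) :=
    fun y hy => ⟨hy, ht⟩
  have h3 := HasFDerivWithinAt.comp x h1 h2 h0
  exact h3.hasFDerivAt (mem_of_superset (hΩ.mem_nhds hx) subset_closure)

theorem IsC1Cylinder.hasDerivWithinAt_time (hu : IsC1Cylinder Ω T u) {x : Euc N}
    {t : ℝ} (hx : x ∈ closure Ω) (ht : t ∈ Icc 0 T) :
    HasDerivWithinAt (fun s => u x s) (cylDeriv Ω T u (x, t) (0, 1)) (Icc 0 T) t := by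
  have h1 := hu.hasFDerivWithinAt (p := (x, t)) ⟨hx, ht⟩
  have h2 : HasDerivWithinAt (fun s : ℝ => (x, s)) ((0 : Euc N), (1 : ℝ)) (Icc 0 T) t :=
    ((hasDerivAt_const t x).prodMk (hasDerivAt_id t)).hasDerivWithinAt
  have h3 : MapsTo (fun s : ℝ => (x, s)) (Icc 0 T) (closure Ω ×ˢ Icc 0 T) := fun y hy => ⟨hx, hy⟩
  exact h1.comp_hasDerivWithinAt t h2 h3

theorem IsC1Cylinder.derivWithin_eq (hT : 0 < T) (hu : IsC1Cylinder Ω T u) {x : Euc N}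
    {t : ℝ} (hx : x ∈ closure Ω) (ht : t ∈ Icc 0 T) :
    derivWithin (fun s => u x s) (Icc 0 T) t = cylDeriv Ω T u (x, t) (0, 1) :=
  (hu.hasDerivWithinAt_time hx ht).derivWithin (uniqueDiffOn_Icc hT t ht)

theorem IsC1Cylinder.hasDerivAt_time (hu : IsC1Cylinder Ω T u) {x : Euc N}
    {t : ℝ} (hx : x ∈ closure Ω) (ht : t ∈ Ioo 0 T) :
    HasDerivAt (fun s => u x s) (cylDeriv Ω T u (x, t) (0, 1)) t :=
  (hu.hasDerivWithinAt_time hx (Ioo_subset_Icc_self ht)).hasDerivAt (Icc_mem_nhds ht.1 ht.2)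

theorem IsC1Cylinder.spaceGrad_eq (hΩ : IsOpen Ω) (hu : IsC1Cylinder Ω T u) {x : Euc N}
    {t : ℝ} (hx : x ∈ Ω) (ht : t ∈ Icc 0 T) :
    spaceGrad u x t = (InnerProductSpace.toDual ℝ (Euc N)).symm
      ((cylDeriv Ω T u (x, t)).comp (.inl ℝ (Euc N) ℝ)) := by
  rw [spaceGrad, gradient, (hu.hasFDerivAt_space hΩ hx ht).fderiv]

/-- The spatial gradient, continued continuously to the closed cylinder. -/
noncomputable def cylGrad (Ω : Set (Euc N)) (T : ℝ) (u : Euc N → ℝ → ℝ) (p : Euc N × ℝ) : Euc N :=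
  (InnerProductSpace.toDual ℝ (Euc N)).symm ((cylDeriv Ω T u p).comp (.inl ℝ (Euc N) ℝ))

theorem IsC1Cylinder.continuousOn_cylGrad (hΩ : IsBoundedSmoothDomain Ω) (hT : 0 < T)
    (hu : IsC1Cylinder Ω T u) : ContinuousOn (cylGrad Ω T u) (closure Ω ×ˢ Icc 0 T) :=
  (InnerProductSpace.toDual ℝ (Euc N)).symm.continuous.comp_continuousOn
    ((hu.continuousOn_cylDeriv hΩ hT).clm_comp continuousOn_const)

theorem IsC1Cylinder.exists_bound (hΩ : IsBoundedSmoothDomain Ω) (hT : 0 < T)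
    (hu : IsC1Cylinder Ω T u) : ∃ C, 0 ≤ C ∧ ∀ x ∈ closure Ω, ∀ t ∈ Icc 0 T,
      |u x t| ≤ C ∧ ‖cylDeriv Ω T u (x, t)‖ ≤ C ∧ ‖cylGrad Ω T u (x, t)‖ ≤ C := by
  obtain ⟨A, hA⟩ := (hΩ.isCompact_cylinder (T := T)).exists_bound_of_continuousOn
    (ContDiffOn.continuousOn hu)
  obtain ⟨B, hB⟩ := (hΩ.isCompact_cylinder (T := T)).exists_bound_of_continuousOn
    (hu.continuousOn_cylDeriv hΩ hT)
  obtain ⟨C, hC⟩ := (hΩ.isCompact_cylinder (T := T)).exists_bound_of_continuousOn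
    (hu.continuousOn_cylGrad hΩ hT)
  refine ⟨max (max A (max B C)) 0, le_max_right _ _, fun x hx t ht => ⟨?_, ?_, ?_⟩⟩
  · exact (hA (x, t) ⟨hx, ht⟩).trans (by simp)
  · exact (hB (x, t) ⟨hx, ht⟩).trans (by simp)
  · exact (hC (x, t) ⟨hx, ht⟩).trans (by simp)

/-- Continuous functions on the closed cylinder have continuous integrals over `Ω`. -/
theorem IsBoundedSmoothDomain.continuousOn_integral (hΩ : IsBoundedSmoothDomain Ω)
    {h : Euc N → ℝ → ℝ} (hc : ContinuousOn (fun p : Euc N × ℝ => h p.1 p.2)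
      (closure Ω ×ˢ Icc 0 T)) :
    ContinuousOn (fun t => ∫ x in Ω, h x t) (Icc 0 T) := by
  obtain ⟨A, hA⟩ := (hΩ.isCompact_cylinder (T := T)).exists_bound_of_continuousOn hc
  have hfin : IsFiniteMeasure (volume.restrict Ω) := ⟨by simpa using hΩ.isBounded.measure_lt_top⟩
  intro t ht
  refine continuousWithinAt_of_dominated (bound := fun _ => A) ?_ ?_ (integrable_const A) ?_
  · filter_upwards [self_mem_nhdsWithin] with s hs
    have : ContinuousOn (fun x => h x s) Ω :=
      hc.comp (f := fun x => (x, s)) (by fun_prop) fun x hx => ⟨subset_closure hx, hs⟩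
    exact this.aestronglyMeasurable hΩ.isOpen.measurableSet
  · filter_upwards [self_mem_nhdsWithin] with s hs
    filter_upwards [ae_restrict_mem hΩ.isOpen.measurableSet] with x hx
      using hA (x, s) ⟨subset_closure hx, hs⟩
  · filter_upwards [ae_restrict_mem hΩ.isOpen.measurableSet] with x hx
    have : ContinuousOn (fun s => h x s) (Icc 0 T) :=
      hc.comp (f := fun s => (x, s)) (by fun_prop) fun s hs => ⟨subset_closure hx, hs⟩
    exact this t ht

/-- Differentiation of integrals over `Ω` with respect to time. -/
theorem IsC1Cylinder.hasDerivAt_integral (hΩ : IsBoundedSmoothDomain Ω) (hT : 0 < T)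
    (hu : IsC1Cylinder Ω T u) {t : ℝ} (ht : t ∈ Ioo 0 T) :
    HasDerivAt (fun t => ∫ x in Ω, u x t) (∫ x in Ω, cylDeriv Ω T u (x, t) (0, 1)) t := by
  obtain ⟨A, hA0, hA⟩ := hu.exists_bound hΩ hT
  have hfin : IsFiniteMeasure (volume.restrict Ω) := ⟨by simpa using hΩ.isBounded.measure_lt_top⟩
  have hcd := hu.continuousOn_cylDeriv hΩ hT
  have hm : ∀ s ∈ Icc 0 T, AEStronglyMeasurable (fun x => u x s) (volume.restrict Ω) := by
    intro s hs
    have : ContinuousOn (fun x => u x s) Ω := ((hu.slice hs).continuousOn).mono subset_closure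
    exact this.aestronglyMeasurable hΩ.isOpen.measurableSet
  refine (hasDerivAt_integral_of_dominated_loc_of_deriv_le (F := fun t x => u x t)
    (F' := fun t x => cylDeriv Ω T u (x, t) (0, 1)) (bound := fun _ => A)
    (s := Ioo 0 T) (Ioo_mem_nhds ht.1 ht.2) ?_ ?_ ?_ ?_ (integrable_const A) ?_).2
  · filter_upwards [Icc_mem_nhds ht.1 ht.2] with s hs using hm s hs
  · refine Integrable.of_bound (hm t (Ioo_subset_Icc_self ht)) A ?_
    filter_upwards [ae_restrict_mem hΩ.isOpen.measurableSet] with x hx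
      using (hA x (subset_closure hx) t (Ioo_subset_Icc_self ht)).1
  · have : ContinuousOn (fun x => cylDeriv Ω T u (x, t) (0, 1)) Ω :=
      (hcd.clm_apply continuousOn_const).comp (f := fun x => (x, t)) (by fun_prop)
        fun x hx => ⟨subset_closure hx, Ioo_subset_Icc_self ht⟩
    exact this.aestronglyMeasurable hΩ.isOpen.measurableSet
  · filter_upwards [ae_restrict_mem hΩ.isOpen.measurableSet] with x hx s hs
    refine (ContinuousLinearMap.le_opNorm _ _).trans ?_
    have h1 := (hA x (subset_closure hx) s (Ioo_subset_Icc_self hs)).2.1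
    have h2 : ‖((0 : Euc N), (1 : ℝ))‖ = 1 := by simp [Prod.norm_def]
    rw [h2, mul_one]
    exact h1
  · filter_upwards [ae_restrict_mem hΩ.isOpen.measurableSet] with x hx s hs
    exact hu.hasDerivAt_time (subset_closure hx) hs

end Cylinder

/-! ### Powers of the positive part and a Taylor estimate. -/

section Calculus

open Filter Topology

theorem hasDerivAt_max_zero_pow (n : ℕ) (s : ℝ) :
    HasDerivAt (fun s : ℝ => (max s 0) ^ (n + 2)) ((n + 2) * (max s 0) ^ (n + 1)) s := by
  rcases lt_trichotomy s 0 with h | rfl | h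
  · have h1 : (fun s : ℝ => (max s 0) ^ (n + 2)) =ᶠ[𝓝 s] fun _ => 0 := by
      filter_upwards [Iio_mem_nhds h] with y hy
      rw [max_eq_right (le_of_lt hy), zero_pow (by omega)]
    rw [max_eq_right h.le, zero_pow (by omega), mul_zero]
    exact (hasDerivAt_const s (0 : ℝ)).congr_of_eventuallyEq h1
  · rw [max_self, zero_pow (by omega), mul_zero, hasDerivAt_iff_isLittleO_nhds_zero]
    have h1 : (fun h : ℝ => h ^ (n + 2)) =o[𝓝 0] fun h => h := by
      simpa using Asymptotics.isLittleO_pow_pow (𝕜 := ℝ) (m := 1) (n := n + 2) (by omega)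
    refine (Asymptotics.isBigO_of_le _ fun h => ?_).trans_isLittleO h1
    simp only [zero_add, max_self, smul_zero, sub_zero, ne_eq, Nat.add_eq_zero_iff, OfNat.ofNat_ne_zero,
      and_false, not_false_eq_true, zero_pow, norm_pow]
    refine pow_le_pow_left₀ (norm_nonneg _) ?_ _
    rcases le_total h 0 with h0 | h0 <;> simp [h0]
  · have h1 : (fun s : ℝ => (max s 0) ^ (n + 2)) =ᶠ[𝓝 s] fun s => s ^ (n + 2) := by
      filter_upwards [Ioi_mem_nhds h] with y hy
      rw [max_eq_left (le_of_lt hy)]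
    rw [max_eq_left h.le]
    have h2 := hasDerivAt_pow (n + 2) s
    simp only [Nat.cast_add, Nat.cast_ofNat] at h2
    exact h2.congr_of_eventuallyEq h1

/-- Second order Taylor estimate on an interval. -/
theorem abs_sub_sub_le_of_abs_deriv2_le {g g' g'' : ℝ → ℝ} {L B : ℝ}
    (h1 : ∀ s, HasDerivAt g (g' s) s) (h2 : ∀ s, HasDerivAt g' (g'' s) s)
    (hB : ∀ s ∈ Icc (-L) L, |g'' s| ≤ B) {a b : ℝ} (ha : a ∈ Icc (-L) L) (hb : b ∈ Icc (-L) L) :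
    |g b - g a - g' a * (b - a)| ≤ B * (b - a) ^ 2 := by
  have hsub : uIcc a b ⊆ Icc (-L) L := uIcc_subset_Icc ha hb
  have hB0 : 0 ≤ B := (abs_nonneg _).trans (hB a ha)
  have h3 : ∀ s ∈ uIcc a b, |g' s - g' a| ≤ B * |b - a| := by
    intro s hs
    have := (convex_Icc (-L) L).norm_image_sub_le_of_norm_hasDerivWithin_le
      (fun x _ => (h2 x).hasDerivWithinAt) hB ha (hsub hs)
    refine this.trans (mul_le_mul_of_nonneg_left ?_ hB0)
    exact abs_sub_left_of_mem_uIcc hs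
  have h4 := (convex_uIcc a b).norm_image_sub_le_of_norm_hasDerivWithin_le
      (f := fun s => g s - g' a * s) (f' := fun s => g' s - g' a)
      (fun x _ => ((h1 x).sub (by simpa using (hasDerivAt_id x).const_mul (g' a))).hasDerivWithinAt)
      h3 left_mem_uIcc right_mem_uIcc
  calc |g b - g a - g' a * (b - a)| = ‖(g b - g' a * b) - (g a - g' a * a)‖ := by
        rw [Real.norm_eq_abs]; ring_nf
    _ ≤ B * |b - a| * |b - a| := h4
    _ = B * (b - a) ^ 2 := by rw [mul_assoc, abs_mul_abs_self]; ring

end Calculus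

/-! ### Integrability over Ω and the chain rule on the cylinder. -/

section Integrability

open Filter Topology

variable {N : ℕ} {Ω : Set (Euc N)} {T : ℝ} {u v : Euc N → ℝ → ℝ}

theorem IsBoundedSmoothDomain.isFiniteMeasure (hΩ : IsBoundedSmoothDomain Ω) :
    IsFiniteMeasure (volume.restrict Ω) :=
  ⟨by simpa using hΩ.isBounded.measure_lt_top⟩

theorem IsBoundedSmoothDomain.memLp_top {V : Type*} [NormedAddCommGroup V]
    (hΩ : IsBoundedSmoothDomain Ω) {g : Euc N → V}
    (hg : ContinuousOn g (closure Ω)) : MemLp g ⊤ (volume.restrict Ω) := by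
  obtain ⟨A, hA⟩ := hΩ.isCompact_closure.exists_bound_of_continuousOn hg
  exact memLp_top_of_bound ((hg.mono subset_closure).aestronglyMeasurable hΩ.isOpen.measurableSet) A
    ((ae_restrict_mem hΩ.isOpen.measurableSet).mono fun x hx => hA x (subset_closure hx))

theorem IsBoundedSmoothDomain.integrableOn {V : Type*} [NormedAddCommGroup V]
    (hΩ : IsBoundedSmoothDomain Ω) {g : Euc N → V}
    (hg : ContinuousOn g (closure Ω)) : IntegrableOn g Ω :=
  (hg.integrableOn_compact hΩ.isCompact_closure).mono_set subset_closure

/-- The Laplacian is formed from unrestricted derivatives and carries no information on ∂Ω; a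
representative continuous up to the boundary is what gives integrability over Ω. -/
theorem IsBoundedSmoothDomain.exists_continuousOn_laplacian (hΩ : IsBoundedSmoothDomain Ω)
    {v : Euc N → ℝ} (hv : ContDiffOn ℝ 2 v (closure Ω)) :
    ∃ L : Euc N → ℝ, ContinuousOn L (closure Ω) ∧ EqOn (Laplacian.laplacian v) L Ω := by
  set b := EuclideanSpace.basisFun (Fin N) ℝ with hb
  have hD : ContDiffOn ℝ 1 (fderivWithin ℝ v (closure Ω)) (closure Ω) :=
    hv.fderivWithin hΩ.uniqueDiffOn_closure (by norm_num)
  refine ⟨fun x => ∑ j, fderivWithin ℝ (fderivWithin ℝ v (closure Ω)) (closure Ω) x (b j) (b j),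
    continuousOn_finsetSum _ fun j _ => ?_, fun x hx => ?_⟩
  · exact ((hD.continuousOn_fderivWithin hΩ.uniqueDiffOn_closure le_rfl).clm_apply
      continuousOn_const).clm_apply continuousOn_const
  · rw [laplacian_eq_sum_fderiv]
    refine Finset.sum_congr rfl fun j _ => ?_
    have hxn := hΩ.isOpen.mem_nhds hx
    have h2 : fderivWithin ℝ v (closure Ω) =ᶠ[𝓝 x] fderiv ℝ v := by
      filter_upwards [hxn] with y hy
      rw [fderivWithin_closure_eq hΩ.isOpen hy]
    rw [fderivWithin_of_mem_nhds (mem_of_superset hxn subset_closure), h2.fderiv_eq]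

theorem IsC1Cylinder.continuousOn_comp (hu : IsC1Cylinder Ω T u) {g : ℝ → ℝ} (hg : Continuous g)
    {t : ℝ} (ht : t ∈ Icc 0 T) : ContinuousOn (fun x => g (u x t)) (closure Ω) :=
  hg.comp_continuousOn (hu.slice ht).continuousOn

theorem cylDeriv_comp (hΩ : IsBoundedSmoothDomain Ω) (hT : 0 < T) (hu : IsC1Cylinder Ω T u)
    {g : ℝ → ℝ} {g' : ℝ} {p : Euc N × ℝ} (hp : p ∈ closure Ω ×ˢ Icc 0 T)
    (hg : HasDerivAt g g' (u p.1 p.2)) :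
    cylDeriv Ω T (fun x t => g (u x t)) p = g' • cylDeriv Ω T u p :=
  (hg.comp_hasFDerivWithinAt p (hu.hasFDerivWithinAt hp)).fderivWithin
    (hΩ.uniqueDiffOn_cylinder hT p hp)

theorem IsC1Cylinder.comp (hu : IsC1Cylinder Ω T u) {g : ℝ → ℝ} (hg : ContDiff ℝ 1 g) :
    IsC1Cylinder Ω T (fun x t => g (u x t)) :=
  hg.comp_contDiffOn hu

theorem cylDeriv_sub (hΩ : IsBoundedSmoothDomain Ω) (hT : 0 < T) (hu : IsC1Cylinder Ω T u)
    (hv : IsC1Cylinder Ω T v) {p : Euc N × ℝ} (hp : p ∈ closure Ω ×ˢ Icc 0 T) :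
    cylDeriv Ω T (u - v) p = cylDeriv Ω T u p - cylDeriv Ω T v p :=
  ((hu.hasFDerivWithinAt hp).sub (hv.hasFDerivWithinAt hp)).fderivWithin
    (hΩ.uniqueDiffOn_cylinder hT p hp)

theorem laplacian_fun_sub {v w : Euc N → ℝ} {x : Euc N} (hv : ContDiffAt ℝ 2 v x)
    (hw : ContDiffAt ℝ 2 w x) : Laplacian.laplacian (fun y => v y - w y) x =
      Laplacian.laplacian v x - Laplacian.laplacian w x := by
  exact hv.laplacian_sub hw

end Integrability

/-! ### The maximum principle by an energy method. -/

section MaximumPrinciple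

open Filter Topology

variable {n : ℕ} {Ω : Set (Euc (n + 1))} {T : ℝ} {f : ℝ → ℝ} {ε : ℝ} {u₀ : Euc (n + 1) → ℝ}
  {u : Euc (n + 1) → ℝ → ℝ}

theorem IsC1Cylinder.gradient_eq (hΩ : IsOpen Ω) (hu : IsC1Cylinder Ω T u) {x : Euc (n + 1)}
    {t : ℝ} (hx : x ∈ Ω) (ht : t ∈ Icc 0 T) :
    gradient (fun y => u y t) x = cylGrad Ω T u (x, t) :=
  hu.spaceGrad_eq hΩ hx ht

theorem cylGrad_comp (hΩ : IsBoundedSmoothDomain Ω) (hT : 0 < T) (hu : IsC1Cylinder Ω T u)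
    {g : ℝ → ℝ} {g' : ℝ} {p : Euc (n + 1) × ℝ} (hp : p ∈ closure Ω ×ˢ Icc 0 T)
    (hg : HasDerivAt g g' (u p.1 p.2)) :
    cylGrad Ω T (fun x t => g (u x t)) p = g' • cylGrad Ω T u p := by
  simp only [cylGrad]
  rw [cylDeriv_comp hΩ hT hu hp hg, ContinuousLinearMap.smul_comp, map_smul]

theorem IsC1Cylinder.continuousOn_cylGrad_slice (hΩ : IsBoundedSmoothDomain Ω) (hT : 0 < T)
    (hu : IsC1Cylinder Ω T u) {t : ℝ} (ht : t ∈ Icc 0 T) :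
    ContinuousOn (fun x => cylGrad Ω T u (x, t)) (closure Ω) :=
  (hu.continuousOn_cylGrad hΩ hT).comp (f := fun x => (x, t)) (by fun_prop) fun _ hx => ⟨hx, ht⟩

theorem IsC1Cylinder.continuousOn_cylDeriv_time (hΩ : IsBoundedSmoothDomain Ω) (hT : 0 < T)
    (hu : IsC1Cylinder Ω T u) {t : ℝ} (ht : t ∈ Icc 0 T) :
    ContinuousOn (fun x => cylDeriv Ω T u (x, t) (0, 1)) (closure Ω) :=
  ((hu.continuousOn_cylDeriv hΩ hT).clm_apply continuousOn_const).comp (f := fun x => (x, t))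
    (by fun_prop) fun _ hx => ⟨hx, ht⟩

/-- Energies `∫ φ(u)` with `φ` convex and `φ' f' ≥ 0` decrease along solutions. -/
theorem IsAllenCahnSolution.integral_deriv_nonpos (hΩ : IsBoundedSmoothDomain Ω) (hT : 0 < T)
    (hu : IsAllenCahnSolution Ω T f ε u₀ u) {η : ℝ → ℝ} (hη : ContDiff ℝ 1 η)
    (hη' : ∀ s, 0 ≤ deriv η s) (hηf : ∀ s, 0 ≤ η s * deriv f s) {t : ℝ} (ht : t ∈ Ioo 0 T) :
    ∫ x in Ω, η (u x t) * cylDeriv Ω T u (x, t) (0, 1) ≤ 0 := by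
  have htc := Ioo_subset_Icc_self ht
  have hu1 := hu.C2.isC1Cylinder
  have hsl := hu.C2.slice htc
  have hη1 : IsC1Cylinder Ω T (fun x t => η (u x t)) := hu1.comp hη
  have hgreen := hΩ.green (isC1Closure_of_contDiffOn hΩ (hη1.slice htc)) hsl
  have h0 : ∫ x in frontier Ω, η (u x t) * boundaryNormalDeriv Ω (fun x => u x t) x
      ∂(Measure.euclideanHausdorffMeasure n) = 0 := by
    refine (setIntegral_congr_fun isClosed_frontier.measurableSet fun x hx => ?_).trans
      (integral_zero _ _)
    simp only [hu.neumann x hx t ht, mul_zero]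
  rw [h0] at hgreen
  obtain ⟨L, hLc, hL⟩ := hΩ.exists_continuousOn_laplacian hsl
  have hηc : ContinuousOn (fun x => η (u x t)) (closure Ω) := (hη1.slice htc).continuousOn
  have hgc := hu1.continuousOn_cylGrad_slice hΩ hT htc
  have hg2 : ∀ x ∈ Ω, inner ℝ (gradient (fun x => η (u x t)) x) (gradient (fun x => u x t) x) =
      deriv η (u x t) * ‖cylGrad Ω T u (x, t)‖ ^ 2 := by
    intro x hx
    rw [hη1.gradient_eq hΩ.isOpen hx htc, hu1.gradient_eq hΩ.isOpen hx htc,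
      cylGrad_comp hΩ hT hu1 (p := (x, t)) ⟨subset_closure hx, htc⟩
        ((hη.differentiable one_ne_zero) _).hasDerivAt,
      real_inner_smul_left, real_inner_self_eq_norm_sq]
  rw [← hgreen]
  refine setIntegral_mono_on ?_ ?_ hΩ.isOpen.measurableSet fun x hx => ?_
  · exact hΩ.integrableOn (hηc.mul (hu1.continuousOn_cylDeriv_time hΩ hT htc))
  · have : ContinuousOn (fun x => η (u x t) * L x +
        deriv η (u x t) * ‖cylGrad Ω T u (x, t)‖ ^ 2) (closure Ω) :=
      (hηc.mul hLc).add (((hη.continuous_deriv le_rfl).comp_continuousOn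
        (hu1.slice htc).continuousOn).mul (hgc.norm.pow 2))
    refine (hΩ.integrableOn this).congr_fun (fun x hx => ?_) hΩ.isOpen.measurableSet
    dsimp only
    rw [hg2 x hx, hL hx]
  · rw [hg2 x hx]
    have heq := hu.equation x hx t ht
    rw [allenCahnOp, hu1.derivWithin_eq hT (subset_closure hx) htc] at heq
    have h1 : cylDeriv Ω T u (x, t) (0, 1) = Laplacian.laplacian (fun y => u y t) x
      - 1 / ε ^ 2 * deriv f (u x t) := by linarith
    rw [h1]
    have h2 := mul_nonneg (hη' (u x t)) (sq_nonneg ‖cylGrad Ω T u (x, t)‖)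
    have h3 : 0 ≤ 1 / ε ^ 2 * (η (u x t) * deriv f (u x t)) := mul_nonneg (by positivity) (hηf _)
    linarith

/-- The maximum principle. -/
theorem IsAllenCahnSolution.abs_le (hΩ : IsBoundedSmoothDomain Ω) (hT : 0 < T)
    (hu : IsAllenCahnSolution Ω T f ε u₀ u) {k : ℝ} (hk : 0 < k)
    (hf : ∀ s : ℝ, k ≤ |s| → 0 ≤ s * deriv f s) (h₀ : ∀ x ∈ Ω, |u₀ x| ≤ k) :
    ∀ x ∈ Ω, ∀ t ∈ Icc 0 T, |u x t| ≤ k := by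
  -- The penalty vanishes exactly on [-k, k]. Cubes are used so that its derivative η is C¹ and can
  -- serve as a test function η(u); the sign condition on f' applies exactly where η is nonzero.
  set φ : ℝ → ℝ := fun s => (max (s - k) 0) ^ 3 + (max (-s - k) 0) ^ 3 with hφ
  set η : ℝ → ℝ := fun s => 3 * (max (s - k) 0) ^ 2 - 3 * (max (-s - k) 0) ^ 2 with hη
  have hu1 := hu.C2.isC1Cylinder
  have hd1 : ∀ s : ℝ, HasDerivAt (fun s : ℝ => s - k) 1 s := fun s => (hasDerivAt_id s).sub_const k
  have hd2 : ∀ s : ℝ, HasDerivAt (fun s : ℝ => -s - k) (-1) s := fun s =>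
    (hasDerivAt_neg s).sub_const k
  have hφd : ∀ s, HasDerivAt φ (η s) s := by
    intro s
    have h1 := (hasDerivAt_max_zero_pow 1 (s - k)).comp s (hd1 s)
    have h2 := (hasDerivAt_max_zero_pow 1 (-s - k)).comp s (hd2 s)
    refine (h1.add h2).congr_deriv ?_
    simp only [hη]; norm_num; ring
  have hηd : ∀ s, HasDerivAt η (6 * max (s - k) 0 + 6 * max (-s - k) 0) s := by
    intro s
    have h1 := ((hasDerivAt_max_zero_pow 0 (s - k)).comp s (hd1 s)).const_mul 3
    have h2 := ((hasDerivAt_max_zero_pow 0 (-s - k)).comp s (hd2 s)).const_mul 3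
    refine (h1.sub h2).congr_deriv ?_
    norm_num; ring
  have hηc : ContDiff ℝ 1 η := by
    rw [contDiff_one_iff_deriv]
    refine ⟨fun s => (hηd s).differentiableAt, ?_⟩
    rw [funext fun s => (hηd s).deriv]
    fun_prop
  have hφc : ContDiff ℝ 1 φ := by
    rw [contDiff_one_iff_deriv]
    refine ⟨fun s => (hφd s).differentiableAt, ?_⟩
    rw [funext fun s => (hφd s).deriv]
    exact hηc.continuous
  have hη' : ∀ s, 0 ≤ deriv η s := fun s => by rw [(hηd s).deriv]; positivity
  have hηf : ∀ s, 0 ≤ η s * deriv f s := by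
    intro s
    rcases le_or_gt k |s| with h | h
    · have hfs := hf s h
      rcases le_total 0 s with h0 | h0
      · rw [abs_of_nonneg h0] at h
        have h1 : max (-s - k) 0 = 0 := max_eq_right (by linarith)
        have h2 : 0 ≤ deriv f s := by
          by_contra h3
          have := mul_neg_of_pos_of_neg (hk.trans_le h) (not_le.1 h3)
          linarith
        simp only [hη, h1]
        have : (0:ℝ) ≤ (max (s - k) 0) ^ 2 := sq_nonneg _
        have := mul_nonneg this h2
        linarith
      · rw [abs_of_nonpos h0] at h
        have h1 : max (s - k) 0 = 0 := max_eq_right (by linarith)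
        have h2 : deriv f s ≤ 0 := by
          by_contra h3
          have := mul_neg_of_neg_of_pos (show s < 0 by linarith) (not_le.1 h3)
          linarith
        simp only [hη, h1]
        have : (0:ℝ) ≤ (max (-s - k) 0) ^ 2 := sq_nonneg _
        have := mul_nonneg this (neg_nonneg.2 h2)
        linarith
    · obtain ⟨h1, h2⟩ := abs_lt.1 h
      have h3 : max (s - k) 0 = 0 := max_eq_right (by linarith)
      have h4 : max (-s - k) 0 = 0 := max_eq_right (by linarith)
      simp [hη, h3, h4]
  have hφ0 : ∀ s, 0 ≤ φ s := fun s => by simp only [hφ]; positivity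
  have hφ1 : IsC1Cylinder Ω T (fun x t => φ (u x t)) := hu1.comp hφc
  set F : ℝ → ℝ := fun t => ∫ x in Ω, φ (u x t) with hF
  have hFc : ContinuousOn F (Icc 0 T) := hΩ.continuousOn_integral (ContDiffOn.continuousOn hφ1)
  have hFd : ∀ t ∈ Ioo 0 T, HasDerivAt F (∫ x in Ω, cylDeriv Ω T (fun x t => φ (u x t)) (x, t) (0, 1)) t :=
    fun t ht => hφ1.hasDerivAt_integral hΩ hT ht
  have hanti : AntitoneOn F (Icc 0 T) := by
    refine antitoneOn_of_deriv_nonpos (convex_Icc 0 T) hFc ?_ ?_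
    · rw [interior_Icc]
      exact fun t ht => (hFd t ht).differentiableAt.differentiableWithinAt
    · rw [interior_Icc]
      intro t ht
      rw [(hFd t ht).deriv]
      refine le_trans (le_of_eq ?_) (hu.integral_deriv_nonpos hΩ hT hηc hη' hηf ht)
      refine setIntegral_congr_fun hΩ.isOpen.measurableSet fun x hx => ?_
      rw [cylDeriv_comp hΩ hT hu1 (p := (x, t)) ⟨subset_closure hx, Ioo_subset_Icc_self ht⟩ (hφd _),
        smul_apply, smul_eq_mul]
  have hF0 : F 0 = 0 := by
    refine (setIntegral_congr_fun hΩ.isOpen.measurableSet fun x hx => ?_).trans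
      (integral_zero _ _)
    obtain ⟨h1, h2⟩ := _root_.abs_le.1 (h₀ x hx)
    have h3 : max (u₀ x - k) 0 = 0 := max_eq_right (by linarith)
    have h4 : max (-u₀ x - k) 0 = 0 := max_eq_right (by linarith)
    simp [hφ, hu.initial x hx, h3, h4]
  intro x hx t ht
  have hFt : F t = 0 := le_antisymm (hF0 ▸ hanti (left_mem_Icc.2 hT.le) ht ht.1)
    (integral_nonneg fun x => hφ0 _)
  have hcl : ContinuousOn (fun x => φ (u x t)) (closure Ω) := (hφ1.slice ht).continuousOn
  -- The penalty energy is nonnegative, nonincreasing and initially zero, so it vanishes. The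
  -- penalty is then zero almost everywhere, and everywhere in Ω by continuity.
  have hae := (setIntegral_eq_zero_iff_of_nonneg_ae (Eventually.of_forall fun x => hφ0 (u x t))
    (hΩ.integrableOn hcl)).1 hFt
  have hz := Measure.eqOn_open_of_ae_eq hae hΩ.isOpen (hcl.mono subset_closure) continuousOn_const hx
  have hz' : (max (u x t - k) 0) ^ 3 + (max (-u x t - k) 0) ^ 3 = 0 := hz
  have h1 : 0 ≤ (max (u x t - k) 0) ^ 3 := by positivity
  have h2 : 0 ≤ (max (-u x t - k) 0) ^ 3 := by positivity
  have h3 : max (u x t - k) 0 = 0 := eq_zero_of_pow_eq_zero (n := 3) (by linarith)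
  have h4 : max (-u x t - k) 0 = 0 := eq_zero_of_pow_eq_zero (n := 3) (by linarith)
  rw [_root_.abs_le]
  constructor
  · have := h4 ▸ le_max_left (-u x t - k) 0; linarith
  · have := h3 ▸ le_max_left (u x t - k) 0; linarith

end MaximumPrinciple

/-! ### Weak gradients of C¹ functions and the energy identity for the difference. -/

section EnergyIdentity

open Filter Topology

variable {n : ℕ} {Ω : Set (Euc (n + 1))} {T : ℝ} {f : ℝ → ℝ} {ε : ℝ} {u₀ : Euc (n + 1) → ℝ}
  {u v uA : Euc (n + 1) → ℝ → ℝ}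

theorem boundaryNormalDeriv_fun_sub {N : ℕ} {Ω : Set (Euc N)} (hΩ : IsBoundedSmoothDomain Ω)
    {v w : Euc N → ℝ}
    (hv : ContDiffOn ℝ 1 v (closure Ω)) (hw : ContDiffOn ℝ 1 w (closure Ω)) {x : Euc N}
    (hx : x ∈ frontier Ω) : boundaryNormalDeriv Ω (fun y => v y - w y) x =
      boundaryNormalDeriv Ω v x - boundaryNormalDeriv Ω w x := by
  have hxc := frontier_subset_closure hx
  simp only [boundaryNormalDeriv]
  rw [fderivWithin_fun_sub (hΩ.uniqueDiffOn_closure x hxc)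
    (hv.differentiableOn one_ne_zero x hxc) (hw.differentiableOn one_ne_zero x hxc), sub_apply]

/-- A `C¹` function has its classical gradient as weak gradient. -/
theorem IsC1Cylinder.isH1WithGradient (hΩ : IsBoundedSmoothDomain Ω) (hT : 0 < T)
    (hv : IsC1Cylinder Ω T v) {t : ℝ} (ht : t ∈ Icc 0 T) :
    IsH1WithGradient Ω (fun x => v x t) (fun x => spaceGrad v x t) := by
  have := hΩ.isFiniteMeasure
  have hvc := isC1Closure_of_contDiffOn hΩ (hv.slice ht)
  refine ⟨(hΩ.memLp_top (hv.slice ht).continuousOn).mono_exponent le_top, ?_, ?_⟩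
  · refine ((hΩ.memLp_top (hv.continuousOn_cylGrad_slice hΩ hT ht)).mono_exponent le_top).ae_eq ?_
    filter_upwards [ae_restrict_mem hΩ.isOpen.measurableSet] with x hx
    exact (hv.spaceGrad_eq hΩ.isOpen hx ht).symm
  · intro φ hφ _ hφs w
    have hφc : IsC1Closure Ω φ := isC1Closure_of_contDiff hΩ.isCompact_closure (hφ.of_le (by simp))
    have hdiv := hΩ.integral_fderiv (hvc.mul hΩ.isOpen hΩ.isCompact_closure hφc) w
    have h0 : ∫ x in frontier Ω, v x t * φ x * inner ℝ (outerUnitNormal Ω x) w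
        ∂(Measure.euclideanHausdorffMeasure n) = 0 := by
      refine (setIntegral_congr_fun isClosed_frontier.measurableSet fun x hx => ?_).trans
        (integral_zero _ _)
      have : φ x = 0 := by
        by_contra h
        have h1 := hφs (subset_tsupport φ h)
        rw [hΩ.isOpen.frontier_eq] at hx
        exact hx.2 h1
      simp [this]
    rw [h0] at hdiv
    have h1 : ∀ x ∈ Ω, fderiv ℝ (fun x => v x t * φ x) x w =
        v x t * fderiv ℝ φ x w + inner ℝ (spaceGrad v x t) w * φ x := by
      intro x hx
      have hd := (hv.hasFDerivAt_space hΩ.isOpen hx ht).differentiableAt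
      rw [fderiv_fun_mul hd (hφ.differentiable (by simp) x), add_apply, smul_apply, smul_apply,
        spaceGrad, inner_gradient_left]
      simp only [smul_eq_mul]; ring
    rw [setIntegral_congr_fun hΩ.isOpen.measurableSet h1, integral_add] at hdiv
    · linarith
    · exact hΩ.integrableOn ((hv.slice ht).continuousOn.mul
        ((hφ.continuous_fderiv (by simp)).clm_apply continuous_const).continuousOn)
    · refine (hΩ.integrableOn (((hv.continuousOn_cylGrad_slice hΩ hT ht).inner (𝕜 := ℝ)
        (continuousOn_const (c := w))).mul hφ.continuous.continuousOn)).congr_fun (fun x hx => ?_)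
          hΩ.isOpen.measurableSet
      rw [hv.spaceGrad_eq hΩ.isOpen hx ht]; rfl

/-- The energy identity for the difference of a solution and an approximate solution. -/
theorem IsAllenCahnSolution.hasDerivAt_integral_sq (hΩ : IsBoundedSmoothDomain Ω) (hT : 0 < T)
    (hf : ContDiff ℝ ∞ f)
    (hu : IsAllenCahnSolution Ω T f ε u₀ u) (hA : IsC2Cylinder Ω T uA) {t : ℝ} (ht : t ∈ Ioo 0 T) :
    HasDerivAt (fun t => ∫ x in Ω, (u x t - uA x t) ^ 2)
      (2 * (-(∫ x in Ω, ‖spaceGrad (u - uA) x t‖ ^ 2)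
        - (∫ x in Ω, 1 / ε ^ 2 * ((u x t - uA x t) * (deriv f (u x t) - deriv f (uA x t))))
        - ((∫ x in frontier Ω, boundaryNormalDeriv Ω (fun y => uA y t) x * (u x t - uA x t)
              ∂(Measure.euclideanHausdorffMeasure n))
          + ∫ x in Ω, allenCahnOp T f ε uA x t * (u x t - uA x t)))) t := by
  have htc := Ioo_subset_Icc_self ht
  have hu1 := hu.C2.isC1Cylinder
  have hA1 := hA.isC1Cylinder
  have hvA : IsC2Cylinder Ω T (u - uA) := hu.C2.sub hA
  have hv1 := hvA.isC1Cylinder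
  have hfd : Continuous (deriv f) := hf.continuous_deriv (by simp)
  have hsq : IsC1Cylinder Ω T (fun x t => (u x t - uA x t) ^ 2) :=
    ContDiffOn.pow hv1 2
  have h := hsq.hasDerivAt_integral hΩ hT ht
  convert h using 1
  obtain ⟨L, hLc, hL⟩ := hΩ.exists_continuousOn_laplacian (hvA.slice htc)
  have hgreen := hΩ.green (isC1Closure_of_contDiffOn hΩ (hv1.slice htc)) (hvA.slice htc)
  -- Since u satisfies the Neumann condition, the normal derivative of the difference is -s^A; the
  -- boundary term of Green's identity becomes part of the residual.
  have hbd : ∫ x in frontier Ω, (u - uA) x t * boundaryNormalDeriv Ω (fun x => (u - uA) x t) x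
      ∂(Measure.euclideanHausdorffMeasure n) = -∫ x in frontier Ω,
        boundaryNormalDeriv Ω (fun y => uA y t) x * (u x t - uA x t)
        ∂(Measure.euclideanHausdorffMeasure n) := by
    rw [← integral_neg]
    refine setIntegral_congr_fun isClosed_frontier.measurableSet fun x hx => ?_
    have := boundaryNormalDeriv_fun_sub hΩ (hu1.slice htc) (hA1.slice htc) hx
    simp only [Pi.sub_apply]
    rw [this, hu.neumann x hx t ht]; ring
  rw [hbd] at hgreen
  have hvc : ContinuousOn (fun x => u x t - uA x t) (closure Ω) := (hv1.slice htc).continuousOn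
  have hgc := hv1.continuousOn_cylGrad_slice hΩ hT htc
  have hVt := hv1.continuousOn_cylDeriv_time hΩ hT htc
  have hnc : ContinuousOn (fun x => 1 / ε ^ 2 * ((u x t - uA x t) *
      (deriv f (u x t) - deriv f (uA x t)))) (closure Ω) :=
    continuousOn_const.mul (hvc.mul ((hu1.continuousOn_comp hfd htc).sub
      (hA1.continuousOn_comp hfd htc)))
  -- pointwise identities
  have hr : ∀ x ∈ Ω, allenCahnOp T f ε uA x t * (u x t - uA x t) =
      (u x t - uA x t) * L x - (u x t - uA x t) * cylDeriv Ω T (u - uA) (x, t) (0, 1)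
        - 1 / ε ^ 2 * ((u x t - uA x t) * (deriv f (u x t) - deriv f (uA x t))) := by
    intro x hx
    have hxc := subset_closure hx
    have heq := hu.equation x hx t ht
    rw [allenCahnOp, hu1.derivWithin_eq hT hxc htc] at heq
    rw [allenCahnOp, hA1.derivWithin_eq hT hxc htc,
      cylDeriv_sub hΩ hT hu1 hA1 ⟨hxc, htc⟩, sub_apply]
    have hxn := hΩ.isOpen.mem_nhds hx
    have hlap : Laplacian.laplacian (fun x => (u - uA) x t) x = _ := laplacian_fun_sub
      (((hu.C2.slice htc).mono subset_closure).contDiffAt hxn)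
      (((hA.slice htc).mono subset_closure).contDiffAt hxn)
    rw [← hL hx, hlap]
    linear_combination (u x t - uA x t) * heq
  have hg2 : ∀ x ∈ Ω, inner ℝ (gradient (fun x => (u - uA) x t) x)
      (gradient (fun x => (u - uA) x t) x) = ‖cylGrad Ω T (u - uA) (x, t)‖ ^ 2 := by
    intro x hx
    rw [hv1.gradient_eq hΩ.isOpen hx htc, real_inner_self_eq_norm_sq]
  have e1 : ∫ x in Ω, ‖spaceGrad (u - uA) x t‖ ^ 2 =
      ∫ x in Ω, ‖cylGrad Ω T (u - uA) (x, t)‖ ^ 2 :=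
    setIntegral_congr_fun hΩ.isOpen.measurableSet fun x hx => by
      rw [hv1.spaceGrad_eq hΩ.isOpen hx htc]; rfl
  have e2 : ∫ x in Ω, ((u - uA) x t * Laplacian.laplacian (fun x => (u - uA) x t) x +
      inner ℝ (gradient (fun x => (u - uA) x t) x) (gradient (fun x => (u - uA) x t) x)) =
      (∫ x in Ω, (u x t - uA x t) * L x) + ∫ x in Ω, ‖cylGrad Ω T (u - uA) (x, t)‖ ^ 2 := by
    rw [← integral_add (f := fun x => (u x t - uA x t) * L x)
      (g := fun x => ‖cylGrad Ω T (u - uA) (x, t)‖ ^ 2) (hΩ.integrableOn (hvc.mul hLc))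
      (hΩ.integrableOn (hgc.norm.pow 2))]
    refine setIntegral_congr_fun hΩ.isOpen.measurableSet fun x hx => ?_
    rw [hg2 x hx, hL hx]; rfl
  rw [e2] at hgreen
  have e3 : ∫ x in Ω, allenCahnOp T f ε uA x t * (u x t - uA x t) =
      (∫ x in Ω, (u x t - uA x t) * L x)
        - (∫ x in Ω, (u x t - uA x t) * cylDeriv Ω T (u - uA) (x, t) (0, 1))
        - ∫ x in Ω, 1 / ε ^ 2 * ((u x t - uA x t) * (deriv f (u x t) - deriv f (uA x t))) := by
    rw [← integral_sub (f := fun x => (u x t - uA x t) * L x)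
        (g := fun x => (u x t - uA x t) * cylDeriv Ω T (u - uA) (x, t) (0, 1))
        (hΩ.integrableOn (hvc.mul hLc)) (hΩ.integrableOn (hvc.mul hVt)),
      ← integral_sub (f := fun x => (u x t - uA x t) * L x -
        (u x t - uA x t) * cylDeriv Ω T (u - uA) (x, t) (0, 1)) (hΩ.integrableOn ((hvc.mul hLc).sub (hvc.mul hVt))) (hΩ.integrableOn hnc)]
    exact setIntegral_congr_fun hΩ.isOpen.measurableSet hr
  have e4 : ∫ x in Ω, cylDeriv Ω T (fun x t => (u x t - uA x t) ^ 2) (x, t) (0, 1) =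
      2 * ∫ x in Ω, (u x t - uA x t) * cylDeriv Ω T (u - uA) (x, t) (0, 1) := by
    rw [← integral_const_mul]
    refine setIntegral_congr_fun hΩ.isOpen.measurableSet fun x hx => ?_
    have hp : ((x, t) : Euc (n + 1) × ℝ) ∈ closure Ω ×ˢ Icc 0 T := ⟨subset_closure hx, htc⟩
    have := cylDeriv_comp hΩ hT hv1 (g := fun s => s ^ 2) (p := (x, t)) hp (hasDerivAt_pow 2 _)
    have h2 : (fun x t => (u x t - uA x t) ^ 2) = fun x t => ((u - uA) x t) ^ 2 := rfl
    rw [h2, this]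
    simp; ring
  rw [e4, e3, e1]
  linarith

end EnergyIdentity

/-! ### The anisotropic Gagliardo–Nirenberg inequality along forward lines. -/

section GagliardoNirenberg

open Filter Topology
open scoped ENNReal

/-- If a function vanishes eventually along a line, its powers are bounded by the integral of their
derivative. -/
theorem ofReal_abs_rpow_le_lintegral {h h' : ℝ → ℝ} {γ A b : ℝ} (hγ : 1 < γ) (hb : 0 ≤ b)
    (hd : ∀ s, 0 ≤ s → HasDerivAt h (h' s) s) (hm : Measurable h') (hA : ∀ s, |h' s| ≤ A)
    (hhm : Measurable h) (hhA : ∀ s, |h s| ≤ A) (hz : h b = 0) :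
    ENNReal.ofReal (|h 0| ^ γ) ≤ ∫⁻ s, ENNReal.ofReal (γ * |h s| ^ (γ - 1) * |h' s|) := by
  have hA0 : 0 ≤ A := (abs_nonneg _).trans (hA 0)
  have hderiv : ∀ s, 0 ≤ s →
      HasDerivAt (fun s => |h s| ^ γ) (γ * |h s| ^ (γ - 2) * h s * h' s) s := fun s hs =>
    (hasDerivAt_abs_rpow (h s) hγ).comp s (hd s hs)
  have habs : ∀ s, |γ * |h s| ^ (γ - 2) * h s * h' s| = γ * |h s| ^ (γ - 1) * |h' s| := by
    intro s
    rw [abs_mul, abs_mul, abs_mul, abs_of_pos (by linarith : 0 < γ), abs_of_nonneg (by positivity)]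
    rcases eq_or_ne (h s) 0 with h0 | h0
    · rw [h0, abs_zero, Real.zero_rpow (by linarith : γ - 1 ≠ 0)]; ring
    · have : |h s| ^ (γ - 1) = |h s| ^ (γ - 2) * |h s| := by
        rw [show γ - 1 = (γ - 2) + 1 by ring, Real.rpow_add_one (abs_ne_zero.2 h0)]
      rw [this]; ring
  have hmeas : Measurable fun s => γ * |h s| ^ (γ - 2) * h s * h' s := by
    have : Measurable fun s => |h s| := hhm.abs
    fun_prop
  have hbound : ∀ s, |γ * |h s| ^ (γ - 2) * h s * h' s| ≤ γ * A ^ (γ - 1) * A := by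
    intro s
    rw [habs]
    have h1 : |h s| ^ (γ - 1) ≤ A ^ (γ - 1) :=
      Real.rpow_le_rpow (abs_nonneg _) (hhA s) (by linarith)
    have h2 : 0 ≤ A ^ (γ - 1) := Real.rpow_nonneg hA0 _
    exact mul_le_mul (mul_le_mul_of_nonneg_left h1 (by linarith)) (hA s) (abs_nonneg _)
      (by positivity)
  have hint : IntervalIntegrable (fun s => γ * |h s| ^ (γ - 2) * h s * h' s) volume 0 b := by
    rw [intervalIntegrable_iff]
    have : IsFiniteMeasure (volume.restrict (uIoc 0 b)) := ⟨by simp [uIoc]⟩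
    exact Integrable.of_bound (C := γ * A ^ (γ - 1) * A) hmeas.aestronglyMeasurable
      (Eventually.of_forall hbound)
  have hftc := intervalIntegral.integral_eq_sub_of_hasDerivAt (a := 0) (b := b)
    (fun s hs => hderiv s (by rw [uIcc_of_le hb] at hs; exact hs.1)) hint
  rw [hz, abs_zero, Real.zero_rpow (by linarith), zero_sub] at hftc
  have h1 : |h 0| ^ γ ≤ ∫ s in Ioc 0 b, γ * |h s| ^ (γ - 1) * |h' s| := by
    calc |h 0| ^ γ = |∫ s in 0..b, γ * |h s| ^ (γ - 2) * h s * h' s| := by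
          rw [hftc, abs_neg, abs_of_nonneg (Real.rpow_nonneg (abs_nonneg _) _)]
      _ ≤ ∫ s in 0..b, |γ * |h s| ^ (γ - 2) * h s * h' s| :=
          intervalIntegral.abs_integral_le_integral_abs hb
      _ = _ := by
          rw [intervalIntegral.integral_of_le hb]
          simp_rw [habs]
  refine (ENNReal.ofReal_le_ofReal h1).trans ?_
  rw [ofReal_integral_eq_lintegral_ofReal]
  · exact setLIntegral_le_lintegral _ _
  · have := hint.abs
    rw [intervalIntegrable_iff, uIoc_of_le hb] at this
    exact this.congr (Eventually.of_forall habs)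
  · exact Eventually.of_forall fun s => by positivity

/-- Cancelling the common power I^b leaves I^(1/2) on the left, and the result is squared.
Finiteness of I is indispensable: for I = ∞ nothing can be cancelled. -/
theorem le_of_rpow_le_mul_rpow {I c : ℝ≥0∞} {a b : ℝ} (hI : I ≠ ⊤) (hb : 0 ≤ b)
    (hab : a = 1 / 2 + b) {k : ℝ≥0∞} (h : k * I ^ a ≤ c * I ^ b) : k ^ (2 : ℝ) * I ≤ c ^ (2 : ℝ) := by
  rcases eq_or_ne I 0 with rfl | h0
  · simp
  have h1 : k * I ^ (1 / 2 : ℝ) ≤ c := by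
    rw [hab, ENNReal.rpow_add _ _ h0 hI, ← mul_assoc] at h
    exact (ENNReal.mul_le_mul_iff_left (ENNReal.rpow_pos (pos_iff_ne_zero.2 h0) hI).ne'
      (ENNReal.rpow_ne_top_of_nonneg hb hI)).1 h
  calc k ^ (2 : ℝ) * I = (k * I ^ (1 / 2 : ℝ)) ^ (2 : ℝ) := by
        rw [ENNReal.mul_rpow_of_nonneg _ _ (by norm_num), ← ENNReal.rpow_mul]; norm_num
    _ ≤ c ^ (2 : ℝ) := ENNReal.rpow_le_rpow h1 (by norm_num)

/-- An anisotropic Gagliardo-Nirenberg inequality for functions whose forward coordinate lines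
starting in the support can be followed until the function vanishes. -/
theorem lintegral_rpow_le_of_forward_lines {n : ℕ} (hn : 1 ≤ n) {D : Set (Fin (n + 1) → ℝ)}
    {w : (Fin (n + 1) → ℝ) → ℝ} {g : Fin (n + 1) → (Fin (n + 1) → ℝ) → ℝ} {A r : ℝ}
    (hw : Measurable w) (hg : ∀ j, Measurable (g j)) (hwA : ∀ q, |w q| ≤ A)
    (hgA : ∀ j q, |g j q| ≤ A) (hr : ∀ q, r < ‖q‖ → w q = 0) (hD : ∀ q, q ∉ D → w q = 0)
    (hline : ∀ q ∈ D, ∀ j, ∀ τ : ℝ, 0 ≤ τ → HasDerivAt (fun s : ℝ => w (q + s • Pi.single j 1))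
      (g j (q + τ • Pi.single j 1)) τ)
    {a : Fin (n + 1) → ℝ} (ha : ∀ j, 0 < a j) :
    (∏ j, ENNReal.ofReal (a j)) ^ (2 / (n + 1 : ℝ)) *
        ∫⁻ q, ENNReal.ofReal |w q| ^ (2 + 4 / (n + 1 : ℝ)) ≤
      ENNReal.ofReal (2 * (n + 3) * n / (n + 1) ^ 2) ^ (2 : ℝ) *
        (∫⁻ q, ENNReal.ofReal |w q| ^ (2 : ℝ)) ^ (2 / (n + 1 : ℝ)) *
        ∫⁻ q, ENNReal.ofReal (∑ j, a j * |g j q|) ^ (2 : ℝ) := by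
  have hn' : (1 : ℝ) ≤ n := by exact_mod_cast hn
  have hn0 : (0 : ℝ) < n := by linarith
  have hN0 : (0 : ℝ) < n + 1 := by linarith
  -- With this value γ (n + 1)/n = 2 + 4/(n + 1), the exponent that results from multiplying the
  -- one-dimensional bounds over all n + 1 directions.
  set γ : ℝ := 2 * (n + 3) * n / (n + 1) ^ 2 with hγ
  have hγ2 : 2 ≤ γ := by
    rw [hγ, le_div_iff₀ (by positivity)]; nlinarith
  set W : (Fin (n + 1) → ℝ) → ℝ≥0∞ := fun q => ENNReal.ofReal |w q| with hW
  set G : (Fin (n + 1) → ℝ) → ℝ≥0∞ := fun q => ENNReal.ofReal (∑ j, a j * |g j q|) with hG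
  have hWm : Measurable W := hw.abs.ennreal_ofReal
  have hGm : Measurable G := by
    refine Measurable.ennreal_ofReal ?_
    exact Finset.measurable_fun_sum _ fun j _ => (hg j).abs.const_mul (a j)
  set F : (Fin (n + 1) → ℝ) → ℝ≥0∞ := fun q => ENNReal.ofReal γ * (W q ^ (γ - 1) * G q) with hF
  have hFm : Measurable F := ((hWm.pow_const _).mul hGm).const_mul _
  set I : ℝ≥0∞ := ∫⁻ q, W q ^ (2 + 4 / (n + 1 : ℝ)) with hI
  have hupd : ∀ (q : Fin (n + 1) → ℝ) j (s : ℝ), q + s • Pi.single j 1 = Function.update q j (q j + s) := by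
    intro q j s
    ext i
    by_cases h : i = j
    · subst h; simp
    · simp [h]
  have hpt : ∀ q j, ENNReal.ofReal (a j) * W q ^ γ ≤ ∫⁻ s, F (Function.update q j s) := by
    intro q j
    by_cases hq : q ∈ D
    · have hcont : Measurable fun s : ℝ => Function.update q j (q j + s) :=
        (measurable_update q (a := j)).comp (measurable_const_add (q j))
      have hmeas1 : Measurable fun s : ℝ => w (q + s • Pi.single j 1) := by
        simp_rw [hupd]; exact hw.comp hcont
      have hmeas2 : Measurable fun s : ℝ => g j (q + s • Pi.single j 1) := by
        simp_rw [hupd]; exact (hg j).comp hcont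
      -- A step of this length makes the j-th coordinate exceed r, so the endpoint is beyond the
      -- ball outside which w vanishes.
      have hb : w (q + (|r| + |q j| + 1) • Pi.single j 1) = 0 := by
        apply hr
        have h1 : ‖(q + (|r| + |q j| + 1) • (Pi.single j 1 : Fin (n + 1) → ℝ)) j‖ ≤ _ := norm_le_pi_norm _ j
        refine lt_of_lt_of_le ?_ h1
        simp only [Pi.add_apply, Pi.smul_apply, Pi.single_eq_same, smul_eq_mul, mul_one,
          Real.norm_eq_abs]
        have h2 := le_abs_self r
        have h3 := neg_abs_le (q j)
        have h4 := le_abs_self (q j + (|r| + |q j| + 1))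
        linarith
      have h := ofReal_abs_rpow_le_lintegral (h := fun s : ℝ => w (q + s • Pi.single j 1))
        (h' := fun s : ℝ => g j (q + s • Pi.single j 1)) (by linarith : 1 < γ)
        (by positivity : 0 ≤ |r| + |q j| + 1) (fun s hs => hline q hq j s hs) hmeas2
        (fun s => hgA j _) hmeas1 (fun s => hwA _) hb
      simp only [zero_smul, add_zero] at h
      have h5 : W q ^ γ = ENNReal.ofReal (|w q| ^ γ) := by
        rw [hW, ENNReal.ofReal_rpow_of_nonneg (abs_nonneg _) (by linarith)]
      rw [h5]
      calc ENNReal.ofReal (a j) * ENNReal.ofReal (|w q| ^ γ)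
          ≤ ENNReal.ofReal (a j) * ∫⁻ s : ℝ, ENNReal.ofReal (γ * |w (q + s • Pi.single j 1)| ^ (γ - 1) *
              |g j (q + s • Pi.single j 1)|) := by gcongr
        _ = ∫⁻ s : ℝ, ENNReal.ofReal (a j) * ENNReal.ofReal (γ * |w (q + s • Pi.single j 1)| ^ (γ - 1) *
              |g j (q + s • Pi.single j 1)|) := (lintegral_const_mul' _ _ ENNReal.ofReal_ne_top).symm
        _ ≤ ∫⁻ s, F (Function.update q j (q j + s)) := by
            refine lintegral_mono fun s => ?_
            dsimp only
            rw [← hupd]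
            simp only [hF, hW, hG]
            rw [ENNReal.ofReal_rpow_of_nonneg (abs_nonneg _) (by linarith),
              ← ENNReal.ofReal_mul (ha j).le, ← ENNReal.ofReal_mul (by positivity),
              ← ENNReal.ofReal_mul (by linarith)]
            refine ENNReal.ofReal_le_ofReal ?_
            have h6 : a j * |g j (q + s • Pi.single j 1)| ≤ ∑ i, a i * |g i (q + s • Pi.single j 1)| :=
              Finset.single_le_sum (f := fun i => a i * |g i (q + s • Pi.single j 1)|)
                (fun i _ => mul_nonneg (ha i).le (abs_nonneg _)) (Finset.mem_univ j)
            have h7 : 0 ≤ γ * |w (q + s • Pi.single j 1)| ^ (γ - 1) := by positivity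
            calc _ = (γ * |w (q + s • Pi.single j 1)| ^ (γ - 1)) *
                  (a j * |g j (q + s • Pi.single j 1)|) := by ring
              _ ≤ _ := mul_le_mul_of_nonneg_left h6 h7
              _ = _ := by ring
        _ = ∫⁻ s, F (Function.update q j s) :=
            lintegral_add_left_eq_self (fun s => F (Function.update q j s)) (q j)
    · have : W q = 0 := by simp [hW, hD q hq]
      rw [this, ENNReal.zero_rpow_of_pos (by linarith), mul_zero]
      exact zero_le
  have hconj : (Fintype.card (Fin (n + 1)) : ℝ).HolderConjugate ((n + 1) / n) := by
    rw [Real.holderConjugate_iff]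
    simp only [Fintype.card_fin, Nat.cast_add, Nat.cast_one]
    refine ⟨by linarith, ?_⟩
    field_simp
    ring
  -- Gagliardo's product inequality: the integral of ∏ⱼ (∫ F along the j-th line)^(1/n) is at most
  -- (∫F)^((n+1)/n). The weights aⱼ enter only through their product.
  have hprod := lintegral_prod_lintegral_pow_le (A := fun _ : Fin (n + 1) => ℝ) (fun _ => volume)
    hconj hFm
  rw [← volume_pi] at hprod
  have hPI : (∏ j, ENNReal.ofReal (a j)) ^ (1 / (n : ℝ)) * I ≤ (∫⁻ q, F q) ^ ((n + 1 : ℝ) / n) := by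
    refine le_trans ?_ hprod
    rw [hI, ← lintegral_const_mul _ (hWm.pow_const _)]
    refine lintegral_mono fun q => ?_
    dsimp only
    simp only [Fintype.card_fin, Nat.cast_add, Nat.cast_one, add_sub_cancel_right]
    calc _ = ∏ j, (ENNReal.ofReal (a j) * W q ^ γ) ^ (1 / (n : ℝ)) := by
          rw [ENNReal.prod_rpow_of_nonneg (by positivity), Finset.prod_mul_distrib,
            ENNReal.mul_rpow_of_nonneg _ _ (by positivity)]
          congr 1
          rw [Finset.prod_const, Finset.card_univ, Fintype.card_fin, ← ENNReal.rpow_natCast,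
            ← ENNReal.rpow_mul, ← ENNReal.rpow_mul]
          congr 1
          rw [hγ]; push_cast; field_simp; ring
      _ ≤ _ := Finset.prod_le_prod' fun j _ => ENNReal.rpow_le_rpow (hpt q j) (by positivity)
  have hPI2 : (∏ j, ENNReal.ofReal (a j)) ^ (1 / (n + 1 : ℝ)) * I ^ (n / (n + 1 : ℝ)) ≤
      ∫⁻ q, F q := by
    have := ENNReal.rpow_le_rpow hPI (by positivity : 0 ≤ n / (n + 1 : ℝ))
    rw [ENNReal.mul_rpow_of_nonneg _ _ (by positivity), ← ENNReal.rpow_mul, ← ENNReal.rpow_mul] at this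
    have e1 : 1 / (n : ℝ) * (n / (n + 1)) = 1 / (n + 1) := by field_simp
    have e2 : ((n : ℝ) + 1) / n * (n / (n + 1)) = 1 := by field_simp
    rwa [e1, e2, ENNReal.rpow_one] at this
  -- Cauchy–Schwarz separates the gradient from the power of w.
  have hHol : ∫⁻ q, F q ≤ ENNReal.ofReal γ * ((∫⁻ q, W q ^ (2 * γ - 2)) ^ (1 / 2 : ℝ) *
      (∫⁻ q, G q ^ (2 : ℝ)) ^ (1 / 2 : ℝ)) := by
    rw [hF]
    refine (lintegral_const_mul (ENNReal.ofReal γ) ((hWm.pow_const (γ - 1)).mul hGm)).le.trans ?_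
    gcongr
    have := ENNReal.lintegral_mul_norm_pow_le (μ := volume) (f := fun q => W q ^ (2 * γ - 2))
      (g := fun q => G q ^ (2 : ℝ)) (hWm.pow_const _).aemeasurable (hGm.pow_const _).aemeasurable
      (p := 1 / 2) (q := 1 / 2) (by norm_num) (by norm_num) (by norm_num)
    refine le_trans (le_of_eq ?_) this
    refine lintegral_congr fun q => ?_
    rw [← ENNReal.rpow_mul, ← ENNReal.rpow_mul]
    norm_num
    congr 2; ring
  -- Interpolation between the exponents 2 and 2 + 4/(n + 1), with Hölder weights 2/(n + 1) and (n -
  -- 1)/(n + 1). The factor of I produced here is moved back to the left-hand side.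
  have hint : ∫⁻ q, W q ^ (2 * γ - 2) ≤ (∫⁻ q, W q ^ (2 : ℝ)) ^ (2 / (n + 1 : ℝ)) *
      I ^ ((n - 1) / (n + 1 : ℝ)) := by
    have := ENNReal.lintegral_mul_norm_pow_le (μ := volume) (f := fun q => W q ^ (2 : ℝ))
      (g := fun q => W q ^ (2 + 4 / (n + 1 : ℝ))) (hWm.pow_const _).aemeasurable
      (hWm.pow_const _).aemeasurable
      (p := 2 / (n + 1 : ℝ)) (q := (n - 1) / (n + 1 : ℝ)) (by positivity)
      (div_nonneg (by linarith) hN0.le) (by field_simp; ring)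
    refine le_trans (le_of_eq ?_) this
    refine lintegral_congr fun q => ?_
    rw [← ENNReal.rpow_mul, ← ENNReal.rpow_mul,
      ← ENNReal.rpow_add_of_nonneg _ _ (by positivity)
        (mul_nonneg (by positivity) (div_nonneg (by linarith) hN0.le))]
    congr 1
    rw [hγ]; field_simp; ring
  -- Boundedness of w and of its support allows this last cancellation.
  have hItop : I ≠ ⊤ := by
    have h1 : I ≤ ∫⁻ q in Metric.closedBall (0 : Fin (n + 1) → ℝ) r,
        ENNReal.ofReal A ^ (2 + 4 / (n + 1 : ℝ)) := by
      rw [hI, ← lintegral_indicator Metric.isClosed_closedBall.measurableSet]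
      refine lintegral_mono fun q => ?_
      by_cases hq : q ∈ Metric.closedBall (0 : Fin (n + 1) → ℝ) r
      · rw [indicator_of_mem hq]
        exact ENNReal.rpow_le_rpow (ENNReal.ofReal_le_ofReal (hwA q)) (by positivity)
      · rw [indicator_of_notMem hq]
        have : w q = 0 := hr q (by simpa using hq)
        simp only [hW, this, abs_zero, ENNReal.ofReal_zero]
        rw [ENNReal.zero_rpow_of_pos (by positivity)]
    refine ne_top_of_le_ne_top ?_ h1
    rw [setLIntegral_const]
    exact ENNReal.mul_ne_top (ENNReal.rpow_ne_top_of_nonneg (by positivity) ENNReal.ofReal_ne_top)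
      measure_closedBall_lt_top.ne
  set Y := ∫⁻ q, W q ^ (2 : ℝ) with hY
  set Z := ∫⁻ q, G q ^ (2 : ℝ) with hZ
  have hfin : (∏ j, ENNReal.ofReal (a j)) ^ (1 / (n + 1 : ℝ)) * I ^ (n / (n + 1 : ℝ)) ≤
      (ENNReal.ofReal γ * Y ^ (1 / (n + 1 : ℝ)) * Z ^ (1 / 2 : ℝ)) *
        I ^ ((n - 1) / (2 * (n + 1)) : ℝ) := by
    refine hPI2.trans (hHol.trans ?_)
    calc _ ≤ ENNReal.ofReal γ * ((Y ^ (2 / (n + 1 : ℝ)) * I ^ ((n - 1) / (n + 1 : ℝ))) ^ (1 / 2 : ℝ) *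
        Z ^ (1 / 2 : ℝ)) := by gcongr
      _ = _ := by
        rw [ENNReal.mul_rpow_of_nonneg _ _ (by norm_num), ← ENNReal.rpow_mul, ← ENNReal.rpow_mul]
        have e1 : 2 / (n + 1 : ℝ) * (1 / 2) = 1 / (n + 1) := by field_simp
        have e2 : ((n : ℝ) - 1) / (n + 1) * (1 / 2) = (n - 1) / (2 * (n + 1)) := by field_simp
        rw [e1, e2]; ring
  have := le_of_rpow_le_mul_rpow hItop (div_nonneg (by linarith) (by positivity))
    (by field_simp; ring) hfin
  rw [ENNReal.mul_rpow_of_nonneg _ _ (by norm_num), ENNReal.mul_rpow_of_nonneg _ _ (by norm_num),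
    ← ENNReal.rpow_mul, ← ENNReal.rpow_mul, ← ENNReal.rpow_mul] at this
  have e1 : 1 / (n + 1 : ℝ) * 2 = 2 / (n + 1) := by ring
  have e2 : (1 / 2 : ℝ) * 2 = 1 := by norm_num
  rwa [e1, e2, ENNReal.rpow_one] at this

end GagliardoNirenberg

/-! ### Forward charts and the inequality localized in one chart. -/

section GagliardoNirenberg

open Filter Topology
open scoped ENNReal

/-- `lintegral_rpow_le_of_forward_lines` in Euclidean space. -/
theorem lintegral_rpow_le_of_forward_lines' {n : ℕ} (hn : 1 ≤ n) {D : Set (Euc (n + 1))}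
    {w : Euc (n + 1) → ℝ} {g : Fin (n + 1) → Euc (n + 1) → ℝ} {A r : ℝ}
    (hw : Measurable w) (hg : ∀ j, Measurable (g j)) (hwA : ∀ q, |w q| ≤ A)
    (hgA : ∀ j q, |g j q| ≤ A) (hr : ∀ q, r < ‖q‖ → w q = 0) (hD : ∀ q, q ∉ D → w q = 0)
    (hline : ∀ q ∈ D, ∀ j, ∀ τ : ℝ, 0 ≤ τ →
      HasDerivAt (fun s : ℝ => w (q + s • EuclideanSpace.single j 1))
      (g j (q + τ • EuclideanSpace.single j 1)) τ)
    {a : Fin (n + 1) → ℝ} (ha : ∀ j, 0 < a j) :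
    (∏ j, ENNReal.ofReal (a j)) ^ (2 / (n + 1 : ℝ)) *
        ∫⁻ q, ENNReal.ofReal |w q| ^ (2 + 4 / (n + 1 : ℝ)) ≤
      ENNReal.ofReal (2 * (n + 3) * n / (n + 1) ^ 2) ^ (2 : ℝ) *
        (∫⁻ q, ENNReal.ofReal |w q| ^ (2 : ℝ)) ^ (2 / (n + 1 : ℝ)) *
        ∫⁻ q, ENNReal.ofReal (∑ j, a j * |g j q|) ^ (2 : ℝ) := by
  have hmp := PiLp.volume_preserving_toLp (Fin (n + 1))
  have h := lintegral_rpow_le_of_forward_lines hn (D := WithLp.toLp 2 ⁻¹' D)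
    (w := fun q => w (WithLp.toLp 2 q)) (g := fun j q => g j (WithLp.toLp 2 q)) (A := A) (r := r)
    (hw.comp hmp.measurable) (fun j => (hg j).comp hmp.measurable) (fun q => hwA _)
    (fun j q => hgA j _) (fun q hq => hr _ (hq.trans_le ?_)) (fun q hq => hD _ hq)
    (fun q hq j τ hτ => ?_) ha
  · have hsum : Measurable fun q : Euc (n + 1) => ∑ j, a j * |g j q| :=
      Finset.measurable_fun_sum _ fun j _ => (hg j).abs.const_mul (a j)
    rwa [hmp.lintegral_comp (f := fun q => ENNReal.ofReal |w q| ^ (2 + 4 / (n + 1 : ℝ)))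
        (hw.abs.ennreal_ofReal.pow_const _),
      hmp.lintegral_comp (f := fun q => ENNReal.ofReal |w q| ^ (2 : ℝ))
        (hw.abs.ennreal_ofReal.pow_const _),
      hmp.lintegral_comp (f := fun q => ENNReal.ofReal (∑ j, a j * |g j q|) ^ (2 : ℝ))
        (hsum.ennreal_ofReal.pow_const _)] at h
  · refine (pi_norm_le_iff_of_nonneg (norm_nonneg _)).2 fun i => ?_
    exact PiLp.norm_apply_le (WithLp.toLp 2 q) i
  · exact hline (WithLp.toLp 2 q) hq j τ hτ

/-- A chart in which the forward coordinate lines starting in `Ω` stay in `Ω`. -/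
structure IsForwardChart {N : ℕ} (Ω B V : Set (Euc N)) (Ψ Φ : Euc N → Euc N) (L : ℝ) : Prop where
  isOpen : IsOpen B
  isBounded : Bornology.IsBounded B
  convex : Convex ℝ B
  differentiableAt : ∀ q ∈ B, DifferentiableAt ℝ Ψ q
  injOn : InjOn Ψ B
  one_le_det : ∀ q ∈ B, 1 ≤ L * |(fderiv ℝ Ψ q).det|
  det_le : ∀ q ∈ B, |(fderiv ℝ Ψ q).det| ≤ L
  norm_le : ∀ q ∈ B, ‖fderiv ℝ Ψ q‖ ≤ L
  continuousOn : ContinuousOn Φ V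
  mapsTo : MapsTo Φ V B
  right_inv : ∀ x ∈ V, Ψ (Φ x) = x
  forward : ∀ q ∈ B, Ψ q ∈ Ω → ∀ j, ∀ τ : ℝ, 0 ≤ τ → q + τ • EuclideanSpace.single j 1 ∈ B →
    Ψ (q + τ • EuclideanSpace.single j 1) ∈ Ω

/-- The local anisotropic Gagliardo-Nirenberg inequality in a forward chart. -/
theorem IsForwardChart.lintegral_rpow_le {n : ℕ} (hn : 1 ≤ n) {Ω B V : Set (Euc (n + 1))}
    {Ψ Φ : Euc (n + 1) → Euc (n + 1)} {L : ℝ} (h : IsForwardChart Ω B V Ψ Φ L) (hL : 0 < L)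
    (hΩ : IsOpen Ω) {ψ χ E : Euc (n + 1) → ℝ} {A L' : ℝ} (hψ : ContDiffOn ℝ 1 ψ Ω)
    (hψA : ∀ x ∈ Ω, |ψ x| ≤ A) (hψA' : ∀ x ∈ Ω, ‖fderiv ℝ ψ x‖ ≤ A) (hχ : ContDiff ℝ 1 χ)
    (hχc : HasCompactSupport χ) (hχV : tsupport χ ⊆ V) (hχ1 : ∀ x, |χ x| ≤ 1)
    (hχ' : ∀ x, ‖fderiv ℝ χ x‖ ≤ L') {a : Fin (n + 1) → ℝ} (ha : ∀ j, 0 < a j)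
    (hE : ∀ q ∈ B, Ψ q ∈ Ω →
      ∑ j, a j * |fderiv ℝ ψ (Ψ q) (fderiv ℝ Ψ q (EuclideanSpace.single j 1))| ≤ E (Ψ q)) :
    (∏ j, ENNReal.ofReal (a j)) ^ (2 / (n + 1 : ℝ)) *
        ∫⁻ x in Ω, ENNReal.ofReal |χ x * ψ x| ^ (2 + 4 / (n + 1 : ℝ)) ≤
      ENNReal.ofReal L * (ENNReal.ofReal (2 * (n + 3) * n / (n + 1) ^ 2) ^ (2 : ℝ) *
        (ENNReal.ofReal L * ∫⁻ x in Ω, ENNReal.ofReal |ψ x| ^ (2 : ℝ)) ^ (2 / (n + 1 : ℝ)) *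
        (ENNReal.ofReal L *
          ∫⁻ x in Ω, ENNReal.ofReal (E x + (∑ j, a j) * (L' * L) * |ψ x|) ^ (2 : ℝ))) := by
  classical
  have hA0 : 0 ≤ |A| := abs_nonneg A
  have hL'0 : 0 ≤ L' := (norm_nonneg _).trans (hχ' 0)
  have hΨc : ContinuousOn Ψ B := fun q hq => (h.differentiableAt q hq).continuousAt.continuousWithinAt
  -- The function is extended by zero from D. It may jump where the chart meets ∂Ω, but forward
  -- lines starting in D never cross that part, so it is differentiable along them.
  set D := B ∩ Ψ ⁻¹' Ω with hDdef
  have hDo : IsOpen D := hΨc.isOpen_inter_preimage h.isOpen hΩ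
  set w₀ : Euc (n + 1) → ℝ := fun q => χ (Ψ q) * ψ (Ψ q) with hw₀
  set w : Euc (n + 1) → ℝ := D.indicator w₀ with hw
  set g : Fin (n + 1) → Euc (n + 1) → ℝ := fun j =>
    D.indicator fun q => fderiv ℝ w q (EuclideanSpace.single j 1) with hg
  -- derivative of `w` in `D`
  have hwd : ∀ q ∈ D, HasFDerivAt w
      ((χ (Ψ q) • fderiv ℝ ψ (Ψ q) + ψ (Ψ q) • fderiv ℝ χ (Ψ q)).comp (fderiv ℝ Ψ q)) q := by
    intro q hq
    have h1 : HasFDerivAt (fun x => χ x * ψ x)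
        (χ (Ψ q) • fderiv ℝ ψ (Ψ q) + ψ (Ψ q) • fderiv ℝ χ (Ψ q)) (Ψ q) :=
      ((hχ.differentiable one_ne_zero) (Ψ q)).hasFDerivAt.mul
        ((hψ.contDiffAt (hΩ.mem_nhds hq.2)).differentiableAt one_ne_zero).hasFDerivAt
    have h2 := h1.comp q (h.differentiableAt q hq.1).hasFDerivAt
    refine h2.congr_of_eventuallyEq ?_
    filter_upwards [hDo.mem_nhds hq] with p hp
    rw [hw, indicator_of_mem hp]; rfl
  have hwc : ContinuousOn w₀ D := by
    refine ((hχ.continuous.comp_continuousOn hΨc).mono inter_subset_left).mul ?_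
    exact hψ.continuousOn.comp (hΨc.mono inter_subset_left) fun q hq => hq.2
  have hwm : Measurable w := by
    rw [hw, ← piecewise_eq_indicator]
    exact hwc.measurable_piecewise continuousOn_const hDo.measurableSet
  have hgm : ∀ j, Measurable (g j) := fun j =>
    (measurable_fderiv_apply_const ℝ w _).indicator hDo.measurableSet
  have hsingle : ∀ j : Fin (n + 1), ‖EuclideanSpace.single j (1 : ℝ)‖ = 1 := by simp
  have hgq : ∀ j, ∀ q ∈ D, g j q = χ (Ψ q) * fderiv ℝ ψ (Ψ q)
      (fderiv ℝ Ψ q (EuclideanSpace.single j 1)) + ψ (Ψ q) * fderiv ℝ χ (Ψ q)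
      (fderiv ℝ Ψ q (EuclideanSpace.single j 1)) := by
    intro j q hq
    rw [hg]
    simp only
    rw [indicator_of_mem hq, (hwd q hq).fderiv]; rfl
  have hvec : ∀ j, ∀ q ∈ B, ‖fderiv ℝ Ψ q (EuclideanSpace.single j 1)‖ ≤ L := by
    intro j q hq
    refine ((fderiv ℝ Ψ q).le_opNorm _).trans ?_
    rw [hsingle, mul_one]; exact h.norm_le q hq
  have hgb : ∀ j, ∀ q ∈ D, |g j q| ≤ |fderiv ℝ ψ (Ψ q)
      (fderiv ℝ Ψ q (EuclideanSpace.single j 1))| + (L' * L) * |ψ (Ψ q)| := by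
    intro j q hq
    rw [hgq j q hq]
    refine (abs_add_le _ _).trans (add_le_add ?_ ?_)
    · rw [abs_mul]
      exact mul_le_of_le_one_left (abs_nonneg _) (hχ1 _)
    · rw [abs_mul, mul_comm]
      refine mul_le_mul_of_nonneg_right ?_ (abs_nonneg _)
      rw [← Real.norm_eq_abs]
      refine ((fderiv ℝ χ (Ψ q)).le_opNorm _).trans ?_
      exact mul_le_mul (hχ' _) (hvec j q hq.1) (norm_nonneg _) hL'0
  set M := |A| + |A| * L + L' * L * |A| with hM
  have hM1 : |A| ≤ M := by
    rw [hM]; have := mul_nonneg hA0 hL.le; have := mul_nonneg (mul_nonneg hL'0 hL.le) hA0; linarith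
  have hM0 : 0 ≤ M := hA0.trans hM1
  have hwM : ∀ q, |w q| ≤ M := by
    intro q
    by_cases hq : q ∈ D
    · rw [hw, indicator_of_mem hq, hw₀]
      simp only
      rw [abs_mul]
      refine (mul_le_of_le_one_left (abs_nonneg _) (hχ1 _)).trans ?_
      exact (hψA _ hq.2).trans ((le_abs_self A).trans hM1)
    · rw [hw, indicator_of_notMem hq, abs_zero]; exact hM0
  have hgM : ∀ j q, |g j q| ≤ M := by
    intro j q
    by_cases hq : q ∈ D
    · refine (hgb j q hq).trans ?_
      have h1 : |fderiv ℝ ψ (Ψ q) (fderiv ℝ Ψ q (EuclideanSpace.single j 1))| ≤ |A| * L := by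
        rw [← Real.norm_eq_abs]
        refine ((fderiv ℝ ψ (Ψ q)).le_opNorm _).trans ?_
        exact mul_le_mul ((hψA' _ hq.2).trans (le_abs_self A)) (hvec j q hq.1) (norm_nonneg _) hA0
      have h2 : L' * L * |ψ (Ψ q)| ≤ L' * L * |A| :=
        mul_le_mul_of_nonneg_left ((hψA _ hq.2).trans (le_abs_self A)) (by positivity)
      rw [hM]; linarith
    · simp only [hg]
      rw [indicator_of_notMem hq, abs_zero]; exact hM0
  obtain ⟨r, hr⟩ := h.isBounded.exists_norm_le
  have hwr : ∀ q, r < ‖q‖ → w q = 0 := by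
    intro q hq
    have : q ∉ D := fun hqD => absurd (hr q hqD.1) (not_le.2 hq)
    rw [hw, indicator_of_notMem this]
  -- the support of `w`
  have hK : IsCompact (tsupport χ) := hχc
  set S := Φ '' tsupport χ with hS
  have hSc : IsClosed S := (hK.image_of_continuousOn (h.continuousOn.mono hχV)).isClosed
  have hSw : ∀ q, q ∉ S → w q = 0 := by
    intro q hq
    by_cases hqD : q ∈ D
    · rw [hw, indicator_of_mem hqD, hw₀]
      have : χ (Ψ q) = 0 := by
        by_contra h0
        have h1 : Ψ q ∈ tsupport χ := subset_tsupport χ h0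
        refine hq ⟨Ψ q, h1, ?_⟩
        exact h.injOn (h.mapsTo (hχV h1)) hqD.1 (h.right_inv _ (hχV h1))
      simp [this]
    · rw [hw, indicator_of_notMem hqD]
  have hSB : S ⊆ B := by
    rintro _ ⟨x, hx, rfl⟩; exact h.mapsTo (hχV hx)
  have hline : ∀ q ∈ D, ∀ j, ∀ τ : ℝ, 0 ≤ τ →
      HasDerivAt (fun s : ℝ => w (q + s • EuclideanSpace.single j 1))
      (g j (q + τ • EuclideanSpace.single j 1)) τ := by
    intro q hq j τ hτ
    have hl : HasDerivAt (fun s : ℝ => q + s • EuclideanSpace.single j (1 : ℝ))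
        (EuclideanSpace.single j 1) τ := by
      simpa using ((hasDerivAt_id τ).smul_const (EuclideanSpace.single j (1 : ℝ))).const_add q
    by_cases hB : q + τ • EuclideanSpace.single j (1 : ℝ) ∈ B
    · have hD' : q + τ • EuclideanSpace.single j (1 : ℝ) ∈ D :=
        ⟨hB, h.forward q hq.1 hq.2 j τ hτ hB⟩
      have h1 := (hwd _ hD').differentiableAt.hasFDerivAt
      have h2 := h1.comp_hasDerivAt τ hl
      simp only [hg]
      rw [indicator_of_mem hD']
      exact h2
    · have hD' : q + τ • EuclideanSpace.single j (1 : ℝ) ∉ D := fun hh => hB hh.1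
      simp only [hg]
      rw [indicator_of_notMem hD']
      -- A point of the line outside B is outside the closed set S ⊆ B carrying the support of w.
      -- The function is therefore zero near that parameter, with derivative zero.
      have h1 : ∀ᶠ s in 𝓝 τ, q + s • EuclideanSpace.single j (1 : ℝ) ∈ Sᶜ :=
        hl.continuousAt (hSc.isOpen_compl.mem_nhds fun hh => hB (hSB hh))
      refine (hasDerivAt_const τ (0 : ℝ)).congr_of_eventuallyEq ?_
      filter_upwards [h1] with s hs using hSw _ hs
  have hmain := lintegral_rpow_le_of_forward_lines' hn hwm hgm hwM hgM hwr
    (fun q hq => by rw [hw, indicator_of_notMem hq]) hline ha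
  -- change of variables
  have hcov : ∀ F : Euc (n + 1) → ℝ≥0∞, ∫⁻ x in Ψ '' D, F x =
      ∫⁻ q in D, ENNReal.ofReal |(fderiv ℝ Ψ q).det| * F (Ψ q) := fun F =>
    lintegral_image_eq_lintegral_abs_det_fderiv_mul volume hDo.measurableSet
      (fun q hq => (h.differentiableAt q hq.1).hasFDerivAt.hasFDerivWithinAt)
      (h.injOn.mono inter_subset_left) F
  have hup : ∀ F : Euc (n + 1) → ℝ≥0∞, ∫⁻ q in D, F (Ψ q) ≤ ENNReal.ofReal L * ∫⁻ x in Ω, F x := by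
    intro F
    have h1 : ∫⁻ x in Ψ '' D, F x ≤ ∫⁻ x in Ω, F x :=
      lintegral_mono_set (by rintro _ ⟨q, hq, rfl⟩; exact hq.2)
    refine le_trans ?_ (mul_le_mul_right h1 _)
    rw [hcov, ← lintegral_const_mul' _ _ ENNReal.ofReal_ne_top]
    refine setLIntegral_mono' hDo.measurableSet fun q hq => ?_
    rw [← mul_assoc, ← ENNReal.ofReal_mul hL.le]
    calc F (Ψ q) = 1 * F (Ψ q) := (one_mul _).symm
      _ ≤ _ := by
        gcongr
        rw [← ENNReal.ofReal_one]
        exact ENNReal.ofReal_le_ofReal (h.one_le_det q hq.1)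
  have hlow : ∫⁻ x in Ω, ENNReal.ofReal |χ x * ψ x| ^ (2 + 4 / (n + 1 : ℝ)) ≤
      ENNReal.ofReal L * ∫⁻ q, ENNReal.ofReal |w q| ^ (2 + 4 / (n + 1 : ℝ)) := by
    have hp : 0 < 2 + 4 / (n + 1 : ℝ) := by positivity
    have h1 : ∫⁻ x in Ω, ENNReal.ofReal |χ x * ψ x| ^ (2 + 4 / (n + 1 : ℝ)) ≤
        ∫⁻ x in Ψ '' D, ENNReal.ofReal |χ x * ψ x| ^ (2 + 4 / (n + 1 : ℝ)) := by
      calc _ ≤ ∫⁻ x in Ω, (Ψ '' D).indicator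
            (fun x => ENNReal.ofReal |χ x * ψ x| ^ (2 + 4 / (n + 1 : ℝ))) x :=
            setLIntegral_mono' hΩ.measurableSet fun x hx => ?_
        _ ≤ ∫⁻ x, (Ψ '' D).indicator
            (fun x => ENNReal.ofReal |χ x * ψ x| ^ (2 + 4 / (n + 1 : ℝ))) x :=
            setLIntegral_le_lintegral _ _
        _ ≤ _ := lintegral_indicator_le _ _
      by_cases hxD : x ∈ Ψ '' D
      · rw [indicator_of_mem hxD]
      have : χ x = 0 := by
        by_contra h0
        have hxV := hχV (subset_tsupport χ h0)
        refine hxD ⟨Φ x, ⟨h.mapsTo hxV, ?_⟩, h.right_inv x hxV⟩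
        rw [mem_preimage, h.right_inv x hxV]; exact hx
      rw [this, zero_mul, abs_zero, ENNReal.ofReal_zero, ENNReal.zero_rpow_of_pos hp]
      exact zero_le
    refine h1.trans ?_
    rw [hcov, ← lintegral_const_mul' _ _ ENNReal.ofReal_ne_top,
      ← lintegral_indicator hDo.measurableSet]
    refine lintegral_mono fun q => ?_
    by_cases hq : q ∈ D
    · rw [indicator_of_mem hq, hw, indicator_of_mem hq]
      gcongr
      exact h.det_le q hq.1
    · rw [indicator_of_notMem hq]; exact zero_le
  have hY : ∫⁻ q, ENNReal.ofReal |w q| ^ (2 : ℝ) ≤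
      ENNReal.ofReal L * ∫⁻ x in Ω, ENNReal.ofReal |ψ x| ^ (2 : ℝ) := by
    refine le_trans ?_ (hup fun x => ENNReal.ofReal |ψ x| ^ (2 : ℝ))
    rw [← lintegral_indicator hDo.measurableSet]
    refine lintegral_mono fun q => ?_
    by_cases hq : q ∈ D
    · simp only [hw, indicator_of_mem hq, hw₀]
      refine ENNReal.rpow_le_rpow (ENNReal.ofReal_le_ofReal ?_) zero_le_two
      rw [abs_mul]
      exact mul_le_of_le_one_left (abs_nonneg _) (hχ1 _)
    · simp only [hw, indicator_of_notMem hq]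
      simp
  have hZ : ∫⁻ q, ENNReal.ofReal (∑ j, a j * |g j q|) ^ (2 : ℝ) ≤ ENNReal.ofReal L *
      ∫⁻ x in Ω, ENNReal.ofReal (E x + (∑ j, a j) * (L' * L) * |ψ x|) ^ (2 : ℝ) := by
    refine le_trans ?_ (hup fun x => ENNReal.ofReal (E x + (∑ j, a j) * (L' * L) * |ψ x|) ^ (2 : ℝ))
    rw [← lintegral_indicator hDo.measurableSet]
    refine lintegral_mono fun q => ?_
    by_cases hq : q ∈ D
    · rw [indicator_of_mem hq]
      gcongr
      calc ∑ j, a j * |g j q| ≤ ∑ j, (a j * |fderiv ℝ ψ (Ψ q)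
            (fderiv ℝ Ψ q (EuclideanSpace.single j 1))| + a j * ((L' * L) * |ψ (Ψ q)|)) := by
            refine Finset.sum_le_sum fun j _ => ?_
            rw [← mul_add]
            exact mul_le_mul_of_nonneg_left (hgb j q hq) (ha j).le
        _ ≤ _ := by
            rw [Finset.sum_add_distrib, ← Finset.sum_mul, mul_assoc (∑ j, a j)]
            exact add_le_add (hE q hq.1 hq.2) le_rfl
    · have : ∀ j, g j q = 0 := fun j => by simp only [hg]; rw [indicator_of_notMem hq]
      simp [this]
  calc _ ≤ (∏ j, ENNReal.ofReal (a j)) ^ (2 / (n + 1 : ℝ)) *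
        (ENNReal.ofReal L * ∫⁻ q, ENNReal.ofReal |w q| ^ (2 + 4 / (n + 1 : ℝ))) := by gcongr
    _ = ENNReal.ofReal L * ((∏ j, ENNReal.ofReal (a j)) ^ (2 / (n + 1 : ℝ)) *
        ∫⁻ q, ENNReal.ofReal |w q| ^ (2 + 4 / (n + 1 : ℝ))) := by ring
    _ ≤ _ := by
      refine mul_le_mul_right (hmain.trans ?_) _
      gcongr

end GagliardoNirenberg

/-! ### Inverse functions depending on time, and directions pointing into Ω. -/

section LocalInverse

open Filter Topology

variable {N : ℕ}

/-- The inverse function theorem with a parameter `t`: local inverses of `φ(·,t)`. The predicate `P`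
expresses closeness to the base point and to the inverse derivative there. -/
theorem exists_local_inverse_family {φ : Euc N × ℝ → Euc N} {x₀ : Euc N} {t₀ : ℝ}
    (hφ : ContDiffAt ℝ 1 φ (x₀, t₀)) (A : Euc N ≃L[ℝ] Euc N)
    (hA : HasFDerivAt (fun x => φ (x, t₀)) (A : Euc N →L[ℝ] Euc N) x₀)
    {P : Euc N × ℝ → (Euc N →L[ℝ] Euc N) → Prop}
    (hP : ∀ᶠ z in 𝓝 ((x₀, t₀), (A.symm : Euc N →L[ℝ] Euc N)), P z.1 z.2) :
    ∃ B V : Set (Euc N), ∃ I ∈ 𝓝 t₀, ∃ Ψ : Euc N → ℝ → Euc N, IsOpen B ∧ Bornology.IsBounded B ∧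
      Convex ℝ B ∧ V ∈ 𝓝 x₀ ∧ ∀ t ∈ I,
      (∀ q ∈ B, DifferentiableAt ℝ (fun q => Ψ q t) q ∧
        P (Ψ q t, t) (fderiv ℝ (fun q => Ψ q t) q) ∧ φ (Ψ q t, t) = q ∧
        DifferentiableAt ℝ (fun x => φ (x, t)) (Ψ q t)) ∧
      ContinuousOn (fun x => φ (x, t)) V ∧ ∀ x ∈ V, φ (x, t) ∈ B ∧ Ψ (φ (x, t)) t = x := by
  set D := fderiv ℝ φ (x₀, t₀) with hD
  have hDφ : HasFDerivAt φ D (x₀, t₀) := (hφ.differentiableAt one_ne_zero).hasFDerivAt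
  have hDA : ∀ v, D (v, 0) = A v := by
    intro v
    have h1 : HasFDerivAt (fun x : Euc N => (x, t₀)) (.inl ℝ (Euc N) ℝ) x₀ :=
      hasFDerivAt_prodMk_left x₀ t₀
    have h2 := (HasFDerivAt.comp x₀ (g := φ) hDφ h1).unique hA
    simpa using congrArg (fun l => l v) h2
  set c := D (0, 1) with hc
  have hDs : ∀ v τ, D (v, τ) = A v + τ • c := by
    intro v τ
    rw [← hDA v, hc, ← map_smul, ← map_add]; simp
  set Lf : Euc N × ℝ →L[ℝ] Euc N × ℝ := D.prod (.snd ℝ _ _) with hLf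
  set Li : Euc N × ℝ →L[ℝ] Euc N × ℝ := ((A.symm : Euc N →L[ℝ] Euc N).comp
    (.fst ℝ _ _ - (ContinuousLinearMap.snd ℝ (Euc N) ℝ).smulRight c)).prod (.snd ℝ _ _) with hLi
  set L : (Euc N × ℝ) ≃L[ℝ] Euc N × ℝ := ContinuousLinearEquiv.equivOfInverse Lf Li
    (by rintro ⟨v, τ⟩; simp [hLf, hLi, hDs]) (by rintro ⟨v, τ⟩; simp [hLf, hLi, hDs]) with hL
  -- Keeping time as a second component turns the family into one local diffeomorphism with block
  -- triangular derivative. Its inverse restricts to inverses of every φ(·,t) on a common ball, for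
  -- t near t₀.
  set Φ : Euc N × ℝ → Euc N × ℝ := fun z => (φ z, z.2) with hΦ
  have hΦc : ContDiffAt ℝ 1 Φ (x₀, t₀) := hφ.prodMk contDiffAt_snd
  have hΦd : HasFDerivAt Φ (L : Euc N × ℝ →L[ℝ] Euc N × ℝ) (x₀, t₀) := hDφ.prodMk hasFDerivAt_snd
  set e := hΦc.toOpenPartialHomeomorph Φ hΦd one_ne_zero with he
  have hes : (x₀, t₀) ∈ e.source := hΦc.mem_toOpenPartialHomeomorph_source hΦd one_ne_zero
  have heΦ : ∀ z, e z = Φ z := fun z => rfl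
  set z₀ : Euc N × ℝ := (φ (x₀, t₀), t₀) with hz₀
  have hz₀t : z₀ ∈ e.target := e.map_source hes
  have hez₀ : e.symm z₀ = (x₀, t₀) := e.left_inv hes
  have hinv : ContDiffAt ℝ 1 e.symm z₀ := hΦc.to_localInverse hΦd one_ne_zero
  have hΞ2 : ∀ z ∈ e.target, Φ (e.symm z) = z := fun z hz => e.right_inv hz
  have hDinv : fderiv ℝ e.symm z₀ = (L.symm : Euc N × ℝ →L[ℝ] Euc N × ℝ) := by
    have h1 : HasFDerivAt e.symm (fderiv ℝ e.symm z₀) z₀ :=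
      (hinv.differentiableAt one_ne_zero).hasFDerivAt
    have h2 : HasFDerivAt Φ (L : Euc N × ℝ →L[ℝ] Euc N × ℝ) (e.symm z₀) := by rwa [hez₀]
    have h3 := h2.comp z₀ h1
    have h4 : HasFDerivAt (fun z => z) (ContinuousLinearMap.id ℝ (Euc N × ℝ)) z₀ := hasFDerivAt_id z₀
    have h5 : (Φ ∘ e.symm) =ᶠ[𝓝 z₀] fun z => z := by
      filter_upwards [e.open_target.mem_nhds hz₀t] with z hz using hΞ2 z hz
    have h6 := h3.unique (h4.congr_of_eventuallyEq h5)
    refine ContinuousLinearMap.ext fun v => ?_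
    have h7 := congrArg (fun l => L.symm (l v)) h6
    simpa using h7
  set Ψ : Euc N → ℝ → Euc N := fun q t => (e.symm (q, t)).1 with hΨ
  set DΨ : Euc N × ℝ → Euc N →L[ℝ] Euc N := fun z =>
    (ContinuousLinearMap.fst ℝ (Euc N) ℝ).comp ((fderiv ℝ e.symm z).comp (.inl ℝ (Euc N) ℝ)) with hDΨ
  have hDΨ0 : DΨ z₀ = (A.symm : Euc N →L[ℝ] Euc N) := by
    ext1 v
    simp only [hDΨ, hDinv]
    have : L.symm (v, 0) = (A.symm v, 0) := by
      rw [ContinuousLinearEquiv.symm_apply_eq]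
      simp [hL, hLf, hDs]
    simp [this]
  have hDΨc : ContinuousAt DΨ z₀ := by
    have : ContinuousAt (fderiv ℝ e.symm) z₀ :=
      (hinv.fderiv_right (m := 0) (by norm_num)).continuousAt
    exact continuousAt_const.clm_comp (this.clm_comp continuousAt_const)
  have hev : ∀ᶠ z in 𝓝 z₀, z ∈ e.target ∧ DifferentiableAt ℝ e.symm z ∧
      DifferentiableAt ℝ φ (e.symm z) ∧ P (e.symm z) (DΨ z) := by
    have h1 : ∀ᶠ z in 𝓝 z₀, DifferentiableAt ℝ e.symm z :=
      (hinv.eventually (by simp)).mono fun z hz => hz.differentiableAt one_ne_zero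
    have h2 : Tendsto e.symm (𝓝 z₀) (𝓝 (x₀, t₀)) := by
      have := hinv.continuousAt.tendsto
      rwa [hez₀] at this
    have h3 : ∀ᶠ z in 𝓝 z₀, DifferentiableAt ℝ φ (e.symm z) :=
      h2.eventually ((hφ.eventually (by simp)).mono fun z hz => hz.differentiableAt one_ne_zero)
    have h4 : Tendsto (fun z => (e.symm z, DΨ z)) (𝓝 z₀)
        (𝓝 ((x₀, t₀), (A.symm : Euc N →L[ℝ] Euc N))) := by
      refine h2.prodMk_nhds ?_
      have := hDΨc.tendsto
      rwa [hDΨ0] at this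
    filter_upwards [e.open_target.mem_nhds hz₀t, h1, h3, h4.eventually hP] with z a b c d
      using ⟨a, b, c, d⟩
  obtain ⟨u, hu, I₁, hI₁, hsub⟩ := mem_nhds_prod_iff.1 hev
  obtain ⟨ρ, hρ, hball⟩ := Metric.mem_nhds_iff.1 hu
  have hev2 : ∀ᶠ z in 𝓝 (x₀, t₀), z ∈ e.source ∧ φ z ∈ Metric.ball (φ (x₀, t₀)) ρ ∧
      ContinuousAt φ z := by
    filter_upwards [e.open_source.mem_nhds hes,
      hφ.continuousAt (Metric.ball_mem_nhds _ hρ),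
      (hφ.eventually (by simp)).mono fun z hz => hz.continuousAt] with z a b c using ⟨a, b, c⟩
  obtain ⟨V, hV, I₂, hI₂, hsub2⟩ := mem_nhds_prod_iff.1 hev2
  refine ⟨Metric.ball (φ (x₀, t₀)) ρ, V, I₁ ∩ I₂, inter_mem hI₁ hI₂, Ψ, Metric.isOpen_ball,
    Metric.isBounded_ball, convex_ball _ _, hV, fun t ht => ⟨fun q hq => ?_, fun x hx => ?_,
      fun x hx => ?_⟩⟩
  · obtain ⟨h1, h2, h3, h4⟩ := hsub (show (q, t) ∈ u ×ˢ I₁ from ⟨hball hq, ht.1⟩)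
    have h5 := hΞ2 _ h1
    have h5' : (Φ (e.symm (q, t))).2 = t := by rw [h5]
    have h6 : e.symm (q, t) = (Ψ q t, t) := by
      apply Prod.ext
      · rfl
      · exact h5'
    have h7 : HasFDerivAt (fun q => Ψ q t) (DΨ (q, t)) q := by
      have a1 : HasFDerivAt (fun q : Euc N => (q, t)) (.inl ℝ (Euc N) ℝ) q :=
        hasFDerivAt_prodMk_left q t
      have a2 := HasFDerivAt.comp q (g := e.symm) h2.hasFDerivAt a1
      exact (ContinuousLinearMap.fst ℝ (Euc N) ℝ).hasFDerivAt.comp q a2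
    refine ⟨h7.differentiableAt, ?_, ?_, ?_⟩
    · rw [h7.fderiv, ← h6]; exact h4
    · rw [← h6]; exact congrArg Prod.fst h5
    · rw [h6] at h3
      exact DifferentiableAt.comp (Ψ q t) (g := φ) h3
        (hasFDerivAt_prodMk_left (Ψ q t) t).differentiableAt
  · have := (hsub2 (show (x, t) ∈ V ×ˢ I₂ from ⟨hx, ht.2⟩)).2.2
    have h2 : ContinuousAt (fun x => φ (x, t)) x :=
      ContinuousAt.comp (g := φ) (f := fun x => (x, t)) this (by fun_prop)
    exact h2.continuousWithinAt
  · obtain ⟨h1, h2, -⟩ := hsub2 (show (x, t) ∈ V ×ˢ I₂ from ⟨hx, ht.2⟩)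
    exact ⟨h2, congrArg Prod.fst (e.left_inv h1)⟩

/-- The parametrized local inverses, as forward charts with uniform constants. -/
theorem exists_isForwardChart_family {φ : Euc N × ℝ → Euc N} {x₀ : Euc N} {t₀ : ℝ} {Ω : Set (Euc N)}
    (hφ : ContDiffAt ℝ 1 φ (x₀, t₀)) (A : Euc N ≃L[ℝ] Euc N)
    (hA : HasFDerivAt (fun x => φ (x, t₀)) (A : Euc N →L[ℝ] Euc N) x₀)
    {P : Euc N × ℝ → (Euc N →L[ℝ] Euc N) → Prop}
    (hP : ∀ᶠ z in 𝓝 ((x₀, t₀), (A.symm : Euc N →L[ℝ] Euc N)), P z.1 z.2) :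
    ∃ B : Set (Euc N), ∃ V ∈ 𝓝 x₀, ∃ I ∈ 𝓝 t₀, ∃ Ψ : Euc N → ℝ → Euc N, ∃ L : ℝ, 0 < L ∧
      IsOpen B ∧ Convex ℝ B ∧ ∀ t ∈ I, (∀ q ∈ B, DifferentiableAt ℝ (fun q => Ψ q t) q ∧
        P (Ψ q t, t) (fderiv ℝ (fun q => Ψ q t) q) ∧ φ (Ψ q t, t) = q ∧
        DifferentiableAt ℝ (fun x => φ (x, t)) (Ψ q t) ∧ ‖fderiv ℝ (fun q => Ψ q t) q‖ ≤ L) ∧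
      ((∀ q ∈ B, Ψ q t ∈ Ω → ∀ j, ∀ τ : ℝ, 0 ≤ τ → q + τ • EuclideanSpace.single j 1 ∈ B →
        Ψ (q + τ • EuclideanSpace.single j 1) t ∈ Ω) →
        IsForwardChart Ω B V (fun q => Ψ q t) (fun x => φ (x, t)) L) := by
  have hdet : (A.symm : Euc N →L[ℝ] Euc N).det ≠ 0 := by
    intro h0
    have := A.symm.toLinearEquiv.isUnit_det'
    exact this.ne_zero h0
  set d := |(A.symm : Euc N →L[ℝ] Euc N).det| with hd
  have hd0 : 0 < d := abs_pos.2 hdet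
  -- At the base point each of the required bounds then holds strictly (L d ≥ 2 in the first), so
  -- all of them are open conditions and persist in the whole chart.
  set L := 2 / d + (d + 1) + (‖(A.symm : Euc N →L[ℝ] Euc N)‖ + 1) with hL
  have hq : 0 < 2 / d := by positivity
  have hnn := norm_nonneg (A.symm : Euc N →L[ℝ] Euc N)
  have hL1 : 2 / d ≤ L := by rw [hL]; linarith
  have hL2 : d < L := by rw [hL]; linarith
  have hL3 : ‖(A.symm : Euc N →L[ℝ] Euc N)‖ < L := by rw [hL]; linarith
  have hL0 : 0 < L := hd0.trans hL2
  have h1 : 1 < L * d := by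
    calc 1 < 2 / d * d := by rw [div_mul_cancel₀ _ hd0.ne']; norm_num
      _ ≤ L * d := by gcongr
  have hQ : ∀ᶠ M in 𝓝 (A.symm : Euc N →L[ℝ] Euc N),
      1 < L * |M.det| ∧ |M.det| < L ∧ ‖M‖ < L := by
    have c1 : ContinuousAt (fun M : Euc N →L[ℝ] Euc N => |M.det|)
      (A.symm : Euc N →L[ℝ] Euc N) := ContinuousLinearMap.continuous_det.abs.continuousAt
    have c2 : ContinuousAt (fun M : Euc N →L[ℝ] Euc N => ‖M‖)
      (A.symm : Euc N →L[ℝ] Euc N) := continuous_norm.continuousAt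
    filter_upwards [(continuousAt_const.mul c1).eventually_const_lt h1, c1.eventually_lt_const hL2,
      c2.eventually_lt_const hL3] with M a b c using ⟨a, b, c⟩
  have hPQ : ∀ᶠ z in 𝓝 ((x₀, t₀), (A.symm : Euc N →L[ℝ] Euc N)),
      P z.1 z.2 ∧ (1 < L * |z.2.det| ∧ |z.2.det| < L ∧ ‖z.2‖ < L) :=
    hP.and ((continuous_snd.tendsto' ((x₀, t₀), (A.symm : Euc N →L[ℝ] Euc N)) _ rfl).eventually hQ)
  obtain ⟨B, V, I, hI, Ψ, hBo, hBb, hBc, hV, h⟩ := exists_local_inverse_family hφ A hA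
    (P := fun z M => P z M ∧ (1 < L * |M.det| ∧ |M.det| < L ∧ ‖M‖ < L)) hPQ
  refine ⟨B, V, hV, I, hI, Ψ, L, hL0, hBo, hBc, fun t ht => ⟨fun q hq => ?_, fun hfw => ?_⟩⟩
  · obtain ⟨a, ⟨b, c⟩, d, e⟩ := (h t ht).1 q hq
    exact ⟨a, b, d, e, c.2.2.le⟩
  · obtain ⟨hq, hc, hx⟩ := h t ht
    exact
    { isOpen := hBo
      isBounded := hBb
      convex := hBc
      differentiableAt := fun q hqB => (hq q hqB).1
      injOn := fun p hp q hqB hpq => by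
        rw [← (hq p hp).2.2.1, ← (hq q hqB).2.2.1]
        simp only at hpq
        rw [hpq]
      one_le_det := fun q hqB => (hq q hqB).2.1.2.1.le
      det_le := fun q hqB => (hq q hqB).2.1.2.2.1.le
      norm_le := fun q hqB => (hq q hqB).2.1.2.2.2.le
      continuousOn := hc
      mapsTo := fun x hxV => (hx x hxV).1
      right_inv := fun x hxV => (hx x hxV).2
      forward := hfw }

theorem IsForwardChart.mono {Ω B V : Set (Euc N)} {Ψ Φ : Euc N → Euc N} {L L' : ℝ}
    (h : IsForwardChart Ω B V Ψ Φ L) (hL : L ≤ L') : IsForwardChart Ω B V Ψ Φ L' :=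
  { h with
    one_le_det := fun q hq => (h.one_le_det q hq).trans (by gcongr)
    det_le := fun q hq => (h.det_le q hq).trans hL
    norm_le := fun q hq => (h.norm_le q hq).trans hL }

/-- The direction `v` points into `Ω` at the point `x` of its closure. -/
def PointsInward (Ω : Set (Euc N)) (x v : Euc N) : Prop :=
  x ∈ Ω ∨ ∃ U ρ, IsLocalDefiningFunction Ω x U ρ ∧ fderiv ℝ ρ x v < 0

theorem Convex.add_smul_mem_of_le {B : Set (Euc N)} (hB : Convex ℝ B) {q e : Euc N} {τ : ℝ}
    (hq : q ∈ B) (hqτ : q + τ • e ∈ B) : ∀ s ∈ Icc 0 τ, q + s • e ∈ B := by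
  intro s hs
  rcases (hs.1.trans hs.2).eq_or_lt with h0 | h0
  · obtain rfl : s = 0 := le_antisymm (h0 ▸ hs.2) hs.1
    simpa using hq
  · have := hB.add_smul_mem hq hqτ (t := s / τ)
      ⟨div_nonneg hs.1 h0.le, (div_le_one h0).2 hs.2⟩
    rwa [smul_smul, div_mul_cancel₀ _ h0.ne'] at this

/-- Curves whose velocity is close to a direction pointing inward stay in `Ω`. -/
theorem PointsInward.exists_forward {Ω : Set (Euc N)} (hΩ : IsOpen Ω) {x e : Euc N}
    {M : Euc N →L[ℝ] Euc N} (h : PointsInward Ω x (M e)) :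
    ∃ Q : Euc N → (Euc N →L[ℝ] Euc N) → Prop, (∀ᶠ z in 𝓝 (x, M), Q z.1 z.2) ∧
      ∀ (B : Set (Euc N)) (Ψ : Euc N → Euc N), Convex ℝ B →
        (∀ q ∈ B, DifferentiableAt ℝ Ψ q ∧ Q (Ψ q) (fderiv ℝ Ψ q)) →
        ∀ q ∈ B, Ψ q ∈ Ω → ∀ τ : ℝ, 0 ≤ τ → q + τ • e ∈ B → Ψ (q + τ • e) ∈ Ω := by
  rcases h with hx | ⟨U, ρ, hρ, hneg⟩
  · refine ⟨fun y _ => y ∈ Ω, continuous_fst.continuousAt.eventually (hΩ.mem_nhds hx), ?_⟩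
    exact fun B Ψ _ hB q _ _ τ _ hq => (hB _ hq).2
  · obtain ⟨hUo, hxU, hρs, -, -, hΩU⟩ := hρ
    have hiff : ∀ y ∈ U, (y ∈ Ω ↔ ρ y < 0) := fun y hy =>
      ⟨fun h => (hΩU.subset ⟨h, hy⟩).2, fun h => (hΩU.symm.subset ⟨hy, h⟩).1⟩
    have hcd : ContinuousAt (fun z : Euc N × (Euc N →L[ℝ] Euc N) => fderiv ℝ ρ z.1 (z.2 e)) (x, M) := by
      have h1 : ContinuousAt (fderiv ℝ ρ) x :=
        ((hρs.contDiffAt (hUo.mem_nhds hxU)).fderiv_right (m := 0) (by simp)).continuousAt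
      have h2 : ContinuousAt (fun z : Euc N × (Euc N →L[ℝ] Euc N) => fderiv ℝ ρ z.1) (x, M) :=
        ContinuousAt.comp (g := fderiv ℝ ρ) (f := Prod.fst) h1 continuous_fst.continuousAt
      exact h2.clm_apply (continuousAt_snd.clm_apply continuousAt_const)
    -- The open condition says that a velocity M e lowers ρ. Convexity keeps the segment in B, so ρ
    -- ∘ Ψ is nonincreasing along it and stays negative.
    refine ⟨fun y M => y ∈ U ∧ fderiv ℝ ρ y (M e) < 0, ?_, ?_⟩
    · exact (continuous_fst.continuousAt.eventually (hUo.mem_nhds hxU)).and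
        (hcd.eventually_lt_const hneg)
    · intro B Ψ hBc hB q hq hqΩ τ hτ hqτ
      have hline := hBc.add_smul_mem_of_le hq hqτ
      have hd : ∀ s ∈ Icc 0 τ, HasDerivAt (fun s : ℝ => ρ (Ψ (q + s • e)))
          (fderiv ℝ ρ (Ψ (q + s • e)) (fderiv ℝ Ψ (q + s • e) e)) s := by
        intro s hs
        have hl : HasDerivAt (fun s : ℝ => q + s • e) e s := by
          simpa using ((hasDerivAt_id s).smul_const e).const_add q
        have hBs := hB _ (hline s hs)
        have h1 := (hBs.1.hasFDerivAt).comp_hasDerivAt s hl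
        have h2 := ((hρs.contDiffAt (hUo.mem_nhds hBs.2.1)).differentiableAt (by simp)).hasFDerivAt
        exact h2.comp_hasDerivAt s h1
      have hanti : AntitoneOn (fun s : ℝ => ρ (Ψ (q + s • e))) (Icc 0 τ) := by
        refine antitoneOn_of_deriv_nonpos (convex_Icc 0 τ)
          (fun s hs => (hd s hs).continuousAt.continuousWithinAt)
          (fun s hs => (hd s (interior_subset hs)).differentiableAt.differentiableWithinAt) ?_
        intro s hs
        have hs' := interior_subset hs
        rw [(hd s hs').deriv]
        exact (hB _ (hline s hs')).2.2.le
      have h1 := hanti (left_mem_Icc.2 hτ) (right_mem_Icc.2 hτ) hτ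
      simp only [zero_smul, add_zero] at h1
      exact (hiff _ (hB _ hqτ).2.1).2 (h1.trans_lt ((hiff _ (hB q hq).2.1).1 hqΩ))

end LocalInverse

/-! ### Differential calculus in the curvilinear coordinates. -/

namespace CurvilinearCoordinates

open Filter Topology

variable {N : ℕ} {Ω : Set (Euc N)} {T w : ℝ} {Γ : EvolvingHypersurface Ω T}
  (X : CurvilinearCoordinates Γ w)

/-- The coordinate vector `∂_r X` at the point `x`. -/
noncomputable def radialVector (t : ℝ) (x : Euc N) : Euc N :=
  deriv (fun ρ => X.X ρ (X.s x t) t) (X.r x t)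

/-- The derivative `D_σ X` at the point `x`. -/
noncomputable def lateralDeriv (t : ℝ) (x : Euc N) : Euc N →L[ℝ] Euc N :=
  fderiv ℝ (fun σ => X.X (X.r x t) σ t) (X.s x t)

variable {x : Euc N} {t : ℝ}

theorem hasFDerivAt_X {ρ : ℝ} {σ : Euc N} (h : (ρ, σ, t) ∈ X.O) :
    HasFDerivAt (fun p : ℝ × Euc N × ℝ => X.X p.1 p.2.1 p.2.2)
      (fderiv ℝ (fun p : ℝ × Euc N × ℝ => X.X p.1 p.2.1 p.2.2) (ρ, σ, t)) (ρ, σ, t) :=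
  ((X.smooth_X.contDiffAt (X.isOpen_O.mem_nhds h)).differentiableAt (by simp)).hasFDerivAt

theorem hasFDerivAt_r (h : (x, t) ∈ X.W) :
    HasFDerivAt (fun y => X.r y t) (fderiv ℝ (fun y => X.r y t) x) x := by
  have h1 := ((X.smooth_r.contDiffAt (X.isOpen_W.mem_nhds h)).differentiableAt (by simp))
  exact (DifferentiableAt.comp x (g := fun p : Euc N × ℝ => X.r p.1 p.2) h1
    (by fun_prop : DifferentiableAt ℝ (fun y : Euc N => (y, t)) x)).hasFDerivAt

theorem hasFDerivAt_s (h : (x, t) ∈ X.W) :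
    HasFDerivAt (fun y => X.s y t) (fderiv ℝ (fun y => X.s y t) x) x := by
  have h1 := ((X.smooth_s.contDiffAt (X.isOpen_W.mem_nhds h)).differentiableAt (by simp))
  exact (DifferentiableAt.comp x (g := fun p : Euc N × ℝ => X.s p.1 p.2) h1
    (by fun_prop : DifferentiableAt ℝ (fun y : Euc N => (y, t)) x)).hasFDerivAt

theorem hasDerivAt_radial (h : (x, t) ∈ X.W) :
    HasDerivAt (fun ρ => X.X ρ (X.s x t) t) (X.radialVector t x) (X.r x t) := by
  have h1 := X.hasFDerivAt_X (X.right_inv x t h).1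
  have h2 : HasDerivAt (fun ρ : ℝ => (ρ, X.s x t, t)) ((1 : ℝ), (0 : Euc N), (0 : ℝ)) (X.r x t) :=
    (hasDerivAt_id _).prodMk (hasDerivAt_const _ _)
  have h3 := h1.comp_hasDerivAt (X.r x t) h2
  exact h3.differentiableAt.hasDerivAt

theorem radialVector_eq (h : (x, t) ∈ X.W) : X.radialVector t x =
    fderiv ℝ (fun p : ℝ × Euc N × ℝ => X.X p.1 p.2.1 p.2.2) (X.r x t, X.s x t, t) (1, 0, 0) := by
  have h1 := X.hasFDerivAt_X (X.right_inv x t h).1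
  have h2 : HasDerivAt (fun ρ : ℝ => (ρ, X.s x t, t)) ((1 : ℝ), (0 : Euc N), (0 : ℝ)) (X.r x t) :=
    (hasDerivAt_id _).prodMk (hasDerivAt_const _ _)
  exact (h1.comp_hasDerivAt (X.r x t) h2).deriv

theorem lateralDeriv_eq (h : (x, t) ∈ X.W) : X.lateralDeriv t x =
    (fderiv ℝ (fun p : ℝ × Euc N × ℝ => X.X p.1 p.2.1 p.2.2) (X.r x t, X.s x t, t)).comp
      ((ContinuousLinearMap.inr ℝ ℝ (Euc N × ℝ)).comp (ContinuousLinearMap.inl ℝ (Euc N) ℝ)) := by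
  have h1 := X.hasFDerivAt_X (X.right_inv x t h).1
  have h2 : HasFDerivAt (fun σ : Euc N => (X.r x t, σ, t))
      ((ContinuousLinearMap.inr ℝ ℝ (Euc N × ℝ)).comp (ContinuousLinearMap.inl ℝ (Euc N) ℝ))
      (X.s x t) :=
    (hasFDerivAt_prodMk_right (X.r x t) (X.s x t, t)).comp (X.s x t)
      (hasFDerivAt_prodMk_left (X.s x t) t)
  exact (HasFDerivAt.comp (X.s x t) (g := fun p : ℝ × Euc N × ℝ => X.X p.1 p.2.1 p.2.2) h1 h2).fderiv

/-- Decomposition of a vector into its radial and lateral parts. -/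
theorem decomposition (h : (x, t) ∈ X.W) (v : Euc N) :
    v = fderiv ℝ (fun y => X.r y t) x v • X.radialVector t x +
      X.lateralDeriv t x (fderiv ℝ (fun y => X.s y t) x v) := by
  have h1 := X.hasFDerivAt_X (X.right_inv x t h).1
  have h2 : HasFDerivAt (fun y => (X.r y t, X.s y t, t)) _ x :=
    (X.hasFDerivAt_r h).prodMk ((X.hasFDerivAt_s h).prodMk (hasFDerivAt_const t x))
  have h3 := HasFDerivAt.comp x (g := fun p : ℝ × Euc N × ℝ => X.X p.1 p.2.1 p.2.2) h1 h2
  have h4 : ((fun p : ℝ × Euc N × ℝ => X.X p.1 p.2.1 p.2.2) ∘ fun y => (X.r y t, X.s y t, t))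
      =ᶠ[𝓝 x] fun y => y := by
    have : ∀ᶠ y in 𝓝 x, (y, t) ∈ X.W :=
      (Continuous.prodMk_left t).continuousAt.eventually (X.isOpen_W.mem_nhds h)
    filter_upwards [this] with y hy using (X.right_inv y t hy).2.2
  have h5 := h3.unique ((hasFDerivAt_id x).congr_of_eventuallyEq h4)
  have h6 := congrArg (fun l => l v) h5
  simp only [ContinuousLinearMap.comp_apply, ContinuousLinearMap.prod_apply,
    ContinuousLinearMap.id_apply, zero_apply] at h6
  rw [X.radialVector_eq h, X.lateralDeriv_eq h, ← map_smul]
  simp only [ContinuousLinearMap.comp_apply, ContinuousLinearMap.inl_apply,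
    ContinuousLinearMap.inr_apply]
  rw [← map_add]
  conv_lhs => rw [← h6]
  simp

theorem left_inv_eventually (h : (x, t) ∈ X.W) : ∀ᶠ ρ in 𝓝 (X.r x t),
    (X.X ρ (X.s x t) t, t) ∈ X.W ∧ X.r (X.X ρ (X.s x t) t) t = ρ ∧
      X.s (X.X ρ (X.s x t) t) t = X.s x t := by
  obtain ⟨h1, h2, -⟩ := X.right_inv x t h
  have : ∀ᶠ ρ in 𝓝 (X.r x t), (ρ, X.s x t, t) ∈ X.O :=
    (Continuous.prodMk_left (X.s x t, t)).continuousAt.eventually (X.isOpen_O.mem_nhds h1)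
  filter_upwards [this] with ρ hρ using X.left_inv ρ _ t hρ h2

/-- Along the radial curve ρ ↦ X(ρ, s, t) the coordinate r equals ρ while s is constant;
differentiating both facts gives this identity and its companion for s. -/
theorem fderiv_r_radialVector (h : (x, t) ∈ X.W) :
    fderiv ℝ (fun y => X.r y t) x (X.radialVector t x) = 1 := by
  have hx : X.X (X.r x t) (X.s x t) t = x := (X.right_inv x t h).2.2
  have h1 : HasFDerivAt (fun y => X.r y t) (fderiv ℝ (fun y => X.r y t) x) (X.X (X.r x t) (X.s x t) t) := by
    rw [hx]; exact X.hasFDerivAt_r h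
  have h2 := h1.comp_hasDerivAt (X.r x t) (X.hasDerivAt_radial h)
  refine h2.unique ((hasDerivAt_id _).congr_of_eventuallyEq ?_)
  filter_upwards [X.left_inv_eventually h] with ρ hρ using hρ.2.1

theorem fderiv_s_radialVector (h : (x, t) ∈ X.W) :
    fderiv ℝ (fun y => X.s y t) x (X.radialVector t x) = 0 := by
  have hx : X.X (X.r x t) (X.s x t) t = x := (X.right_inv x t h).2.2
  have h1 : HasFDerivAt (fun y => X.s y t) (fderiv ℝ (fun y => X.s y t) x) (X.X (X.r x t) (X.s x t) t) := by
    rw [hx]; exact X.hasFDerivAt_s h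
  have h2 := h1.comp_hasDerivAt (X.r x t) (X.hasDerivAt_radial h)
  refine h2.unique ((hasDerivAt_const _ (X.s x t)).congr_of_eventuallyEq ?_)
  filter_upwards [X.left_inv_eventually h] with ρ hρ using hρ.2.2

theorem mem_of_mem_tube {η : ℝ} (hη : η ≤ w) (h : (x, t) ∈ X.tube η) :
    (x, t) ∈ X.W ∧ X.r x t ∈ Ioo (-η) η ∧ X.s x t ∈ Γ.S ∧ t ∈ Icc 0 T := by
  obtain ⟨ρ, hρ, σ, hσ, t', ht', he⟩ := h
  rw [Prod.mk.injEq] at he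
  obtain ⟨rfl, rfl⟩ := he
  have hO : (ρ, σ, t) ∈ X.O := X.subset_O ⟨⟨by linarith [hρ.1], by linarith [hρ.2]⟩, hσ, ht'⟩
  obtain ⟨h1, h2, h3⟩ := X.left_inv ρ σ t hO (Γ.S_ssubset.1 hσ)
  rw [h2, h3]
  exact ⟨h1, hρ, hσ, ht'⟩

/-- A closed range of r between the two widths gives the compact set. It supplies uniform constants
on the smaller tube and separates that tube from points outside the larger one. -/
theorem exists_compact_tube {η η' : ℝ} (hη : η < η') (hη' : η' ≤ w) :
    ∃ K : Set (Euc N × ℝ), IsCompact K ∧ X.tube η ⊆ K ∧ K ⊆ X.tube η' := by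
  set F : ℝ × Euc N × ℝ → Euc N × ℝ := fun p => (X.X p.1 p.2.1 p.2.2, p.2.2) with hF
  have hsub : Icc (-η) η ×ˢ (Γ.S ×ˢ Icc 0 T) ⊆ X.O := fun p hp =>
    X.subset_O ⟨⟨by linarith [hp.1.1], by linarith [hp.1.2]⟩, hp.2⟩
  have hFc : ContinuousOn F (Icc (-η) η ×ˢ (Γ.S ×ˢ Icc 0 T)) :=
    (X.smooth_X.continuousOn.mono hsub).prodMk (by fun_prop)
  refine ⟨F '' (Icc (-η) η ×ˢ (Γ.S ×ˢ Icc 0 T)),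
    (isCompact_Icc.prod (Γ.isCompact_S.prod isCompact_Icc)).image_of_continuousOn hFc, ?_, ?_⟩
  · rintro p ⟨ρ, hρ, σ, hσ, t, ht, rfl⟩
    exact ⟨(ρ, σ, t), ⟨Ioo_subset_Icc_self hρ, hσ, ht⟩, rfl⟩
  · rintro _ ⟨⟨ρ, σ, t⟩, ⟨hρ, hσ, ht⟩, rfl⟩
    exact ⟨ρ, ⟨by linarith [hρ.1], by linarith [hρ.2]⟩, σ, hσ, t, ht, rfl⟩

/-- A vector v with dr(v) = 0 has no radial part, so D_σX D_xs v = v, and ∇_τ is the gradient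
followed by the adjoint of this composition. Hence derivatives along level sets of r are controlled
by ∇_τ alone. -/
theorem tangentialGrad_inner (h : (x, t) ∈ X.W) {v : Euc N}
    (hv : fderiv ℝ (fun y => X.r y t) x v = 0) (g : Euc N) :
    inner ℝ (X.tangentialGrad t x g) v = inner ℝ g v := by
  have h1 := X.decomposition h v
  rw [hv, zero_smul, zero_add] at h1
  conv_rhs => rw [h1]
  rw [tangentialGrad, ContinuousLinearMap.adjoint_inner_left, ContinuousLinearMap.adjoint_inner_left]
  rfl

theorem normalDeriv_eq (t : ℝ) (x g : Euc N) :
    X.normalDeriv t x g = inner ℝ g (X.radialVector t x) := rfl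

open Classical in
/-- The anisotropic size of a gradient: in the tube `Γ_t(η)` the normal component carries the
weight `ε`. -/
noncomputable def anisotropicNorm (η ε t : ℝ) (x g : Euc N) : ℝ :=
  if x ∈ X.tubeAt η t then ‖X.tangentialGrad t x g‖ + ε * |X.normalDeriv t x g| else ‖g‖

end CurvilinearCoordinates

/-! ### Bases adapted to the boundary and to the radial direction. -/

section Bases

open Filter Topology Module

variable {n : ℕ} {Ω : Set (Euc (n + 1))}

/-- The coordinates with respect to a basis, as an element of Euclidean space. -/
noncomputable def coordEquiv (b : Basis (Fin (n + 1)) ℝ (Euc (n + 1))) :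
    Euc (n + 1) ≃L[ℝ] Euc (n + 1) :=
  b.equivFun.toContinuousLinearEquiv.trans (EuclideanSpace.equiv (Fin (n + 1)) ℝ).symm

theorem coordEquiv_apply (b : Basis (Fin (n + 1)) ℝ (Euc (n + 1))) (v : Euc (n + 1))
    (i : Fin (n + 1)) : coordEquiv b v i = b.coord i v := rfl

theorem coordEquiv_symm_single (b : Basis (Fin (n + 1)) ℝ (Euc (n + 1))) (j : Fin (n + 1)) :
    (coordEquiv b).symm (EuclideanSpace.single j 1) = b j := by
  rw [ContinuousLinearEquiv.symm_apply_eq]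
  ext i
  rw [coordEquiv_apply]
  simp [Finsupp.single_apply, eq_comm]

theorem IsLocalDefiningFunction.fderiv_ne_zero {N : ℕ} {Ω U : Set (Euc N)} {x : Euc N}
    {ρ : Euc N → ℝ} (h : IsLocalDefiningFunction Ω x U ρ) : fderiv ℝ ρ x ≠ 0 := by
  intro h0
  exact h.2.2.2.2.1 (by rw [gradient, h0, map_zero])

/-- At a boundary point the basis is taken on the affine hyperplane dρ = -1; in the interior every
direction is admissible. -/
theorem IsBoundedSmoothDomain.exists_basis_inward (hΩ : IsBoundedSmoothDomain Ω) {x : Euc (n + 1)}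
    (hx : x ∈ closure Ω) :
    ∃ b : Basis (Fin (n + 1)) ℝ (Euc (n + 1)), ∀ j, PointsInward Ω x (b j) := by
  by_cases hxΩ : x ∈ Ω
  · exact ⟨(EuclideanSpace.basisFun (Fin (n + 1)) ℝ).toBasis, fun j => Or.inl hxΩ⟩
  · obtain ⟨U, ρ, hρ⟩ := hΩ.smooth_boundary x (by rw [hΩ.isOpen.frontier_eq]; exact ⟨hx, hxΩ⟩)
    have hne : (fderiv ℝ ρ x : Euc (n + 1) →ₗ[ℝ] ℝ) ≠ 0 := by
      intro h0
      exact hρ.fderiv_ne_zero (ContinuousLinearMap.coe_injective h0)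
    obtain ⟨b, hb⟩ := exists_basis_apply_eq_neg_one (finrank_euclideanSpace_fin (𝕜 := ℝ)) hne
    refine ⟨b, fun j => Or.inr ⟨U, ρ, hρ, ?_⟩⟩
    have : fderiv ℝ ρ x (b j) = -1 := hb j
    rw [this]; norm_num

/-- A basis adapted to a functional `ℓ` and a vector `v₀` with `ℓ v₀ = 1` which is tangential to the
boundary. -/
theorem exists_basis_inward_cons {x v₀ : Euc (n + 1)} {ℓ : Euc (n + 1) →ₗ[ℝ] ℝ} (hℓ : ℓ v₀ = 1)
    (hv₀ : x ∉ Ω → ∃ U ρ, IsLocalDefiningFunction Ω x U ρ ∧ fderiv ℝ ρ x v₀ = 0) :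
    ∃ b : Basis (Fin (n + 1)) ℝ (Euc (n + 1)), b 0 = v₀ ∧
      ∀ j : Fin n, ℓ (b j.succ) = 0 ∧ PointsInward Ω x (b j.succ) := by
  have hℓ0 : ℓ ≠ 0 := by
    rintro rfl; simp at hℓ
  have hfin : finrank ℝ (LinearMap.ker ℓ) = n := by
    have := Module.Dual.finrank_ker_add_one_of_ne_zero (f := ℓ) hℓ0
    rw [finrank_euclideanSpace_fin] at this
    omega
  have key : ∃ b : Basis (Fin n) ℝ (LinearMap.ker ℓ), ∀ j, PointsInward Ω x (b j) := by
    by_cases hxΩ : x ∈ Ω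
    · exact ⟨(finBasisOfFinrankEq ℝ _ hfin), fun j => Or.inl hxΩ⟩
    · obtain ⟨U, ρ, hρ, hρ0⟩ := hv₀ hxΩ
      set ν : LinearMap.ker ℓ →ₗ[ℝ] ℝ := (fderiv ℝ ρ x : Euc (n + 1) →ₗ[ℝ] ℝ).comp
        (LinearMap.ker ℓ).subtype with hν
      -- dρ vanishes on v₀; if it also vanished on ker ℓ, which together with v₀ spans the space, it
      -- would be zero.
      have hne : ν ≠ 0 := by
        intro h0
        refine hρ.fderiv_ne_zero (ContinuousLinearMap.ext fun v => ?_)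
        have h1 : v - ℓ v • v₀ ∈ LinearMap.ker ℓ := by
          rw [LinearMap.mem_ker, map_sub, map_smul, hℓ]; simp
        have h2 : fderiv ℝ ρ x (v - ℓ v • v₀) = 0 := congrArg (fun l => l ⟨_, h1⟩) h0
        rw [map_sub, map_smul, hρ0, smul_zero, sub_zero] at h2
        simpa using h2
      obtain ⟨b, hb⟩ := exists_basis_apply_eq_neg_one hfin hne
      refine ⟨b, fun j => Or.inr ⟨U, ρ, hρ, ?_⟩⟩
      have : fderiv ℝ ρ x (b j) = -1 := hb j
      rw [this]; norm_num
  obtain ⟨b, hb⟩ := key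
  refine ⟨Basis.mkFinCons v₀ b ?_ ?_, ?_, fun j => ?_⟩
  · intro c y hy hc
    have := congrArg ℓ hc
    rw [map_add, map_smul, hℓ, LinearMap.mem_ker.1 hy] at this
    simpa using this
  · intro z
    refine ⟨-ℓ z, ?_⟩
    rw [LinearMap.mem_ker, map_add, map_smul, hℓ]; simp
  · simp
  · simp only [Basis.coe_mkFinCons, Fin.cons_succ, Function.comp_apply]
    exact ⟨LinearMap.mem_ker.1 (b j).2, hb j⟩

end Bases

/-! ### Forward charts compatible with the tube around Γ. -/

section Charts

open Filter Topology Module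

variable {n : ℕ} {Ω : Set (Euc (n + 1))} {T δ : ℝ} {Γ : EvolvingHypersurface Ω T}

theorem abs_inner_clm_single_le {g : Euc (n + 1)} {M : Euc (n + 1) →L[ℝ] Euc (n + 1)} {L : ℝ}
    (hM : ‖M‖ ≤ L) (j : Fin (n + 1)) :
    |inner ℝ g (M (EuclideanSpace.single j 1))| ≤ L * ‖g‖ := by
  refine (abs_real_inner_le_norm _ _).trans ?_
  have : ‖M (EuclideanSpace.single j (1 : ℝ))‖ ≤ L := by
    refine (M.le_opNorm _).trans ?_
    simpa using hM
  rw [mul_comm]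
  exact mul_le_mul_of_nonneg_right this (norm_nonneg _)

/-- Forward charts away from the evolving hypersurface. -/
theorem CurvilinearCoordinates.exists_isForwardChart_of_notMem (X : CurvilinearCoordinates Γ (2 * δ))
    (hδ : 0 < δ) (hΩ : IsBoundedSmoothDomain Ω) (ε₀ : ℝ) {x₀ : Euc (n + 1)} {t₀ : ℝ}
    (hx₀ : x₀ ∈ closure Ω) (h : (x₀, t₀) ∉ X.tube (2 * δ)) :
    ∃ V ∈ 𝓝 x₀, ∃ I ∈ 𝓝 t₀, ∃ L : ℝ, 0 < L ∧ ∀ t ∈ I, t ∈ Icc 0 T →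
      ∃ B Ψ Φ, IsForwardChart Ω B V Ψ Φ L ∧ ∀ ε ∈ Ioc 0 ε₀, ∀ q ∈ B, Ψ q ∈ Ω → ∀ g,
        ε * |inner ℝ g (fderiv ℝ Ψ q (EuclideanSpace.single 0 1))| +
          ∑ j : Fin n, |inner ℝ g (fderiv ℝ Ψ q (EuclideanSpace.single j.succ 1))| ≤
        L * X.anisotropicNorm δ ε t (Ψ q) g := by
  obtain ⟨b, hb⟩ := hΩ.exists_basis_inward hx₀
  -- The margin between δ and 2δ is used here: the base point avoids a compact set containing the
  -- smaller tube, so near it the anisotropic norm is the Euclidean one.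
  obtain ⟨K, hKc, hK1, hK2⟩ := X.exists_compact_tube (η := δ) (η' := 2 * δ) (by linarith) le_rfl
  set A := coordEquiv b with hA
  have hin : ∀ j, PointsInward Ω x₀
      ((A.symm : Euc (n + 1) →L[ℝ] Euc (n + 1)) (EuclideanSpace.single j 1)) := by
    intro j
    have : (A.symm : Euc (n + 1) →L[ℝ] Euc (n + 1)) (EuclideanSpace.single j 1) = b j :=
      coordEquiv_symm_single b j
    rw [this]; exact hb j
  choose Q hQ hQf using fun j => (hin j).exists_forward hΩ.isOpen
  have htend : Tendsto (fun z : (Euc (n + 1) × ℝ) × (Euc (n + 1) →L[ℝ] Euc (n + 1)) => (z.1.1, z.2))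
      (𝓝 ((x₀, t₀), (A.symm : Euc (n + 1) →L[ℝ] Euc (n + 1))))
      (𝓝 (x₀, (A.symm : Euc (n + 1) →L[ℝ] Euc (n + 1)))) :=
    Continuous.tendsto' (by fun_prop) _ _ rfl
  have hP : ∀ᶠ z in 𝓝 ((x₀, t₀), (A.symm : Euc (n + 1) →L[ℝ] Euc (n + 1))),
      (∀ j, Q j z.1.1 z.2) ∧ z.1 ∉ K := by
    refine (eventually_all.2 fun j => htend.eventually (hQ j)).and ?_
    exact (continuous_fst.tendsto' _ _ rfl).eventually
      (hKc.isClosed.isOpen_compl.mem_nhds fun hh => h (hK2 hh))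
  have hφ : ContDiffAt ℝ 1 (fun z : Euc (n + 1) × ℝ => A z.1) (x₀, t₀) :=
    A.contDiff.contDiffAt.comp (x₀, t₀) contDiffAt_fst
  obtain ⟨B, V, hV, I, hI, Ψ, L, hL, -, hBc, hch⟩ := exists_isForwardChart_family (Ω := Ω)
    (P := fun z M => (∀ j, Q j z.1 M) ∧ z ∉ K) hφ A A.hasFDerivAt hP
  have hn0 : (0 : ℝ) ≤ n := Nat.cast_nonneg n
  have hLL : L ≤ 1 + (1 + |ε₀| + n) * L := by
    have h1 : 0 ≤ |ε₀| * L := mul_nonneg (abs_nonneg _) hL.le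
    have h2 : 0 ≤ n * L := mul_nonneg hn0 hL.le
    nlinarith
  refine ⟨V, hV, I, hI, 1 + (1 + |ε₀| + n) * L, by linarith, fun t ht hT =>
    ⟨B, fun q => Ψ q t, fun x => A x, IsForwardChart.mono ?_ hLL, fun ε hε q hq hqΩ g => ?_⟩⟩
  · refine (hch t ht).2 fun q hq hqΩ j τ hτ hqτ => ?_
    exact hQf j B (fun q => Ψ q t) hBc
      (fun p hp => ⟨((hch t ht).1 p hp).1, ((hch t ht).1 p hp).2.1.1 j⟩) q hq hqΩ τ hτ hqτ
  · have hnot : Ψ q t ∉ X.tubeAt δ t := fun hh => ((hch t ht).1 q hq).2.1.2 (hK1 hh)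
    rw [CurvilinearCoordinates.anisotropicNorm, if_neg hnot]
    have hM := ((hch t ht).1 q hq).2.2.2.2
    have h1 := abs_inner_clm_single_le (g := g) hM 0
    have h2 : ∑ j : Fin n, |inner ℝ g (fderiv ℝ (fun q => Ψ q t) q
        (EuclideanSpace.single j.succ 1))| ≤ n * (L * ‖g‖) := by
      refine (Finset.sum_le_sum fun j _ => abs_inner_clm_single_le (g := g) hM j.succ).trans ?_
      simp
    have h3 : ε * |inner ℝ g (fderiv ℝ (fun q => Ψ q t) q (EuclideanSpace.single 0 1))| ≤
        |ε₀| * (L * ‖g‖) :=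
      mul_le_mul (hε.2.trans (le_abs_self _)) h1 (abs_nonneg _) (abs_nonneg _)
    have h4 : 0 ≤ L * ‖g‖ := by positivity
    have h5 := norm_nonneg g
    calc _ ≤ |ε₀| * (L * ‖g‖) + n * (L * ‖g‖) := add_le_add h3 h2
      _ ≤ _ := by nlinarith

/-- Forward charts near the evolving hypersurface. -/
theorem CurvilinearCoordinates.exists_isForwardChart_of_mem (X : CurvilinearCoordinates Γ (2 * δ))
    (hδ : 0 < δ) (hΩ : IsBoundedSmoothDomain Ω) (ε₀ : ℝ) {x₀ : Euc (n + 1)} {t₀ : ℝ}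
    (hx₀ : x₀ ∈ closure Ω) (h : (x₀, t₀) ∈ X.tube (2 * δ)) :
    ∃ V ∈ 𝓝 x₀, ∃ I ∈ 𝓝 t₀, ∃ L : ℝ, 0 < L ∧ ∀ t ∈ I, t ∈ Icc 0 T →
      ∃ B Ψ Φ, IsForwardChart Ω B V Ψ Φ L ∧ ∀ ε ∈ Ioc 0 ε₀, ∀ q ∈ B, Ψ q ∈ Ω → ∀ g,
        ε * |inner ℝ g (fderiv ℝ Ψ q (EuclideanSpace.single 0 1))| +
          ∑ j : Fin n, |inner ℝ g (fderiv ℝ Ψ q (EuclideanSpace.single j.succ 1))| ≤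
        L * X.anisotropicNorm δ ε t (Ψ q) g := by
  obtain ⟨hW, hr, hs, ht₀⟩ := X.mem_of_mem_tube le_rfl h
  have hXx₀ := (X.right_inv x₀ t₀ hW).2.2
  have hrI : X.r x₀ t₀ ∈ Icc (-(2 * δ)) (2 * δ) := Ioo_subset_Icc_self hr
  obtain ⟨Vt, hVto, hVt⟩ := X.tube_open (2 * δ) ⟨by linarith, le_rfl⟩
  -- the basis
  have hv₀ : x₀ ∉ Ω → ∃ U ρ, IsLocalDefiningFunction Ω x₀ U ρ ∧
      fderiv ℝ ρ x₀ (X.radialVector t₀ x₀) = 0 := by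
    intro hxΩ
    have hxf : x₀ ∈ frontier Ω := by rw [hΩ.isOpen.frontier_eq]; exact ⟨hx₀, hxΩ⟩
    obtain ⟨U, ρ, hρ⟩ := hΩ.smooth_boundary x₀ hxf
    refine ⟨U, ρ, hρ, ?_⟩
    -- If x₀ lies on ∂Ω, its parameter s lies in ∂Σ, and the whole radial curve through x₀ runs in
    -- ∂Ω. Hence ∂_rX is tangent to ∂Ω and may be the first basis vector.
    have hbd : X.s x₀ t₀ ∈ hypersurfaceBoundary Γ.S := by
      rw [← X.mem_frontier_iff _ hrI _ hs _ ht₀, hXx₀]; exact hxf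
    have h1 : HasFDerivAt ρ (fderiv ℝ ρ x₀) (X.X (X.r x₀ t₀) (X.s x₀ t₀) t₀) := by
      rw [hXx₀]
      exact ((hρ.2.2.1.contDiffAt (hρ.1.mem_nhds hρ.2.1)).differentiableAt (by simp)).hasFDerivAt
    have hrad := X.hasDerivAt_radial hW
    have h2 := h1.comp_hasDerivAt (X.r x₀ t₀) hrad
    refine h2.unique ((hasDerivAt_const _ (0 : ℝ)).congr_of_eventuallyEq ?_)
    have h3 : ∀ᶠ s in 𝓝 (X.r x₀ t₀), X.X s (X.s x₀ t₀) t₀ ∈ U :=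
      hrad.continuousAt (hρ.1.mem_nhds (by rw [hXx₀]; exact hρ.2.1))
    filter_upwards [h3, Ioo_mem_nhds hr.1 hr.2] with s hsU hsI
    exact hρ.eq_zero_of_mem_frontier hΩ.isOpen hsU
      ((X.mem_frontier_iff s (Ioo_subset_Icc_self hsI) _ hs _ ht₀).2 hbd)
  obtain ⟨b, hb0, hb⟩ := exists_basis_inward_cons (v₀ := X.radialVector t₀ x₀)
    (ℓ := (fderiv ℝ (fun y => X.r y t₀) x₀ : Euc (n + 1) →ₗ[ℝ] ℝ)) (X.fderiv_r_radialVector hW) hv₀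
  set A := coordEquiv b with hA
  -- the coordinates
  set c₀ : Euc (n + 1) →L[ℝ] ℝ := LinearMap.toContinuousLinearMap (b.coord 0) with hc₀
  set π : Euc (n + 1) →L[ℝ] Euc (n + 1) := .id ℝ _ - c₀.smulRight (b 0) with hπ
  have hπa : ∀ y, π y = y - b.coord 0 y • b 0 := fun y => rfl
  have hπ0 : π (b 0) = 0 := by rw [hπa]; simp
  have hcπ : ∀ y, b.coord 0 (π y) = 0 := fun y => by rw [hπa, map_sub, map_smul]; simp
  set Dσ := X.lateralDeriv t₀ x₀ with hDσ
  -- The first coordinate is exactly r; the others are linear functions of s, with the b₀-component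
  -- removed by π. The linear map Dσ is frozen at the base point, which makes the derivative there
  -- equal to A by the radial-lateral decomposition.
  set φ : Euc (n + 1) × ℝ → Euc (n + 1) := fun z =>
    A (X.r z.1 z.2 • b 0 + π (Dσ (X.s z.1 z.2))) with hφdef
  have hφr : ∀ z, φ z 0 = X.r z.1 z.2 := by
    intro z
    rw [hφdef]
    simp only
    rw [hA, coordEquiv_apply, map_add, map_smul, hcπ]; simp
  have hφd : ∀ x t, (x, t) ∈ X.W → HasFDerivAt (fun x => φ (x, t))
      ((A : Euc (n + 1) →L[ℝ] Euc (n + 1)).comp ((fderiv ℝ (fun y => X.r y t) x).smulRight (b 0) +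
        π.comp (Dσ.comp (fderiv ℝ (fun y => X.s y t) x)))) x := by
    intro x t hxW
    have h1 := (X.hasFDerivAt_r hxW).smul_const (b 0)
    have h2 := π.hasFDerivAt.comp x (Dσ.hasFDerivAt.comp x (X.hasFDerivAt_s hxW))
    exact A.hasFDerivAt.comp x (h1.add h2)
  have hφA : HasFDerivAt (fun x => φ (x, t₀)) (A : Euc (n + 1) →L[ℝ] Euc (n + 1)) x₀ := by
    refine (hφd x₀ t₀ hW).congr_fderiv (ContinuousLinearMap.ext fun v => ?_)
    have hdec := X.decomposition hW v
    have hrc : fderiv ℝ (fun y => X.r y t₀) x₀ v = b.coord 0 v := by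
      have : (fderiv ℝ (fun y => X.r y t₀) x₀ : Euc (n + 1) →ₗ[ℝ] ℝ) = b.coord 0 := by
        refine b.ext fun j => ?_
        refine Fin.cases ?_ (fun j => ?_) j
        · rw [hb0]; simpa [← hb0] using X.fderiv_r_radialVector hW
        · rw [(hb j).1]; simp
      exact congrArg (fun l => l v) this
    have h3 : Dσ (fderiv ℝ (fun y => X.s y t₀) x₀ v) =
        v - fderiv ℝ (fun y => X.r y t₀) x₀ v • b 0 := by
      rw [hb0, eq_sub_iff_add_eq]; exact (add_comm _ _).trans hdec.symm
    simp only [ContinuousLinearMap.comp_apply, add_apply, ContinuousLinearMap.smulRight_apply,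
      ContinuousLinearEquiv.coe_coe]
    rw [h3, map_sub, map_smul, hπ0, smul_zero, sub_zero, hπa, hrc]
    congr 1; abel
  have hφc : ContDiffAt ℝ 1 φ (x₀, t₀) := by
    have h1 : ContDiffAt ℝ 1 (fun z : Euc (n + 1) × ℝ => X.r z.1 z.2) (x₀, t₀) :=
      (X.smooth_r.contDiffAt (X.isOpen_W.mem_nhds hW)).of_le (by simp)
    have h2 : ContDiffAt ℝ 1 (fun z : Euc (n + 1) × ℝ => X.s z.1 z.2) (x₀, t₀) :=
      (X.smooth_s.contDiffAt (X.isOpen_W.mem_nhds hW)).of_le (by simp)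
    have h3 := (π.comp Dσ).contDiff.contDiffAt.comp (x₀, t₀) h2
    exact A.contDiff.contDiffAt.comp (x₀, t₀) ((h1.smul contDiffAt_const).add h3)
  have hin : ∀ j : Fin n, PointsInward Ω x₀
      ((A.symm : Euc (n + 1) →L[ℝ] Euc (n + 1)) (EuclideanSpace.single j.succ 1)) := by
    intro j
    have : (A.symm : Euc (n + 1) →L[ℝ] Euc (n + 1)) (EuclideanSpace.single j.succ 1) = b j.succ :=
      coordEquiv_symm_single b j.succ
    rw [this]; exact (hb j).2
  choose Q hQ hQf using fun j => (hin j).exists_forward hΩ.isOpen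
  have htend : Tendsto (fun z : (Euc (n + 1) × ℝ) × (Euc (n + 1) →L[ℝ] Euc (n + 1)) => (z.1.1, z.2))
      (𝓝 ((x₀, t₀), (A.symm : Euc (n + 1) →L[ℝ] Euc (n + 1))))
      (𝓝 (x₀, (A.symm : Euc (n + 1) →L[ℝ] Euc (n + 1)))) :=
    Continuous.tendsto' (by fun_prop) _ _ rfl
  have hfst : Tendsto (Prod.fst : (Euc (n + 1) × ℝ) × (Euc (n + 1) →L[ℝ] Euc (n + 1)) → _)
      (𝓝 ((x₀, t₀), (A.symm : Euc (n + 1) →L[ℝ] Euc (n + 1)))) (𝓝 (x₀, t₀)) :=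
    continuous_fst.tendsto' _ _ rfl
  have hP : ∀ᶠ z in 𝓝 ((x₀, t₀), (A.symm : Euc (n + 1) →L[ℝ] Euc (n + 1))),
      (∀ j, Q j z.1.1 z.2) ∧ z.1 ∈ X.W ∧ X.r z.1.1 z.1.2 ∈ Ioo (-(2 * δ)) (2 * δ) ∧ z.1 ∈ Vt := by
    have hrc : ∀ᶠ z : Euc (n + 1) × ℝ in 𝓝 (x₀, t₀), X.r z.1 z.2 ∈ Ioo (-(2 * δ)) (2 * δ) :=
      (X.smooth_r.continuousOn.continuousAt (X.isOpen_W.mem_nhds hW)) (Ioo_mem_nhds hr.1 hr.2)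
    exact (eventually_all.2 fun j => htend.eventually (hQ j)).and
      ((hfst.eventually (X.isOpen_W.mem_nhds hW)).and ((hfst.eventually hrc).and
        (hfst.eventually (hVto.mem_nhds (hVt.subset h).1))))
  obtain ⟨B, V, hV, I, hI, Ψ, L, hL, hBo, hBc, hch⟩ := exists_isForwardChart_family (Ω := Ω)
    (P := fun z M => (∀ j, Q j z.1 M) ∧ z ∈ X.W ∧ X.r z.1 z.2 ∈ Ioo (-(2 * δ)) (2 * δ) ∧ z ∈ Vt)
    hφc A hφA hP
  -- properties of the charts
  have hΨd : ∀ t ∈ I, ∀ q ∈ B, ∀ v, fderiv ℝ (fun y => X.r y t) (Ψ q t)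
      (fderiv ℝ (fun q => Ψ q t) q v) = v 0 := by
    intro t ht q hq v
    obtain ⟨h1, h2, -⟩ := (hch t ht).1 q hq
    have h3 := (X.hasFDerivAt_r h2.2.1).comp q h1.hasFDerivAt
    have h4 : HasFDerivAt (fun q : Euc (n + 1) => q 0)
        (EuclideanSpace.proj (0 : Fin (n + 1)) : Euc (n + 1) →L[ℝ] ℝ) q :=
      (EuclideanSpace.proj (0 : Fin (n + 1)) : Euc (n + 1) →L[ℝ] ℝ).hasFDerivAt
    have h5 := h3.unique (h4.congr_of_eventuallyEq ?_)
    · exact congrArg (fun l => l v) h5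
    · filter_upwards [hBo.mem_nhds hq] with p hp
      have := hφr (Ψ p t, t)
      rw [((hch t ht).1 p hp).2.2.1] at this
      exact this.symm
  -- The derivative of φ sends ∂_rX to A b₀, the first unit vector, at every point of the chart. The
  -- derivative of Ψ is injective, hence surjective, and therefore takes the first unit vector back
  -- to ∂_rX.
  have hΨ0 : ∀ t ∈ I, ∀ q ∈ B, fderiv ℝ (fun q => Ψ q t) q (EuclideanSpace.single 0 1) =
      X.radialVector t (Ψ q t) := by
    intro t ht q hq
    obtain ⟨h1, h2, -⟩ := (hch t ht).1 q hq
    have h3 := (hφd _ t h2.2.1).comp q h1.hasFDerivAt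
    have h5 := h3.unique ((hasFDerivAt_id q).congr_of_eventuallyEq (by
      filter_upwards [hBo.mem_nhds hq] with p hp using ((hch t ht).1 p hp).2.2.1))
    have hinj : Function.Injective (fderiv ℝ (fun q => Ψ q t) q : Euc (n + 1) →ₗ[ℝ] Euc (n + 1)) := by
      intro v v' hv
      have e1 := congrArg (fun l => l v) h5
      have e2 := congrArg (fun l => l v') h5
      simp only [ContinuousLinearMap.comp_apply, ContinuousLinearMap.id_apply] at e1 e2
      rw [← e1, ← e2]
      have hv' : fderiv ℝ (fun q => Ψ q t) q v = fderiv ℝ (fun q => Ψ q t) q v' := hv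
      rw [hv']
    obtain ⟨v, hv⟩ := LinearMap.injective_iff_surjective.1 hinj (X.radialVector t (Ψ q t))
    have hv' : fderiv ℝ (fun q => Ψ q t) q v = X.radialVector t (Ψ q t) := hv
    have e1 := congrArg (fun l => l v) h5
    simp only [ContinuousLinearMap.comp_apply, ContinuousLinearMap.id_apply, hv', add_apply,
      ContinuousLinearMap.smulRight_apply, X.fderiv_r_radialVector h2.2.1,
      X.fderiv_s_radialVector h2.2.1, map_zero, add_zero, one_smul] at e1
    have e2 : A (b 0) = EuclideanSpace.single 0 1 := by
      rw [hA, ← coordEquiv_symm_single b 0, ContinuousLinearEquiv.apply_symm_apply]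
    rw [← hv', ← e1, ← e2]; rfl
  -- Relative openness of the tube is essential: Ω-points of the chart lie in the tube itself, so
  -- their parameter s is in Σ and not merely in the larger hypersurface Σ₀.
  have hΨtube : ∀ t ∈ I, t ∈ Icc 0 T → ∀ q ∈ B, Ψ q t ∈ Ω → X.s (Ψ q t) t ∈ Γ.S := by
    intro t ht hT q hq hqΩ
    have : (Ψ q t, t) ∈ X.tube (2 * δ) :=
      hVt.symm.subset ⟨((hch t ht).1 q hq).2.1.2.2.2, subset_closure hqΩ, hT⟩
    exact (X.mem_of_mem_tube le_rfl this).2.2.1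
  have hn0 : (0 : ℝ) ≤ n := Nat.cast_nonneg n
  have hL1 : 0 ≤ |ε₀| * L := mul_nonneg (abs_nonneg _) hL.le
  have hL2 : 0 ≤ n * L := mul_nonneg hn0 hL.le
  have hLL : L ≤ 1 + (1 + |ε₀| + n) * L := by nlinarith
  refine ⟨V, hV, I, hI, 1 + (1 + |ε₀| + n) * L, by linarith, fun t ht hT =>
    ⟨B, fun q => Ψ q t, fun x => φ (x, t), IsForwardChart.mono ?_ hLL, fun ε hε q hq hqΩ g => ?_⟩⟩
  · refine (hch t ht).2 fun q hq hqΩ j τ hτ hqτ => ?_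
    refine Fin.cases (fun hqτ => ?_) (fun j hqτ => ?_) j hqτ
    · -- along the radial lines
      have hline := hBc.add_smul_mem_of_le hq hqτ
      have hconst : ∀ s ∈ Icc 0 τ, X.s (Ψ (q + s • EuclideanSpace.single 0 1) t) t =
          X.s (Ψ (q + (0 : ℝ) • EuclideanSpace.single 0 1) t) t := by
        have hd : ∀ s ∈ Icc 0 τ, HasDerivAt
            (fun s : ℝ => X.s (Ψ (q + s • EuclideanSpace.single 0 1) t) t) 0 s := by
          intro s hs
          have hl : HasDerivAt (fun s : ℝ => q + s • EuclideanSpace.single 0 (1 : ℝ))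
              (EuclideanSpace.single 0 1) s := by
            simpa using ((hasDerivAt_id s).smul_const (EuclideanSpace.single 0 (1 : ℝ))).const_add q
          obtain ⟨h1, h2, -⟩ := (hch t ht).1 _ (hline s hs)
          have h3 := h1.hasFDerivAt.comp_hasDerivAt s hl
          rw [hΨ0 t ht _ (hline s hs)] at h3
          have h4 := (X.hasFDerivAt_s h2.2.1).comp_hasDerivAt s h3
          rwa [X.fderiv_s_radialVector h2.2.1] at h4
        exact constant_of_has_deriv_right_zero
          (fun s hs => (hd s hs).continuousAt.continuousWithinAt)
          (fun s hs => (hd s (Ico_subset_Icc_self hs)).hasDerivWithinAt)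
      have hc := hconst τ (right_mem_Icc.2 hτ)
      rw [zero_smul, add_zero] at hc
      have hS := hΨtube t ht hT q hq hqΩ
      obtain ⟨-, ⟨-, hW1, hr1, -⟩, -⟩ := (hch t ht).1 q hq
      obtain ⟨-, ⟨-, hW2, hr2, -⟩, -⟩ := (hch t ht).1 _ hqτ
      simp only at hW1 hr1 hW2 hr2
      have e1 := (X.right_inv _ t hW1).2.2
      have e2 := (X.right_inv _ t hW2).2.2
      rw [hc] at e2
      -- The radial direction is not inward, so a different reason keeps the line in Ω: s stays
      -- constant along it, and whether X(ρ, s, t) lies on ∂Ω depends only on whether s ∈ ∂Σ.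
      have hnb : X.s (Ψ q t) t ∉ hypersurfaceBoundary Γ.S := by
        rw [← X.mem_frontier_iff _ (Ioo_subset_Icc_self hr1) _ hS _ hT, e1, hΩ.isOpen.frontier_eq]
        exact fun hh => hh.2 hqΩ
      have hcl := X.maps_closure _ (Ioo_subset_Icc_self hr2) _ hS _ hT
      rw [← X.mem_frontier_iff _ (Ioo_subset_Icc_self hr2) _ hS _ hT, e2,
        hΩ.isOpen.frontier_eq] at hnb
      rw [e2] at hcl
      by_contra hh
      exact hnb ⟨hcl, hh⟩
    · exact hQf j B (fun q => Ψ q t) hBc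
        (fun p hp => ⟨((hch t ht).1 p hp).1, ((hch t ht).1 p hp).2.1.1 j⟩) q hq hqΩ τ hτ hqτ
  · obtain ⟨-, ⟨-, hW1, -⟩, -, -, hM⟩ := (hch t ht).1 q hq
    have hg := norm_nonneg g
    have h4 : 0 ≤ L * ‖g‖ := by positivity
    rw [CurvilinearCoordinates.anisotropicNorm]
    split_ifs with htube
    · have hτ0 := norm_nonneg (X.tangentialGrad t (Ψ q t) g)
      have h2 : ∑ j : Fin n, |inner ℝ g (fderiv ℝ (fun q => Ψ q t) q
          (EuclideanSpace.single j.succ 1))| ≤ n * (L * ‖X.tangentialGrad t (Ψ q t) g‖) := by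
        have h3 : ∀ j : Fin n, |inner ℝ g (fderiv ℝ (fun q => Ψ q t) q
            (EuclideanSpace.single j.succ 1))| ≤ L * ‖X.tangentialGrad t (Ψ q t) g‖ := by
          intro j
          -- The remaining coordinate directions leave r unchanged, so the full gradient may be
          -- replaced by ∇_τ.
          rw [← X.tangentialGrad_inner hW1 (v := fderiv ℝ (fun q => Ψ q t) q
            (EuclideanSpace.single j.succ 1)) (by rw [hΨd t ht q hq]; simp) g]
          exact abs_inner_clm_single_le hM j.succ
        exact (Finset.sum_le_sum fun j _ => h3 j).trans_eq (by simp)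
      rw [hΨ0 t ht q hq, ← X.normalDeriv_eq]
      have h5 : 0 ≤ ε * |X.normalDeriv t (Ψ q t) g| := mul_nonneg hε.1.le (abs_nonneg _)
      refine (add_le_add_right h2 _).trans ?_
      have h6 := mul_nonneg hL.le hτ0
      have h7 := mul_nonneg hL1 hτ0
      have h8 := mul_nonneg (by positivity : 0 ≤ (1 + |ε₀| + n) * L) h5
      nlinarith
    · have h1 := abs_inner_clm_single_le (g := g) hM 0
      have h2 : ∑ j : Fin n, |inner ℝ g (fderiv ℝ (fun q => Ψ q t) q
          (EuclideanSpace.single j.succ 1))| ≤ n * (L * ‖g‖) := by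
        refine (Finset.sum_le_sum fun j _ => abs_inner_clm_single_le (g := g) hM j.succ).trans ?_
        simp
      have h3 : ε * |inner ℝ g (fderiv ℝ (fun q => Ψ q t) q (EuclideanSpace.single 0 1))| ≤
          |ε₀| * (L * ‖g‖) :=
        mul_le_mul (hε.2.trans (le_abs_self _)) h1 (abs_nonneg _) (abs_nonneg _)
      calc _ ≤ |ε₀| * (L * ‖g‖) + n * (L * ‖g‖) := add_le_add h3 h2
        _ ≤ _ := by nlinarith

end Charts

/-! ### From local charts to an inequality uniform in ε and t. -/

section GlobalInequality

open Filter Topology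
open scoped ENNReal

variable {n : ℕ} {Ω : Set (Euc (n + 1))} {T δ : ℝ} {Γ : EvolvingHypersurface Ω T}

theorem CurvilinearCoordinates.anisotropicNorm_nonneg {N : ℕ} {Ω : Set (Euc N)} {T w : ℝ}
    {Γ : EvolvingHypersurface Ω T} (X : CurvilinearCoordinates Γ w) {η ε : ℝ} (hε : 0 ≤ ε) (t : ℝ)
    (x g : Euc N) : 0 ≤ X.anisotropicNorm η ε t x g := by
  rw [CurvilinearCoordinates.anisotropicNorm]
  split_ifs <;> positivity

theorem fderiv_apply_eq_inner_gradient {N : ℕ} (ψ : Euc N → ℝ) (x v : Euc N) :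
    fderiv ℝ ψ x v = inner ℝ (gradient ψ x) v := by
  rw [inner_gradient_left]

theorem CurvilinearCoordinates.exists_isForwardChart (X : CurvilinearCoordinates Γ (2 * δ))
    (hδ : 0 < δ) (hΩ : IsBoundedSmoothDomain Ω) (ε₀ : ℝ) (t₀ : ℝ) {x₀ : Euc (n + 1)}
    (hx₀ : x₀ ∈ closure Ω) :
    ∃ V ∈ 𝓝 x₀, ∃ I ∈ 𝓝 t₀, ∃ L : ℝ, 0 < L ∧ ∀ t ∈ I, t ∈ Icc 0 T →
      ∃ B Ψ Φ, IsForwardChart Ω B V Ψ Φ L ∧ ∀ ε ∈ Ioc 0 ε₀, ∀ q ∈ B, Ψ q ∈ Ω → ∀ g,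
        ε * |inner ℝ g (fderiv ℝ Ψ q (EuclideanSpace.single 0 1))| +
          ∑ j : Fin n, |inner ℝ g (fderiv ℝ Ψ q (EuclideanSpace.single j.succ 1))| ≤
        L * X.anisotropicNorm δ ε t (Ψ q) g := by
  by_cases h : (x₀, t₀) ∈ X.tube (2 * δ)
  · exact X.exists_isForwardChart_of_mem hδ hΩ ε₀ hx₀ h
  · exact X.exists_isForwardChart_of_notMem hδ hΩ ε₀ hx₀ h

/-- The localized inequality in a neighbourhood of a point in space-time. -/
theorem CurvilinearCoordinates.exists_local_gagliardoNirenberg (hn : 1 ≤ n)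
    (X : CurvilinearCoordinates Γ (2 * δ)) (hΩ : IsBoundedSmoothDomain Ω)
    {ε₀ : ℝ} {V : Set (Euc (n + 1))} {I : Set ℝ} {L : ℝ} (hL : 0 < L)
    (hch : ∀ t ∈ I, t ∈ Icc 0 T →
      ∃ B Ψ Φ, IsForwardChart Ω B V Ψ Φ L ∧ ∀ ε ∈ Ioc 0 ε₀, ∀ q ∈ B, Ψ q ∈ Ω → ∀ g,
        ε * |inner ℝ g (fderiv ℝ Ψ q (EuclideanSpace.single 0 1))| +
          ∑ j : Fin n, |inner ℝ g (fderiv ℝ Ψ q (EuclideanSpace.single j.succ 1))| ≤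
        L * X.anisotropicNorm δ ε t (Ψ q) g)
    {χ : Euc (n + 1) → ℝ} (hχ : ContDiff ℝ ∞ χ) (hχc : HasCompactSupport χ) (hχV : tsupport χ ⊆ V)
    (hχ0 : ∀ x, 0 ≤ χ x) (hχ1 : ∀ x, χ x ≤ 1) :
    ∃ C : ℝ≥0∞, C ≠ ⊤ ∧ ∀ ε ∈ Ioc 0 ε₀, ∀ t ∈ I, t ∈ Icc 0 T → ∀ ψ, ContDiffOn ℝ 1 ψ (closure Ω) →
      ENNReal.ofReal ε ^ (2 / (n + 1 : ℝ)) *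
        ∫⁻ x in Ω, ENNReal.ofReal |χ x * ψ x| ^ (2 + 4 / (n + 1 : ℝ)) ≤
      C * ((∫⁻ x in Ω, ENNReal.ofReal |ψ x| ^ (2 : ℝ)) ^ (2 / (n + 1 : ℝ)) *
        ∫⁻ x in Ω, ENNReal.ofReal (|ψ x| +
          X.anisotropicNorm δ ε t x (gradient ψ x)) ^ (2 : ℝ)) := by
  obtain ⟨L', hL'⟩ : ∃ L', ∀ x, ‖fderiv ℝ χ x‖ ≤ L' :=
    (hχ.continuous_fderiv (by simp)).bounded_above_of_compact_support (hχc.fderiv (𝕜 := ℝ))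
  have hL'0 : 0 ≤ L' := (norm_nonneg _).trans (hL' 0)
  set M := L + (|ε₀| + n) * (L' * L) with hM
  have hM0 : 0 ≤ M := by positivity
  refine ⟨ENNReal.ofReal L * (ENNReal.ofReal (2 * (n + 3) * n / (n + 1) ^ 2) ^ (2 : ℝ) *
    ENNReal.ofReal L ^ (2 / (n + 1 : ℝ)) * (ENNReal.ofReal L * ENNReal.ofReal M ^ (2 : ℝ))), ?_, ?_⟩
  · have h2 : (0 : ℝ) ≤ 2 / (n + 1 : ℝ) := by positivity
    have := ENNReal.rpow_ne_top_of_nonneg h2 (ENNReal.ofReal_ne_top (r := L))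
    have := ENNReal.rpow_ne_top_of_nonneg zero_le_two (ENNReal.ofReal_ne_top (r := M))
    have := ENNReal.rpow_ne_top_of_nonneg zero_le_two
      (ENNReal.ofReal_ne_top (r := 2 * (n + 3) * n / (n + 1) ^ 2))
    finiteness
  · intro ε hε t htI ht ψ hψ
    obtain ⟨B, Ψ, Φ, hF, hE⟩ := hch t htI ht
    have hψc := isC1Closure_of_contDiffOn hΩ hψ
    obtain ⟨A₁, hA₁⟩ := hΩ.isCompact_closure.exists_bound_of_continuousOn hψc.continuousOn
    obtain ⟨A₂, hA₂⟩ := hψc.bounded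
    -- The radial direction gets weight ε, as in the energy, and the others weight 1. Their product
    -- ε produces the factor ε^(2/N) on the left.
    set a : Fin (n + 1) → ℝ := Fin.cons ε fun _ => 1 with ha
    have ha0 : ∀ j, 0 < a j := fun j => Fin.cases hε.1 (fun j => by simp [ha]) j
    have hasum : ∑ j, a j = ε + n := by rw [Fin.sum_univ_succ]; simp [ha]
    have haprod : ∏ j, ENNReal.ofReal (a j) = ENNReal.ofReal ε := by
      rw [Fin.prod_univ_succ]; simp [ha]
    have h := hF.lintegral_rpow_le hn hL hΩ.isOpen (ψ := ψ) (χ := χ)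
      (E := fun x => L * X.anisotropicNorm δ ε t x (gradient ψ x)) (A := max A₁ A₂) (L' := L')
      hψc.contDiffOn (fun x hx => (hA₁ x (subset_closure hx)).trans (le_max_left _ _))
      (fun x hx => (hA₂ x hx).trans (le_max_right _ _)) (hχ.of_le (by simp)) hχc hχV
      (fun x => by rw [abs_of_nonneg (hχ0 x)]; exact hχ1 x) hL' (a := a) ha0
      (fun q hq hqΩ => by
        simp only [fderiv_apply_eq_inner_gradient]
        rw [Fin.sum_univ_succ]
        simpa [ha] using hE ε hε q hq hqΩ (gradient ψ (Ψ q)))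
    rw [haprod] at h
    refine h.trans ?_
    have hZ : ∫⁻ x in Ω, ENNReal.ofReal (L * X.anisotropicNorm δ ε t x (gradient ψ x) +
        (∑ j, a j) * (L' * L) * |ψ x|) ^ (2 : ℝ) ≤ ENNReal.ofReal M ^ (2 : ℝ) *
        ∫⁻ x in Ω, ENNReal.ofReal (|ψ x| +
          X.anisotropicNorm δ ε t x (gradient ψ x)) ^ (2 : ℝ) := by
      rw [← lintegral_const_mul' _ _ (ENNReal.rpow_ne_top_of_nonneg zero_le_two
        ENNReal.ofReal_ne_top)]
      refine lintegral_mono fun x => ?_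
      dsimp only
      rw [← ENNReal.mul_rpow_of_nonneg _ _ zero_le_two, ← ENNReal.ofReal_mul hM0]
      refine ENNReal.rpow_le_rpow (ENNReal.ofReal_le_ofReal ?_) zero_le_two
      have h1 := X.anisotropicNorm_nonneg (η := δ) hε.1.le t x (gradient ψ x)
      have h2 := abs_nonneg (ψ x)
      have h3 : ε ≤ |ε₀| := hε.2.trans (le_abs_self _)
      have h4 : (ε + n) * (L' * L) ≤ (|ε₀| + n) * (L' * L) := by gcongr
      have h5 : 0 ≤ (|ε₀| + n) * (L' * L) := by positivity
      rw [hasum, hM]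
      have h6 := mul_le_mul_of_nonneg_right h4 h2
      have h7 := mul_nonneg h5 h1
      have h8 := mul_nonneg hL.le h2
      linarith
    calc _ ≤ ENNReal.ofReal L * (ENNReal.ofReal (2 * (n + 3) * n / (n + 1) ^ 2) ^ (2 : ℝ) *
        (ENNReal.ofReal L * ∫⁻ x in Ω, ENNReal.ofReal |ψ x| ^ (2 : ℝ)) ^ (2 / (n + 1 : ℝ)) *
        (ENNReal.ofReal L * (ENNReal.ofReal M ^ (2 : ℝ) * ∫⁻ x in Ω, ENNReal.ofReal (|ψ x| +
          X.anisotropicNorm δ ε t x (gradient ψ x)) ^ (2 : ℝ)))) := by gcongr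
      _ = _ := by
        rw [ENNReal.mul_rpow_of_nonneg _ _ (by positivity)]
        ring

/-- The anisotropic Gagliardo-Nirenberg inequality, for times near a given one. -/
theorem CurvilinearCoordinates.exists_gagliardoNirenberg_near (hn : 1 ≤ n)
    (X : CurvilinearCoordinates Γ (2 * δ)) (hδ : 0 < δ) (hΩ : IsBoundedSmoothDomain Ω)
    (ε₀ t₀ : ℝ) :
    ∃ I ∈ 𝓝 t₀, ∃ C : ℝ≥0∞, C ≠ ⊤ ∧ ∀ ε ∈ Ioc 0 ε₀, ∀ t ∈ I, t ∈ Icc 0 T →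
      ∀ ψ, ContDiffOn ℝ 1 ψ (closure Ω) →
      ENNReal.ofReal ε ^ (2 / (n + 1 : ℝ)) *
        ∫⁻ x in Ω, ENNReal.ofReal |ψ x| ^ (2 + 4 / (n + 1 : ℝ)) ≤
      C * ((∫⁻ x in Ω, ENNReal.ofReal |ψ x| ^ (2 : ℝ)) ^ (2 / (n + 1 : ℝ)) *
        ∫⁻ x in Ω, ENNReal.ofReal (|ψ x| +
          X.anisotropicNorm δ ε t x (gradient ψ x)) ^ (2 : ℝ)) := by
  choose! V hV I hI L hL hch using fun x (hx : x ∈ closure Ω) =>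
    X.exists_isForwardChart hδ hΩ ε₀ t₀ hx
  obtain ⟨s, χ, hsc, hχ, hχc, hχV, hχ0, hχ1, hχs⟩ := hΩ.isCompact_closure.exists_smooth_partition hV
  choose! C hC hGN using fun x (hx : x ∈ s) => X.exists_local_gagliardoNirenberg hn hΩ
    (hL x (hsc x hx)) (hch x (hsc x hx)) (hχ x) (hχc x) (hχV x hx) (hχ0 x) (hχ1 x)
  have hp1 : (1 : ℝ) ≤ 2 + 4 / (n + 1 : ℝ) := by
    have : (0 : ℝ) ≤ 4 / (n + 1 : ℝ) := by positivity
    linarith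
  refine ⟨⋂ x ∈ s, I x, (biInter_finset_mem s).2 fun x hx => hI x (hsc x hx),
    ((s.card : ℝ≥0∞)) ^ (2 + 4 / (n + 1 : ℝ) - 1) * ∑ x ∈ s, C x, ?_, ?_⟩
  · refine ENNReal.mul_ne_top (ENNReal.rpow_ne_top_of_nonneg (by linarith)
      (ENNReal.natCast_ne_top _)) (ENNReal.sum_ne_top.2 hC)
  · intro ε hε t htI ht ψ hψ
    set R := (∫⁻ x in Ω, ENNReal.ofReal |ψ x| ^ (2 : ℝ)) ^ (2 / (n + 1 : ℝ)) *
        ∫⁻ x in Ω, ENNReal.ofReal (|ψ x| +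
          X.anisotropicNorm δ ε t x (gradient ψ x)) ^ (2 : ℝ) with hR
    have hmeas : ∀ z ∈ s, AEMeasurable (fun x => ENNReal.ofReal |χ z x * ψ x| ^
        (2 + 4 / (n + 1 : ℝ))) (volume.restrict Ω) := by
      intro z _
      have : ContinuousOn (fun x => χ z x * ψ x) Ω :=
        (hχ z).continuous.continuousOn.mul (hψ.continuousOn.mono subset_closure)
      exact ((this.abs.aemeasurable hΩ.isOpen.measurableSet).ennreal_ofReal).pow_const _
    have hpt : ∀ x ∈ Ω, ENNReal.ofReal |ψ x| ^ (2 + 4 / (n + 1 : ℝ)) ≤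
        (s.card : ℝ≥0∞) ^ (2 + 4 / (n + 1 : ℝ) - 1) *
          ∑ z ∈ s, ENNReal.ofReal |χ z x * ψ x| ^ (2 + 4 / (n + 1 : ℝ)) := by
      intro x hx
      refine le_trans ?_ (ENNReal.rpow_sum_le_const_mul_sum_rpow s
        (fun z => ENNReal.ofReal |χ z x * ψ x|) hp1)
      gcongr
      rw [← ENNReal.ofReal_sum_of_nonneg fun z _ => abs_nonneg _]
      refine ENNReal.ofReal_le_ofReal ?_
      calc |ψ x| = |∑ z ∈ s, χ z x * ψ x| := by
            rw [← Finset.sum_mul, hχs x (subset_closure hx), one_mul]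
        _ ≤ _ := Finset.abs_sum_le_sum_abs _ _
    have hcard : (s.card : ℝ≥0∞) ^ (2 + 4 / (n + 1 : ℝ) - 1) ≠ ⊤ :=
      ENNReal.rpow_ne_top_of_nonneg (by linarith) (ENNReal.natCast_ne_top _)
    calc ENNReal.ofReal ε ^ (2 / (n + 1 : ℝ)) *
        ∫⁻ x in Ω, ENNReal.ofReal |ψ x| ^ (2 + 4 / (n + 1 : ℝ))
        ≤ ENNReal.ofReal ε ^ (2 / (n + 1 : ℝ)) * ∫⁻ x in Ω,
          (s.card : ℝ≥0∞) ^ (2 + 4 / (n + 1 : ℝ) - 1) *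
          ∑ z ∈ s, ENNReal.ofReal |χ z x * ψ x| ^ (2 + 4 / (n + 1 : ℝ)) := by
          exact mul_le_mul_right (setLIntegral_mono' hΩ.isOpen.measurableSet hpt) _
      _ = (s.card : ℝ≥0∞) ^ (2 + 4 / (n + 1 : ℝ) - 1) * ∑ z ∈ s,
          ENNReal.ofReal ε ^ (2 / (n + 1 : ℝ)) *
            ∫⁻ x in Ω, ENNReal.ofReal |χ z x * ψ x| ^ (2 + 4 / (n + 1 : ℝ)) := by
          rw [lintegral_const_mul' _ _ hcard, lintegral_finsetSum' _ hmeas, Finset.mul_sum,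
            Finset.mul_sum, Finset.mul_sum]
          exact Finset.sum_congr rfl fun z _ => by ring
      _ ≤ (s.card : ℝ≥0∞) ^ (2 + 4 / (n + 1 : ℝ) - 1) * ∑ z ∈ s, C z * R := by
          refine mul_le_mul_right (Finset.sum_le_sum fun z hz => ?_) _
          exact hGN z hz ε hε t (mem_iInter₂.1 htI z hz) ht ψ hψ
      _ = _ := by rw [← Finset.sum_mul, mul_assoc]

/-- The anisotropic Gagliardo-Nirenberg inequality, uniformly in time. -/
theorem CurvilinearCoordinates.exists_gagliardoNirenberg (hn : 1 ≤ n)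
    (X : CurvilinearCoordinates Γ (2 * δ)) (hδ : 0 < δ) (hΩ : IsBoundedSmoothDomain Ω) (ε₀ : ℝ) :
    ∃ C : ℝ≥0∞, C ≠ ⊤ ∧ ∀ ε ∈ Ioc 0 ε₀, ∀ t ∈ Icc 0 T, ∀ ψ, ContDiffOn ℝ 1 ψ (closure Ω) →
      ENNReal.ofReal ε ^ (2 / (n + 1 : ℝ)) *
        ∫⁻ x in Ω, ENNReal.ofReal |ψ x| ^ (2 + 4 / (n + 1 : ℝ)) ≤
      C * ((∫⁻ x in Ω, ENNReal.ofReal |ψ x| ^ (2 : ℝ)) ^ (2 / (n + 1 : ℝ)) *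
        ∫⁻ x in Ω, ENNReal.ofReal (|ψ x| +
          X.anisotropicNorm δ ε t x (gradient ψ x)) ^ (2 : ℝ)) := by
  choose I hI C hC hGN using fun t₀ => X.exists_gagliardoNirenberg_near hn hδ hΩ ε₀ t₀
  -- Finitely many of the neighbourhoods cover the time interval, and the sum of their constants
  -- dominates each of them.
  obtain ⟨s, -, hs⟩ := isCompact_Icc.elim_nhds_subcover (s := Icc 0 T) I fun t _ => hI t
  refine ⟨∑ t ∈ s, C t, ENNReal.sum_ne_top.2 fun t _ => hC t, fun ε hε t ht ψ hψ => ?_⟩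
  obtain ⟨z, hz, htz⟩ := mem_iUnion₂.1 (hs ht)
  refine (hGN z ε hε t htz ht ψ hψ).trans ?_
  gcongr
  exact Finset.single_le_sum (f := C) (fun _ _ => zero_le) hz

end GlobalInequality

/-! ### Continuity and bounds for the normal and tangential derivatives. -/

namespace CurvilinearCoordinates

open Filter Topology

variable {N : ℕ} {Ω : Set (Euc N)} {T w : ℝ} {Γ : EvolvingHypersurface Ω T}
  (X : CurvilinearCoordinates Γ w)

/-- The operator taking a gradient to its tangential part. -/
noncomputable def tangentialOp (p : Euc N × ℝ) : Euc N →L[ℝ] Euc N :=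
  (ContinuousLinearMap.adjoint (fderiv ℝ (fun y => X.s y p.2) p.1)).comp
    (ContinuousLinearMap.adjoint (X.lateralDeriv p.2 p.1))

theorem tangentialGrad_eq (t : ℝ) (x g : Euc N) :
    X.tangentialGrad t x g = X.tangentialOp (x, t) g := rfl

theorem continuousOn_coords : ContinuousOn (fun p : Euc N × ℝ => (X.r p.1 p.2, X.s p.1 p.2, p.2))
    X.W :=
  X.smooth_r.continuousOn.prodMk (X.smooth_s.continuousOn.prodMk continuousOn_snd)

theorem continuousOn_fderiv_X : ContinuousOn (fun p : Euc N × ℝ =>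
    fderiv ℝ (fun p : ℝ × Euc N × ℝ => X.X p.1 p.2.1 p.2.2) (X.r p.1 p.2, X.s p.1 p.2, p.2)) X.W :=
  (X.smooth_X.continuousOn_fderiv_of_isOpen X.isOpen_O (by simp)).comp X.continuousOn_coords
    fun p hp => (X.right_inv p.1 p.2 hp).1

theorem continuousOn_radialVector :
    ContinuousOn (fun p : Euc N × ℝ => X.radialVector p.2 p.1) X.W :=
  (X.continuousOn_fderiv_X.clm_apply continuousOn_const).congr fun _ hp => X.radialVector_eq hp

theorem continuousOn_tangentialOp : ContinuousOn X.tangentialOp X.W := by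
  have h1 : ContinuousOn (fun p : Euc N × ℝ => X.lateralDeriv p.2 p.1) X.W :=
    (X.continuousOn_fderiv_X.clm_comp continuousOn_const).congr fun p hp => X.lateralDeriv_eq hp
  have h2 : ContinuousOn (fun p : Euc N × ℝ => fderiv ℝ (fun y => X.s y p.2) p.1) X.W := by
    refine ((X.smooth_s.continuousOn_fderiv_of_isOpen X.isOpen_W (by simp)).clm_comp
      (continuousOn_const (c := ContinuousLinearMap.inl ℝ (Euc N) ℝ))).congr fun p hp => ?_
    have h3 := ((X.smooth_s.contDiffAt (X.isOpen_W.mem_nhds hp)).differentiableAt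
      (by simp)).hasFDerivAt
    have h4 : HasFDerivAt (fun y : Euc N => (y, p.2)) (ContinuousLinearMap.inl ℝ (Euc N) ℝ) p.1 :=
      hasFDerivAt_prodMk_left p.1 p.2
    exact (HasFDerivAt.comp (f := fun y : Euc N => (y, p.2)) p.1
      (g := fun p : Euc N × ℝ => X.s p.1 p.2) h3 h4).fderiv
  have hadj : Continuous (ContinuousLinearMap.adjoint : (Euc N →L[ℝ] Euc N) → _) :=
    ContinuousLinearMap.adjoint.continuous
  exact (hadj.comp_continuousOn h2).clm_comp (hadj.comp_continuousOn h1)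

/-- The coefficient fields are continuous on the coordinate domain, hence bounded on a compact set
between the tubes of widths η and w; this uses η < w. The bound is taken at least 1 so that it may
later be divided by. -/
theorem exists_gradient_bound {η : ℝ} (hη : η < w) : ∃ B : ℝ, 1 ≤ B ∧ ∀ t, ∀ x ∈ X.tubeAt η t,
    ∀ g, ‖X.tangentialGrad t x g‖ ≤ B * ‖g‖ ∧ |X.normalDeriv t x g| ≤ B * ‖g‖ := by
  obtain ⟨K, hKc, hK1, hK2⟩ := X.exists_compact_tube hη le_rfl
  have hKW : K ⊆ X.W := fun p hp => (X.mem_of_mem_tube (x := p.1) (t := p.2) le_rfl (hK2 hp)).1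
  obtain ⟨B₁, h1⟩ := hKc.exists_bound_of_continuousOn (X.continuousOn_tangentialOp.mono hKW)
  obtain ⟨B₂, h2⟩ := hKc.exists_bound_of_continuousOn (X.continuousOn_radialVector.mono hKW)
  refine ⟨max 1 (max B₁ B₂), le_max_left _ _, fun t x hx g => ⟨?_, ?_⟩⟩
  · rw [tangentialGrad_eq]
    refine (ContinuousLinearMap.le_opNorm _ _).trans ?_
    gcongr
    exact (h1 _ (hK1 hx)).trans ((le_max_left _ _).trans (le_max_right _ _))
  · rw [normalDeriv_eq]
    refine (abs_real_inner_le_norm _ _).trans ?_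
    rw [mul_comm]
    gcongr
    exact (h2 _ (hK1 hx)).trans ((le_max_right _ _).trans (le_max_right _ _))

theorem measurableSet_tube {η : ℝ} (hη : η ∈ Ioc 0 w) : MeasurableSet (X.tube η) := by
  obtain ⟨V, hV, h⟩ := X.tube_open η hη
  rw [tube, h]
  exact hV.measurableSet.inter (isClosed_closure.measurableSet.prod measurableSet_Icc)

theorem measurableSet_tubeAt {η : ℝ} (hη : η ∈ Ioc 0 w) (t : ℝ) : MeasurableSet (X.tubeAt η t) :=
  measurable_prodMk_right (X.measurableSet_tube hη)

theorem tube_subset_W {η : ℝ} (hη : η ≤ w) : X.tube η ⊆ X.W :=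
  fun p hp => (X.mem_of_mem_tube (x := p.1) (t := p.2) hη hp).1

theorem continuousOn_tangentialGrad {A : Set (Euc N × ℝ)} (hA : A ⊆ X.W) {g : Euc N × ℝ → Euc N}
    (hg : ContinuousOn g A) : ContinuousOn (fun p => X.tangentialGrad p.2 p.1 (g p)) A :=
  (X.continuousOn_tangentialOp.mono hA).clm_apply hg

theorem continuousOn_normalDeriv {A : Set (Euc N × ℝ)} (hA : A ⊆ X.W) {g : Euc N × ℝ → Euc N}
    (hg : ContinuousOn g A) : ContinuousOn (fun p => X.normalDeriv p.2 p.1 (g p)) A :=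
  hg.inner (X.continuousOn_radialVector.mono hA)

end CurvilinearCoordinates

/-! ### Square integrability of the gradient parts at fixed time. -/

section SliceIntegrals

open Filter Topology

variable {N : ℕ} {Ω : Set (Euc N)} {T w η : ℝ} {Γ : EvolvingHypersurface Ω T}
  (X : CurvilinearCoordinates Γ w)

theorem IsBoundedSmoothDomain.integrableOn_of_bound {V : Type*} [NormedAddCommGroup V]
    (hΩ : IsBoundedSmoothDomain Ω) {A : Set (Euc N)} (hA : MeasurableSet A) (hAΩ : A ⊆ Ω)
    {F : Euc N → V} (hF : ContinuousOn F A) {B : ℝ} (hB : ∀ x ∈ A, ‖F x‖ ≤ B) :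
    IntegrableOn F A := by
  have : IsFiniteMeasure (volume.restrict A) :=
    ⟨by simpa using (measure_mono hAΩ).trans_lt hΩ.isBounded.measure_lt_top⟩
  exact Integrable.of_bound (hF.aestronglyMeasurable hA) B
    ((ae_restrict_mem hA).mono fun x hx => hB x hx)

/-- The parts of the gradient in and off the tube are square integrable. -/
theorem CurvilinearCoordinates.integrableOn_slices (hΩ : IsBoundedSmoothDomain Ω) (hη : 0 < η)
    (hηw : η < w) {ψ : Euc N → ℝ} (hψ : ContDiffOn ℝ 1 ψ (closure Ω)) (t : ℝ) :
    IntegrableOn (fun x => ‖X.tangentialGrad t x (gradient ψ x)‖ ^ 2) (Ω ∩ X.tubeAt η t) ∧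
    IntegrableOn (fun x => X.normalDeriv t x (gradient ψ x) ^ 2) (Ω ∩ X.tubeAt η t) ∧
    IntegrableOn (fun x => ‖gradient ψ x‖ ^ 2) Ω := by
  have hψc := isC1Closure_of_contDiffOn hΩ hψ
  obtain ⟨C, hC⟩ := hψc.bounded
  have hgn : ∀ x, ‖gradient ψ x‖ = ‖fderiv ℝ ψ x‖ := fun x => by
    rw [gradient, LinearIsometryEquiv.norm_map]
  have hg : ContinuousOn (gradient ψ) Ω :=
    (InnerProductSpace.toDual ℝ (Euc N)).symm.continuous.comp_continuousOn
      (hψc.contDiffOn.continuousOn_fderiv_of_isOpen hΩ.isOpen le_rfl)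
  obtain ⟨B, hB1, hB⟩ := X.exists_gradient_bound hηw
  have hmA := hΩ.isOpen.measurableSet.inter (X.measurableSet_tubeAt ⟨hη, hηw.le⟩ t)
  have hslice : ContinuousOn (fun x : Euc N => (x, t)) (Ω ∩ X.tubeAt η t) := by fun_prop
  have hmaps : MapsTo (fun x : Euc N => (x, t)) (Ω ∩ X.tubeAt η t) X.W := fun x hx =>
    X.tube_subset_W hηw.le hx.2
  have hgA := hg.mono (inter_subset_left (t := X.tubeAt η t))
  refine ⟨hΩ.integrableOn_of_bound hmA inter_subset_left (B := (B * C) ^ 2)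
      (((X.continuousOn_tangentialOp.comp hslice hmaps).clm_apply hgA).norm.pow 2) fun x hx => ?_,
    hΩ.integrableOn_of_bound hmA inter_subset_left (B := (B * C) ^ 2)
      ((hgA.inner (X.continuousOn_radialVector.comp hslice hmaps)).pow 2) fun x hx => ?_,
    hΩ.integrableOn_of_bound hΩ.isOpen.measurableSet Subset.rfl (B := C ^ 2) (hg.norm.pow 2)
      fun x hx => ?_⟩
  · have h1 := (hB t x hx.2 (gradient ψ x)).1
    have h2 : ‖gradient ψ x‖ ≤ C := by rw [hgn]; exact hC x hx.1
    rw [Real.norm_eq_abs, abs_of_nonneg (by positivity)]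
    exact pow_le_pow_left₀ (norm_nonneg _) (h1.trans (by gcongr)) 2
  · have h1 := (hB t x hx.2 (gradient ψ x)).2
    have h2 : ‖gradient ψ x‖ ≤ C := by rw [hgn]; exact hC x hx.1
    rw [Real.norm_eq_abs, abs_of_nonneg (by positivity), ← sq_abs]
    exact pow_le_pow_left₀ (abs_nonneg _) (h1.trans (by gcongr)) 2
  · have h2 : ‖gradient ψ x‖ ≤ C := by rw [hgn]; exact hC x hx
    rw [Real.norm_eq_abs, abs_of_nonneg (by positivity)]
    exact pow_le_pow_left₀ (norm_nonneg _) h2 2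

end SliceIntegrals

/-! ### The Gagliardo–Nirenberg inequality in terms of the energy. -/

section RealInequality

open Filter Topology
open scoped ENNReal

variable {n : ℕ} {Ω : Set (Euc (n + 1))} {T δ : ℝ} {Γ : EvolvingHypersurface Ω T}

/-- The anisotropic Gagliardo-Nirenberg inequality for real integrals. -/
theorem CurvilinearCoordinates.exists_integral_rpow_le (hn : 1 ≤ n)
    (X : CurvilinearCoordinates Γ (2 * δ)) (hδ : 0 < δ) (hΩ : IsBoundedSmoothDomain Ω) (ε₀ : ℝ) :
    ∃ C : ℝ, 0 ≤ C ∧ ∀ ε ∈ Ioc 0 ε₀, ∀ t ∈ Icc 0 T, ∀ ψ, ContDiffOn ℝ 1 ψ (closure Ω) →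
      ∫ x in Ω, |ψ x| ^ (2 + 4 / (n + 1 : ℝ)) ≤
      C * ((∫ x in Ω, ψ x ^ 2) / ε) ^ (2 / (n + 1 : ℝ)) *
        ((∫ x in Ω, ψ x ^ 2)
          + (∫ x in Ω ∩ X.tubeAt δ t, ‖X.tangentialGrad t x (gradient ψ x)‖ ^ 2)
          + ε ^ 2 * (∫ x in Ω ∩ X.tubeAt δ t, X.normalDeriv t x (gradient ψ x) ^ 2)
          + ∫ x in Ω \ X.tubeAt δ t, ‖gradient ψ x‖ ^ 2) := by
  obtain ⟨C, hC, hGN⟩ := X.exists_gagliardoNirenberg hn hδ hΩ ε₀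
  -- The 3 comes from (α + β + γ)² ≤ 3(α² + β² + γ²), applied in the tube to |ψ|, the tangential
  -- part and ε times the normal part.
  refine ⟨C.toReal * 3, by positivity, fun ε hε t ht ψ hψ => ?_⟩
  have h := hGN ε hε t ht ψ hψ
  have hε0 := hε.1
  have hmt := X.measurableSet_tubeAt (η := δ) ⟨hδ, by linarith⟩ t
  obtain ⟨i1, i2, i3⟩ := X.integrableOn_slices hΩ hδ (by linarith) hψ t
  have hp : (0 : ℝ) ≤ 2 + 4 / (n + 1 : ℝ) := by positivity
  have hq : (0 : ℝ) ≤ 2 / (n + 1 : ℝ) := by positivity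
  have iy : IntegrableOn (fun x => ψ x ^ 2) Ω := hΩ.integrableOn (hψ.continuousOn.pow 2)
  have ip : IntegrableOn (fun x => |ψ x| ^ (2 + 4 / (n + 1 : ℝ))) Ω :=
    hΩ.integrableOn (hψ.continuousOn.abs.rpow_const fun _ _ => Or.inr hp)
  set y := ∫ x in Ω, ψ x ^ 2 with hy
  set I := ∫ x in Ω, |ψ x| ^ (2 + 4 / (n + 1 : ℝ)) with hI
  set a := ∫ x in Ω ∩ X.tubeAt δ t, ‖X.tangentialGrad t x (gradient ψ x)‖ ^ 2 with ha
  set b := ∫ x in Ω ∩ X.tubeAt δ t, X.normalDeriv t x (gradient ψ x) ^ 2 with hb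
  set c := ∫ x in Ω \ X.tubeAt δ t, ‖gradient ψ x‖ ^ 2 with hc
  have hy0 : 0 ≤ y := integral_nonneg fun x => sq_nonneg _
  have hI0 : 0 ≤ I := integral_nonneg fun x => by positivity
  have ha0 : 0 ≤ a := integral_nonneg fun x => by positivity
  have hb0 : 0 ≤ b := integral_nonneg fun x => by positivity
  have hc0 : 0 ≤ c := integral_nonneg fun x => by positivity
  have eI : ∫⁻ x in Ω, ENNReal.ofReal |ψ x| ^ (2 + 4 / (n + 1 : ℝ)) = ENNReal.ofReal I := by
    rw [hI, ofReal_integral_eq_lintegral_ofReal ip (Eventually.of_forall fun x => by positivity)]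
    exact lintegral_congr fun x => by rw [ENNReal.ofReal_rpow_of_nonneg (abs_nonneg _) hp]
  have ey : ∫⁻ x in Ω, ENNReal.ofReal |ψ x| ^ (2 : ℝ) = ENNReal.ofReal y := by
    rw [hy, ofReal_integral_eq_lintegral_ofReal iy (Eventually.of_forall fun x => sq_nonneg _)]
    exact lintegral_congr fun x => by
      rw [ENNReal.ofReal_rpow_of_nonneg (abs_nonneg _) zero_le_two, Real.rpow_two, sq_abs]
  set F : Euc (n + 1) → ℝ := fun x => ψ x ^ 2
    + (X.tubeAt δ t).indicator (fun x => ‖X.tangentialGrad t x (gradient ψ x)‖ ^ 2) x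
    + ε ^ 2 * (X.tubeAt δ t).indicator (fun x => X.normalDeriv t x (gradient ψ x) ^ 2) x
    + (X.tubeAt δ t)ᶜ.indicator (fun x => ‖gradient ψ x‖ ^ 2) x with hF
  have j1 : IntegrableOn ((X.tubeAt δ t).indicator
      fun x => ‖X.tangentialGrad t x (gradient ψ x)‖ ^ 2) Ω := by
    rw [IntegrableOn, integrable_indicator_iff hmt, IntegrableOn, Measure.restrict_restrict hmt,
      inter_comm]
    exact i1
  have j2 : IntegrableOn ((X.tubeAt δ t).indicator
      fun x => X.normalDeriv t x (gradient ψ x) ^ 2) Ω := by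
    rw [IntegrableOn, integrable_indicator_iff hmt, IntegrableOn, Measure.restrict_restrict hmt,
      inter_comm]
    exact i2
  have j3 : IntegrableOn ((X.tubeAt δ t)ᶜ.indicator fun x => ‖gradient ψ x‖ ^ 2) Ω :=
    Integrable.indicator i3 hmt.compl
  have hFi : IntegrableOn F Ω := ((iy.add j1).add (j2.const_mul _)).add j3
  have hFint : ∫ x in Ω, F x = y + a + ε ^ 2 * b + c := by
    have e1 : ∫ x in Ω, F x = (∫ x in Ω, (ψ x ^ 2
        + (X.tubeAt δ t).indicator (fun x => ‖X.tangentialGrad t x (gradient ψ x)‖ ^ 2) x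
        + ε ^ 2 * (X.tubeAt δ t).indicator (fun x => X.normalDeriv t x (gradient ψ x) ^ 2) x))
        + ∫ x in Ω, (X.tubeAt δ t)ᶜ.indicator (fun x => ‖gradient ψ x‖ ^ 2) x :=
      integral_add ((iy.add j1).add (j2.const_mul _)) j3
    have e2 : (∫ x in Ω, (ψ x ^ 2
        + (X.tubeAt δ t).indicator (fun x => ‖X.tangentialGrad t x (gradient ψ x)‖ ^ 2) x
        + ε ^ 2 * (X.tubeAt δ t).indicator (fun x => X.normalDeriv t x (gradient ψ x) ^ 2) x)) =
        (∫ x in Ω, (ψ x ^ 2 +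
          (X.tubeAt δ t).indicator (fun x => ‖X.tangentialGrad t x (gradient ψ x)‖ ^ 2) x)) +
        ∫ x in Ω, ε ^ 2 * (X.tubeAt δ t).indicator
          (fun x => X.normalDeriv t x (gradient ψ x) ^ 2) x :=
      integral_add (iy.add j1) (j2.const_mul _)
    have e3 : (∫ x in Ω, (ψ x ^ 2 +
          (X.tubeAt δ t).indicator (fun x => ‖X.tangentialGrad t x (gradient ψ x)‖ ^ 2) x)) =
        y + ∫ x in Ω, (X.tubeAt δ t).indicator
          (fun x => ‖X.tangentialGrad t x (gradient ψ x)‖ ^ 2) x := integral_add iy j1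
    rw [e1, e2, e3, integral_const_mul, setIntegral_indicator hmt, setIntegral_indicator hmt,
      setIntegral_indicator hmt.compl, ← sdiff_eq]
  have hZ : ∫⁻ x in Ω, ENNReal.ofReal (|ψ x| +
      X.anisotropicNorm δ ε t x (gradient ψ x)) ^ (2 : ℝ) ≤
      ENNReal.ofReal 3 * ENNReal.ofReal (y + a + ε ^ 2 * b + c) := by
    have hF0 : ∀ x, 0 ≤ F x := by
      intro x
      have h1 : 0 ≤ (X.tubeAt δ t).indicator
        (fun x => ‖X.tangentialGrad t x (gradient ψ x)‖ ^ 2) x :=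
        indicator_nonneg (fun _ _ => by positivity) _
      have h2 : 0 ≤ (X.tubeAt δ t).indicator (fun x => X.normalDeriv t x (gradient ψ x) ^ 2) x :=
        indicator_nonneg (fun _ _ => by positivity) _
      have h3 : 0 ≤ (X.tubeAt δ t)ᶜ.indicator (fun x => ‖gradient ψ x‖ ^ 2) x :=
        indicator_nonneg (fun _ _ => by positivity) _
      simp only [hF]
      positivity
    rw [← hFint, ofReal_integral_eq_lintegral_ofReal hFi (Eventually.of_forall hF0),
      ← lintegral_const_mul' _ _ ENNReal.ofReal_ne_top]
    refine lintegral_mono fun x => ?_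
    dsimp only
    have h1 := X.anisotropicNorm_nonneg (η := δ) hε0.le t x (gradient ψ x)
    rw [ENNReal.ofReal_rpow_of_nonneg (by positivity) zero_le_two, Real.rpow_two,
      ← ENNReal.ofReal_mul (by norm_num)]
    refine ENNReal.ofReal_le_ofReal ?_
    simp only [hF, CurvilinearCoordinates.anisotropicNorm]
    by_cases hx : x ∈ X.tubeAt δ t
    · rw [if_pos hx, indicator_of_mem hx, indicator_of_mem hx,
        indicator_of_notMem (by simpa using hx), add_zero, ← sq_abs (ψ x),
        ← sq_abs (X.normalDeriv t x (gradient ψ x)), ← mul_pow]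
      set α := |ψ x|
      set β := ‖X.tangentialGrad t x (gradient ψ x)‖
      set γ := ε * |X.normalDeriv t x (gradient ψ x)|
      nlinarith [sq_nonneg (α - β), sq_nonneg (α - γ), sq_nonneg (β - γ)]
    · rw [if_neg hx, indicator_of_notMem hx, indicator_of_notMem hx,
        indicator_of_mem (by simpa using hx), mul_zero, add_zero, add_zero, ← sq_abs (ψ x)]
      set α := |ψ x|
      set β := ‖gradient ψ x‖
      nlinarith [sq_nonneg (α - β), sq_nonneg α, sq_nonneg β]
  have hE0 : 0 ≤ y + a + ε ^ 2 * b + c := by positivity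
  have h2 : ENNReal.ofReal (ε ^ (2 / (n + 1 : ℝ)) * I) ≤
      ENNReal.ofReal (C.toReal * (y ^ (2 / (n + 1 : ℝ)) * (3 * (y + a + ε ^ 2 * b + c)))) := by
    rw [ENNReal.ofReal_mul (by positivity), ← ENNReal.ofReal_rpow_of_nonneg hε0.le hq,
      ENNReal.ofReal_mul (by positivity), ENNReal.ofReal_toReal hC, ENNReal.ofReal_mul (by positivity),
      ← ENNReal.ofReal_rpow_of_nonneg hy0 hq, ENNReal.ofReal_mul (by norm_num), ← eI, ← ey]
    exact h.trans (mul_le_mul_right (mul_le_mul_right hZ _) _)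
  have h3 := (ENNReal.ofReal_le_ofReal_iff (by positivity)).1 h2
  rw [Real.div_rpow hy0 hε0.le]
  have hεp : 0 < ε ^ (2 / (n + 1 : ℝ)) := Real.rpow_pos_of_pos hε0 _
  have e : C.toReal * 3 * (y ^ (2 / (n + 1 : ℝ)) / ε ^ (2 / (n + 1 : ℝ))) *
      (y + a + ε ^ 2 * b + c) =
      (C.toReal * (y ^ (2 / (n + 1 : ℝ)) * (3 * (y + a + ε ^ 2 * b + c)))) /
        ε ^ (2 / (n + 1 : ℝ)) := by ring
  rw [e, le_div_iff₀ hεp, mul_comm]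
  exact h3

end RealInequality

/-! ### Integrals over parts of a cylinder. -/

section Fubini

open Filter Topology

variable {N : ℕ} {Ω : Set (Euc N)}

/-- Integrals over parts of a cylinder as iterated integrals. -/
theorem IsBoundedSmoothDomain.setIntegral_cylinder (hΩ : IsBoundedSmoothDomain Ω) {T : ℝ}
    {A : Set (Euc N × ℝ)} (hA : MeasurableSet A) {F : Euc N × ℝ → ℝ} {B : ℝ}
    (hF : ContinuousOn F (cylinder Ω T ∩ A)) (hB : ∀ p ∈ cylinder Ω T ∩ A, |F p| ≤ B) :
    IntegrableOn (fun t => ∫ x in Ω ∩ {x | (x, t) ∈ A}, F (x, t)) (Ioo 0 T) ∧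
    ∫ p in cylinder Ω T ∩ A, F p = ∫ t in Ioo 0 T, ∫ x in Ω ∩ {x | (x, t) ∈ A}, F (x, t) := by
  have hcm : MeasurableSet (cylinder Ω T) := hΩ.isOpen.measurableSet.prod measurableSet_Ioo
  have hm := hcm.inter hA
  have hfin : IsFiniteMeasure (volume.restrict (cylinder Ω T ∩ A)) := by
    refine ⟨?_⟩
    rw [Measure.restrict_apply_univ]
    refine (measure_mono inter_subset_left).trans_lt ?_
    rw [_root_.cylinder, Measure.volume_eq_prod, Measure.prod_prod]
    exact ENNReal.mul_lt_top hΩ.isBounded.measure_lt_top (by simp)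
  have hint : IntegrableOn F (cylinder Ω T ∩ A) :=
    Integrable.of_bound (hF.aestronglyMeasurable hm) B
      ((ae_restrict_mem hm).mono fun p hp => hB p hp)
  have hint2 : Integrable (A.indicator F)
      ((volume.restrict Ω).prod (volume.restrict (Ioo 0 T))) := by
    rw [Measure.prod_restrict, ← Measure.volume_eq_prod, integrable_indicator_iff hA, IntegrableOn,
      Measure.restrict_restrict hA, inter_comm]
    exact hint
  have hslice : ∀ t, ∫ x in Ω, A.indicator F (x, t) =
      ∫ x in Ω ∩ {x | (x, t) ∈ A}, F (x, t) := by
    intro t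
    have hAt : MeasurableSet {x | (x, t) ∈ A} := measurable_prodMk_right hA
    rw [← setIntegral_indicator hAt]
    rfl
  constructor
  · have := hint2.integral_prod_right
    simp only [hslice] at this
    exact this
  · have h1 : ∫ p in cylinder Ω T ∩ A, F p = ∫ p, A.indicator F p
        ∂((volume.restrict Ω).prod (volume.restrict (Ioo 0 T))) := by
      rw [Measure.prod_restrict, ← Measure.volume_eq_prod, ← setIntegral_indicator hA]
      rfl
    rw [h1, integral_prod_symm _ hint2]
    simp only [hslice]

end Fubini

/-! ### Absorbing the cubic term; the origin of k = max{2, N/2}. -/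

section Absorption

/-- The cube `s³/ε²` is absorbed, on `[0, L]`, by a square and a power `2 + 4/N` with weights `A`
and `θ ε^(-4k/N)`. -/
def AbsorbsCube (N L k A θ : ℝ) : Prop :=
  ∀ ε : ℝ, 0 < ε → ∀ s ∈ Icc 0 L,
    s ^ 3 / ε ^ 2 ≤ A * s ^ 2 + θ * s ^ (2 + 4 / N) / (ε ^ (2 * k)) ^ (2 / N)

/-- Below the threshold θ^(-1/(q-1)) the constant suffices; above it θ σ^(q-1) ≥ 1. -/
theorem le_add_mul_rpow {σ θ q : ℝ} (hσ : 0 ≤ σ) (hθ : 0 < θ) (hq : 1 < q) :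
    σ ≤ θ ^ (-(1 / (q - 1))) + θ * σ ^ q := by
  have hA : 0 < θ ^ (-(1 / (q - 1))) := Real.rpow_pos_of_pos hθ _
  rcases le_total σ (θ ^ (-(1 / (q - 1)))) with h | h
  · have : 0 ≤ θ * σ ^ q := by positivity
    linarith
  · have hσ0 : 0 < σ := hA.trans_le h
    have h1 : θ⁻¹ ≤ σ ^ (q - 1) := by
      have h2 := Real.rpow_le_rpow hA.le h (sub_pos.2 hq).le
      rwa [← Real.rpow_mul hθ.le, neg_mul, one_div_mul_cancel (sub_pos.2 hq).ne',
        Real.rpow_neg_one] at h2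
    have h3 : σ ^ q = σ * σ ^ (q - 1) := by
      rw [← Real.rpow_one_add' hσ (by linarith), add_sub_cancel]
    have h4 : 1 ≤ θ * σ ^ (q - 1) := by
      rwa [inv_le_iff_one_le_mul₀' hθ] at h1
    rw [h3]
    nlinarith

/-- For σ = s/ε² the claim is σ ≤ A + θ σ^(4/N), possible with every θ > 0 because 4/N > 1. The free
choice of θ is what the critical case N ≤ 3, M = 2 relies on. -/
theorem exists_absorbsCube_of_lt_four {N L θ : ℝ} (hN0 : 0 < N) (hN : N < 4) (hθ : 0 < θ) :
    ∃ A, 0 ≤ A ∧ AbsorbsCube N L 2 A θ := by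
  have hq : 1 < 4 / N := by rwa [one_lt_div hN0]
  refine ⟨θ ^ (-(1 / (4 / N - 1))), by positivity, fun ε hε s hs => ?_⟩
  have h := le_add_mul_rpow (σ := s / ε ^ 2) (by have := hs.1; positivity) hθ hq
  rw [Real.div_rpow hs.1 (by positivity)] at h
  have h2 : ((ε ^ 2) ^ (4 / N) : ℝ) = (ε ^ ((2 : ℝ) * 2)) ^ (2 / N) := by
    rw [← Real.rpow_natCast, ← Real.rpow_mul hε.le, ← Real.rpow_mul hε.le]
    congr 1
    push_cast
    ring
  rw [h2] at h
  have h3 : s ^ (2 + 4 / N) = s ^ 2 * s ^ (4 / N) := by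
    rw [Real.rpow_add_of_nonneg hs.1 zero_le_two (by positivity), Real.rpow_two]
  rw [h3]
  calc s ^ 3 / ε ^ 2 = s ^ 2 * (s / ε ^ 2) := by ring
    _ ≤ s ^ 2 * (θ ^ (-(1 / (4 / N - 1))) + θ * (s ^ (4 / N) / (ε ^ ((2 : ℝ) * 2)) ^ (2 / N))) :=
        mul_le_mul_of_nonneg_left h (sq_nonneg s)
    _ = _ := by ring

/-- Here 2 + 4/N ≤ 3, so boundedness of s lowers the exponent; with k = N/2 the power of ε is
exactly ε², and no quadratic term is needed. The price is that θ cannot be made small. -/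
theorem exists_absorbsCube_of_four_le {N L : ℝ} (hN : 4 ≤ N) (hL : 0 < L) :
    ∃ θ, 0 < θ ∧ AbsorbsCube N L (N / 2) 0 θ := by
  have hN0 : 0 < N := by linarith
  have hq : 0 ≤ 1 - 4 / N := by rw [sub_nonneg, div_le_one hN0]; exact hN
  refine ⟨L ^ (1 - 4 / N), Real.rpow_pos_of_pos hL _, fun ε hε s hs => ?_⟩
  have h2 : ((ε ^ (2 * (N / 2))) ^ (2 / N) : ℝ) = ε ^ 2 := by
    rw [← Real.rpow_mul hε.le, ← Real.rpow_natCast]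
    congr 1
    field_simp
    norm_num
  rw [h2, zero_mul, zero_add]
  refine div_le_div_of_nonneg_right ?_ (by positivity)
  have h3 : s ^ 3 = s ^ (1 - 4 / N) * s ^ (2 + 4 / N) := by
    rw [← Real.rpow_add_of_nonneg hs.1 hq (by positivity), ← Real.rpow_natCast]
    congr 1
    push_cast
    ring
  rw [h3]
  exact mul_le_mul_of_nonneg_right (Real.rpow_le_rpow hs.1 hs.2 hq) (Real.rpow_nonneg hs.1 _)

theorem exists_absorbsCube {N L : ℝ} (hN0 : 0 < N) (hL : 0 < L) :
    ∃ A θ, 0 ≤ A ∧ 0 < θ ∧ AbsorbsCube N L (max 2 (N / 2)) A θ := by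
  rcases lt_or_ge N 4 with h | h
  · obtain ⟨A, hA, h'⟩ := exists_absorbsCube_of_lt_four (L := L) hN0 h one_pos
    rw [max_eq_left (by linarith)]
    exact ⟨A, 1, hA, one_pos, h'⟩
  · obtain ⟨θ, hθ, h'⟩ := exists_absorbsCube_of_four_le h hL
    rw [max_eq_right (by linarith)]
    exact ⟨0, θ, le_rfl, hθ, h'⟩

end Absorption

/-! ### Combining the estimates. -/

section Bookkeeping

/-- The algebra behind the energy inequality. -/
theorem energy_bookkeeping {G Q P w y τ ν o ρ e C c₀ Λ B q α κ E a b d : ℝ}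
    (hC : 0 < C) (hc₀ : 0 < c₀) (hΛ : 0 ≤ Λ) (he : 0 ≤ e) (hΛe : Λ * e ≤ 1 / 8)
    (hy : 0 ≤ y) (hτ : 0 ≤ τ) (hν : 0 ≤ ν) (ho : 0 ≤ o)
    (h1 : -C * y + o + c₀ * τ ≤ G + Q) (h2 : -Q ≤ q) (hq : e * q = B * y)
    (h3 : Λ * o + ν ≤ Λ * G) (h4 : Q - w ≤ P)
    (h5 : w ≤ α * y + κ * (y + τ + e * ν + o)) (hκ : κ ≤ 1 / 16) (hκ' : κ ≤ c₀ / 8)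
    (h6 : |ρ| ≤ C * E * (a + b + d)) (ha : a ^ 2 = y) (hb : b ^ 2 = τ) (hd : d ^ 2 = o) :
    2 * (-G - P - ρ) + (7 / 4 * o + 5 / 4 * (c₀ * τ + e * ν)) ≤
      2 * (C + Λ * B + α + 2) * y + 2 * (C ^ 2 * (5 + 2 / c₀)) * E ^ 2 := by
  -- With e = ε², the share 1 - Λe of the form goes to the spectral estimate. The share Λe retains
  -- the gradient, giving e·ν and restoring the full o, while its potential part costs at most Λ B
  -- y.
  have s1 : (1 - Λ * e) * (-C * y + o + c₀ * τ) ≤ (1 - Λ * e) * (G + Q) :=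
    mul_le_mul_of_nonneg_left h1 (by linarith)
  have s2 : e * (Λ * o + ν) ≤ e * (Λ * G) := mul_le_mul_of_nonneg_left h3 he
  have s3 : Λ * (e * -Q) ≤ Λ * (B * y) := by
    rw [← hq]
    exact mul_le_mul_of_nonneg_left (mul_le_mul_of_nonneg_left h2 he) hΛ
  have s4 : Λ * e * (C * y) ≥ 0 := by positivity
  have s5 : Λ * e * (c₀ * τ) ≤ 1 / 8 * (c₀ * τ) := mul_le_mul_of_nonneg_right hΛe (by positivity)
  have s6 : o + 7 / 8 * (c₀ * τ) + e * ν - (C + Λ * B) * y ≤ G + Q := by linarith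
  have heν : 0 ≤ e * ν := by positivity
  -- After doubling, the cubic remainder takes 1/4 of c₀τ and 1/8 each of eν and o; the residual
  -- takes another 1/4 of c₀τ and 1/8 of o. This leaves 7/4 of o and at least 5/4 of c₀τ + eν.
  have s7 : κ * (y + τ + e * ν + o) ≤ y + c₀ / 8 * τ + 1 / 16 * (e * ν + o) := by
    have := mul_le_mul_of_nonneg_right hκ (by positivity : 0 ≤ y + e * ν + o)
    have := mul_le_mul_of_nonneg_right hκ' hτ
    linarith
  have t1 : C * E * a ≤ y + C ^ 2 * E ^ 2 := by
    rw [← ha]; nlinarith [sq_nonneg (C * E - a), sq_nonneg a, sq_nonneg (C * E)]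
  have t2 : C * E * b ≤ c₀ / 8 * τ + 2 * C ^ 2 * E ^ 2 / c₀ := by
    rw [← hb, ← sub_nonneg]
    have : c₀ / 8 * b ^ 2 + 2 * C ^ 2 * E ^ 2 / c₀ - C * E * b =
        2 / c₀ * (C * E - c₀ * b / 4) ^ 2 := by field_simp; ring
    rw [this]
    positivity
  have t3 : C * E * d ≤ o / 16 + 4 * (C ^ 2 * E ^ 2) := by
    rw [← hd]; nlinarith [sq_nonneg (2 * (C * E) - d / 4)]
  have t4 : -ρ ≤ C * E * (a + b + d) := (neg_le_abs ρ).trans h6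
  have t5 : C ^ 2 * (5 + 2 / c₀) * E ^ 2 = 5 * (C ^ 2 * E ^ 2) + 2 * C ^ 2 * E ^ 2 / c₀ := by ring
  linarith

end Bookkeeping

/-! ### The differential inequality for ‖u - u^A‖². -/

section EnergyInequality

open Filter Topology

variable {n : ℕ} {Ω : Set (Euc (n + 1))} {T₀ δ : ℝ} {Γ : EvolvingHypersurface Ω T₀}
  {f : ℝ → ℝ} {ε₀ C c₀ K : ℝ} {uA : ℝ → Euc (n + 1) → ℝ → ℝ}

theorem l2Norm_sq {α V : Type*} [MeasureSpace α] [NormedAddCommGroup V] (A : Set α) (v : α → V) :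
    l2Norm A v ^ 2 = ∫ x in A, ‖v x‖ ^ 2 :=
  Real.sq_sqrt (integral_nonneg fun _ => by positivity)

set_option maxHeartbeats 1000000 in
/-- The energy inequality for the difference of a solution and an approximate solution. -/
theorem CurvilinearCoordinates.exists_energy_inequality (hn : 1 ≤ n)
    (hΩ : IsBoundedSmoothDomain Ω) (hT₀ : 0 < T₀) (hδ : 0 < δ)
    (X : CurvilinearCoordinates Γ (2 * δ)) (hf : IsDoubleWell f) (hε₀ : 0 < ε₀)
    (huA : ∀ ε ∈ Ioc 0 ε₀, IsC2Cylinder Ω T₀ (uA ε)) (hc₀ : 0 < c₀) (hC : 0 < C)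
    (hspec : SpectralEstimate X δ f ε₀ c₀ C uA) (K : ℝ) :
    ∃ L C₁ C₂ C₃ : ℝ, ∃ ε₁ ∈ Ioc 0 ε₀, 0 < L ∧ 0 ≤ C₁ ∧ 0 ≤ C₂ ∧ 0 ≤ C₃ ∧
      ∀ k A θ m : ℝ, 0 ≤ A → 0 ≤ θ → AbsorbsCube (n + 1 : ℝ) L k A θ →
      ∀ (u₀ : ℝ → Euc (n + 1) → ℝ) (u : ℝ → Euc (n + 1) → ℝ → ℝ),
        (∀ ε ∈ Ioc 0 ε₀, IsAllenCahnSolution Ω T₀ f ε (u₀ ε) (u ε)) →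
        UniformlyBounded Ω T₀ ε₀ K uA u₀ → RemainderEstimate X δ f ε₀ C m uA u →
        ∀ ε ∈ Ioc 0 ε₁, ∀ t ∈ Ioo 0 T₀,
          C₁ * θ * ((∫ x in Ω, (u ε x t - uA ε x t) ^ 2) / ε / ε ^ (2 * k)) ^ (2 / (n + 1 : ℝ)) ≤
            min (1 / 16) (c₀ / 8) →
          ∃ d, HasDerivAt (fun t => ∫ x in Ω, (u ε x t - uA ε x t) ^ 2) d t ∧
            d + (7 / 4 * (∫ x in Ω \ X.tubeAt δ t, ‖spaceGrad (u ε - uA ε) x t‖ ^ 2)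
              + 5 / 4 * (c₀ * (∫ x in Ω ∩ X.tubeAt δ t,
                  ‖X.tangentialGrad t x (spaceGrad (u ε - uA ε) x t)‖ ^ 2)
                + ε ^ 2 * ∫ x in Ω ∩ X.tubeAt δ t,
                  X.normalDeriv t x (spaceGrad (u ε - uA ε) x t) ^ 2)) ≤
            2 * (C₂ + C₁ * A) * (∫ x in Ω, (u ε x t - uA ε x t) ^ 2)
              + 2 * C₃ * ε ^ (2 * m + 1) := by
  obtain ⟨R₀, hR₀, hsign⟩ := hf.sign
  obtain ⟨Cg, hCg, hGN⟩ := X.exists_integral_rpow_le hn hδ hΩ ε₀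
  obtain ⟨B, hB1, hB⟩ := X.exists_gradient_bound (η := δ) (by linarith)
  -- Beyond R₀ the sign condition on f' holds, and K bounds the initial values and u^A; so both u
  -- and u^A stay in [-k₀, k₀].
  set k₀ := max R₀ |K| with hk₀
  have hk₀1 : 1 ≤ k₀ := hR₀.trans (le_max_left _ _)
  have hfd : ContDiff ℝ ∞ (deriv f) := ((contDiff_infty_iff_deriv).1 hf.smooth).2
  have hfd2 : ContDiff ℝ ∞ (deriv (deriv f)) := ((contDiff_infty_iff_deriv).1 hfd).2
  have hfd3 : ContDiff ℝ ∞ (deriv (deriv (deriv f))) := ((contDiff_infty_iff_deriv).1 hfd2).2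
  obtain ⟨B₂, hB₂⟩ := (isCompact_Icc (a := -k₀) (b := k₀)).exists_bound_of_continuousOn
    hfd2.continuous.continuousOn
  obtain ⟨B₃, hB₃⟩ := (isCompact_Icc (a := -k₀) (b := k₀)).exists_bound_of_continuousOn
    hfd3.continuous.continuousOn
  have h0k : (0 : ℝ) ∈ Icc (-k₀) k₀ := ⟨by linarith, by linarith⟩
  have hB₂0 : 0 ≤ B₂ := (norm_nonneg _).trans (hB₂ 0 h0k)
  have hB₃0 : 0 ≤ B₃ := (norm_nonneg _).trans (hB₃ 0 h0k)
  set Λ := B ^ 2 with hΛ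
  have hΛ0 : 0 < Λ := by positivity
  -- 2k₀ bounds |u - u^A|, the range on which the cube must be absorbed. The factor Cg + 1 lets one
  -- constant dominate both B₃ Cg and B₃, and the choice of ε₁ ensures Λ ε² ≤ 1/8.
  refine ⟨2 * k₀, B₃ * (Cg + 1), C + Λ * B₂ + 2, C ^ 2 * (5 + 2 / c₀),
    min ε₀ (Real.sqrt (1 / (8 * Λ))), ⟨lt_min hε₀ (Real.sqrt_pos.2 (by positivity)),
      min_le_left _ _⟩, by positivity, by positivity, by positivity, by positivity, ?_⟩
  intro k A θ m hA hθ habs u₀ u hu hbdd hrem ε hε t ht hsmall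
  have hε0 := hε.1
  have hεε : ε ∈ Ioc 0 ε₀ := ⟨hε.1, hε.2.trans (min_le_left _ _)⟩
  have hΛε : Λ * ε ^ 2 ≤ 1 / 8 := by
    have h1 : ε ^ 2 ≤ 1 / (8 * Λ) := by
      have := pow_le_pow_left₀ hε0.le (hε.2.trans (min_le_right _ _)) 2
      rwa [Real.sq_sqrt (by positivity)] at this
    calc Λ * ε ^ 2 ≤ Λ * (1 / (8 * Λ)) := by gcongr
      _ = 1 / 8 := by field_simp
  have htc := Ioo_subset_Icc_self ht
  have hu2 := (hu ε hεε).C2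
  have hA2 := huA ε hεε
  have hv1 : IsC1Cylinder Ω T₀ (u ε - uA ε) := (hu2.sub hA2).isC1Cylinder
  have hψ := hv1.slice htc
  have hderiv := (hu ε hεε).hasDerivAt_integral_sq hΩ hT₀ hf.smooth hA2 ht
  refine ⟨_, hderiv, ?_⟩
  have hmΩ := hΩ.isOpen.measurableSet
  have hmt := X.measurableSet_tubeAt (η := δ) ⟨hδ, by linarith⟩ t
  have hbu : ∀ x ∈ Ω, u ε x t ∈ Icc (-k₀) k₀ := fun x hx =>
    _root_.abs_le.1 ((hu ε hεε).abs_le hΩ hT₀ (by linarith)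
      (fun s hs => hsign s ((le_max_left _ _).trans hs))
      (fun x hx => ((hbdd ε hεε).2 x hx).trans ((le_abs_self K).trans (le_max_right _ _))) x hx t htc)
  have hbA : ∀ x ∈ Ω, uA ε x t ∈ Icc (-k₀) k₀ := fun x hx =>
    _root_.abs_le.1 (((hbdd ε hεε).1 x hx t ht).trans ((le_abs_self K).trans (le_max_right _ _)))
  have hH1 := hv1.isH1WithGradient hΩ hT₀ htc
  have hsp := hspec ε hεε t htc _ _ hH1
  rw [l2Norm_sq, l2Norm_sq, l2Norm_sq] at hsp
  have hre := hrem ε hεε t (Ioo_subset_Ioc_self ht)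
  have hgn := hGN ε hεε t htc _ hψ
  obtain ⟨i1, i2, i3⟩ := X.integrableOn_slices hΩ hδ (by linarith) hψ t
  have huc : ContinuousOn (fun x => u ε x t) (closure Ω) := (hu2.slice htc).continuousOn
  have hAc : ContinuousOn (fun x => uA ε x t) (closure Ω) := (hA2.slice htc).continuousOn
  have hvc : ContinuousOn (fun x => u ε x t - uA ε x t) (closure Ω) := huc.sub hAc
  have hqc : ContinuousOn (fun x => 1 / ε ^ 2 * deriv (deriv f) (uA ε x t) *
      (u ε x t - uA ε x t) ^ 2) (closure Ω) :=
    (continuousOn_const.mul (hfd2.continuous.comp_continuousOn hAc)).mul (hvc.pow 2)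
  have hpc : ContinuousOn (fun x => 1 / ε ^ 2 * ((u ε x t - uA ε x t) *
      (deriv f (u ε x t) - deriv f (uA ε x t)))) (closure Ω) :=
    continuousOn_const.mul (hvc.mul ((hfd.continuous.comp_continuousOn huc).sub
      (hfd.continuous.comp_continuousOn hAc)))
  have hcc : ContinuousOn (fun x => B₃ * (|u ε x t - uA ε x t| ^ 3 / ε ^ 2)) (closure Ω) :=
    continuousOn_const.mul ((hvc.abs.pow 3).div_const _)
  have hy : IntegrableOn (fun x => (u ε x t - uA ε x t) ^ 2) Ω := hΩ.integrableOn (hvc.pow 2)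
  have hpw : (0 : ℝ) ≤ 2 + 4 / (n + 1 : ℝ) := by positivity
  have hpi : IntegrableOn (fun x => |u ε x t - uA ε x t| ^ (2 + 4 / (n + 1 : ℝ))) Ω :=
    hΩ.integrableOn (hvc.abs.rpow_const fun _ _ => Or.inr hpw)
  set y := ∫ x in Ω, (u ε x t - uA ε x t) ^ 2 with hydef
  have hy0 : 0 ≤ y := integral_nonneg fun x => sq_nonneg _
  have hsplit : ∫ x in Ω, (‖spaceGrad (u ε - uA ε) x t‖ ^ 2 +
      1 / ε ^ 2 * deriv (deriv f) (uA ε x t) * ((u ε - uA ε) x t) ^ 2) =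
      (∫ x in Ω, ‖spaceGrad (u ε - uA ε) x t‖ ^ 2) +
      ∫ x in Ω, 1 / ε ^ 2 * deriv (deriv f) (uA ε x t) * (u ε x t - uA ε x t) ^ 2 :=
    integral_add i3 (hΩ.integrableOn hqc)
  rw [hsplit] at hsp
  have hgn' : ∫ x in Ω, |u ε x t - uA ε x t| ^ (2 + 4 / (n + 1 : ℝ)) ≤
      Cg * (y / ε) ^ (2 / (n + 1 : ℝ)) * (y
        + (∫ x in Ω ∩ X.tubeAt δ t, ‖X.tangentialGrad t x (spaceGrad (u ε - uA ε) x t)‖ ^ 2)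
        + ε ^ 2 * (∫ x in Ω ∩ X.tubeAt δ t, X.normalDeriv t x (spaceGrad (u ε - uA ε) x t) ^ 2)
        + ∫ x in Ω \ X.tubeAt δ t, ‖spaceGrad (u ε - uA ε) x t‖ ^ 2) := hgn
  have hysp : ∫ x in Ω, ‖(u ε - uA ε) x t‖ ^ 2 = y :=
    integral_congr_ae (Eventually.of_forall fun x => by
      simp only [Real.norm_eq_abs, sq_abs]; rfl)
  rw [hysp] at hsp
  have hcubic : (∫ x in Ω, B₃ * (|u ε x t - uA ε x t| ^ 3 / ε ^ 2)) ≤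
      B₃ * (A * y) + B₃ * (θ * (∫ x in Ω, |u ε x t - uA ε x t| ^ (2 + 4 / (n + 1 : ℝ))) /
        (ε ^ (2 * k)) ^ (2 / (n + 1 : ℝ))) := by
    have e1 : (∫ x in Ω, (B₃ * (A * (u ε x t - uA ε x t) ^ 2) +
        B₃ * (θ / (ε ^ (2 * k)) ^ (2 / (n + 1 : ℝ)) *
          |u ε x t - uA ε x t| ^ (2 + 4 / (n + 1 : ℝ))))) =
        (∫ x in Ω, B₃ * (A * (u ε x t - uA ε x t) ^ 2)) +
        ∫ x in Ω, B₃ * (θ / (ε ^ (2 * k)) ^ (2 / (n + 1 : ℝ)) *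
          |u ε x t - uA ε x t| ^ (2 + 4 / (n + 1 : ℝ))) :=
      integral_add ((hy.const_mul _).const_mul _) ((hpi.const_mul _).const_mul _)
    rw [integral_const_mul, integral_const_mul, integral_const_mul, integral_const_mul] at e1
    have e2 : θ * (∫ x in Ω, |u ε x t - uA ε x t| ^ (2 + 4 / (n + 1 : ℝ))) /
        (ε ^ (2 * k)) ^ (2 / (n + 1 : ℝ)) = θ / (ε ^ (2 * k)) ^ (2 / (n + 1 : ℝ)) *
        ∫ x in Ω, |u ε x t - uA ε x t| ^ (2 + 4 / (n + 1 : ℝ)) := by ring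
    rw [e2, hydef, ← e1]
    refine setIntegral_mono_on (hΩ.integrableOn hcc)
      (((hy.const_mul _).const_mul _).add ((hpi.const_mul _).const_mul _)) hmΩ fun x hx => ?_
    have h1 := habs ε hε0 |u ε x t - uA ε x t| ⟨abs_nonneg _, by
      have h1 := hbu x hx
      have h2 := hbA x hx
      rw [_root_.abs_le]
      constructor <;> linarith [h1.1, h1.2, h2.1, h2.2]⟩
    rw [sq_abs] at h1
    calc _ ≤ B₃ * _ := mul_le_mul_of_nonneg_left h1 hB₃0
      _ = _ := by ring
  have hnl : (∫ x in Ω, 1 / ε ^ 2 * deriv (deriv f) (uA ε x t) * (u ε x t - uA ε x t) ^ 2) -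
      (∫ x in Ω, B₃ * (|u ε x t - uA ε x t| ^ 3 / ε ^ 2)) ≤
      ∫ x in Ω, 1 / ε ^ 2 * ((u ε x t - uA ε x t) *
        (deriv f (u ε x t) - deriv f (uA ε x t))) := by
    have e1 : (∫ x in Ω, (1 / ε ^ 2 * deriv (deriv f) (uA ε x t) * (u ε x t - uA ε x t) ^ 2 -
        B₃ * (|u ε x t - uA ε x t| ^ 3 / ε ^ 2))) = _ :=
      integral_sub (hΩ.integrableOn hqc) (hΩ.integrableOn hcc)
    rw [← e1]
    refine setIntegral_mono_on ((hΩ.integrableOn hqc).sub (hΩ.integrableOn hcc))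
      (hΩ.integrableOn hpc) hmΩ fun x hx => ?_
    have h1 := abs_sub_sub_le_of_abs_deriv2_le
      (fun s => (hfd.differentiable (by simp) s).hasDerivAt)
      (fun s => (hfd2.differentiable (by simp) s).hasDerivAt) hB₃ (hbA x hx) (hbu x hx)
    set a := u ε x t - uA ε x t with ha
    set r := deriv f (u ε x t) - deriv f (uA ε x t) with hr
    set g := deriv (deriv f) (uA ε x t) with hg
    have h2 : a * (g * a - r) ≤ |a| * (B₃ * a ^ 2) := by
      refine (le_abs_self _).trans ?_
      rw [abs_mul, abs_sub_comm (g * a) r]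
      exact mul_le_mul_of_nonneg_left h1 (abs_nonneg _)
    have h3 : |a| * (B₃ * a ^ 2) = B₃ * |a| ^ 3 := by rw [← sq_abs a]; ring
    have h4 : 1 / ε ^ 2 * (a * (g * a - r)) ≤ 1 / ε ^ 2 * (B₃ * |a| ^ 3) := by
      rw [← h3]; exact mul_le_mul_of_nonneg_left h2 (by positivity)
    have h5 : 1 / ε ^ 2 * (B₃ * |a| ^ 3) = B₃ * (|a| ^ 3 / ε ^ 2) := by ring
    have h6 : 1 / ε ^ 2 * (a * (g * a - r)) = 1 / ε ^ 2 * g * a ^ 2 - 1 / ε ^ 2 * (a * r) := by ring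
    linarith
  have hQ : -(∫ x in Ω, 1 / ε ^ 2 * deriv (deriv f) (uA ε x t) * (u ε x t - uA ε x t) ^ 2) ≤
      1 / ε ^ 2 * B₂ * y := by
    rw [hydef, ← integral_neg, ← integral_const_mul]
    refine setIntegral_mono_on (hΩ.integrableOn hqc).neg (hy.const_mul _) hmΩ fun x hx => ?_
    have h1 : -deriv (deriv f) (uA ε x t) ≤ B₂ := (neg_le_abs _).trans (hB₂ _ (hbA x hx))
    have h2 := mul_le_mul_of_nonneg_left h1
      (by positivity : 0 ≤ 1 / ε ^ 2 * (u ε x t - uA ε x t) ^ 2)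
    calc _ = 1 / ε ^ 2 * (u ε x t - uA ε x t) ^ 2 * -deriv (deriv f) (uA ε x t) := by ring
      _ ≤ _ := h2
      _ = _ := by ring
  -- Λ = B² dominates the square of the normal derivative by that of the gradient in the tube; off
  -- the tube the gradient is kept as it is.
  have hG : Λ * (∫ x in Ω \ X.tubeAt δ t, ‖spaceGrad (u ε - uA ε) x t‖ ^ 2) +
      (∫ x in Ω ∩ X.tubeAt δ t, X.normalDeriv t x (spaceGrad (u ε - uA ε) x t) ^ 2) ≤
      Λ * ∫ x in Ω, ‖spaceGrad (u ε - uA ε) x t‖ ^ 2 := by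
    have e1 := integral_inter_add_sdiff (μ := volume) (f := fun x => ‖spaceGrad (u ε - uA ε) x t‖ ^ 2)
      hmt i3
    rw [← e1, mul_add, add_comm]
    refine add_le_add_left ?_ _
    rw [← integral_const_mul]
    refine setIntegral_mono_on i2 ((i3.mono_set inter_subset_left).const_mul _) (hmΩ.inter hmt)
      fun x hx => ?_
    have := (hB t x hx.2 (spaceGrad (u ε - uA ε) x t)).2
    rw [← sq_abs, hΛ, ← mul_pow]
    exact pow_le_pow_left₀ (abs_nonneg _) this 2
  -- The fraction of the energy consumed by the cubic term. It depends on y itself, which is why it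
  -- is assumed small here and justified later by continuation.
  set κ := B₃ * Cg * θ * (y / ε / ε ^ (2 * k)) ^ (2 / (n + 1 : ℝ)) with hκ
  have hκle : κ ≤ min (1 / 16) (c₀ / 8) := by
    refine le_trans ?_ hsmall
    have h0 : 0 ≤ (y / ε / ε ^ (2 * k)) ^ (2 / (n + 1 : ℝ)) := by positivity
    have : B₃ * Cg * θ ≤ B₃ * (Cg + 1) * θ := by
      refine mul_le_mul_of_nonneg_right ?_ hθ
      nlinarith
    exact mul_le_mul_of_nonneg_right this h0
  have hw : (∫ x in Ω, B₃ * (|u ε x t - uA ε x t| ^ 3 / ε ^ 2)) ≤ B₃ * A * y + κ *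
      (y + (∫ x in Ω ∩ X.tubeAt δ t, ‖X.tangentialGrad t x (spaceGrad (u ε - uA ε) x t)‖ ^ 2) +
        ε ^ 2 * (∫ x in Ω ∩ X.tubeAt δ t, X.normalDeriv t x (spaceGrad (u ε - uA ε) x t) ^ 2) +
        ∫ x in Ω \ X.tubeAt δ t, ‖spaceGrad (u ε - uA ε) x t‖ ^ 2) := by
    refine hcubic.trans ?_
    rw [← mul_assoc]
    refine add_le_add_right ?_ _
    have hd : 0 < (ε ^ (2 * k)) ^ (2 / (n + 1 : ℝ)) :=
      Real.rpow_pos_of_pos (Real.rpow_pos_of_pos hε0 _) _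
    rw [hκ, Real.div_rpow (by positivity) (by positivity)]
    calc _ ≤ B₃ * (θ * _ / (ε ^ (2 * k)) ^ (2 / (n + 1 : ℝ))) :=
          mul_le_mul_of_nonneg_left (div_le_div_of_nonneg_right
            (mul_le_mul_of_nonneg_left hgn' hθ) hd.le) hB₃0
      _ = B₃ * Cg * θ * ((y / ε) ^ (2 / (n + 1 : ℝ)) / (ε ^ (2 * k)) ^ (2 / (n + 1 : ℝ))) * _ := by
          ring
  have hE : (ε ^ (m + 1 / 2)) ^ 2 = ε ^ (2 * m + 1) := by
    rw [← Real.rpow_natCast, ← Real.rpow_mul hε0.le]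
    congr 1
    push_cast
    ring
  have hb := l2Norm_sq (Ω ∩ X.tubeAt δ t)
    (fun x => X.tangentialGrad t x (spaceGrad (u ε - uA ε) x t))
  have hd := l2Norm_sq (Ω \ X.tubeAt δ t) (fun x => spaceGrad (u ε - uA ε) x t)
  have ha : l2Norm Ω (fun x => u ε x t - uA ε x t) ^ 2 = y := (l2Norm_sq _ _).trans hysp
  have hτ0 : 0 ≤ ∫ x in Ω ∩ X.tubeAt δ t,
      ‖X.tangentialGrad t x (spaceGrad (u ε - uA ε) x t)‖ ^ 2 :=
    integral_nonneg fun x => by positivity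
  have hν0 : 0 ≤ ∫ x in Ω ∩ X.tubeAt δ t, X.normalDeriv t x (spaceGrad (u ε - uA ε) x t) ^ 2 :=
    integral_nonneg fun x => by positivity
  have ho0 : 0 ≤ ∫ x in Ω \ X.tubeAt δ t, ‖spaceGrad (u ε - uA ε) x t‖ ^ 2 :=
    integral_nonneg fun x => by positivity
  have hq : ε ^ 2 * (1 / ε ^ 2 * B₂ * y) = B₂ * y := by
    have := hε0.ne'
    field_simp
  have key := energy_bookkeeping hC hc₀ hΛ0.le (sq_nonneg ε) hΛε hy0 hτ0 hν0 ho0 hsp hQ hq hG hnl hw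
    (hκle.trans (min_le_left _ _)) (hκle.trans (min_le_right _ _)) hre ha hb hd
  rw [hE] at key
  refine key.trans ?_
  have hAy : B₃ * A * y ≤ B₃ * (Cg + 1) * A * y := by
    have : B₃ * A ≤ B₃ * (Cg + 1) * A :=
      mul_le_mul_of_nonneg_right (le_mul_of_one_le_right hB₃0 (by linarith)) hA
    exact mul_le_mul_of_nonneg_right this hy0
  linarith

end EnergyInequality

/-! ### The continuation argument. -/

section Bootstrap

open Filter Topology

/-- A continuation argument: if `y` satisfies a differential inequality as long as
`e^(-2βt) y ≤ B`, and is small initially, then this bound persists. -/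
theorem bootstrap_estimate {T B β P : ℝ} {y o p : ℝ → ℝ} (hT : 0 < T) (hB : 0 < B) (hP : 0 ≤ P)
    (hyc : ContinuousOn y (Icc 0 T)) (hy0 : ∀ t, 0 ≤ y t) (hyi : y 0 ≤ B / 2)
    (ho : ∀ t, 0 ≤ o t) (hp : ∀ t, 0 ≤ p t)
    (hoi : IntegrableOn (fun t => Real.exp (-2 * β * t) * o t) (Ioo 0 T))
    (hpi : IntegrableOn (fun t => Real.exp (-2 * β * t) * p t) (Ioo 0 T))
    (hd : ∀ t ∈ Ioo 0 T, Real.exp (-2 * β * t) * y t ≤ B → ∃ d, HasDerivAt y d t ∧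
      d + (7 / 4 * o t + 5 / 4 * p t) ≤ 2 * β * y t + P)
    (hJ : ∫ t in (0 : ℝ)..T, Real.exp (-2 * β * t) * P ≤ B / 16) :
    (∀ t ∈ Icc 0 T, Real.exp (-2 * β * t) * y t + ∫ s in Ioo 0 T, Real.exp (-2 * β * s) * o s ≤ B) ∧
    ∫ s in Ioo 0 T, Real.exp (-2 * β * s) * p s ≤ B := by
  set z : ℝ → ℝ := fun t => Real.exp (-2 * β * t) * y t with hz
  have hzc : ContinuousOn z (Icc 0 T) := ContinuousOn.mul (by fun_prop) hyc
  set D : ℝ → ℝ := fun t => 7 / 4 * (Real.exp (-2 * β * t) * o t) +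
    5 / 4 * (Real.exp (-2 * β * t) * p t) with hD
  have hDi : IntegrableOn D (Ioo 0 T) := (hoi.const_mul _).add (hpi.const_mul _)
  have hD0 : ∀ t, 0 ≤ D t := fun t => by
    have := ho t
    have := hp t
    positivity
  have hPc : Continuous fun t : ℝ => Real.exp (-2 * β * t) * P := by fun_prop
  -- Initially the weighted norm is at most B/2 and the source contributes at most B/16, in total
  -- 9B/16. While the bound B holds on (0,t), the exponential weight cancels the growth term 2βy.
  have main : ∀ t ∈ Icc 0 T, (∀ s ∈ Ioo 0 t, z s ≤ B) →
      z t + ∫ s in Ioo 0 t, D s ≤ 9 / 16 * B := by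
    intro t ht hzt
    have hDt : IntegrableOn D (Ioo 0 t) := hDi.mono_set (Ioo_subset_Ioo_right ht.2)
    have hDI : IntegrableOn D (Icc 0 t) := by rwa [integrableOn_Icc_iff_integrableOn_Ioo]
    have hDii : IntervalIntegrable D volume 0 t :=
      (intervalIntegrable_iff_integrableOn_Icc_of_le ht.1).2 hDI
    have hder : ∀ s ∈ Ioo 0 t, ∃ d, HasDerivAt z d s ∧ d ≤ Real.exp (-2 * β * s) * P - D s := by
      intro s hs
      obtain ⟨d, hd1, hd2⟩ := hd s ⟨hs.1, hs.2.trans_le ht.2⟩ (hzt s hs)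
      have he : HasDerivAt (fun t => Real.exp (-2 * β * t)) (Real.exp (-2 * β * s) * (-2 * β)) s := by
        simpa using ((hasDerivAt_id s).const_mul (-2 * β)).exp
      refine ⟨_, he.mul hd1, ?_⟩
      have h1 := mul_le_mul_of_nonneg_left hd2 (Real.exp_pos (-2 * β * s)).le
      simp only [hD]
      linarith
    choose! z' hz' hz'' using hder
    have h1 := intervalIntegral.sub_le_integral_of_hasDeriv_right_of_le ht.1
      (hzc.mono (Icc_subset_Icc_right ht.2)) (fun s hs => (hz' s hs).hasDerivWithinAt)
      ((hPc.integrableOn_Icc).sub hDI) hz''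
    have h2 : ∫ s in (0 : ℝ)..t, (Real.exp (-2 * β * s) * P - D s) =
        (∫ s in (0 : ℝ)..t, Real.exp (-2 * β * s) * P) - ∫ s in (0 : ℝ)..t, D s :=
      intervalIntegral.integral_sub (hPc.intervalIntegrable _ _) hDii
    have h3 : ∫ s in (0 : ℝ)..t, D s = ∫ s in Ioo 0 t, D s := by
      rw [intervalIntegral.integral_of_le ht.1, integral_Ioc_eq_integral_Ioo]
    have h4 : ∫ s in (0 : ℝ)..t, Real.exp (-2 * β * s) * P ≤ B / 16 := by
      refine le_trans ?_ hJ
      exact intervalIntegral.integral_mono_interval le_rfl ht.1 ht.2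
        (Eventually.of_forall fun s => by positivity) (hPc.intervalIntegrable _ _)
    have h5 : z 0 ≤ B / 2 := by simpa [hz] using hyi
    simp only [Pi.sub_apply] at h1
    linarith
  have hall : ∀ t ∈ Icc 0 T, z t ≤ B := by
    by_contra! hcon
    obtain ⟨t₁, ht₁, hzt₁⟩ := hcon
    -- At the first time where z ≥ 3B/4 the bound B has held throughout the past, so z ≤ 9B/16
    -- there, a contradiction. The level 3B/4 lies strictly between 9B/16 and B.
    set A := Icc 0 T ∩ z ⁻¹' Ici (3 / 4 * B) with hA
    have hAc : IsClosed A := hzc.preimage_isClosed_of_isClosed isClosed_Icc isClosed_Ici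
    have hAne : A.Nonempty := ⟨t₁, ht₁, by simp only [mem_preimage, mem_Ici]; linarith⟩
    have hAb : BddBelow A := ⟨0, fun t ht => ht.1.1⟩
    have hmem := hAc.csInf_mem hAne hAb
    have h1 := main _ hmem.1 fun s hs => by
      by_contra! hlt
      have : s ∈ A := ⟨⟨hs.1.le, hs.2.le.trans hmem.1.2⟩, by
        simp only [mem_preimage, mem_Ici]; linarith⟩
      exact absurd (csInf_le hAb this) (not_le.2 hs.2)
    have h2 : 3 / 4 * B ≤ z (sInf A) := hmem.2
    have h3 : 0 ≤ ∫ s in Ioo 0 (sInf A), D s := integral_nonneg hD0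
    linarith
  have hz0 : ∀ t, 0 ≤ z t := fun t => mul_nonneg (Real.exp_pos _).le (hy0 t)
  have hfin := main T ⟨hT.le, le_rfl⟩ fun s hs => hall s (Ioo_subset_Icc_self hs)
  have hDe : ∫ s in Ioo 0 T, D s = 7 / 4 * (∫ s in Ioo 0 T, Real.exp (-2 * β * s) * o s) +
      5 / 4 * ∫ s in Ioo 0 T, Real.exp (-2 * β * s) * p s := by
    have : ∫ s in Ioo 0 T, D s = (∫ s in Ioo 0 T, 7 / 4 * (Real.exp (-2 * β * s) * o s)) +
      ∫ s in Ioo 0 T, 5 / 4 * (Real.exp (-2 * β * s) * p s) :=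
        integral_add (hoi.const_mul _) (hpi.const_mul _)
    rw [this, integral_const_mul, integral_const_mul]
  have hoI : 0 ≤ ∫ s in Ioo 0 T, Real.exp (-2 * β * s) * o s :=
    integral_nonneg fun s => mul_nonneg (Real.exp_pos _).le (ho s)
  have hpI : 0 ≤ ∫ s in Ioo 0 T, Real.exp (-2 * β * s) * p s :=
    integral_nonneg fun s => mul_nonneg (Real.exp_pos _).le (hp s)
  have hzT := hz0 T
  refine ⟨fun t ht => ?_, by linarith⟩
  have h1 := main t ht fun s hs => hall s ⟨hs.1.le, hs.2.le.trans ht.2⟩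
  have h2 : 0 ≤ ∫ s in Ioo 0 t, D s := integral_nonneg hD0
  have h3 : z t = Real.exp (-2 * β * t) * y t := rfl
  linarith

/-- The bound does not depend on T and decreases in β: a large β makes the accumulated source small.
-/
theorem integral_exp_mul_le {T β P : ℝ} (hβ : 0 < β) (hP : 0 ≤ P) :
    ∫ t in (0 : ℝ)..T, Real.exp (-2 * β * t) * P ≤ P / (2 * β) := by
  have h : ∫ t in (0 : ℝ)..T, Real.exp (-2 * β * t) = (1 - Real.exp (-2 * β * T)) / (2 * β) := by
    have h0 : -2 * β ≠ 0 := by linarith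
    rw [intervalIntegral.integral_comp_mul_left (fun t => Real.exp t) h0, integral_exp, mul_zero,
      Real.exp_zero, smul_eq_mul]
    field_simp
    ring
  rw [intervalIntegral.integral_mul_const]
  calc _ ≤ 1 / (2 * β) * P := by
        refine mul_le_mul_of_nonneg_right ?_ hP
        rw [h]
        have := Real.exp_pos (-2 * β * T)
        gcongr
        linarith
    _ = P / (2 * β) := by ring

end Bootstrap

/-! ### From the bootstrap to the difference estimate. -/

section Assembly

open Filter Topology

variable {N : ℕ} {Ω : Set (Euc N)} {T T₀ δ : ℝ} {Γ : EvolvingHypersurface Ω T₀}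

/-- Squared weighted norms over parts of a cylinder as iterated integrals. -/
theorem IsBoundedSmoothDomain.l2Norm_cylinder_sq {V : Type*} [NormedAddCommGroup V]
    [NormedSpace ℝ V] (hΩ : IsBoundedSmoothDomain Ω)
    {A : Set (Euc N × ℝ)} (hA : MeasurableSet A) {F : Euc N × ℝ → V} {β B : ℝ}
    (hF : ContinuousOn F (cylinder Ω T ∩ A)) (hB : ∀ p ∈ cylinder Ω T ∩ A, ‖F p‖ ≤ B) :
    IntegrableOn (fun t => Real.exp (-2 * β * t) * ∫ x in Ω ∩ {x | (x, t) ∈ A}, ‖F (x, t)‖ ^ 2)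
      (Ioo 0 T) ∧
    l2Norm (cylinder Ω T ∩ A) (fun p => Real.exp (-β * p.2) • F p) ^ 2 =
      ∫ t in Ioo 0 T, Real.exp (-2 * β * t) * ∫ x in Ω ∩ {x | (x, t) ∈ A}, ‖F (x, t)‖ ^ 2 := by
  have he : ∀ p : Euc N × ℝ, ‖Real.exp (-β * p.2) • F p‖ ^ 2 =
      Real.exp (-2 * β * p.2) * ‖F p‖ ^ 2 := fun p => by
    rw [norm_smul, mul_pow, Real.norm_eq_abs, abs_of_pos (Real.exp_pos _), ← Real.exp_nat_mul]
    congr 2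
    push_cast
    ring
  have hc : ContinuousOn (fun p : Euc N × ℝ => Real.exp (-2 * β * p.2) * ‖F p‖ ^ 2)
      (cylinder Ω T ∩ A) := ContinuousOn.mul (by fun_prop) (hF.norm.pow 2)
  -- The absolute value of β makes the bound valid for either sign of the weight's exponent.
  obtain ⟨h1, h2⟩ := hΩ.setIntegral_cylinder hA hc (B := Real.exp (2 * |β| * T) * B ^ 2)
    fun p hp => by
      rw [abs_of_nonneg (by positivity)]
      have h0 : 0 < p.2 ∧ p.2 < T := hp.1.2
      have h3 : -2 * β * p.2 ≤ 2 * |β| * T := by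
        have h4 := neg_abs_le β
        have h5 : |β| * p.2 ≤ |β| * T := mul_le_mul_of_nonneg_left h0.2.le (abs_nonneg _)
        nlinarith
      exact mul_le_mul (Real.exp_le_exp.2 h3) (pow_le_pow_left₀ (norm_nonneg _) (hB p hp) 2)
        (by positivity) (by positivity)
  simp only [integral_const_mul] at h1 h2
  refine ⟨h1, ?_⟩
  rw [l2Norm_sq, ← h2]
  simp only [he]

/-- The difference estimate follows from a differential inequality valid as long as the desired
bound holds. -/
theorem CurvilinearCoordinates.differenceEstimate_of_energy (hΩ : IsBoundedSmoothDomain Ω)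
    (X : CurvilinearCoordinates Γ (2 * δ)) (hδ : 0 < δ) {v : Euc N → ℝ → ℝ}
    (hv : IsC1Cylinder Ω T₀ v) (hT : 0 < T) (hTT : T ≤ T₀) {c₀ R ε β P : ℝ} {M : ℕ} (hc₀ : 0 < c₀)
    (hR : 0 < R) (hε : 0 < ε) (hP : 0 ≤ P)
    (hi : ∫ x in Ω, v x 0 ^ 2 ≤ R ^ 2 * ε ^ (2 * M + 1))
    (hd : ∀ t ∈ Ioo 0 T,
      Real.exp (-2 * β * t) * (∫ x in Ω, v x t ^ 2) ≤ 2 * R ^ 2 * ε ^ (2 * M + 1) →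
      ∃ d, HasDerivAt (fun t => ∫ x in Ω, v x t ^ 2) d t ∧
        d + (7 / 4 * (∫ x in Ω \ X.tubeAt δ t, ‖spaceGrad v x t‖ ^ 2)
          + 5 / 4 * (c₀ * (∫ x in Ω ∩ X.tubeAt δ t,
              ‖X.tangentialGrad t x (spaceGrad v x t)‖ ^ 2)
            + ε ^ 2 * ∫ x in Ω ∩ X.tubeAt δ t, X.normalDeriv t x (spaceGrad v x t) ^ 2)) ≤
          2 * β * (∫ x in Ω, v x t ^ 2) + P)
    (hJ : ∫ t in (0 : ℝ)..T, Real.exp (-2 * β * t) * P ≤ 2 * R ^ 2 * ε ^ (2 * M + 1) / 16) :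
    DifferenceEstimate X δ c₀ R M ε β T v := by
  have hT₀ : 0 < T₀ := hT.trans_le hTT
  have hmt := X.measurableSet_tube (η := δ) ⟨hδ, by linarith⟩
  obtain ⟨A, hA0, hA⟩ := hv.exists_bound hΩ hT₀
  obtain ⟨B, hB1, hB⟩ := X.exists_gradient_bound (η := δ) (by linarith)
  have hsg : ∀ p ∈ cylinder Ω T, spaceGrad v p.1 p.2 = cylGrad Ω T₀ v p := fun p hp =>
    hv.spaceGrad_eq hΩ.isOpen hp.1 ⟨hp.2.1.le, hp.2.2.le.trans hTT⟩
  have hgc : ContinuousOn (fun p : Euc N × ℝ => spaceGrad v p.1 p.2) (cylinder Ω T) :=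
    ((hv.continuousOn_cylGrad hΩ hT₀).mono fun p hp =>
      ⟨subset_closure hp.1, hp.2.1.le, hp.2.2.le.trans hTT⟩).congr hsg
  have hgb : ∀ p ∈ cylinder Ω T, ‖spaceGrad v p.1 p.2‖ ≤ A := fun p hp => by
    rw [hsg p hp]
    exact (hA p.1 (subset_closure hp.1) p.2 ⟨hp.2.1.le, hp.2.2.le.trans hTT⟩).2.2
  obtain ⟨o1, o2⟩ := hΩ.l2Norm_cylinder_sq (β := β) hmt.compl (hgc.mono inter_subset_left)
    fun p hp => hgb p hp.1
  obtain ⟨τ1, τ2⟩ := hΩ.l2Norm_cylinder_sq (β := β) hmt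
    (X.continuousOn_tangentialGrad (inter_subset_right.trans (X.tube_subset_W (by linarith)))
      (hgc.mono inter_subset_left)) (B := B * A)
    fun p hp => ((hB p.2 p.1 hp.2 _).1).trans (by gcongr; exact hgb p hp.1)
  obtain ⟨ν1, ν2⟩ := hΩ.l2Norm_cylinder_sq (β := β) hmt
    (X.continuousOn_normalDeriv (inter_subset_right.trans (X.tube_subset_W (by linarith)))
      (hgc.mono inter_subset_left)) (B := B * A)
    fun p hp => ((hB p.2 p.1 hp.2 _).2).trans (by gcongr; exact hgb p hp.1)
  simp only [Real.norm_eq_abs, sq_abs, smul_eq_mul] at ν1 ν2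
  set y : ℝ → ℝ := fun t => ∫ x in Ω, v x t ^ 2 with hy
  set o : ℝ → ℝ := fun t => ∫ x in Ω \ X.tubeAt δ t, ‖spaceGrad v x t‖ ^ 2 with ho
  set τ : ℝ → ℝ := fun t => ∫ x in Ω ∩ X.tubeAt δ t,
    ‖X.tangentialGrad t x (spaceGrad v x t)‖ ^ 2 with hτ
  set ν : ℝ → ℝ := fun t => ∫ x in Ω ∩ X.tubeAt δ t,
    X.normalDeriv t x (spaceGrad v x t) ^ 2 with hν
  have ho1 : IntegrableOn (fun t => Real.exp (-2 * β * t) * o t) (Ioo 0 T) := o1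
  have ho2 : l2Norm (cylinder Ω T \ X.tube δ)
      (fun p => Real.exp (-β * p.2) • spaceGrad v p.1 p.2) ^ 2 =
      ∫ t in Ioo 0 T, Real.exp (-2 * β * t) * o t := o2
  have hτ1 : IntegrableOn (fun t => Real.exp (-2 * β * t) * τ t) (Ioo 0 T) := τ1
  have hν1 : IntegrableOn (fun t => Real.exp (-2 * β * t) * ν t) (Ioo 0 T) := ν1
  have hpeq : (fun t => Real.exp (-2 * β * t) * (c₀ * τ t + ε ^ 2 * ν t)) =
      fun t => c₀ * (Real.exp (-2 * β * t) * τ t) + ε ^ 2 * (Real.exp (-2 * β * t) * ν t) := by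
    funext t
    ring
  have hpint : ∫ t in Ioo 0 T, Real.exp (-2 * β * t) * (c₀ * τ t + ε ^ 2 * ν t) =
      c₀ * (∫ t in Ioo 0 T, Real.exp (-2 * β * t) * τ t) +
        ε ^ 2 * ∫ t in Ioo 0 T, Real.exp (-2 * β * t) * ν t := by
    rw [hpeq]
    have : ∫ t in Ioo 0 T, (c₀ * (Real.exp (-2 * β * t) * τ t) +
        ε ^ 2 * (Real.exp (-2 * β * t) * ν t)) =
        (∫ t in Ioo 0 T, c₀ * (Real.exp (-2 * β * t) * τ t)) +
        ∫ t in Ioo 0 T, ε ^ 2 * (Real.exp (-2 * β * t) * ν t) :=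
      integral_add (hτ1.const_mul _) (hν1.const_mul _)
    rw [this, integral_const_mul, integral_const_mul]
  have hyc : ContinuousOn y (Icc 0 T) :=
    (hΩ.continuousOn_integral (ContinuousOn.pow (ContDiffOn.continuousOn hv) 2)).mono
      (Icc_subset_Icc_right hTT)
  -- The target 2R²ε^(2M+1) is twice the bound on the initial data, which is the factor of room the
  -- continuation argument needs.
  have hboot := bootstrap_estimate (p := fun t => c₀ * τ t + ε ^ 2 * ν t) hT
    (by positivity : 0 < 2 * R ^ 2 * ε ^ (2 * M + 1)) hP hyc
    (fun t => integral_nonneg fun x => sq_nonneg _) (hi.trans_eq (by ring))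
    (fun t => integral_nonneg fun x => by positivity)
    (fun t => by
      have h1 : 0 ≤ τ t := integral_nonneg fun x => by positivity
      have h2 : 0 ≤ ν t := integral_nonneg fun x => by positivity
      positivity) ho1
    (by rw [hpeq]; exact (hτ1.const_mul _).add (hν1.const_mul _)) hd hJ
  refine ⟨fun t ht => ?_, ?_⟩
  · rw [ho2, l2Norm_sq]
    have : ∫ x in Ω, ‖Real.exp (-β * t) * v x t‖ ^ 2 = Real.exp (-2 * β * t) * y t := by
      rw [hy, ← integral_const_mul]
      refine integral_congr_ae (Eventually.of_forall fun x => ?_)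
      dsimp only
      rw [norm_mul, mul_pow, Real.norm_eq_abs, Real.norm_eq_abs, sq_abs, sq_abs,
        ← Real.exp_nat_mul]
      congr 2
      push_cast
      ring
    rw [this]
    exact hboot.1 t ht
  · rw [τ2, ν2]
    exact hpint.symm.le.trans hboot.2

end Assembly

/-! ### Sufficient conditions on β, the radius and the source. -/

section Criterion

open Filter Topology

/-- The expression is continuous in ε and vanishes at 0, as both exponents are positive. The
variable ε is later also specialized to a radius. -/
theorem exists_forall_mul_rpow_le (a b : ℝ) {c p κ : ℝ} (hc : 0 < c) (hp : 0 < p) (hκ : 0 < κ) :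
    ∃ ε₁ > 0, ∀ ε ∈ Ioc 0 ε₁, a * (b * ε ^ c) ^ p ≤ κ := by
  have h : Continuous fun ε : ℝ => a * (b * ε ^ c) ^ p :=
    continuous_const.mul ((continuous_const.mul (Real.continuous_rpow_const hc.le)).rpow_const
      fun _ => Or.inr hp.le)
  have h0 : a * (b * (0 : ℝ) ^ c) ^ p < κ := by
    rwa [Real.zero_rpow hc.ne', mul_zero, Real.zero_rpow hp.ne', mul_zero]
  obtain ⟨r, hr, h1⟩ := Metric.eventually_nhds_iff.1 (h.continuousAt.eventually (gt_mem_nhds h0))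
  refine ⟨r / 2, by positivity, fun ε hε => (h1 ?_).le⟩
  rw [Real.dist_eq, sub_zero, abs_of_pos hε.1]
  linarith [hε.2]

variable {n : ℕ} {Ω : Set (Euc (n + 1))} {T₀ δ : ℝ} {Γ : EvolvingHypersurface Ω T₀}
  {f : ℝ → ℝ} {ε₀ C c₀ : ℝ} {uA : ℝ → Euc (n + 1) → ℝ → ℝ}

/-- A criterion for the difference estimate: the nonlinearity is absorbed as long as the desired
bound holds, and the remaining terms are controlled by the exponential weight and a small source. -/
theorem CurvilinearCoordinates.exists_differenceEstimate_criterion (hn : 1 ≤ n)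
    (hΩ : IsBoundedSmoothDomain Ω) (hT₀ : 0 < T₀) (hδ : 0 < δ)
    (X : CurvilinearCoordinates Γ (2 * δ)) (hf : IsDoubleWell f) (hε₀ : 0 < ε₀)
    (huA : ∀ ε ∈ Ioc 0 ε₀, IsC2Cylinder Ω T₀ (uA ε)) (hc₀ : 0 < c₀) (hC : 0 < C)
    (hspec : SpectralEstimate X δ f ε₀ c₀ C uA) (K : ℝ) :
    ∃ L C₁ C₂ C₃ : ℝ, ∃ ε₁ ∈ Ioc 0 ε₀, 0 < L ∧ 0 ≤ C₁ ∧ 0 ≤ C₂ ∧ 0 ≤ C₃ ∧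
      ∀ k A θ m : ℝ, 0 ≤ A → 0 ≤ θ → AbsorbsCube (n + 1 : ℝ) L k A θ →
      ∀ (M : ℕ) (R β P : ℝ), 0 < R → 0 ≤ β → 0 ≤ P →
      ∀ (u₀ : ℝ → Euc (n + 1) → ℝ) (u : ℝ → Euc (n + 1) → ℝ → ℝ),
        (∀ ε ∈ Ioc 0 ε₀, IsAllenCahnSolution Ω T₀ f ε (u₀ ε) (u ε)) →
        UniformlyBounded Ω T₀ ε₀ K uA u₀ → RemainderEstimate X δ f ε₀ C m uA u →
        WellPrepared Ω ε₀ R M uA u₀ →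
        ∀ ε ∈ Ioc 0 ε₁, ∀ T ∈ Ioc 0 T₀,
          C₁ * θ * (2 * R ^ 2 * Real.exp (2 * β * T) * ε ^ (2 * (M - k))) ^ (2 / (n + 1 : ℝ)) ≤
            min (1 / 16) (c₀ / 8) →
          (∀ y, 0 ≤ y → y ≤ 2 * R ^ 2 * ε ^ (2 * M + 1) * Real.exp (2 * β * T) →
            2 * (C₂ + C₁ * A) * y + 2 * C₃ * ε ^ (2 * m + 1) ≤ 2 * β * y + P) →
          ∫ t in (0 : ℝ)..T, Real.exp (-2 * β * t) * P ≤ 2 * R ^ 2 * ε ^ (2 * M + 1) / 16 →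
          DifferenceEstimate X δ c₀ R M ε β T (u ε - uA ε) := by
  obtain ⟨L, C₁, C₂, C₃, ε₁, hε₁, hL, hC₁, hC₂, hC₃, h⟩ :=
    X.exists_energy_inequality hn hΩ hT₀ hδ hf hε₀ huA hc₀ hC hspec K
  refine ⟨L, C₁, C₂, C₃, ε₁, hε₁, hL, hC₁, hC₂, hC₃, ?_⟩
  intro k A θ m hA hθ habs M R β P hR hβ hP u₀ u hu hbdd hrem hwell ε hε T hT hsmall hlin hJ
  have hε0 := hε.1
  have hεε : ε ∈ Ioc 0 ε₀ := ⟨hε.1, hε.2.trans hε₁.2⟩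
  have hv1 : IsC1Cylinder Ω T₀ (u ε - uA ε) := ((hu ε hεε).C2.sub (huA ε hεε)).isC1Cylinder
  refine X.differenceEstimate_of_energy hΩ hδ hv1 hT.1 hT.2 hc₀ hR hε0 hP ?_ ?_ hJ
  · have h1 := pow_le_pow_left₀ (Real.sqrt_nonneg _) (hwell ε hεε) 2
    have h2 : ∫ x in Ω, (u ε - uA ε) x 0 ^ 2 = l2Norm Ω (fun x => u₀ ε x - uA ε x 0) ^ 2 := by
      rw [l2Norm_sq]
      refine setIntegral_congr_fun hΩ.isOpen.measurableSet fun x hx => ?_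
      simp only [Pi.sub_apply, Real.norm_eq_abs, sq_abs, (hu ε hεε).initial x hx]
    rw [h2]
    refine h1.trans_eq ?_
    rw [mul_pow, ← Real.rpow_natCast (ε ^ ((M : ℝ) + 1 / 2)), ← Real.rpow_mul hε0.le,
      ← Real.rpow_natCast ε]
    congr 2
    push_cast
    ring
  · intro t ht hy
    have hy0 : 0 ≤ ∫ x in Ω, (u ε x t - uA ε x t) ^ 2 := integral_nonneg fun x => sq_nonneg _
    have hyb : ∫ x in Ω, (u ε x t - uA ε x t) ^ 2 ≤
        2 * R ^ 2 * ε ^ (2 * M + 1) * Real.exp (2 * β * T) := by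
      have h1 : Real.exp (2 * β * t) * (Real.exp (-2 * β * t) *
          ∫ x in Ω, (u ε x t - uA ε x t) ^ 2) ≤
          Real.exp (2 * β * t) * (2 * R ^ 2 * ε ^ (2 * M + 1)) :=
        mul_le_mul_of_nonneg_left hy (Real.exp_pos _).le
      rw [← mul_assoc, ← Real.exp_add] at h1
      have h2 : 2 * β * t + -2 * β * t = 0 := by ring
      rw [h2, Real.exp_zero, one_mul, mul_comm] at h1
      refine h1.trans (mul_le_mul_of_nonneg_left (Real.exp_le_exp.2 ?_) (by positivity))
      exact mul_le_mul_of_nonneg_left ht.2.le (by positivity)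
    obtain ⟨d, hd1, hd2⟩ := h k A θ m hA hθ habs u₀ u hu hbdd hrem ε hε t
      ⟨ht.1, ht.2.trans_le hT.2⟩ (by
        refine le_trans ?_ hsmall
        refine mul_le_mul_of_nonneg_left (Real.rpow_le_rpow (by positivity) ?_ (by positivity))
          (by positivity)
        -- The power 2M + 1 loses 1 to the Gagliardo–Nirenberg inequality and 2k to the absorption
        -- of the cube; what remains decides between M > k and M = k.
        have e : ε ^ (2 * ((M : ℝ) - k)) = ε ^ (2 * M + 1) / ε / ε ^ (2 * k) := by
          rw [mul_sub, Real.rpow_sub hε0, pow_succ, mul_div_cancel_right₀ _ hε0.ne',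
            ← Real.rpow_natCast]
          push_cast
          rfl
        rw [e]
        calc _ ≤ 2 * R ^ 2 * ε ^ (2 * M + 1) * Real.exp (2 * β * T) / ε / ε ^ (2 * k) := by
              gcongr
          _ = _ := by ring)
    exact ⟨d, hd1, hd2.trans (hlin _ hy0 hyb)⟩

end Criterion

/-! ### The three regimes. -/

theorem theorem6p4 {N : ℕ} (hN : 2 ≤ N) {Ω : Set (Euc N)} (hΩ : IsBoundedSmoothDomain Ω)
    {T₀ : ℝ} (hT₀ : 0 < T₀) (Γ : EvolvingHypersurface Ω T₀)
    {δ : ℝ} (hδ : 0 < δ) (X : CurvilinearCoordinates Γ (2 * δ))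
    {f : ℝ → ℝ} (hf : IsDoubleWell f)
    {ε₀ : ℝ} (hε₀ : 0 < ε₀) (uA : ℝ → Euc N → ℝ → ℝ)
    (huA : ∀ ε ∈ Set.Ioc 0 ε₀, IsC2Cylinder Ω T₀ (uA ε))
    {c₀ C K : ℝ} (hc₀ : 0 < c₀) (hC : 0 < C)
    (hspec : SpectralEstimate X δ f ε₀ c₀ C uA) :
    (∀ (M : ℕ) (R : ℝ), max 2 ((N : ℝ) / 2) < M → 0 < R →
      ∃ β > 0, ∃ ε₁ ∈ Set.Ioc 0 ε₀, ∀ (u₀ : ℝ → Euc N → ℝ) (u : ℝ → Euc N → ℝ → ℝ),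
        (∀ ε ∈ Set.Ioc 0 ε₀, IsAllenCahnSolution Ω T₀ f ε (u₀ ε) (u ε)) →
        UniformlyBounded Ω T₀ ε₀ K uA u₀ →
        RemainderEstimate X δ f ε₀ C M uA u →
        WellPrepared Ω ε₀ R M uA u₀ →
        ∀ ε ∈ Set.Ioc 0 ε₁, ∀ T ∈ Set.Ioc 0 T₀,
          DifferenceEstimate X δ c₀ R M ε β T (u ε - uA ε)) ∧
    (∀ (M : ℕ) (M' : ℝ), (M : ℝ) = max 2 ((N : ℝ) / 2) → (M : ℝ) < M' →
      ∃ β > 0, ∃ R' > 0, ∃ ε₁ ∈ Set.Ioc 0 ε₀,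
        ∀ (u₀ : ℝ → Euc N → ℝ) (u : ℝ → Euc N → ℝ → ℝ),
        (∀ ε ∈ Set.Ioc 0 ε₀, IsAllenCahnSolution Ω T₀ f ε (u₀ ε) (u ε)) →
        UniformlyBounded Ω T₀ ε₀ K uA u₀ →
        RemainderEstimate X δ f ε₀ C M' uA u →
        WellPrepared Ω ε₀ R' M uA u₀ →
        ∀ ε ∈ Set.Ioc 0 ε₁, ∀ T ∈ Set.Ioc 0 T₀,
          DifferenceEstimate X δ c₀ R' M ε β T (u ε - uA ε)) ∧
    (∀ R : ℝ, (N = 2 ∨ N = 3) → 0 < R →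
      ∃ ε₁ ∈ Set.Ioc 0 ε₀, ∃ T₁ ∈ Set.Ioc 0 T₀,
        ∀ (u₀ : ℝ → Euc N → ℝ) (u : ℝ → Euc N → ℝ → ℝ),
        (∀ ε ∈ Set.Ioc 0 ε₀, IsAllenCahnSolution Ω T₀ f ε (u₀ ε) (u ε)) →
        UniformlyBounded Ω T₀ ε₀ K uA u₀ →
        RemainderEstimate X δ f ε₀ C 2 uA u →
        WellPrepared Ω ε₀ R 2 uA u₀ →
        ∀ ε ∈ Set.Ioc 0 ε₁, ∀ T ∈ Set.Ioc 0 T₁,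
          DifferenceEstimate X δ c₀ R 2 ε 0 T (u ε - uA ε)) := by
  obtain ⟨n, rfl⟩ : ∃ n, N = n + 1 := ⟨N - 1, by omega⟩
  obtain ⟨L, C₁, C₂, C₃, ε₁, hε₁, hL, hC₁, hC₂, hC₃, crit⟩ :=
    X.exists_differenceEstimate_criterion (by omega) hΩ hT₀ hδ hf hε₀ huA hc₀ hC hspec K
  have hN0 : (0 : ℝ) < n + 1 := by positivity
  have hq : 0 < 2 / (n + 1 : ℝ) := by positivity
  have hκ : 0 < min (1 / 16) (c₀ / 8) := by positivity
  have hcast : ((n + 1 : ℕ) : ℝ) = n + 1 := by push_cast; rfl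
  refine ⟨fun M R hM hR => ?_, fun M M' hM hM' => ?_, fun R hN3 hR => ?_⟩
  · obtain ⟨A, θ, hA, hθ, habs⟩ := exists_absorbsCube hN0 hL
    rw [hcast] at hM
    have hD : 0 ≤ 8 * C₃ / R ^ 2 := by positivity
    have hCA : 0 ≤ C₁ * A := by positivity
    -- The first two terms dominate the growth rate; the third makes the accumulated source C₃/β at
    -- most R²/8, relative to ε^(2M+1). The factor e^(2βT₀) this creates in the smallness condition
    -- is beaten by ε^(2(M-k)).
    set β := C₂ + C₁ * A + 8 * C₃ / R ^ 2 + 1 with hβ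
    have hβ0 : 0 < β := by positivity
    have hβR : C₃ / β ≤ R ^ 2 / 8 := by
      rw [div_le_div_iff₀ hβ0 (by norm_num)]
      have h1 : 8 * C₃ / R ^ 2 ≤ β := by linarith
      rw [div_le_iff₀ (by positivity)] at h1
      linarith
    obtain ⟨ε₂, hε₂, hsm⟩ := exists_forall_mul_rpow_le (C₁ * θ)
      (2 * R ^ 2 * Real.exp (2 * β * T₀)) (c := 2 * (M - max 2 ((n + 1 : ℝ) / 2)))
      (by linarith) hq hκ
    refine ⟨β, hβ0, min ε₁ ε₂, ⟨lt_min hε₁.1 hε₂, (min_le_left _ _).trans hε₁.2⟩, ?_⟩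
    intro u₀ u hu hbdd hrem hwell ε hε T hT
    have hε0 := hε.1
    have hpow : ε ^ (2 * (M : ℝ) + 1) = ε ^ (2 * M + 1) := by
      rw [← Real.rpow_natCast]; push_cast; rfl
    refine crit _ A θ M hA hθ.le habs M R β (2 * C₃ * ε ^ (2 * (M : ℝ) + 1)) hR hβ0.le
      (by positivity) u₀ u hu hbdd hrem hwell ε ⟨hε.1, hε.2.trans (min_le_left _ _)⟩ T hT ?_ ?_ ?_
    · refine le_trans ?_ (hsm ε ⟨hε.1, hε.2.trans (min_le_right _ _)⟩)
      have := hT.2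
      gcongr
    · intro y hy _
      have : (C₂ + C₁ * A) * y ≤ β * y := mul_le_mul_of_nonneg_right (by linarith) hy
      linarith
    · refine (integral_exp_mul_le hβ0 (by positivity)).trans ?_
      rw [hpow]
      calc 2 * C₃ * ε ^ (2 * M + 1) / (2 * β) = C₃ / β * ε ^ (2 * M + 1) := by field_simp
        _ ≤ R ^ 2 / 8 * ε ^ (2 * M + 1) := by gcongr
        _ = _ := by ring
  · obtain ⟨A, θ, hA, hθ, habs⟩ := exists_absorbsCube hN0 hL
    rw [hcast] at hM
    rw [← hM] at habs
    have hCA : 0 ≤ C₁ * A := by positivity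
    set β := C₂ + C₁ * A + 1 with hβ
    have hβ1 : 1 ≤ β := by linarith
    have hβ0 : 0 < β := by linarith
    -- With M = k no power of ε remains, so smallness must come from the radius. β is fixed before
    -- R', so the factor e^(2βT₀) is harmless; this is why β may not depend on the radius here.
    obtain ⟨R', hR', hsm⟩ := exists_forall_mul_rpow_le (C₁ * θ)
      (2 * Real.exp (2 * β * T₀)) (c := 2) two_pos hq hκ
    -- The source is then made small relative to R'² by the surplus power ε^(2(M'-M)), the reason
    -- for requiring a better approximation.
    obtain ⟨ε₂, hε₂, hsm₂⟩ := exists_forall_mul_rpow_le C₃ 1 (c := 2 * (M' - M)) (p := 1)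
      (κ := R' ^ 2 / 8) (by linarith) one_pos (by positivity)
    refine ⟨β, hβ0, R', hR', min ε₁ ε₂, ⟨lt_min hε₁.1 hε₂, (min_le_left _ _).trans hε₁.2⟩, ?_⟩
    intro u₀ u hu hbdd hrem hwell ε hε T hT
    have hε0 := hε.1
    refine crit _ A θ M' hA hθ.le habs M R' β (2 * C₃ * ε ^ (2 * M' + 1)) hR' hβ0.le
      (by positivity) u₀ u hu hbdd hrem hwell ε ⟨hε.1, hε.2.trans (min_le_left _ _)⟩ T hT ?_ ?_ ?_
    · refine le_trans ?_ (hsm R' ⟨hR', le_rfl⟩)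
      have := hT.2
      have h1 : 2 * R' ^ 2 * Real.exp (2 * β * T) * ε ^ (2 * ((M : ℝ) - M)) =
          2 * Real.exp (2 * β * T) * R' ^ (2 : ℝ) := by
        rw [sub_self, mul_zero, Real.rpow_zero, Real.rpow_two]
        ring
      rw [h1]
      gcongr
    · intro y hy _
      have : (C₂ + C₁ * A) * y ≤ β * y := mul_le_mul_of_nonneg_right (by linarith) hy
      linarith
    · refine (integral_exp_mul_le hβ0 (by positivity)).trans ?_
      have h1 := hsm₂ ε ⟨hε.1, hε.2.trans (min_le_right _ _)⟩
      rw [one_mul, Real.rpow_one] at h1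
      have hpow : ε ^ (2 * M' + 1) = ε ^ (2 * (M' - M)) * ε ^ (2 * M + 1) := by
        rw [← Real.rpow_natCast ε (2 * M + 1), ← Real.rpow_add hε0]
        congr 1
        push_cast
        ring
      rw [hpow]
      calc 2 * C₃ * (ε ^ (2 * (M' - M)) * ε ^ (2 * M + 1)) / (2 * β) =
            C₃ * ε ^ (2 * (M' - M)) * ε ^ (2 * M + 1) / β := by field_simp
        _ ≤ C₃ * ε ^ (2 * (M' - M)) * ε ^ (2 * M + 1) := div_le_self (by positivity) hβ1
        _ ≤ R' ^ 2 / 8 * ε ^ (2 * M + 1) := by gcongr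
        _ = _ := by ring
  · have hN4 : (n + 1 : ℝ) < 4 := by
      rw [← hcast]
      exact_mod_cast (by omega : n + 1 < 4)
    set q : ℝ := C₁ * (2 * R ^ 2) ^ (2 / (n + 1 : ℝ)) with hqdef
    have hq0 : 0 ≤ q := by positivity
    -- Neither ε nor R is at disposal, so θ is chosen small against R; q is the factor of θ in the
    -- smallness condition. The resulting A may be large.
    obtain ⟨A, hA, habs⟩ := exists_absorbsCube_of_lt_four (L := L) hN0 hN4
      (θ := min (1 / 16) (c₀ / 8) / (q + 1)) (by positivity)
    set θ := min (1 / 16) (c₀ / 8) / (q + 1) with hθ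
    set E : ℝ := 4 * (C₂ + C₁ * A) * R ^ 2 + 2 * C₃ with hE
    have hE0 : 0 ≤ E := by positivity
    -- With β = 0 the growth term, bounded through the bootstrap bound, is put into the source with
    -- coefficient E; T₁ is chosen so that T E ≤ R²/8.
    refine ⟨ε₁, hε₁, min T₀ (R ^ 2 / 8 / (E + 1)), ⟨lt_min hT₀ (by positivity), min_le_left _ _⟩, ?_⟩
    intro u₀ u hu hbdd hrem hwell ε hε T hT
    have hε0 := hε.1
    have hpow : ε ^ (2 * (2 : ℝ) + 1) = ε ^ (2 * 2 + 1) := by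
      rw [← Real.rpow_natCast]; norm_num
    refine crit 2 A θ 2 hA (by positivity) habs 2 R 0 (E * ε ^ (2 * 2 + 1)) hR le_rfl
      (by positivity) u₀ u hu hbdd hrem (by exact_mod_cast hwell) ε hε T
      ⟨hT.1, hT.2.trans (min_le_left _ _)⟩ ?_ ?_ ?_
    · have h1 : 2 * R ^ 2 * Real.exp (2 * 0 * T) * ε ^ (2 * (((2 : ℕ) : ℝ) - 2)) = 2 * R ^ 2 := by
        norm_num
      rw [h1, hθ]
      calc _ = min (1 / 16) (c₀ / 8) * (q / (q + 1)) := by rw [hqdef]; ring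
        _ ≤ min (1 / 16) (c₀ / 8) * 1 := by
            gcongr
            rw [div_le_one (by positivity)]
            linarith
        _ = _ := mul_one _
    · intro y hy hyb
      rw [mul_zero, zero_mul, Real.exp_zero, mul_one] at hyb
      rw [hpow, hE]
      have := mul_le_mul_of_nonneg_left hyb (by positivity : 0 ≤ 2 * (C₂ + C₁ * A))
      linarith
    · have h1 : ∫ t in (0 : ℝ)..T, Real.exp (-2 * 0 * t) * (E * ε ^ (2 * 2 + 1)) =
          T * (E * ε ^ (2 * 2 + 1)) := by simp; ring
      rw [h1]
      have h2 : T * E ≤ R ^ 2 / 8 := by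
        have h3 : T ≤ R ^ 2 / 8 / (E + 1) := hT.2.trans (min_le_right _ _)
        rw [le_div_iff₀ (by positivity)] at h3
        nlinarith [hT.1]
      calc T * (E * ε ^ (2 * 2 + 1)) = T * E * ε ^ (2 * 2 + 1) := by ring
        _ ≤ R ^ 2 / 8 * ε ^ (2 * 2 + 1) := by gcongr
        _ = _ := by ring
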